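/- Let $d(n)$ be the number of positive divisors of $n$, let $\gamma$ be the Euler–Mascheroni constant, and for $x>0$ let $$\Delta(x)=\sum_{n\le x}d(n)-x(\log x+2\gamma-1),\qquad F(t)=t^{-1/4}\Delta(t)\quad(t>0).$$ Let $\{\mathbb X_n\}$, indexed by the square-free integers $n\ge 1$, be independent random variables, each uniformly distributed on $[0,1]$, and let $$F_{\mathbb X}=\frac{1}{\pi\sqrt2}\sum_{n=1}^{\infty}\frac{\mu(n)^2}{n^{3/4}}\sum_{r=1}^{\infty}\frac{d(nr^2)}{r^{3/2}}\cos\left(2\pi r\mathbb X_n-\frac{\pi}{4}\right),$$ where $\mu$ is the Möbius function and the outer series is the limit of its partial sums over $n\le N$ as $N\to\infty$. This series converges almost surely. For $T>0$ put $$D_F(T)=\sup_{u\in\mathbb R}\left|\frac1T\,\mathrm{meas}\{t\in[T,2T]:F(t)\le u\}-\mathbb P(F_{\mathbb X}\le u)\right|,$$ where $\mathrm{meas}$ is Lebesgue measure. Then there exist absolute constants $C>0$ and $T_0$ such that for all real $T\ge T_0$ $$D_F(T)\le C\,\frac{(\log\log\log T)^{9/4}}{(\log\log T)^{3/4}}.$$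 -/

import Mathlib

open MeasureTheory ProbabilityTheory Filter Topology

noncomputable section

namespace DivisorDiscrepancy

/-- The divisor function `d(n)`, with `d(0) = 0`. -/
def d (n : ℕ) : ℕ := n.divisors.card

/-- `Δ(x) = ∑_{n ≤ x} d(n) - x (log x + 2γ - 1)`. -/
def Delta (x : ℝ) : ℝ :=
  (∑ n ∈ Finset.Icc 1 ⌊x⌋₊, (d n : ℝ)) -
    x * (Real.log x + 2 * Real.eulerMascheroniConstant - 1)

/-- `F(t) = t^{-1/4} Δ(t)`. -/
def F (t : ℝ) : ℝ := t ^ (-(1 / 4) : ℝ) * Delta t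

/-- `ℙ_T(g(t) ∈ B) = (1/T) meas {t ∈ [T, 2T] : g(t) ∈ B}`. -/
def probT (T : ℝ) (g : ℝ → ℝ) (B : Set ℝ) : ℝ :=
  1 / T * volume.real {t : ℝ | t ∈ Set.Icc T (2 * T) ∧ g t ∈ B}

/-- The `r`-th term `d(n r²) r^{-3/2} cos(2π r x - π/4)` of the inner series; it vanishes for
`r = 0` because `d(0) = 0`. -/
def innerTerm (n : ℕ) (x : ℝ) (r : ℕ) : ℝ :=
  (d (n * r ^ 2) : ℝ) / (r : ℝ) ^ (3 / 2 : ℝ) *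
    Real.cos (2 * Real.pi * r * x - Real.pi / 4)

/-- The partial sum over `1 ≤ n ≤ N` of the random trigonometric series, as a function of the
sequence of phases `x`; only the phases with square-free index matter. -/
def partialSeries (x : ℕ → ℝ) (N : ℕ) : ℝ :=
  1 / (Real.pi * √2) *
    ∑ n ∈ Finset.Icc 1 N,
      ((ArithmeticFunction.moebius n : ℤ) : ℝ) ^ 2 / (n : ℝ) ^ (3 / 4 : ℝ) *
        ∑' r : ℕ, innerTerm n (x n) r

/-- The double series converges: every inner series is (absolutely) summable and the outer series
converges as the limit of its partial sums. -/
def SeriesConverges (x : ℕ → ℝ) : Prop :=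
  (∀ n : ℕ, Squarefree n → Summable (innerTerm n (x n))) ∧
    ∃ l : ℝ, Tendsto (partialSeries x) atTop (𝓝 l)

/-- The sum of the trigonometric series with phases `x`. -/
def seriesSum (x : ℕ → ℝ) : ℝ := limUnder atTop (partialSeries x)

/-- The random variable `F_𝕏`. -/
def FX {Ω : Type*} (X : ℕ → Ω → ℝ) (ω : Ω) : ℝ := seriesSum (fun n => X n ω)

/-- The discrepancy `D_F(T) = sup_u |ℙ_T(F(t) ≤ u) - ℙ(F_𝕏 ≤ u)|`. -/
def discrepancy {Ω : Type*} [MeasurableSpace Ω] (P : Measure Ω) (X : ℕ → Ω → ℝ) (T : ℝ) : ℝ :=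
  ⨆ u : ℝ, |probT T F (Set.Iic u) - P.real {ω | FX X ω ≤ u}|

end DivisorDiscrepancy

end

noncomputable section

namespace DivisorDiscrepancy

open Real (exp log cos sin cosh sinh)
open scoped Real FourierTransform

/-! ### The divisor function and its Dirichlet series -/

lemma d_mul_le (a b : ℕ) : d (a * b) ≤ d a * d b := by
  unfold d
  rw [Nat.divisors_mul]
  exact Finset.card_mul_le

lemma d_zero : d 0 = 0 := by simp [d]

lemma one_le_d {n : ℕ} (hn : n ≠ 0) : 1 ≤ d n :=
  Finset.card_pos.2 ⟨1, Nat.one_mem_divisors.2 hn⟩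

lemma sum_divisorsAntidiagonal_le {F G : ℕ → ℝ} (hF : ∀ n, 0 ≤ F n) (hG : ∀ n, 0 ≤ G n)
    (sF : Summable F) (sG : Summable G) (S : Finset ℕ) :
    ∑ n ∈ S, ∑ p ∈ n.divisorsAntidiagonal, F p.1 * G p.2 ≤ (∑' n, F n) * ∑' n, G n := by
  classical
  have hdis : (S : Set ℕ).PairwiseDisjoint Nat.divisorsAntidiagonal := by
    intro a _ b _ hab
    refine Finset.disjoint_left.2 fun p hp hq => hab ?_
    rw [← (Nat.mem_divisorsAntidiagonal.1 hp).1, (Nat.mem_divisorsAntidiagonal.1 hq).1]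
  rw [← Finset.sum_biUnion hdis]
  set U := S.biUnion Nat.divisorsAntidiagonal
  calc ∑ p ∈ U, F p.1 * G p.2
      ≤ ∑ p ∈ (U.image Prod.fst) ×ˢ (U.image Prod.snd), F p.1 * G p.2 := by
        refine Finset.sum_le_sum_of_subset_of_nonneg ?_ fun p _ _ => mul_nonneg (hF _) (hG _)
        intro p hp
        exact Finset.mem_product.2 ⟨Finset.mem_image_of_mem _ hp, Finset.mem_image_of_mem _ hp⟩
    _ = (∑ a ∈ U.image Prod.fst, F a) * ∑ b ∈ U.image Prod.snd, G b := by
        rw [Finset.sum_mul_sum, Finset.sum_product]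
    _ ≤ _ := mul_le_mul (sF.sum_le_tsum _ fun i _ => hF i) (sG.sum_le_tsum _ fun i _ => hG i)
        (Finset.sum_nonneg fun i _ => hG i) (tsum_nonneg hF)

lemma d_pow_succ_le (j n : ℕ) :
    (d n : ℝ) ^ (j + 1) ≤ ∑ p ∈ n.divisorsAntidiagonal, (d p.1 : ℝ) ^ j * (d p.2 : ℝ) ^ j := by
  have h : ∀ p ∈ n.divisorsAntidiagonal, (d n : ℝ) ^ j ≤ (d p.1 : ℝ) ^ j * (d p.2 : ℝ) ^ j := by
    intro p hp
    rw [← mul_pow, ← (Nat.mem_divisorsAntidiagonal.1 hp).1]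
    exact pow_le_pow_left₀ (by positivity) (by exact_mod_cast d_mul_le _ _) _
  calc (d n : ℝ) ^ (j + 1) = ∑ p ∈ n.divisorsAntidiagonal, (d n : ℝ) ^ j := by
        rw [Finset.sum_const, nsmul_eq_mul, pow_succ', d, ← Nat.map_div_right_divisors,
          Finset.card_map]
    _ ≤ _ := Finset.sum_le_sum h

lemma sum_rpow_neg_le {σ : ℝ} (hσ : 1 < σ) (S : Finset ℕ) :
    ∑ n ∈ S, (n : ℝ) ^ (-σ) ≤ 1 + 1 / (σ - 1) := by
  have key : ∀ M : ℕ, ∑ n ∈ Finset.range (M + 1), ((n + 1 : ℕ) : ℝ) ^ (-σ)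
      ≤ 1 + 1 / (σ - 1) := by
    intro M
    have hanti : AntitoneOn (fun x : ℝ => x ^ (-σ)) (Set.Icc (1 : ℝ) (1 + M)) := by
      intro a ha b hb hab
      exact Real.rpow_le_rpow_of_nonpos (by linarith [ha.1]) hab (by linarith)
    have h1 := AntitoneOn.sum_le_integral (x₀ := 1) (a := M) (f := fun x : ℝ => x ^ (-σ)) hanti
    rw [Finset.sum_range_succ']
    have h2 : ∫ x in (1 : ℝ)..(1 + M), x ^ (-σ) ≤ 1 / (σ - 1) := by
      rw [integral_rpow (Or.inr ⟨by linarith, by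
        rw [Set.uIcc_of_le (by simp)]; intro h; linarith [h.1]⟩)]
      have h3 : (0 : ℝ) ≤ (1 + M : ℝ) ^ (-σ + 1) := by positivity
      have h4 : (0 : ℝ) < σ - 1 := by linarith
      rw [show -σ + 1 = -(σ - 1) by ring, Real.one_rpow, div_neg, ← neg_div]
      apply div_le_div_of_nonneg_right _ h4.le
      rw [show -σ + 1 = -(σ - 1) by ring] at h3
      linarith
    have h5 : ∑ i ∈ Finset.range M, ((i + 1 + 1 : ℕ) : ℝ) ^ (-σ)
        = ∑ i ∈ Finset.range M, (1 + ((i + 1 : ℕ) : ℝ)) ^ (-σ) := by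
      refine Finset.sum_congr rfl fun i _ => ?_
      congr 1; push_cast; ring
    rw [h5]
    simp only [zero_add, Nat.cast_one, Real.one_rpow]
    linarith
  refine le_trans ?_ (key (S.sup id))
  calc ∑ n ∈ S, (n : ℝ) ^ (-σ) ≤ ∑ n ∈ Finset.range (S.sup id + 2), (n : ℝ) ^ (-σ) := by
        refine Finset.sum_le_sum_of_subset_of_nonneg ?_ fun p _ _ => by positivity
        intro n hn
        have : n ≤ S.sup id := Finset.le_sup (f := id) hn
        rw [Finset.mem_range]; omega
    _ = _ := by
        rw [Finset.sum_range_succ']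
        simp [Real.zero_rpow (by linarith : -σ ≠ 0)]

/-- The Dirichlet series of `d(n)^j` converges for `σ > 1`, with a bound of the order of its
pole. -/
lemma summable_d_pow {σ : ℝ} (hσ : 1 < σ) (j : ℕ) :
    Summable (fun n : ℕ => (d n : ℝ) ^ j * (n : ℝ) ^ (-σ)) ∧
      ∑' n : ℕ, (d n : ℝ) ^ j * (n : ℝ) ^ (-σ) ≤ (1 + 1 / (σ - 1)) ^ (2 ^ j) := by
  induction j with
  | zero =>
    simp only [pow_zero, one_mul, pow_one]
    have hs := summable_of_sum_le (f := fun n : ℕ => (n : ℝ) ^ (-σ)) (fun n => by positivity)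
      (sum_rpow_neg_le hσ)
    exact ⟨hs, hs.tsum_le_of_sum_le (sum_rpow_neg_le hσ)⟩
  | succ j ih =>
    obtain ⟨hs, hb⟩ := ih
    set F : ℕ → ℝ := fun n => (d n : ℝ) ^ j * (n : ℝ) ^ (-σ) with hF
    have hF0 : ∀ n, 0 ≤ F n := fun n => by positivity
    have hle : ∀ S : Finset ℕ, ∑ n ∈ S, (d n : ℝ) ^ (j + 1) * (n : ℝ) ^ (-σ)
        ≤ (1 + 1 / (σ - 1)) ^ (2 ^ (j + 1)) := by
      intro S
      calc ∑ n ∈ S, (d n : ℝ) ^ (j + 1) * (n : ℝ) ^ (-σ)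
          ≤ ∑ n ∈ S, ∑ p ∈ n.divisorsAntidiagonal, F p.1 * F p.2 := by
            refine Finset.sum_le_sum fun n _ => ?_
            calc (d n : ℝ) ^ (j + 1) * (n : ℝ) ^ (-σ)
                ≤ (∑ p ∈ n.divisorsAntidiagonal, (d p.1 : ℝ) ^ j * (d p.2 : ℝ) ^ j)
                    * (n : ℝ) ^ (-σ) :=
                  mul_le_mul_of_nonneg_right (d_pow_succ_le j n) (by positivity)
              _ = _ := by
                  rw [Finset.sum_mul]
                  refine Finset.sum_congr rfl fun p hp => ?_
                  rw [← (Nat.mem_divisorsAntidiagonal.1 hp).1, Nat.cast_mul,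
                    Real.mul_rpow (by positivity) (by positivity)]
                  simp only [hF]; ring
        _ ≤ (∑' n, F n) * ∑' n, F n := sum_divisorsAntidiagonal_le hF0 hF0 hs hs S
        _ ≤ (1 + 1 / (σ - 1)) ^ (2 ^ j) * (1 + 1 / (σ - 1)) ^ (2 ^ j) :=
            mul_le_mul hb hb (tsum_nonneg hF0) (by
              have : 0 < σ - 1 := by linarith
              positivity)
        _ = _ := by rw [← pow_add]; congr 1; ring
    have hs' := summable_of_sum_le (f := fun n : ℕ => (d n : ℝ) ^ (j + 1) * (n : ℝ) ^ (-σ))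
      (fun n => by positivity) hle
    exact ⟨hs', hs'.tsum_le_of_sum_le hle⟩

lemma exists_d_le : ∃ C : ℝ, 1 ≤ C ∧ ∀ n : ℕ, (d n : ℝ) ≤ C * (n : ℝ) ^ (1 / 8 : ℝ) := by
  obtain ⟨hs, -⟩ := summable_d_pow (σ := 2) (by norm_num) 16
  set B := ∑' n : ℕ, (d n : ℝ) ^ 16 * (n : ℝ) ^ (-(2 : ℝ)) with hB
  refine ⟨max 1 B, le_max_left _ _, fun n => ?_⟩
  rcases Nat.eq_zero_or_pos n with rfl | hn
  · simp [d_zero]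
  have hn' : (0 : ℝ) < n := by exact_mod_cast hn
  have h1 : (d n : ℝ) ^ 16 * (n : ℝ) ^ (-(2 : ℝ)) ≤ B := hs.le_tsum n fun _ _ => by positivity
  have h2 : (d n : ℝ) ^ 16 ≤ B * (n : ℝ) ^ (2 : ℝ) := by
    rw [Real.rpow_neg hn'.le] at h1
    have : (0 : ℝ) < (n : ℝ) ^ (2 : ℝ) := by positivity
    rwa [← div_eq_mul_inv, div_le_iff₀ this] at h1
  have h3 : (d n : ℝ) ^ 16 ≤ (max 1 B * (n : ℝ) ^ (1 / 8 : ℝ)) ^ 16 := by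
    rw [mul_pow, ← Real.rpow_natCast ((n : ℝ) ^ (1 / 8 : ℝ)), ← Real.rpow_mul hn'.le]
    norm_num only
    refine h2.trans ?_
    have h4 : B ≤ (max 1 B) ^ 16 :=
      (le_max_right _ _).trans (le_self_pow₀ (le_max_left _ _) (by norm_num))
    exact mul_le_mul_of_nonneg_right h4 (by positivity)
  exact le_of_pow_le_pow_left₀ (by norm_num) (by positivity) h3

/-! ### A smoothing inequality for distribution functions -/

/-- The Fejér kernel, up to normalisation. -/
def fejer (x : ℝ) : ℝ := Real.sinc (x / 2) ^ 2

lemma fejer_nonneg (x : ℝ) : 0 ≤ fejer x := sq_nonneg _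

lemma continuous_fejer : Continuous fejer := by
  unfold fejer
  exact (Real.continuous_sinc.comp (continuous_id.div_const 2)).pow 2

lemma fejer_le (x : ℝ) : fejer x ≤ 8 * (1 + x ^ 2)⁻¹ := by
  have h0 : (0 : ℝ) < 1 + x ^ 2 := by positivity
  rw [← div_eq_mul_inv, le_div_iff₀ h0]
  rcases le_or_gt (x ^ 2) 7 with h | h
  · have h1 : fejer x ≤ 1 := by
      unfold fejer
      rw [sq_le_one_iff_abs_le_one]
      exact Real.abs_sinc_le_one _
    nlinarith [fejer_nonneg x]
  · have hx : x ≠ 0 := by rintro rfl; norm_num at h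
    have h1 : fejer x * x ^ 2 ≤ 4 := by
      unfold fejer
      rw [Real.sinc_of_ne_zero (by positivity), div_pow]
      have h2 : sin (x / 2) ^ 2 ≤ 1 := Real.sin_sq_le_one _
      have : sin (x / 2) ^ 2 / (x / 2) ^ 2 * x ^ 2 = 4 * sin (x / 2) ^ 2 := by
        field_simp
        ring
      rw [this]; linarith
    have h3 : fejer x ≤ 1 := by
      unfold fejer
      rw [sq_le_one_iff_abs_le_one]
      exact Real.abs_sinc_le_one _
    nlinarith [fejer_nonneg x]

lemma integrable_fejer : Integrable fejer := by
  refine Integrable.mono' ((integrable_inv_one_add_sq).const_mul 8)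
    continuous_fejer.aestronglyMeasurable (ae_of_all _ fun x => ?_)
  rw [Real.norm_of_nonneg (fejer_nonneg x)]
  exact fejer_le x

lemma integral_fejer_pos : 0 < ∫ x, fejer x := by
  refine (integral_pos_iff_support_of_nonneg fejer_nonneg integrable_fejer).2 ?_
  refine (continuous_fejer.isOpen_support).measure_pos _ ⟨0, ?_⟩
  simp [fejer]

lemma fejer_eq_integral (x : ℝ) : (fejer x : ℂ) =
    ∫ ξ in (-1 : ℝ)..1, ((1 - |ξ| : ℝ) : ℂ) * Complex.exp (-(Complex.I * x * ξ)) := by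
  have hc : Continuous fun ξ : ℝ => ((1 - |ξ| : ℝ) : ℂ) * Complex.exp (-(Complex.I * x * ξ)) := by
    fun_prop
  rw [← intervalIntegral.integral_add_adjacent_intervals (b := 0)
    (hc.intervalIntegrable _ _) (hc.intervalIntegrable _ _)]
  have e1 : ∫ ξ in (-1 : ℝ)..0, ((1 - |ξ| : ℝ) : ℂ) * Complex.exp (-(Complex.I * x * ξ))
      = ∫ ξ in (-1 : ℝ)..0, (1 + (ξ : ℂ)) * Complex.exp (-(Complex.I * x * ξ)) := by
    refine intervalIntegral.integral_congr fun ξ hξ => ?_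
    rw [Set.uIcc_of_le (by norm_num)] at hξ
    simp [abs_of_nonpos hξ.2]
  have e2 : ∫ ξ in (0 : ℝ)..1, ((1 - |ξ| : ℝ) : ℂ) * Complex.exp (-(Complex.I * x * ξ))
      = ∫ ξ in (0 : ℝ)..1, (1 - (ξ : ℂ)) * Complex.exp (-(Complex.I * x * ξ)) := by
    refine intervalIntegral.integral_congr fun ξ hξ => ?_
    rw [Set.uIcc_of_le (by norm_num)] at hξ
    simp [abs_of_nonneg hξ.1]
  rw [e1, e2]
  rcases eq_or_ne x 0 with rfl | hx
  · have a1 : ∫ ξ in (-1 : ℝ)..0, (1 + (ξ : ℂ)) * Complex.exp (-(Complex.I * (0 : ℝ) * ξ))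
        = ((∫ ξ in (-1 : ℝ)..0, (1 + ξ) : ℝ) : ℂ) := by
      rw [← intervalIntegral.integral_ofReal]; simp
    have a2 : ∫ ξ in (0 : ℝ)..1, (1 - (ξ : ℂ)) * Complex.exp (-(Complex.I * (0 : ℝ) * ξ))
        = ((∫ ξ in (0 : ℝ)..1, (1 - ξ) : ℝ) : ℂ) := by
      rw [← intervalIntegral.integral_ofReal]; simp
    rw [a1, a2, ← Complex.ofReal_add]
    congr 1
    have : ∫ ξ in (-1 : ℝ)..0, (1 + ξ) = 1 / 2 := by
      rw [intervalIntegral.integral_add (by simp) (by simp)]; simp; norm_num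
    rw [this]
    have : ∫ ξ in (0 : ℝ)..1, (1 - ξ) = 1 / 2 := by
      rw [intervalIntegral.integral_sub (by simp) (by simp)]; simp; norm_num
    rw [this]
    simp [fejer]; norm_num
  set c : ℂ := -(Complex.I * x) with hc'
  have hc0 : c ≠ 0 := by simp [hc', hx]
  have hE : ∀ ξ : ℝ, HasDerivAt (fun ξ : ℝ => Complex.exp (c * ξ)) (c * Complex.exp (c * ξ)) ξ := by
    intro ξ
    have h := ((hasDerivAt_id (ξ : ℂ)).const_mul c).cexp.comp_ofReal
    simp only [id, mul_one] at h
    rw [mul_comm]; exact h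
  have hid : ∀ ξ : ℝ, HasDerivAt (fun ξ : ℝ => (ξ : ℂ)) 1 ξ := fun ξ =>
    (hasDerivAt_id (ξ : ℂ)).comp_ofReal
  have i1 : ∫ ξ in (-1 : ℝ)..0, (1 + (ξ : ℂ)) * Complex.exp (-(Complex.I * x * ξ))
      = 1 / c - 1 / c ^ 2 + Complex.exp (-c) / c ^ 2 := by
    rw [intervalIntegral.integral_eq_sub_of_hasDerivAt
      (f := fun ξ : ℝ => (1 + (ξ : ℂ)) * Complex.exp (c * ξ) / c - Complex.exp (c * ξ) / c ^ 2)]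
    · simp
    · intro ξ _
      convert! ((((hid ξ).const_add 1).mul (hE ξ)).div_const c).sub ((hE ξ).div_const (c ^ 2)) using 1
      rw [show -(Complex.I * x * ξ) = c * ξ by rw [hc']; ring]
      field_simp; ring
    · exact Continuous.intervalIntegrable (by fun_prop) _ _
  have i2 : ∫ ξ in (0 : ℝ)..1, (1 - (ξ : ℂ)) * Complex.exp (-(Complex.I * x * ξ))
      = Complex.exp c / c ^ 2 - 1 / c - 1 / c ^ 2 := by
    rw [intervalIntegral.integral_eq_sub_of_hasDerivAt
      (f := fun ξ : ℝ => (1 - (ξ : ℂ)) * Complex.exp (c * ξ) / c + Complex.exp (c * ξ) / c ^ 2)]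
    · simp; ring
    · intro ξ _
      convert! ((((hid ξ).const_sub 1).mul (hE ξ)).div_const c).add ((hE ξ).div_const (c ^ 2)) using 1
      rw [show -(Complex.I * x * ξ) = c * ξ by rw [hc']; ring]
      field_simp; ring
    · exact Continuous.intervalIntegrable (by fun_prop) _ _
  rw [i1, i2]
  have hcos : Complex.exp c + Complex.exp (-c) = 2 * (cos x : ℂ) := by
    rw [Complex.ofReal_cos, Complex.cos, hc', neg_neg]
    ring_nf
  have hc2 : c ^ 2 = -((x : ℂ) ^ 2) := by
    rw [hc', neg_sq, mul_pow, Complex.I_sq]; ring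
  have hgoal : 1 / c - 1 / c ^ 2 + Complex.exp (-c) / c ^ 2 +
      (Complex.exp c / c ^ 2 - 1 / c - 1 / c ^ 2) =
      (Complex.exp c + Complex.exp (-c) - 2) / c ^ 2 := by ring
  rw [hgoal, hcos, hc2]
  have hfe : fejer x = (2 - 2 * cos x) / x ^ 2 := by
    unfold fejer
    rw [Real.sinc_of_ne_zero (by positivity), div_pow, Real.sin_sq_eq_half_sub]
    rw [show 2 * (x / 2) = x by ring]
    field_simp
  rw [hfe]
  push_cast
  rw [div_neg, ← neg_div]
  ring

lemma integral_fejer_sub (μ : Measure ℝ) [IsProbabilityMeasure μ] (a b : ℝ) :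
    ((∫ x, (∫ r in a..b, fejer (r - x)) ∂μ : ℝ) : ℂ) =
      ∫ ξ in (-1 : ℝ)..1, ((1 - |ξ| : ℝ) : ℂ) * charFun μ ξ *
        ∫ r in a..b, Complex.exp (-(Complex.I * r * ξ)) := by
  have hw : Continuous fun ξ : ℝ => ∫ r in a..b, Complex.exp (-(Complex.I * r * ξ)) := by
    apply intervalIntegral.continuous_parametric_intervalIntegral_of_continuous'
    fun_prop
  have step1 : ∀ x : ℝ, ((∫ r in a..b, fejer (r - x) : ℝ) : ℂ) =
      ∫ ξ in (-1 : ℝ)..1, ((1 - |ξ| : ℝ) : ℂ) * Complex.exp (ξ * x * Complex.I) *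
        ∫ r in a..b, Complex.exp (-(Complex.I * r * ξ)) := by
    intro x
    rw [← intervalIntegral.integral_ofReal]
    simp_rw [fejer_eq_integral]
    rw [intervalIntegral_intervalIntegral_swap]
    · refine intervalIntegral.integral_congr fun ξ _ => ?_
      rw [← intervalIntegral.integral_const_mul]
      refine intervalIntegral.integral_congr fun r _ => ?_
      rw [mul_assoc ((1 - |ξ| : ℝ) : ℂ), ← Complex.exp_add]
      congr 2; push_cast; ring
    · have hc : Continuous (Function.uncurry fun (r ξ : ℝ) => ((1 - |ξ| : ℝ) : ℂ) *
          Complex.exp (-(Complex.I * ((r - x : ℝ) : ℂ) * ξ))) := by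
        simp only [Function.uncurry_def]; fun_prop
      refine (hc.continuousOn.integrableOn_compact
        (isCompact_uIcc.prod isCompact_uIcc)).mono_set
        (Set.prod_mono Set.uIoc_subset_uIcc Set.uIoc_subset_uIcc)
  rw [← integral_complex_ofReal]
  simp_rw [step1]
  rw [← intervalIntegral_integral_swap]
  · refine intervalIntegral.integral_congr fun ξ _ => ?_
    rw [charFun_apply_real, integral_mul_const, integral_const_mul]
  · obtain ⟨M, hM⟩ := (isCompact_Icc (a := (-1 : ℝ)) (b := 1)).exists_bound_of_continuousOn
      hw.continuousOn
    have hmeas : AEStronglyMeasurable (Function.uncurry fun (ξ x : ℝ) =>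
        ((1 - |ξ| : ℝ) : ℂ) * Complex.exp (ξ * x * Complex.I) *
          ∫ r in a..b, Complex.exp (-(Complex.I * r * ξ)))
        ((volume.restrict (Set.uIoc (-1 : ℝ) 1)).prod μ) := by
      refine Continuous.aestronglyMeasurable ?_
      simp only [Function.uncurry_def]
      refine Continuous.mul (by fun_prop) (hw.comp continuous_fst)
    have : IsFiniteMeasure (volume.restrict (Set.uIoc (-1 : ℝ) 1)) := by
      rw [Set.uIoc_of_le (by norm_num)]; infer_instance
    refine Integrable.of_bound hmeas M ?_
    have hmem : ∀ᵐ p ∂((volume.restrict (Set.uIoc (-1 : ℝ) 1)).prod μ),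
        p.1 ∈ Set.uIoc (-1 : ℝ) 1 := by
      have h := ae_restrict_mem (μ := (volume : Measure ℝ)) (measurableSet_uIoc (a := (-1 : ℝ)) (b := 1))
      exact Measure.quasiMeasurePreserving_fst.ae h
    filter_upwards [hmem] with p hp
    rw [Set.uIoc_of_le (by norm_num)] at hp
    have hp' : p.1 ∈ Set.Icc (-1 : ℝ) 1 := ⟨hp.1.le, hp.2⟩
    simp only [Function.uncurry_def, norm_mul]
    have h1 : ‖((1 - |p.1| : ℝ) : ℂ)‖ ≤ 1 := by
      rw [Complex.norm_real, Real.norm_eq_abs, abs_le]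
      have := abs_le.2 hp'
      constructor <;> linarith [abs_nonneg p.1]
    have h2 : ‖Complex.exp (p.1 * p.2 * Complex.I)‖ = 1 := by
      rw [← Complex.ofReal_mul, Complex.norm_exp_ofReal_mul_I]
    have h3 := hM p.1 hp'
    rw [h2, mul_one]
    have := mul_le_mul h1 h3 (norm_nonneg _) zero_le_one
    linarith

lemma integral_fejer_mul_measure (μ : Measure ℝ) [IsProbabilityMeasure μ] {a b : ℝ} (hab : a ≤ b) :
    ∫ s, fejer s * μ.real (Set.Ioc (a - s) (b - s)) = ∫ x, (∫ r in a..b, fejer (r - x)) ∂μ := by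
  have h1 : ∀ s, fejer s * μ.real (Set.Ioc (a - s) (b - s)) =
      ∫ x, fejer s * (Set.Ioc (a - s) (b - s)).indicator (fun _ => (1 : ℝ)) x ∂μ := by
    intro s
    rw [integral_const_mul, integral_indicator measurableSet_Ioc]
    simp
  simp_rw [h1]
  rw [integral_integral_swap]
  · refine integral_congr_ae (ae_of_all _ fun x => ?_)
    simp only
    rw [intervalIntegral.integral_comp_sub_right (fun r => fejer r) x,
      intervalIntegral.integral_of_le (by linarith), ← integral_indicator measurableSet_Ioc]
    refine integral_congr_ae (ae_of_all _ fun s => ?_)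
    simp only [Set.indicator_apply, Set.mem_Ioc]
    have : (a - s < x ∧ x ≤ b - s) ↔ (a - x < s ∧ s ≤ b - x) := by
      constructor <;> rintro ⟨h, h'⟩ <;> constructor <;> linarith
    simp only [this]
    split_ifs <;> simp
  · have hset : MeasurableSet {p : ℝ × ℝ | p.2 ∈ Set.Ioc (a - p.1) (b - p.1)} := by
      simp only [Set.mem_Ioc]
      exact (measurableSet_lt (measurable_const.sub measurable_fst) measurable_snd).inter
        (measurableSet_le measurable_snd (measurable_const.sub measurable_fst))
    have hmeas : AEStronglyMeasurable (Function.uncurry fun (s x : ℝ) => fejer s *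
        (Set.Ioc (a - s) (b - s)).indicator (fun _ => (1 : ℝ)) x) (volume.prod μ) := by
      have : (Function.uncurry fun (s x : ℝ) => fejer s *
        (Set.Ioc (a - s) (b - s)).indicator (fun _ => (1 : ℝ)) x) = fun p => fejer p.1 *
        {p : ℝ × ℝ | p.2 ∈ Set.Ioc (a - p.1) (b - p.1)}.indicator (fun _ => (1 : ℝ)) p := by
        ext p; rfl
      rw [this]
      exact ((continuous_fejer.measurable.comp measurable_fst).mul
        (measurable_const.indicator hset)).aestronglyMeasurable
    refine Integrable.mono' (g := fun p => fejer p.1) ?_ hmeas (ae_of_all _ fun p => ?_)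
    · have := (integrable_fejer).mul_prod (integrable_const (1 : ℝ) (μ := μ))
      simpa using this
    · simp only [Function.uncurry_def, Set.indicator_apply]
      split_ifs
      · simp [abs_of_nonneg (fejer_nonneg _)]
      · simp [fejer_nonneg]

lemma measurable_real_Iic (μ : Measure ℝ) [IsProbabilityMeasure μ] :
    Measurable fun u => μ.real (Set.Iic u) :=
  Monotone.measurable fun _ _ h => measureReal_mono (Set.Iic_subset_Iic.2 h)

lemma tendsto_real_Iic_atBot (μ : Measure ℝ) [IsProbabilityMeasure μ] :
    Tendsto (fun u => μ.real (Set.Iic u)) atBot (𝓝 0) := by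
  have h := tendsto_cdf_atBot μ
  exact h.congr fun u => cdf_eq_real μ u

lemma real_Iic_sub_real_Iic (μ : Measure ℝ) [IsProbabilityMeasure μ] {a b : ℝ} (h : a ≤ b) :
    μ.real (Set.Iic b) - μ.real (Set.Iic a) = μ.real (Set.Ioc a b) := by
  have := measureReal_union (μ := μ) (Set.Iic_disjoint_Ioc (le_refl a) (c := b)) measurableSet_Ioc
  rw [Set.Iic_union_Ioc_eq_Iic h] at this
  linarith

/-- The smoothing inequality at scale one: the convolutions of two distribution functions with
the Fejér kernel are close. -/
lemma abs_integral_fejer_mul_le {μ ν : Measure ℝ} [IsProbabilityMeasure μ] [IsProbabilityMeasure ν]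
    {B : ℝ} (hB : ∀ ξ ∈ Set.Icc (-1 : ℝ) 1, ‖charFun μ ξ - charFun ν ξ‖ ≤ B * |ξ|) (u : ℝ) :
    |∫ s, fejer s * (μ.real (Set.Iic (u - s)) - ν.real (Set.Iic (u - s)))| ≤ 4 * B := by
  set D : ℝ → ℝ := fun u => ∫ s, fejer s * (μ.real (Set.Iic (u - s)) - ν.real (Set.Iic (u - s)))
    with hD
  have hmeasΔ : Measurable fun u => μ.real (Set.Iic u) - ν.real (Set.Iic u) :=
    (measurable_real_Iic μ).sub (measurable_real_Iic ν)
  have hbd : ∀ u, |μ.real (Set.Iic u) - ν.real (Set.Iic u)| ≤ 1 := by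
    intro u
    rw [abs_le]
    constructor <;>
    linarith [measureReal_nonneg (μ := μ) (s := Set.Iic u), measureReal_le_one (μ := μ) (s := Set.Iic u),
      measureReal_nonneg (μ := ν) (s := Set.Iic u), measureReal_le_one (μ := ν) (s := Set.Iic u)]
  have hint : ∀ u, Integrable fun s => fejer s *
      (μ.real (Set.Iic (u - s)) - ν.real (Set.Iic (u - s))) := by
    intro u
    refine integrable_fejer.mul_bdd (c := 1)
      ((hmeasΔ.comp (measurable_const.sub measurable_id)).aestronglyMeasurable) (ae_of_all _ fun s => ?_)
    exact hbd _
  have hdiff : ∀ a b, a ≤ b → |D b - D a| ≤ 4 * B := by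
    intro a b hab
    have hIoc : ∀ (κ : Measure ℝ) [IsProbabilityMeasure κ] (s : ℝ),
        κ.real (Set.Iic (b - s)) - κ.real (Set.Iic (a - s)) = κ.real (Set.Ioc (a - s) (b - s)) := by
      intro κ _ s
      exact real_Iic_sub_real_Iic κ (by linarith)
    have hint2 : ∀ (κ : Measure ℝ) [IsProbabilityMeasure κ],
        Integrable fun s => fejer s * κ.real (Set.Ioc (a - s) (b - s)) := by
      intro κ _
      refine integrable_fejer.mul_bdd (c := 1) ?_ (ae_of_all _ fun s => ?_)
      · simp_rw [← hIoc κ]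
        exact (((measurable_real_Iic κ).comp (measurable_const.sub measurable_id)).sub
          ((measurable_real_Iic κ).comp (measurable_const.sub measurable_id))).aestronglyMeasurable
      · rw [Real.norm_of_nonneg measureReal_nonneg]; exact measureReal_le_one
    have e : D b - D a = (∫ x, (∫ r in a..b, fejer (r - x)) ∂μ) -
        ∫ x, (∫ r in a..b, fejer (r - x)) ∂ν := by
      rw [← integral_fejer_mul_measure μ hab, ← integral_fejer_mul_measure ν hab,
        ← integral_sub (hint2 μ) (hint2 ν), hD, ← integral_sub (hint b) (hint a)]
      refine integral_congr_ae (ae_of_all _ fun s => ?_)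
      simp only
      rw [← hIoc μ, ← hIoc ν]; ring
    have hw : Continuous fun ξ : ℝ => ∫ r in a..b, Complex.exp (-(Complex.I * r * ξ)) := by
      apply intervalIntegral.continuous_parametric_intervalIntegral_of_continuous'
      fun_prop
    have hii : ∀ (κ : Measure ℝ) [IsProbabilityMeasure κ], IntervalIntegrable (fun ξ : ℝ =>
        ((1 - |ξ| : ℝ) : ℂ) * charFun κ ξ * ∫ r in a..b, Complex.exp (-(Complex.I * r * ξ)))
        volume (-1) 1 := fun κ _ =>
      Continuous.intervalIntegrable (by
        have := continuous_charFun (μ := κ)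
        fun_prop) _ _
    have e2 : ((D b - D a : ℝ) : ℂ) = ∫ ξ in (-1 : ℝ)..1, ((1 - |ξ| : ℝ) : ℂ) *
        (charFun μ ξ - charFun ν ξ) * ∫ r in a..b, Complex.exp (-(Complex.I * r * ξ)) := by
      rw [e, Complex.ofReal_sub, integral_fejer_sub, integral_fejer_sub,
        ← intervalIntegral.integral_sub (hii μ) (hii ν)]
      refine intervalIntegral.integral_congr fun ξ _ => ?_
      ring
    have hwb : ∀ ξ : ℝ, |ξ| * ‖∫ r in a..b, Complex.exp (-(Complex.I * r * ξ))‖ ≤ 2 := by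
      intro ξ
      rcases eq_or_ne ξ 0 with rfl | hξ
      · simp
      have hne : -(Complex.I * ξ) ≠ 0 := by simp [hξ]
      have : ∫ r in a..b, Complex.exp (-(Complex.I * r * ξ)) =
          (Complex.exp (-(Complex.I * ξ) * b) - Complex.exp (-(Complex.I * ξ) * a)) /
            (-(Complex.I * ξ)) := by
        rw [← integral_exp_mul_complex hne]
        refine intervalIntegral.integral_congr fun r _ => ?_
        congr 1; ring
      rw [this, norm_div]
      have hn : ‖-(Complex.I * (ξ : ℂ))‖ = |ξ| := by simp
      rw [hn, mul_div_cancel₀ _ (abs_pos.2 hξ).ne']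
      have h1 : ∀ r : ℝ, ‖Complex.exp (-(Complex.I * ξ) * r)‖ = 1 := by
        intro r
        rw [show -(Complex.I * (ξ : ℂ)) * r = ((-(ξ * r) : ℝ) : ℂ) * Complex.I by push_cast; ring,
          Complex.norm_exp_ofReal_mul_I]
      calc _ ≤ _ := norm_sub_le _ _
        _ = 2 := by rw [h1, h1]; norm_num
    have hB0 : 0 ≤ B := by
      have := hB 1 (by simp)
      simp only [abs_one, mul_one] at this
      exact (norm_nonneg _).trans this
    have : ‖((D b - D a : ℝ) : ℂ)‖ ≤ (2 * B) * |1 - (-1 : ℝ)| := by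
      rw [e2]
      refine intervalIntegral.norm_integral_le_of_norm_le_const fun ξ hξ => ?_
      rw [Set.uIoc_of_le (by norm_num)] at hξ
      have hξ' : ξ ∈ Set.Icc (-1 : ℝ) 1 := ⟨hξ.1.le, hξ.2⟩
      rw [norm_mul, norm_mul]
      have h1 : ‖((1 - |ξ| : ℝ) : ℂ)‖ ≤ 1 := by
        rw [Complex.norm_real, Real.norm_eq_abs, abs_le]
        have := abs_le.2 hξ'
        constructor <;> linarith [abs_nonneg ξ]
      calc _ ≤ 1 * (B * |ξ|) * ‖∫ r in a..b, Complex.exp (-(Complex.I * r * ξ))‖ := by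
            gcongr
            exact hB ξ hξ'
        _ = B * (|ξ| * ‖∫ r in a..b, Complex.exp (-(Complex.I * r * ξ))‖) := by ring
        _ ≤ B * 2 := mul_le_mul_of_nonneg_left (hwb ξ) hB0
        _ = 2 * B := by ring
    rw [Complex.norm_real, Real.norm_eq_abs] at this
    norm_num at this
    linarith
  have hlim : Tendsto D atBot (𝓝 0) := by
    have : Tendsto D atBot (𝓝 (∫ s, fejer s * 0)) := by
      refine tendsto_integral_filter_of_dominated_convergence fejer
        (Eventually.of_forall fun u => (hint u).aestronglyMeasurable)
        (Eventually.of_forall fun u => ae_of_all _ fun s => ?_) integrable_fejer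
        (ae_of_all _ fun s => ?_)
      · rw [norm_mul, Real.norm_of_nonneg (fejer_nonneg s)]
        exact mul_le_of_le_one_right (fejer_nonneg s) (hbd _)
      · have ht : Tendsto (fun u : ℝ => u - s) atBot atBot := tendsto_atBot_add_const_right _ (-s) tendsto_id
        have := ((tendsto_real_Iic_atBot μ).comp ht).sub ((tendsto_real_Iic_atBot ν).comp ht)
        rw [sub_zero] at this
        exact this.const_mul _
    simpa using this
  have h2 : Tendsto (fun a => |D u - D a|) atBot (𝓝 |D u - 0|) :=
    (tendsto_const_nhds.sub hlim).abs
  rw [sub_zero] at h2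
  exact le_of_tendsto h2 ((eventually_le_atBot u).mono fun a ha => hdiff a u ha)

lemma exists_smoothing_unit : ∃ C : ℝ, 0 < C ∧ ∀ (μ ν : Measure ℝ) [IsProbabilityMeasure μ]
    [IsProbabilityMeasure ν] (A B : ℝ), 0 ≤ A →
    (∀ a b, a ≤ b → ν.real (Set.Ioc a b) ≤ A * (b - a)) →
    (∀ ξ ∈ Set.Icc (-1 : ℝ) 1, ‖charFun μ ξ - charFun ν ξ‖ ≤ B * |ξ|) →
    ∀ u, |μ.real (Set.Iic u) - ν.real (Set.Iic u)| ≤ C * (A + B) := by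
  set c := ∫ x, fejer x with hc
  have hc0 : 0 < c := integral_fejer_pos
  have htend : Tendsto (fun a : ℝ => ∫ x in (-a)..a, fejer x) atTop (𝓝 c) :=
    intervalIntegral_tendsto_integral integrable_fejer tendsto_neg_atTop_atBot tendsto_id
  obtain ⟨a, ha0, ha⟩ : ∃ a : ℝ, 0 < a ∧ 3 / 4 * c < ∫ x in (-a)..a, fejer x := by
    have := (htend.eventually (lt_mem_nhds (show 3 / 4 * c < c by linarith))).and
      (eventually_gt_atTop (0 : ℝ))
    obtain ⟨a, h1, h2⟩ := this.exists
    exact ⟨a, h2, h1⟩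
  refine ⟨8 / c + 4 * a, by positivity, ?_⟩
  intro μ ν _ _ A B hA hν hB
  set Δ : ℝ → ℝ := fun u => μ.real (Set.Iic u) - ν.real (Set.Iic u) with hΔ
  have hbd : ∀ u, |Δ u| ≤ 1 := by
    intro u
    rw [abs_le]
    constructor <;> simp only [hΔ] <;>
    linarith [measureReal_nonneg (μ := μ) (s := Set.Iic u), measureReal_le_one (μ := μ) (s := Set.Iic u),
      measureReal_nonneg (μ := ν) (s := Set.Iic u), measureReal_le_one (μ := ν) (s := Set.Iic u)]
  have hmeasΔ : Measurable Δ := (measurable_real_Iic μ).sub (measurable_real_Iic ν)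
  set δ := ⨆ u, |Δ u| with hδ
  have hbdd : BddAbove (Set.range fun u => |Δ u|) := ⟨1, by rintro _ ⟨u, rfl⟩; exact hbd u⟩
  have hleδ : ∀ u, |Δ u| ≤ δ := fun u => le_ciSup hbdd u
  have hδ0 : 0 ≤ δ := (abs_nonneg _).trans (hleδ 0)
  have hB0 : 0 ≤ B := by
    have := hB 1 (by simp)
    simp only [abs_one, mul_one] at this
    exact (norm_nonneg _).trans this
  have hstep : ∀ x y, x ≤ y → Δ x - A * (y - x) ≤ Δ y := by
    intro x y hxy
    have h1 : μ.real (Set.Iic x) ≤ μ.real (Set.Iic y) := measureReal_mono (Set.Iic_subset_Iic.2 hxy)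
    have h2 : ν.real (Set.Iic y) - ν.real (Set.Iic x) = ν.real (Set.Ioc x y) :=
      real_Iic_sub_real_Iic ν hxy
    have h3 := hν x y hxy
    simp only [hΔ]; linarith
  have hint : ∀ u, Integrable fun s => fejer s * Δ (u - s) := by
    intro u
    exact integrable_fejer.mul_bdd (c := 1)
      ((hmeasΔ.comp (measurable_const.sub measurable_id)).aestronglyMeasurable) (ae_of_all _ fun s => hbd _)
  have hκ : ∫ x in (Set.Ioc (-a) a)ᶜ, fejer x ≤ c / 4 := by
    have := integral_add_compl (measurableSet_Ioc (a := -a) (b := a)) integrable_fejer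
    rw [intervalIntegral.integral_of_le (by linarith)] at ha
    linarith
  -- a lower bound for an integral against the kernel
  have hlow : ∀ (g : ℝ → ℝ) (η : ℝ), Integrable (fun s => fejer s * g s) → (∀ s, -δ ≤ g s) →
      (∀ s ∈ Set.Ioc (-a) a, η ≤ g s) → 0 ≤ η →
      3 / 4 * c * η - δ * (c / 4) ≤ ∫ s, fejer s * g s := by
    intro g η hg h1 h2 hη
    rw [← integral_add_compl (measurableSet_Ioc (a := -a) (b := a)) hg]
    have k1 : 3 / 4 * c * η ≤ ∫ s in Set.Ioc (-a) a, fejer s * g s := by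
      calc 3 / 4 * c * η ≤ (∫ s in Set.Ioc (-a) a, fejer s) * η := by
            rw [intervalIntegral.integral_of_le (by linarith)] at ha
            exact mul_le_mul_of_nonneg_right ha.le hη
        _ = ∫ s in Set.Ioc (-a) a, fejer s * η := by rw [integral_mul_const]
        _ ≤ _ := setIntegral_mono_on (integrable_fejer.mul_const _).integrableOn hg.integrableOn
            measurableSet_Ioc fun s hs => mul_le_mul_of_nonneg_left (h2 s hs) (fejer_nonneg s)
    have k2 : -(δ * (c / 4)) ≤ ∫ s in (Set.Ioc (-a) a)ᶜ, fejer s * g s := by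
      calc -(δ * (c / 4)) ≤ (∫ s in (Set.Ioc (-a) a)ᶜ, fejer s) * (-δ) := by nlinarith
        _ = ∫ s in (Set.Ioc (-a) a)ᶜ, fejer s * (-δ) := by rw [integral_mul_const]
        _ ≤ _ := setIntegral_mono_on (integrable_fejer.mul_const _).integrableOn hg.integrableOn
            measurableSet_Ioc.compl fun s hs => mul_le_mul_of_nonneg_left (h1 s) (fejer_nonneg s)
    linarith
  have hmain : ∀ u, 3 / 4 * c * (|Δ u| - 2 * A * a) - δ * (c / 4) ≤ 4 * B := by
    intro u
    have hAa : 0 ≤ A * a := by positivity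
    rcases le_or_gt (|Δ u| - 2 * A * a) 0 with hneg | hpos
    · have : 3 / 4 * c * (|Δ u| - 2 * A * a) ≤ 0 :=
        mul_nonpos_of_nonneg_of_nonpos (by positivity) hneg
      have : 0 ≤ δ * (c / 4) := by positivity
      linarith
    rcases le_total 0 (Δ u) with h | h
    · rw [abs_of_nonneg h] at hpos ⊢
      refine (hlow (fun s => Δ (u + a - s)) _ (hint _) (fun s => (abs_le.1 (hleδ _)).1) ?_ hpos.le).trans
        ((le_abs_self _).trans (abs_integral_fejer_mul_le hB (u + a)))
      intro s hs
      have := hstep u (u + a - s) (by linarith [hs.2])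
      have h2 : A * (u + a - s - u) ≤ A * (2 * a) :=
        mul_le_mul_of_nonneg_left (by linarith [hs.1]) hA
      linarith
    · rw [abs_of_nonpos h] at hpos ⊢
      have hi : Integrable (fun s => fejer s * -Δ (u - a - s)) := by
        have := (hint (u - a)).neg
        refine this.congr (ae_of_all _ fun s => ?_)
        simp
      refine (hlow (fun s => -Δ (u - a - s)) _ hi
        (fun s => by have := (abs_le.1 (hleδ (u - a - s))).2; linarith) ?_ hpos.le).trans ?_
      · intro s hs
        have := hstep (u - a - s) u (by linarith [hs.1])
        have h2 : A * (u - (u - a - s)) ≤ A * (2 * a) :=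
          mul_le_mul_of_nonneg_left (by linarith [hs.2]) hA
        linarith
      · have := abs_integral_fejer_mul_le hB (u - a)
        simp only [mul_neg, integral_neg]
        exact (neg_le_abs _).trans this
  have hfin : δ ≤ 8 * B / c + 4 * a * A := by
    have hsup : δ ≤ (4 * B + δ * (c / 4)) / (3 / 4 * c) + 2 * A * a := by
      refine ciSup_le fun u => ?_
      have := hmain u
      rw [← sub_le_iff_le_add, le_div_iff₀ (by positivity)]
      linarith
    have e : (4 * B + δ * (c / 4)) / (3 / 4 * c) = 16 / 3 * (B / c) + δ / 3 := by
      field_simp; ring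
    have hBc : 0 ≤ B / c := by positivity
    rw [e] at hsup
    rw [mul_div_assoc]
    have : 0 ≤ A * a := by positivity
    linarith
  intro u
  refine (hleδ u).trans (hfin.trans ?_)
  have h1 : 8 * B / c = 8 / c * B := by ring
  have h2 : 0 ≤ 8 / c * A := by positivity
  have h3 : 0 ≤ 4 * a * B := by positivity
  rw [h1]; nlinarith

/-- **Smoothing inequality** of Berry–Esseen type. -/
theorem exists_smoothing : ∃ C : ℝ, 0 < C ∧ ∀ (μ ν : Measure ℝ) [IsProbabilityMeasure μ]
    [IsProbabilityMeasure ν] (A B R : ℝ), 0 ≤ A → 0 < R →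
    (∀ a b, a ≤ b → ν.real (Set.Ioc a b) ≤ A * (b - a)) →
    (∀ ξ ∈ Set.Icc (-R) R, ‖charFun μ ξ - charFun ν ξ‖ ≤ B * |ξ|) →
    ∀ u, |μ.real (Set.Iic u) - ν.real (Set.Iic u)| ≤ C * (A / R + B * R) := by
  obtain ⟨C, hC, h⟩ := exists_smoothing_unit
  refine ⟨C, hC, ?_⟩
  intro μ ν _ _ A B R hA hR hν hB u
  have hm : Measurable (fun x : ℝ => R * x) := measurable_const_mul R
  have : IsProbabilityMeasure (μ.map (R * ·)) := Measure.isProbabilityMeasure_map hm.aemeasurable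
  have : IsProbabilityMeasure (ν.map (R * ·)) := Measure.isProbabilityMeasure_map hm.aemeasurable
  have hpre : ∀ u, (fun x : ℝ => R * x) ⁻¹' Set.Iic (R * u) = Set.Iic u := by
    intro u; ext x; exact mul_le_mul_iff_right₀ hR
  have hmap : ∀ (κ : Measure ℝ), (κ.map (R * ·)).real (Set.Iic (R * u)) = κ.real (Set.Iic u) := by
    intro κ
    rw [map_measureReal_apply hm measurableSet_Iic, hpre]
  rw [← hmap μ, ← hmap ν]
  refine h _ _ (A / R) (B * R) (by positivity) ?_ ?_ _
  · intro a b hab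
    rw [map_measureReal_apply hm measurableSet_Ioc]
    have : (fun x : ℝ => R * x) ⁻¹' Set.Ioc a b = Set.Ioc (a / R) (b / R) := by
      ext x
      simp only [Set.mem_preimage, Set.mem_Ioc, div_lt_iff₀ hR, le_div_iff₀ hR, mul_comm R x]
    rw [this]
    refine (hν _ _ (by gcongr)).trans (le_of_eq ?_)
    field_simp
  · intro ξ hξ
    rw [charFun_map_mul, charFun_map_mul]
    refine (hB (R * ξ) ⟨by nlinarith [hξ.1], by nlinarith [hξ.2]⟩).trans (le_of_eq ?_)
    rw [abs_mul, abs_of_pos hR]; ring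

/-! ### Signed sums of square roots -/

open Polynomial in
lemma exists_comp_add_sqrt (p : ℤ[X]) (n : ℕ) : ∃ A B : ℤ[X],
    (p.map (Int.castRingHom ℝ)).comp (X + C √(n : ℝ)) =
      A.map (Int.castRingHom ℝ) + C √(n : ℝ) * B.map (Int.castRingHom ℝ) ∧
    (p.map (Int.castRingHom ℝ)).comp (X - C √(n : ℝ)) =
      A.map (Int.castRingHom ℝ) - C √(n : ℝ) * B.map (Int.castRingHom ℝ) := by
  have hs : (C √(n : ℝ) : ℝ[X]) * C √(n : ℝ) = C (n : ℝ) := by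
    rw [← C_mul, Real.mul_self_sqrt (Nat.cast_nonneg n)]
  induction p using Polynomial.induction_on' with
  | add p q hp hq =>
    obtain ⟨A, B, h1, h2⟩ := hp
    obtain ⟨A', B', h1', h2'⟩ := hq
    refine ⟨A + A', B + B', ?_, ?_⟩
    · simp only [Polynomial.map_add, add_comp, h1, h1']; ring
    · simp only [Polynomial.map_add, add_comp, h2, h2']; ring
  | monomial m a =>
    induction m with
    | zero => exact ⟨C a, 0, by simp, by simp⟩
    | succ m ih =>
      obtain ⟨A, B, h1, h2⟩ := ih
      have hm : (monomial (m + 1) a : ℤ[X]) = monomial m a * X := by simp [monomial_mul_X]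
      refine ⟨A * X + C (n : ℤ) * B, A + B * X, ?_, ?_⟩
      · rw [hm, Polynomial.map_mul, mul_comp, h1]
        simp only [map_X, X_comp, Polynomial.map_add, Polynomial.map_mul, map_C]
        have : (C ((Int.castRingHom ℝ) (n : ℤ)) : ℝ[X]) = C √(n : ℝ) * C √(n : ℝ) := by
          rw [hs]; simp
        rw [this]; ring
      · rw [hm, Polynomial.map_mul, mul_comp, h2]
        simp only [map_X, X_comp, Polynomial.map_add, Polynomial.map_mul, map_C]
        have : (C ((Int.castRingHom ℝ) (n : ℤ)) : ℝ[X]) = C √(n : ℝ) * C √(n : ℝ) := by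
          rw [hs]; simp
        rw [this]; ring

/-- The multiset of all signed sums `± √n₁ ± ⋯ ± √nⱼ`. -/
def signedSums : List ℕ → Multiset ℝ
  | [] => {0}
  | n :: l => (signedSums l).map (· + √(n : ℝ)) + (signedSums l).map (· - √(n : ℝ))

lemma card_signedSums (l : List ℕ) : Multiset.card (signedSums l) = 2 ^ l.length := by
  induction l with
  | nil => simp [signedSums]
  | cons n l ih => simp [signedSums, ih, pow_succ]; ring

open Polynomial in
lemma exists_poly_signedSums (l : List ℕ) : ∃ P : ℤ[X],
    P.map (Int.castRingHom ℝ) = ((signedSums l).map fun a => X - C a).prod := by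
  induction l with
  | nil => exact ⟨X, by simp [signedSums]⟩
  | cons n l ih =>
    obtain ⟨P, hP⟩ := ih
    obtain ⟨A, B, h1, h2⟩ := exists_comp_add_sqrt P n
    refine ⟨A * A - C (n : ℤ) * (B * B), ?_⟩
    have e1 : ((signedSums l).map fun a => X - C (a + √(n : ℝ))).prod =
        (P.map (Int.castRingHom ℝ)).comp (X - C √(n : ℝ)) := by
      rw [hP, multiset_prod_comp, Multiset.map_map]
      congr 1
      refine Multiset.map_congr rfl fun a _ => ?_
      simp; ring
    have e2 : ((signedSums l).map fun a => X - C (a - √(n : ℝ))).prod =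
        (P.map (Int.castRingHom ℝ)).comp (X + C √(n : ℝ)) := by
      rw [hP, multiset_prod_comp, Multiset.map_map]
      congr 1
      refine Multiset.map_congr rfl fun a _ => ?_
      simp; ring
    simp only [signedSums, Multiset.map_add, Multiset.prod_add, Multiset.map_map,
      Function.comp_def, e1, e2, h1, h2]
    have hs : (C √(n : ℝ) : ℝ[X]) * C √(n : ℝ) = C (n : ℝ) := by
      rw [← C_mul, Real.mul_self_sqrt (Nat.cast_nonneg n)]
    have : (C ((Int.castRingHom ℝ) (n : ℤ)) : ℝ[X]) = C √(n : ℝ) * C √(n : ℝ) := by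
      rw [hs]; simp
    simp only [Polynomial.map_sub, Polynomial.map_mul, map_C, this]
    ring

lemma abs_le_of_mem_signedSums {l : List ℕ} {a : ℝ} (ha : a ∈ signedSums l) :
    |a| ≤ (l.map fun n : ℕ => √(n : ℝ)).sum := by
  induction l generalizing a with
  | nil => simp [signedSums] at ha; simp [ha]
  | cons n l ih =>
    simp only [signedSums, Multiset.mem_add, Multiset.mem_map] at ha
    simp only [List.map_cons, List.sum_cons]
    have h0 : 0 ≤ √(n : ℝ) := Real.sqrt_nonneg _
    rcases ha with ⟨b, hb, rfl⟩ | ⟨b, hb, rfl⟩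
    · calc |b + √(n : ℝ)| ≤ |b| + |√(n : ℝ)| := abs_add_le _ _
        _ ≤ _ := by rw [abs_of_nonneg h0]; linarith [ih hb]
    · calc |b - √(n : ℝ)| ≤ |b| + |√(n : ℝ)| := abs_sub _ _
        _ ≤ _ := by rw [abs_of_nonneg h0]; linarith [ih hb]

lemma sum_mem_signedSums (l : List (ℝ × ℕ)) (h : ∀ p ∈ l, p.1 = 1 ∨ p.1 = -1) :
    (l.map fun p => p.1 * √(p.2 : ℝ)).sum ∈ signedSums (l.map Prod.snd) := by
  induction l with
  | nil => simp [signedSums]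
  | cons p l ih =>
    simp only [List.map_cons, List.sum_cons, signedSums, Multiset.mem_add, Multiset.mem_map]
    have := ih fun q hq => h q (List.mem_cons_of_mem _ hq)
    rcases h p List.mem_cons_self with hp | hp
    · exact Or.inl ⟨_, this, by rw [hp]; ring⟩
    · exact Or.inr ⟨_, this, by rw [hp]; ring⟩

open Polynomial in
/-- The product of the nonzero signed sums is, up to sign, a nonzero integer. -/
lemma one_le_prod_signedSums (l : List ℕ) :
    1 ≤ (((signedSums l).filter (· ≠ 0)).map fun a => |a|).prod := by
  classical
  obtain ⟨P, hP⟩ := exists_poly_signedSums l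
  set s := signedSums l
  set t := s.filter (· ≠ 0) with ht
  set e := Multiset.card (s.filter (· = 0)) with he
  have hsplit : (s.map fun a => (X : ℝ[X]) - C a).prod = X ^ e * (t.map fun a => X - C a).prod := by
    have h1 : s = s.filter (· = 0) + t := (Multiset.filter_add_not (· = 0) s).symm
    have h2 : s.filter (· = 0) = Multiset.replicate e 0 := by
      rw [Multiset.eq_replicate]
      exact ⟨rfl, fun b hb => (Multiset.mem_filter.1 hb).2⟩
    conv_lhs => rw [h1, h2]
    simp
  have hcoeff : ((P.coeff e : ℤ) : ℝ) = (t.map fun a => -a).prod := by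
    have h1 : (P.map (Int.castRingHom ℝ)).coeff e = ((P.coeff e : ℤ) : ℝ) := by simp
    rw [← h1, hP, hsplit, show e = 0 + e by simp, mul_comm, coeff_mul_X_pow', if_pos (by simp)]
    simp only [zero_add, Nat.sub_self, coeff_zero_eq_eval_zero]
    rw [eval_multiset_prod, Multiset.map_map]
    simp
  have habs : |(t.map fun a => -a).prod| = (t.map fun a => |a|).prod := by
    have := map_multiset_prod (absHom : ℝ →*₀ ℝ) (t.map fun a => -a)
    rw [Multiset.map_map] at this
    simpa [absHom, Function.comp_def] using this
  have hne : (t.map fun a => |a|).prod ≠ 0 := by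
    refine Multiset.prod_ne_zero fun h => ?_
    obtain ⟨a, ha, h0⟩ := Multiset.mem_map.1 h
    exact (Multiset.mem_filter.1 ha).2 (abs_eq_zero.1 h0)
  rw [← habs, ← hcoeff, ← Int.cast_abs]
  rw [← habs, ← hcoeff, ← Int.cast_abs] at hne
  have : |P.coeff e| ≠ 0 := by exact_mod_cast hne
  have h3 : 1 ≤ |P.coeff e| := Int.one_le_abs (abs_ne_zero.1 this)
  exact_mod_cast h3

lemma one_le_abs_mul_pow {l : List ℕ} {a M : ℝ} (ha : a ∈ signedSums l) (ha0 : a ≠ 0)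
    (hM1 : 1 ≤ M) (hM : (l.map fun n : ℕ => √(n : ℝ)).sum ≤ M) :
    1 ≤ |a| * M ^ (2 ^ l.length) := by
  classical
  have h := one_le_prod_signedSums l
  have hmem : a ∈ (signedSums l).filter (· ≠ 0) := Multiset.mem_filter.2 ⟨ha, ha0⟩
  obtain ⟨t, ht⟩ := Multiset.exists_cons_of_mem hmem
  rw [ht, Multiset.map_cons, Multiset.prod_cons] at h
  refine h.trans (mul_le_mul_of_nonneg_left ?_ (abs_nonneg a))
  have hsub : ∀ b ∈ t, |b| ≤ M := by
    intro b hb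
    have : b ∈ (signedSums l).filter (· ≠ 0) := ht ▸ Multiset.mem_cons_of_mem hb
    exact (abs_le_of_mem_signedSums (Multiset.mem_filter.1 this).1).trans hM
  have hcard : Multiset.card t ≤ 2 ^ l.length := by
    have h1 := congrArg Multiset.card ht
    rw [Multiset.card_cons] at h1
    have h2 := Multiset.card_le_card (Multiset.filter_le (· ≠ (0 : ℝ)) (signedSums l))
    rw [card_signedSums] at h2
    omega
  have hprod : ∀ u : Multiset ℝ, (∀ b ∈ u, |b| ≤ M) →
      (u.map fun a => |a|).prod ≤ M ^ Multiset.card u := by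
    intro u
    induction u using Multiset.induction_on with
    | empty => simp
    | cons b u ih =>
      intro hu
      rw [Multiset.map_cons, Multiset.prod_cons, Multiset.card_cons, pow_succ']
      have hnn : 0 ≤ (u.map fun a => |a|).prod :=
        Multiset.prod_nonneg fun c hc => by
          obtain ⟨x, -, rfl⟩ := Multiset.mem_map.1 hc
          exact abs_nonneg x
      exact mul_le_mul (hu b (Multiset.mem_cons_self _ _))
        (ih fun c hc => hu c (Multiset.mem_cons_of_mem hc)) hnn (by linarith)
  exact (hprod t hsub).trans (pow_le_pow_right₀ hM1 hcard)

/-! ### Linear independence of square roots of squarefree numbers -/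

lemma eq_of_squarefree_mul_sq {k k' r r' : ℕ} (hk : Squarefree k) (hk' : Squarefree k')
    (hr : r ≠ 0) (hr' : r' ≠ 0) (h : k * r ^ 2 = k' * r' ^ 2) : k = k' ∧ r = r' := by
  have hkk : k = k' := by
    refine Nat.eq_of_factorization_eq hk.ne_zero hk'.ne_zero fun p => ?_
    have h1 := hk.natFactorization_le_one p
    have h2 := hk'.natFactorization_le_one p
    have h3 := congrArg (fun n => n.factorization p) h
    simp only [Nat.factorization_mul hk.ne_zero (pow_ne_zero 2 hr),
      Nat.factorization_mul hk'.ne_zero (pow_ne_zero 2 hr'), Nat.factorization_pow,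
      Finsupp.add_apply, Finsupp.smul_apply, smul_eq_mul] at h3
    omega
  subst hkk
  refine ⟨rfl, ?_⟩
  have := Nat.eq_of_mul_eq_mul_left (Nat.pos_of_ne_zero hk.ne_zero) h
  exact Nat.pow_left_injective (by norm_num) this

lemma eq_of_isSquare_mul {k k' : ℕ} (hk : Squarefree k) (hk' : Squarefree k')
    (h : IsSquare (k * k')) : k = k' := by
  obtain ⟨m, hm⟩ := h
  have hm0 : m ≠ 0 := by
    rintro rfl
    have := mul_ne_zero hk.ne_zero hk'.ne_zero
    simp_all
  refine (eq_of_squarefree_mul_sq hk hk' hk'.ne_zero hm0 ?_).1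
  calc k * k' ^ 2 = (k * k') * k' := by ring
    _ = k' * m ^ 2 := by rw [hm]; ring

open Polynomial in
lemma trace_eq_zero_of_sq {K : Type*} [Field K] [Algebra ℚ K] [FiniteDimensional ℚ K] {x : K}
    {n : ℕ} (hx : x ^ 2 = (n : K)) (hn : ¬ IsSquare n) : Algebra.trace ℚ K x = 0 := by
  have hirr : Irreducible (X ^ 2 - C (n : ℚ)) := by
    refine X_pow_sub_C_irreducible_of_prime Nat.prime_two fun b hb => hn ?_
    rw [← Rat.isSquare_natCast_iff]
    exact ⟨b, by rw [← hb, sq]⟩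
  have hmin : minpoly ℚ x = X ^ 2 - C (n : ℚ) :=
    (minpoly.eq_of_irreducible_of_monic hirr (by simp [hx]) (monic_X_pow_sub_C _ two_ne_zero)).symm
  rw [trace_eq_finrank_mul_minpoly_nextCoeff, hmin]
  have : (X ^ 2 - C (n : ℚ)).nextCoeff = 0 := by
    rw [nextCoeff, natDegree_X_pow_sub_C]
    simp [coeff_X_pow]
  rw [this]; simp

open Polynomial in
/-- The square roots of distinct squarefree numbers are linearly independent over the integers. -/
theorem eq_zero_of_sum_mul_sqrt_eq_zero {S : Finset ℕ} (hS : ∀ k ∈ S, Squarefree k) {a : ℕ → ℤ}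
    (h : ∑ k ∈ S, (a k : ℝ) * √(k : ℝ) = 0) : ∀ k ∈ S, a k = 0 := by
  classical
  intro k₀ hk₀
  set K := IntermediateField.adjoin ℚ ((fun k : ℕ => √(k : ℝ)) '' (S : Set ℕ)) with hK
  have hfin : FiniteDimensional ℚ K := by
    refine IntermediateField.finiteDimensional_adjoin fun x hx => ?_
    obtain ⟨k, -, rfl⟩ := hx
    refine ⟨X ^ 2 - C (k : ℚ), monic_X_pow_sub_C _ two_ne_zero, ?_⟩
    simp [Real.sq_sqrt]
  have hmem : ∀ k ∈ S, √(k : ℝ) ∈ K := fun k hk =>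
    IntermediateField.subset_adjoin _ _ ⟨k, hk, rfl⟩
  let s : ℕ → K := fun k => if hk : k ∈ S then ⟨√(k : ℝ), hmem k hk⟩ else 0
  have hs : ∀ k ∈ S, ((s k : K) : ℝ) = √(k : ℝ) := fun k hk => by simp [s, hk]
  have hsq : ∀ k ∈ S, ∀ k' ∈ S, (s k * s k') ^ 2 = ((k * k' : ℕ) : K) := by
    intro k hk k' hk'
    apply Subtype.ext
    push_cast
    rw [hs k hk, hs k' hk', mul_pow, Real.sq_sqrt (Nat.cast_nonneg _),
      Real.sq_sqrt (Nat.cast_nonneg _)]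
  have hsum : ∑ k ∈ S, (a k : K) * (s k * s k₀) = 0 := by
    have h1 : ∑ k ∈ S, (a k : K) * s k = 0 := by
      apply Subtype.ext
      push_cast
      rw [← h]
      exact Finset.sum_congr rfl fun k hk => by rw [hs k hk]
    calc _ = (∑ k ∈ S, (a k : K) * s k) * s k₀ := by
          rw [Finset.sum_mul]; exact Finset.sum_congr rfl fun k _ => by ring
      _ = 0 := by rw [h1, zero_mul]
  have htr := congrArg (Algebra.trace ℚ K) hsum
  rw [map_sum, map_zero, Finset.sum_eq_single k₀] at htr
  · have h0 : s k₀ * s k₀ = algebraMap ℚ K (k₀ : ℚ) := by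
      apply Subtype.ext
      simp only [map_natCast]
      push_cast
      rw [hs k₀ hk₀, Real.mul_self_sqrt (Nat.cast_nonneg _)]
    have h1 : (a k₀ : K) * (s k₀ * s k₀) = algebraMap ℚ K ((a k₀ : ℚ) * k₀) := by
      rw [h0]; simp
    rw [h1, Algebra.trace_algebraMap] at htr
    have hpos : Module.finrank ℚ K ≠ 0 := Module.finrank_pos.ne'
    have hk0 : (k₀ : ℚ) ≠ 0 := by exact_mod_cast (hS k₀ hk₀).ne_zero
    simp only [smul_eq_zero, mul_eq_zero, hpos, hk0, or_false, false_or] at htr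
    exact_mod_cast htr
  · intro k hk hne
    have h1 : (a k : K) * (s k * s k₀) = (a k : ℚ) • (s k * s k₀) := by
      rw [Algebra.smul_def]; simp
    rw [h1, map_smul, trace_eq_zero_of_sq (hsq k hk k₀ hk₀), smul_zero]
    exact fun hsq' => hne (eq_of_isSquare_mul (hS k hk) (hS k₀ hk₀) hsq')
  · exact fun h => absurd hk₀ h

/-! ### Independent uniform phases and trigonometric sums -/

/-- The phases `X n`, for squarefree `n`, are independent and uniform on `[0, 1]`. -/
structure UniformPhases {Ω : Type*} [MeasurableSpace Ω] (P : Measure Ω) (X : ℕ → Ω → ℝ) :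
    Prop where
  measurable : ∀ n : ℕ, Squarefree n → Measurable (X n)
  isUniform : ∀ n : ℕ, Squarefree n → pdf.IsUniform (X n) (Set.Icc 0 1) P volume
  iIndepFun : iIndepFun (fun n : {n : ℕ // Squarefree n} => X n) P

section Phases

variable {Ω : Type*} [MeasurableSpace Ω] {P : Measure Ω} {X : ℕ → Ω → ℝ}

lemma UniformPhases.map_eq (h : UniformPhases P X) {n : ℕ} (hn : Squarefree n) :
    P.map (X n) = volume.restrict (Set.Icc 0 1) := by
  have := h.isUniform n hn
  rw [pdf.IsUniform] at this
  rw [this, ProbabilityTheory.cond]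
  simp

lemma UniformPhases.integral_comp {E : Type*} [NormedAddCommGroup E] [NormedSpace ℝ E]
    (h : UniformPhases P X) {n : ℕ} (hn : Squarefree n) {f : ℝ → E} (hf : StronglyMeasurable f) :
    ∫ ω, f (X n ω) ∂P = ∫ x in (0 : ℝ)..1, f x := by
  rw [← integral_map (h.measurable n hn).aemeasurable hf.aestronglyMeasurable, h.map_eq hn,
    integral_Icc_eq_integral_Ioc, intervalIntegral.integral_of_le zero_le_one]

lemma UniformPhases.integral_prod {𝕜 : Type*} [RCLike 𝕜] (h : UniformPhases P X) {S : Finset ℕ}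
    (hS : ∀ k ∈ S, Squarefree k) {f : ℕ → ℝ → 𝕜} (hf : ∀ k, Measurable (f k)) :
    ∫ ω, ∏ k ∈ S, f k (X k ω) ∂P = ∏ k ∈ S, ∫ x in (0 : ℝ)..1, f k x := by
  let g : S → {n : ℕ // Squarefree n} := fun k => ⟨k.1, hS k.1 k.2⟩
  have hg : Function.Injective g := fun a b hab => by
    apply Subtype.ext
    exact congrArg (fun z : {n : ℕ // Squarefree n} => z.1) hab
  have hi := h.iIndepFun.precomp hg
  have key := hi.integral_fun_prod_comp (f := fun k : S => f k.1)
    (fun k => (h.measurable k.1 (hS k.1 k.2)).aemeasurable)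
    (fun k => (hf k.1).aestronglyMeasurable)
  have e1 : ∀ ω, ∏ k ∈ S, f k (X k ω) = ∏ k : S, f k.1 (X k.1 ω) := fun ω =>
    (Finset.prod_coe_sort S fun k => f k (X k ω)).symm
  simp_rw [e1]
  rw [← Finset.prod_coe_sort S fun k => ∫ x in (0 : ℝ)..1, f k x]
  refine key.trans (Finset.prod_congr rfl fun k _ => ?_)
  exact h.integral_comp (hS k.1 k.2) (hf k.1).stronglyMeasurable

end Phases

/-- The character `x ↦ exp (2π i x)`. -/
def ee (x : ℝ) : ℂ := Complex.exp (((2 * π * x : ℝ) : ℂ) * Complex.I)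

lemma ee_add (x y : ℝ) : ee (x + y) = ee x * ee y := by
  unfold ee; rw [← Complex.exp_add]; congr 1; push_cast; ring

lemma norm_ee (x : ℝ) : ‖ee x‖ = 1 := by
  unfold ee; rw [Complex.norm_exp_ofReal_mul_I]

@[simp] lemma ee_zero : ee 0 = 1 := by simp [ee]

lemma continuous_ee : Continuous ee := by unfold ee; fun_prop

lemma ee_sum {ι : Type*} (S : Finset ι) (f : ι → ℝ) : ee (∑ i ∈ S, f i) = ∏ i ∈ S, ee (f i) := by
  classical
  induction S using Finset.induction_on with
  | empty => simp
  | insert a S ha ih => rw [Finset.sum_insert ha, Finset.prod_insert ha, ee_add, ih]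

lemma integral_ee_int (s : ℤ) : ∫ x in (0 : ℝ)..1, ee (s * x) = if s = 0 then 1 else 0 := by
  split_ifs with h
  · simp [h]
  · have hc : (2 * π * s * Complex.I : ℂ) ≠ 0 := by
      simp [h, Real.pi_ne_zero]
    have : ∀ x : ℝ, ee (s * x) = Complex.exp ((2 * π * s * Complex.I) * x) := by
      intro x; unfold ee; congr 1; push_cast; ring
    simp_rw [this]
    rw [integral_exp_mul_complex hc]
    have h1 : Complex.exp (2 * π * s * Complex.I * ((1 : ℝ) : ℂ)) = 1 := by
      rw [Complex.ofReal_one, mul_one, show (2 * π * s * Complex.I : ℂ) =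
        s * (2 * π * Complex.I) by ring]
      exact Complex.exp_int_mul_two_pi_mul_I s
    rw [h1]; simp

/-- A finite trigonometric sum with frequencies `r` in the phases `x k`. -/
def trigSum (I : Finset (ℕ × ℕ)) (c : ℕ × ℕ → ℝ) (x : ℕ → ℝ) : ℝ :=
  ∑ p ∈ I, c p * cos (2 * π * p.2 * x p.1 - π / 4)

/-- The signed index set of the complex exponentials in a trigonometric sum. -/
def signedIndex (I : Finset (ℕ × ℕ)) : Finset (ℤ × (ℕ × ℕ)) := ({1, -1} : Finset ℤ) ×ˢ I

/-- The coefficients of the complex exponentials in a trigonometric sum. -/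
def signedCoeff (c : ℕ × ℕ → ℝ) (q : ℤ × (ℕ × ℕ)) : ℂ := (c q.2 / 2 : ℝ) * ee (-(q.1 / 8 : ℝ))

lemma trigSum_eq (I : Finset (ℕ × ℕ)) (c : ℕ × ℕ → ℝ) (x : ℕ → ℝ) :
    (trigSum I c x : ℂ) =
      ∑ q ∈ signedIndex I, signedCoeff c q * ee (q.1 * q.2.2 * x q.2.1) := by
  unfold trigSum signedIndex
  rw [Finset.sum_product, Finset.sum_insert (by norm_num), Finset.sum_singleton,
    ← Finset.sum_add_distrib]
  push_cast
  refine Finset.sum_congr rfl fun p _ => ?_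
  unfold signedCoeff ee
  rw [Complex.cos]
  simp only [mul_assoc, ← Complex.exp_add]
  rw [mul_div_assoc', mul_add, add_div]
  congr 1
  · push_cast
    rw [div_mul_eq_mul_div]
    congr 3
    ring
  · push_cast
    rw [div_mul_eq_mul_div]
    congr 3
    ring

lemma trigSum_pow_eq (I : Finset (ℕ × ℕ)) (c : ℕ × ℕ → ℝ) (x : ℕ → ℝ) (j : ℕ) :
    ((trigSum I c x ^ j : ℝ) : ℂ) =
      ∑ f ∈ Fintype.piFinset (fun _ : Fin j => signedIndex I),
        (∏ i, signedCoeff c (f i)) * ee (∑ i, (f i).1 * (f i).2.2 * x (f i).2.1) := by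
  rw [Complex.ofReal_pow, trigSum_eq]
  have := Finset.prod_univ_sum (fun _ : Fin j => signedIndex I)
    (fun _ q => signedCoeff c q * ee (q.1 * q.2.2 * x q.2.1))
  rw [Finset.prod_const, Finset.card_univ, Fintype.card_fin] at this
  rw [this]
  refine Finset.sum_congr rfl fun f _ => ?_
  rw [Finset.prod_mul_distrib, ee_sum]

lemma norm_signedCoeff (c : ℕ × ℕ → ℝ) (q : ℤ × (ℕ × ℕ)) : ‖signedCoeff c q‖ = |c q.2| / 2 := by
  unfold signedCoeff
  rw [norm_mul, norm_ee, Complex.norm_real, mul_one, Real.norm_eq_abs, abs_div, abs_two]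

lemma sum_norm_signedCoeff (I : Finset (ℕ × ℕ)) (c : ℕ × ℕ → ℝ) :
    ∑ q ∈ signedIndex I, ‖signedCoeff c q‖ = ∑ p ∈ I, |c p| := by
  unfold signedIndex
  rw [Finset.sum_product, Finset.sum_insert (by norm_num), Finset.sum_singleton,
    ← Finset.sum_add_distrib]
  refine Finset.sum_congr rfl fun p _ => ?_
  rw [norm_signedCoeff, norm_signedCoeff]; ring

/-- An oscillating integral with phase `θ √t`. -/
lemma norm_average_exp_sqrt_le {T θ : ℝ} (hT : 0 < T) (hθ : 0 < |θ|) :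
    ‖(1 / T : ℂ) * ∫ t in T..(2 * T), Complex.exp (((θ * √t : ℝ) : ℂ) * Complex.I)‖
      ≤ 10 / (|θ| * √T) := by
  have hsT : 0 < √T := Real.sqrt_pos.2 hT
  have hbound1 : ‖∫ t in T..(2 * T), Complex.exp (((θ * √t : ℝ) : ℂ) * Complex.I)‖ ≤ T := by
    have := intervalIntegral.norm_integral_le_of_norm_le_const (a := T) (b := 2 * T) (C := 1)
      (f := fun t : ℝ => Complex.exp (((θ * √t : ℝ) : ℂ) * Complex.I))
      (fun t _ => by rw [Complex.norm_exp_ofReal_mul_I])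
    rw [one_mul, show 2 * T - T = T by ring, abs_of_pos hT] at this
    exact this
  have hnT : ‖(1 / T : ℂ)‖ = 1 / T := by
    rw [norm_div, norm_one, Complex.norm_real, Real.norm_of_nonneg hT.le]
  rw [norm_mul, hnT]
  set z := 1 / (|θ| * √T) with hz
  have hz0 : 0 < z := by positivity
  rw [show 10 / (|θ| * √T) = 10 * z by rw [hz]; ring]
  rcases le_or_gt z 1 with hz1 | hz1
  swap
  · calc _ ≤ 1 / T * T := by gcongr
      _ = 1 := by field_simp
      _ ≤ 10 * z := by linarith
  have hθ0 : (θ : ℂ) ≠ 0 := by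
    rw [Complex.ofReal_ne_zero]; exact abs_pos.1 hθ
  set G : ℝ → ℂ := fun t => (2 * (√t : ℂ) / (Complex.I * θ) + 2 / (θ : ℂ) ^ 2) *
    Complex.exp (((θ * √t : ℝ) : ℂ) * Complex.I) with hG
  have hder : ∀ t ∈ Set.uIcc T (2 * T),
      HasDerivAt G (Complex.exp (((θ * √t : ℝ) : ℂ) * Complex.I)) t := by
    intro t ht
    rw [Set.uIcc_of_le (by linarith)] at ht
    have ht0 : 0 < t := by linarith [ht.1]
    have hst : (√t : ℂ) ≠ 0 := by
      rw [Complex.ofReal_ne_zero]; exact (Real.sqrt_pos.2 ht0).ne'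
    have h1 : HasDerivAt (fun t : ℝ => (√t : ℂ)) ((1 / (2 * √t) : ℝ) : ℂ) t :=
      (Real.hasDerivAt_sqrt ht0.ne').ofReal_comp
    have h2 : HasDerivAt (fun t : ℝ => Complex.exp (((θ * √t : ℝ) : ℂ) * Complex.I))
        (Complex.exp (((θ * √t : ℝ) : ℂ) * Complex.I) *
          (((θ * (1 / (2 * √t)) : ℝ) : ℂ) * Complex.I)) t :=
      ((((Real.hasDerivAt_sqrt ht0.ne').const_mul θ).ofReal_comp).mul_const Complex.I).cexp
    have h3 := (((h1.const_mul 2).div_const (Complex.I * θ)).add_const (2 / (θ : ℂ) ^ 2)).mul h2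
    refine h3.congr_deriv ?_
    push_cast
    have hI : Complex.I ≠ 0 := Complex.I_ne_zero
    field_simp
    ring_nf
    simp only [Complex.I_sq]
    ring
  rw [intervalIntegral.integral_eq_sub_of_hasDerivAt hder
    (Continuous.intervalIntegrable (by fun_prop) _ _)]
  have hGn : ∀ t, T ≤ t → t ≤ 2 * T → ‖G t‖ ≤ 3 * √T / |θ| + 2 / |θ| ^ 2 := by
    intro t ht1 ht2
    simp only [hG]
    rw [norm_mul, Complex.norm_exp_ofReal_mul_I, mul_one]
    refine (norm_add_le _ _).trans ?_
    have hs : √t ≤ 3 / 2 * √T := by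
      rw [Real.sqrt_le_left (by positivity), mul_pow, Real.sq_sqrt hT.le]
      linarith
    have n1 : ‖2 * (√t : ℂ) / (Complex.I * θ)‖ = 2 * √t / |θ| := by
      rw [norm_div, norm_mul, norm_mul, Complex.norm_I, Complex.norm_real, Complex.norm_real,
        Real.norm_of_nonneg (Real.sqrt_nonneg t)]
      simp
    have n2 : ‖2 / (θ : ℂ) ^ 2‖ = 2 / |θ| ^ 2 := by
      rw [norm_div, norm_pow, Complex.norm_real]; simp
    rw [n1, n2]
    have := div_le_div_of_nonneg_right (show 2 * √t ≤ 3 * √T by linarith) hθ.le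
    linarith
  have h4 : ‖G (2 * T) - G T‖ ≤ 2 * (3 * √T / |θ| + 2 / |θ| ^ 2) := by
    refine (norm_sub_le _ _).trans ?_
    have := hGn (2 * T) (by linarith) le_rfl
    have := hGn T le_rfl (by linarith)
    linarith
  have h5 : 1 / T * (2 * (3 * √T / |θ| + 2 / |θ| ^ 2)) = 6 * z + 4 * z ^ 2 := by
    rw [hz]
    have hTs : T = √T ^ 2 := (Real.sq_sqrt hT.le).symm
    conv_lhs => rw [hTs, Real.sqrt_sq hsT.le]
    field_simp
    ring
  calc _ ≤ 1 / T * (2 * (3 * √T / |θ| + 2 / |θ| ^ 2)) := by gcongr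
    _ = 6 * z + 4 * z ^ 2 := h5
    _ ≤ 10 * z := by nlinarith

section Moments

variable {Ω : Type*} [MeasurableSpace Ω] {P : Measure Ω} {X : ℕ → Ω → ℝ}

/-- The integer coefficient of the phase `x k` in a product of exponentials. -/
def phaseCoeff {j : ℕ} (f : Fin j → ℤ × (ℕ × ℕ)) (k : ℕ) : ℤ :=
  ∑ i with (f i).2.1 = k, (f i).1 * (f i).2.2

lemma sum_phases_eq {j : ℕ} (f : Fin j → ℤ × (ℕ × ℕ)) (x : ℕ → ℝ) :
    ∑ i, (f i).1 * (f i).2.2 * x (f i).2.1 =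
      ∑ k ∈ Finset.univ.image (fun i => (f i).2.1), (phaseCoeff f k : ℝ) * x k := by
  rw [← Finset.sum_fiberwise_of_maps_to (g := fun i => (f i).2.1)
    (t := Finset.univ.image (fun i => (f i).2.1))
    (fun i _ => Finset.mem_image_of_mem _ (Finset.mem_univ i))]
  refine Finset.sum_congr rfl fun k _ => ?_
  unfold phaseCoeff
  push_cast
  rw [Finset.sum_mul]
  refine Finset.sum_congr rfl fun i hi => ?_
  rw [(Finset.mem_filter.1 hi).2]

lemma mem_signedIndex {I : Finset (ℕ × ℕ)} {q : ℤ × (ℕ × ℕ)} :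
    q ∈ signedIndex I ↔ (q.1 = 1 ∨ q.1 = -1) ∧ q.2 ∈ I := by
  simp [signedIndex]

lemma norm_average_sub_integral_le [IsProbabilityMeasure P] (h : UniformPhases P X)
    {I : Finset (ℕ × ℕ)} (hI : ∀ p ∈ I, Squarefree p.1) {M T : ℝ}
    (hM : 1 ≤ M) (hIM : ∀ p ∈ I, √((p.1 * p.2 ^ 2 : ℕ) : ℝ) ≤ M) (hT : 0 < T) {j : ℕ}
    {f : Fin j → ℤ × (ℕ × ℕ)} (hf : ∀ i, f i ∈ signedIndex I) :
    ‖(1 / T : ℂ) * (∫ t in T..(2 * T), ee (∑ i, (f i).1 * (f i).2.2 * (2 * √((f i).2.1 * t)))) -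
      ∫ ω, ee (∑ i, (f i).1 * (f i).2.2 * X (f i).2.1 ω) ∂P‖ ≤
      ((j + 1) * M) ^ (2 ^ j) / √T := by
  set S := Finset.univ.image (fun i => (f i).2.1) with hS
  have hSq : ∀ k ∈ S, Squarefree k := by
    intro k hk
    obtain ⟨i, -, rfl⟩ := Finset.mem_image.1 hk
    exact hI _ (mem_signedIndex.1 (hf i)).2
  set β : ℝ := ∑ i, ((f i).1 : ℝ) * √(((f i).2.1 * (f i).2.2 ^ 2 : ℕ) : ℝ) with hβ
  have hsqrt : ∀ i, √(((f i).2.1 * (f i).2.2 ^ 2 : ℕ) : ℝ) = (f i).2.2 * √((f i).2.1 : ℝ) := by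
    intro i
    push_cast
    rw [Real.sqrt_mul (Nat.cast_nonneg _), Real.sqrt_sq (Nat.cast_nonneg _), mul_comm]
  have hβ' : β = ∑ k ∈ S, (phaseCoeff f k : ℝ) * √(k : ℝ) := by
    rw [hβ, ← sum_phases_eq f fun k => √(k : ℝ)]
    refine Finset.sum_congr rfl fun i _ => ?_
    rw [hsqrt]; ring
  have htime : ∀ t : ℝ, ∑ i, (f i).1 * (f i).2.2 * (2 * √((f i).2.1 * t)) = 2 * β * √t := by
    intro t
    rw [hβ, mul_assoc, Finset.sum_mul, Finset.mul_sum]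
    refine Finset.sum_congr rfl fun i _ => ?_
    rw [hsqrt, Real.sqrt_mul (Nat.cast_nonneg _)]; ring
  have hrand : ∫ ω, ee (∑ i, (f i).1 * (f i).2.2 * X (f i).2.1 ω) ∂P =
      ∏ k ∈ S, if phaseCoeff f k = 0 then 1 else 0 := by
    have e : ∀ ω, ee (∑ i, (f i).1 * (f i).2.2 * X (f i).2.1 ω) =
        ∏ k ∈ S, ee (phaseCoeff f k * X k ω) := by
      intro ω
      rw [sum_phases_eq f fun k => X k ω, ee_sum]
    simp_rw [e]
    rw [h.integral_prod hSq (f := fun k x => ee (phaseCoeff f k * x))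
      (fun k => (continuous_ee.comp (continuous_const.mul continuous_id)).measurable)]
    exact Finset.prod_congr rfl fun k _ => integral_ee_int _
  simp_rw [htime]
  rw [hrand]
  have hM0 : (0 : ℝ) ≤ ((j + 1) * M) ^ (2 ^ j) / √T := by positivity
  by_cases hβ0 : β = 0
  · have hz : ∀ k ∈ S, phaseCoeff f k = 0 :=
      eq_zero_of_sum_mul_sqrt_eq_zero hSq (hβ'.symm.trans hβ0)
    rw [Finset.prod_congr rfl fun k hk => if_pos (hz k hk)]
    simp only [hβ0, mul_zero, zero_mul, ee_zero, intervalIntegral.integral_const,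
      Finset.prod_const_one]
    have : (1 / T : ℂ) * ((2 * T - T) • (1 : ℂ)) - 1 = 0 := by
      have hT' : (T : ℂ) ≠ 0 := by rw [Complex.ofReal_ne_zero]; exact hT.ne'
      simp only [Complex.real_smul, mul_one]
      push_cast
      field_simp
      ring
    rw [this, norm_zero]; exact hM0
  · have hne : ∃ k ∈ S, phaseCoeff f k ≠ 0 := by
      by_contra hcon
      push Not at hcon
      exact hβ0 (hβ'.trans (Finset.sum_eq_zero fun k hk => by rw [hcon k hk]; simp))
    obtain ⟨k, hk, hk0⟩ := hne
    rw [Finset.prod_eq_zero hk (if_neg hk0), sub_zero]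
    have hθ : 0 < |4 * π * β| := abs_pos.2 (by positivity)
    have e : ∀ t : ℝ, ee (2 * β * √t) =
        Complex.exp (((4 * π * β * √t : ℝ) : ℂ) * Complex.I) := by
      intro t; unfold ee; congr 3; ring
    simp_rw [e]
    refine (norm_average_exp_sqrt_le hT hθ).trans ?_
    have hlow : 1 ≤ |β| * ((j + 1) * M) ^ (2 ^ j) := by
      set l : List (ℝ × ℕ) := List.ofFn fun i => (((f i).1 : ℝ), (f i).2.1 * (f i).2.2 ^ 2) with hl
      have hmem := sum_mem_signedSums l (by
        intro p hp
        rw [hl, List.mem_ofFn] at hp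
        obtain ⟨i, rfl⟩ := hp
        rcases (mem_signedIndex.1 (hf i)).1 with h | h <;> simp [h])
      have hs1 : (l.map fun p => p.1 * √(p.2 : ℝ)).sum = β := by
        rw [hl, List.map_ofFn, List.sum_ofFn]; rfl
      rw [hs1] at hmem
      have hlen : (l.map Prod.snd).length = j := by simp [hl]
      have := one_le_abs_mul_pow (M := (j + 1) * M) hmem hβ0 (by nlinarith [Nat.cast_nonneg (α := ℝ) j]) (by
        rw [hl, List.map_ofFn, List.map_ofFn, List.sum_ofFn]
        calc _ ≤ ∑ _i : Fin j, M := Finset.sum_le_sum fun i _ => hIM _ (mem_signedIndex.1 (hf i)).2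
          _ ≤ _ := by simp; nlinarith)
      rwa [hlen] at this
    have hsT : 0 < √T := Real.sqrt_pos.2 hT
    rw [abs_mul, abs_of_pos (by positivity : (0 : ℝ) < 4 * π), div_le_div_iff₀ (by positivity) hsT]
    have hpi : (3 : ℝ) < π := Real.pi_gt_three
    calc 10 * √T ≤ (4 * π) * √T := by gcongr; linarith
      _ ≤ (4 * π) * √T * (|β| * ((j + 1) * M) ^ (2 ^ j)) :=
          le_mul_of_one_le_right (by positivity) hlow
      _ = _ := by ring

/-- The moments of a trigonometric sum along `x k = 2 √(k t)`, `t ∈ [T, 2T]`, are close to those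
for independent uniform phases. -/
theorem abs_moment_sub_moment_le [IsProbabilityMeasure P] (h : UniformPhases P X)
    {I : Finset (ℕ × ℕ)} (hI : ∀ p ∈ I, Squarefree p.1) (c : ℕ × ℕ → ℝ) {M T : ℝ}
    (hM : 1 ≤ M) (hIM : ∀ p ∈ I, √((p.1 * p.2 ^ 2 : ℕ) : ℝ) ≤ M) (hT : 0 < T) (j : ℕ) :
    |1 / T * (∫ t in T..(2 * T), trigSum I c (fun k => 2 * √(k * t)) ^ j) -
      ∫ ω, trigSum I c (fun k => X k ω) ^ j ∂P| ≤
      (∑ p ∈ I, |c p|) ^ j * (((j + 1) * M) ^ (2 ^ j) / √T) := by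
  rw [← Real.norm_eq_abs, ← Complex.norm_real]
  set 𝒥 := Fintype.piFinset (fun _ : Fin j => signedIndex I)
  have e1 : ((∫ t in T..(2 * T), trigSum I c (fun k => 2 * √(k * t)) ^ j : ℝ) : ℂ) =
      ∑ f ∈ 𝒥, (∏ i, signedCoeff c (f i)) *
        ∫ t in T..(2 * T), ee (∑ i, (f i).1 * (f i).2.2 * (2 * √((f i).2.1 * t))) := by
    rw [← intervalIntegral.integral_ofReal]
    simp_rw [trigSum_pow_eq]
    rw [intervalIntegral.integral_finsetSum]
    · simp_rw [intervalIntegral.integral_const_mul]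
      rfl
    · intro f _
      refine Continuous.intervalIntegrable (continuous_const.mul (continuous_ee.comp ?_)) _ _
      fun_prop
  have e2 : ((∫ ω, trigSum I c (fun k => X k ω) ^ j ∂P : ℝ) : ℂ) =
      ∑ f ∈ 𝒥, (∏ i, signedCoeff c (f i)) *
        ∫ ω, ee (∑ i, (f i).1 * (f i).2.2 * X (f i).2.1 ω) ∂P := by
    rw [← integral_complex_ofReal]
    simp_rw [trigSum_pow_eq]
    rw [integral_finsetSum]
    · simp_rw [integral_const_mul]
      rfl
    · intro f hf
      refine Integrable.const_mul ?_ _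
      refine Integrable.of_bound (C := 1) ?_ (ae_of_all _ fun ω => (norm_ee _).le)
      refine (continuous_ee.measurable.comp ?_).aestronglyMeasurable
      refine Finset.measurable_fun_sum _ fun i _ => ?_
      have := h.measurable _ (hI _ (mem_signedIndex.1 (Fintype.mem_piFinset.1 hf i)).2)
      exact measurable_const.mul this
  rw [Complex.ofReal_sub, Complex.ofReal_mul, e1, e2, Finset.mul_sum, ← Finset.sum_sub_distrib]
  refine (norm_sum_le _ _).trans ?_
  calc _ ≤ ∑ f ∈ 𝒥, (∏ i, ‖signedCoeff c (f i)‖) * (((j + 1) * M) ^ (2 ^ j) / √T) := by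
        refine Finset.sum_le_sum fun f hf => ?_
        have := norm_average_sub_integral_le h hI hM hIM hT (Fintype.mem_piFinset.1 hf)
        rw [show ∀ a b c d : ℂ, a * (b * c) - b * d = b * (a * c - d) by intros; ring, norm_mul,
          norm_prod]
        refine mul_le_mul_of_nonneg_left ?_ (Finset.prod_nonneg fun _ _ => norm_nonneg _)
        simpa using this
    _ = _ := by
        rw [← Finset.sum_mul, ← Finset.prod_univ_sum (fun _ : Fin j => signedIndex I)
          (fun _ q => ‖signedCoeff c q‖), Finset.prod_const, Finset.card_univ, Fintype.card_fin,
          sum_norm_signedCoeff]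

end Moments

/-! ### The components of the random series -/

/-- The terms of the inner series, with weights. -/
def weightedTerm (u : ℕ → ℝ) (k : ℕ) (x : ℝ) (r : ℕ) : ℝ := u (k * r ^ 2) * innerTerm k x r

/-- The contribution of the squarefree number `k` to the series, with weights. -/
def component (u : ℕ → ℝ) (k : ℕ) (x : ℝ) : ℝ :=
  1 / (π * √2) * (1 / (k : ℝ) ^ (3 / 4 : ℝ) * ∑' r, weightedTerm u k x r)

/-- The constant in the bound for the components. -/
def componentConst : ℝ :=
  1 / (π * √2) * ∑' r : ℕ, (d r : ℝ) ^ 2 * (r : ℝ) ^ (-(11 / 8) : ℝ)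

lemma componentConst_nonneg : 0 ≤ componentConst :=
  mul_nonneg (by positivity) (tsum_nonneg fun _ => by positivity)

lemma abs_weightedTerm_le {u : ℕ → ℝ} {k : ℕ} {a : ℝ}
    (hu : ∀ r : ℕ, r ≠ 0 → |u (k * r ^ 2)| ≤ a * (r : ℝ) ^ (1 / 8 : ℝ)) (x : ℝ) (r : ℕ) :
    |weightedTerm u k x r| ≤ a * d k * ((d r : ℝ) ^ 2 * (r : ℝ) ^ (-(11 / 8) : ℝ)) := by
  rcases Nat.eq_zero_or_pos r with rfl | hr
  · simp [weightedTerm, innerTerm, d_zero]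
  have hr0 : (0 : ℝ) < r := by exact_mod_cast hr
  have ha : |u (k * r ^ 2)| ≤ a * (r : ℝ) ^ (1 / 8 : ℝ) := hu r hr.ne'
  unfold weightedTerm innerTerm
  rw [abs_mul, abs_mul, abs_div, Nat.abs_cast, abs_of_pos (by positivity : (0 : ℝ) < (r : ℝ) ^ (3 / 2 : ℝ))]
  have hd : (d (k * r ^ 2) : ℝ) ≤ d k * (d r : ℝ) ^ 2 := by
    have h1 := d_mul_le k (r ^ 2)
    have h2 := d_mul_le r r
    rw [← sq] at h2
    have : d (k * r ^ 2) ≤ d k * (d r) ^ 2 :=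
      h1.trans (Nat.mul_le_mul_left _ (h2.trans (le_of_eq (sq _).symm)))
    exact_mod_cast this
  have hcos := Real.abs_cos_le_one (2 * π * r * x - π / 4)
  have e : (r : ℝ) ^ (-(11 / 8) : ℝ) = (r : ℝ) ^ (1 / 8 : ℝ) / (r : ℝ) ^ (3 / 2 : ℝ) := by
    rw [← Real.rpow_sub hr0]; norm_num
  rw [e]
  calc _ ≤ (a * (r : ℝ) ^ (1 / 8 : ℝ)) * (d k * (d r : ℝ) ^ 2 / (r : ℝ) ^ (3 / 2 : ℝ) * 1) := by
        gcongr
        exact (abs_nonneg _).trans ha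
    _ = _ := by ring

lemma summable_d_sq_rpow : Summable fun r : ℕ => (d r : ℝ) ^ 2 * (r : ℝ) ^ (-(11 / 8) : ℝ) :=
  (summable_d_pow (by norm_num) 2).1

lemma abs_component_le {u : ℕ → ℝ} {k : ℕ} {a : ℝ}
    (hu : ∀ r : ℕ, r ≠ 0 → |u (k * r ^ 2)| ≤ a * (r : ℝ) ^ (1 / 8 : ℝ)) (x : ℝ) :
    |component u k x| ≤ a * componentConst * (d k * (k : ℝ) ^ (-(3 / 4) : ℝ)) := by
  unfold component componentConst
  have h1 : |∑' r, weightedTerm u k x r| ≤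
      a * d k * ∑' r : ℕ, (d r : ℝ) ^ 2 * (r : ℝ) ^ (-(11 / 8) : ℝ) := by
    rw [← tsum_mul_left]
    exact tsum_of_norm_bounded (f := weightedTerm u k x)
      (summable_d_sq_rpow.mul_left (a * d k)).hasSum (fun r => abs_weightedTerm_le hu x r)
  rw [abs_mul, abs_mul, abs_of_nonneg (by positivity : 0 ≤ 1 / (π * √2)),
    abs_of_nonneg (by positivity : (0 : ℝ) ≤ 1 / (k : ℝ) ^ (3 / 4 : ℝ)),
    Real.rpow_neg (Nat.cast_nonneg k), ← one_div]
  calc _ ≤ 1 / (π * √2) * (1 / (k : ℝ) ^ (3 / 4 : ℝ) *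
        (a * d k * ∑' r : ℕ, (d r : ℝ) ^ 2 * (r : ℝ) ^ (-(11 / 8) : ℝ))) := by gcongr
    _ = _ := by ring

lemma one_le_rpow_nat {r : ℕ} (hr : r ≠ 0) : (1 : ℝ) ≤ (r : ℝ) ^ (1 / 8 : ℝ) :=
  Real.one_le_rpow (by exact_mod_cast Nat.one_le_iff_ne_zero.2 hr) (by norm_num)

lemma weight_bound {u : ℕ → ℝ} (hu : ∀ n, |u n| ≤ 1) (k : ℕ) :
    ∀ r : ℕ, r ≠ 0 → |u (k * r ^ 2)| ≤ 1 * (r : ℝ) ^ (1 / 8 : ℝ) := fun r hr =>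
  (hu _).trans (by rw [one_mul]; exact one_le_rpow_nat hr)

lemma summable_weightedTerm {u : ℕ → ℝ} (hu : ∀ n, |u n| ≤ 1) (k : ℕ) (x : ℝ) :
    Summable (weightedTerm u k x) :=
  Summable.of_norm_bounded (summable_d_sq_rpow.mul_left _)
    fun r => abs_weightedTerm_le (weight_bound hu k) x r

lemma continuous_weightedTerm (u : ℕ → ℝ) (k r : ℕ) : Continuous fun x => weightedTerm u k x r := by
  unfold weightedTerm innerTerm; fun_prop

lemma continuous_component {u : ℕ → ℝ} (hu : ∀ n, |u n| ≤ 1) (k : ℕ) : Continuous (component u k) := by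
  unfold component
  refine continuous_const.mul (continuous_const.mul ?_)
  exact continuous_tsum (fun r => continuous_weightedTerm u k r) (summable_d_sq_rpow.mul_left _)
    fun r x => abs_weightedTerm_le (weight_bound hu k) x r

lemma integral_weightedTerm_mul {u : ℕ → ℝ} (hu : ∀ n, |u n| ≤ 1) (k : ℕ) {g : ℝ → ℝ}
    (hg : Continuous g) (hg1 : ∀ x, |g x| ≤ 1) :
    ∫ x in (0 : ℝ)..1, component u k x * g x = 1 / (π * √2) * (1 / (k : ℝ) ^ (3 / 4 : ℝ) *
      ∑' r, ∫ x in (0 : ℝ)..1, weightedTerm u k x r * g x) := by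
  have h := intervalIntegral.hasSum_integral_of_dominated_convergence (μ := volume) (a := 0) (b := 1)
    (F := fun r x => weightedTerm u k x r * g x)
    (f := fun x => (∑' r, weightedTerm u k x r) * g x)
    (fun r _ => 1 * d k * ((d r : ℝ) ^ 2 * (r : ℝ) ^ (-(11 / 8) : ℝ)))
    (fun r => ((continuous_weightedTerm u k r).mul hg).aestronglyMeasurable)
    (fun r => ae_of_all _ fun x _ => by
      rw [norm_mul]
      exact (mul_le_of_le_one_right (norm_nonneg _) (hg1 x)).trans
        (abs_weightedTerm_le (weight_bound hu k) x r))
    (ae_of_all _ fun x _ => summable_d_sq_rpow.mul_left _)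
    (by simp)
    (ae_of_all _ fun x _ => (summable_weightedTerm hu k x).hasSum.mul_right (g x))
  rw [h.tsum_eq, ← intervalIntegral.integral_const_mul, ← intervalIntegral.integral_const_mul]
  refine intervalIntegral.integral_congr fun x _ => ?_
  simp only [component]; ring

lemma integral_cos_mul_cos (r : ℕ) (hr : r ≠ 0) :
    ∫ x in (0 : ℝ)..1, cos (2 * π * r * x - π / 4) = 0 := by
  have hc : (2 * π * r : ℝ) ≠ 0 := by positivity
  rw [intervalIntegral.integral_comp_mul_sub (fun x => cos x) hc, integral_cos]
  have : 2 * π * r * 1 - π / 4 = (2 * π * r * 0 - π / 4) + r * (2 * π) := by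
    ring
  rw [this, Real.sin_add_nat_mul_two_pi]
  simp

lemma integral_component {u : ℕ → ℝ} (hu : ∀ n, |u n| ≤ 1) (k : ℕ) :
    ∫ x in (0 : ℝ)..1, component u k x = 0 := by
  have h := integral_weightedTerm_mul hu k (g := fun _ => 1) continuous_const (by simp)
  simp only [mul_one] at h
  rw [h]
  have : ∀ r, ∫ x in (0 : ℝ)..1, weightedTerm u k x r = 0 := by
    intro r
    rcases eq_or_ne r 0 with rfl | hr
    · simp [weightedTerm, innerTerm, d_zero]
    · unfold weightedTerm innerTerm
      rw [intervalIntegral.integral_const_mul, intervalIntegral.integral_const_mul,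
        integral_cos_mul_cos r hr]
      simp
  simp [this]

lemma integral_cos_shift_mul (r : ℕ) (hr : r ≠ 0) :
    ∫ x in (0 : ℝ)..1, cos (2 * π * r * x - π / 4) *
      cos (2 * π * x - π / 4) = if r = 1 then 1 / 2 else 0 := by
  have e : ∀ x : ℝ, cos (2 * π * r * x - π / 4) *
      cos (2 * π * x - π / 4) =
      1 / 2 * (cos (2 * π * ((r - 1 : ℤ) : ℝ) * x) +
        sin (2 * π * ((r + 1 : ℤ) : ℝ) * x)) := by
    intro x
    have h1 := Real.cos_add (2 * π * r * x - π / 4) (2 * π * x - π / 4)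
    have h2 := Real.cos_sub (2 * π * r * x - π / 4) (2 * π * x - π / 4)
    have h3 : cos ((2 * π * r * x - π / 4) + (2 * π * x - π / 4)) =
        sin (2 * π * ((r + 1 : ℤ) : ℝ) * x) := by
      rw [← Real.cos_sub_pi_div_two]; congr 1; push_cast; ring
    have h4 : cos ((2 * π * r * x - π / 4) - (2 * π * x - π / 4)) =
        cos (2 * π * ((r - 1 : ℤ) : ℝ) * x) := by
      congr 1; push_cast; ring
    linarith
  simp_rw [e]
  rw [intervalIntegral.integral_const_mul, intervalIntegral.integral_add
    (Continuous.intervalIntegrable (by fun_prop) _ _)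
    (Continuous.intervalIntegrable (by fun_prop) _ _)]
  have hs : ∫ x in (0 : ℝ)..1, sin (2 * π * ((r + 1 : ℤ) : ℝ) * x) = 0 := by
    have hc : (2 * π * ((r + 1 : ℤ) : ℝ) : ℝ) ≠ 0 := by push_cast; positivity
    rw [intervalIntegral.integral_comp_mul_left (fun x => sin x) hc, integral_sin]
    have : cos (2 * π * ((r + 1 : ℤ) : ℝ) * 1) = 1 := by
      rw [show 2 * π * ((r + 1 : ℤ) : ℝ) * 1 = ((r + 1 : ℤ) : ℝ) * (2 * π) by ring]
      exact Real.cos_int_mul_two_pi _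
    rw [this]; simp
  rw [hs]
  split_ifs with h
  · subst h; simp
  · have hc : (2 * π * ((r - 1 : ℤ) : ℝ) : ℝ) ≠ 0 := by
      have : ((r - 1 : ℤ) : ℝ) ≠ 0 := by
        rw [Int.cast_ne_zero]; omega
      positivity
    rw [intervalIntegral.integral_comp_mul_left (fun x => cos x) hc, integral_cos]
    have : sin (2 * π * ((r - 1 : ℤ) : ℝ) * 1) = 0 := by
      rw [show 2 * π * ((r - 1 : ℤ) : ℝ) * 1 = ((2 * (r - 1) : ℤ) : ℝ) * π by
        push_cast; ring]
      exact Real.sin_int_mul_pi _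
    rw [this]; simp

/-- The components have a variance of the expected order. -/
lemma le_integral_component_sq (k : ℕ) :
    1 / 40 * ((d k : ℝ) * (k : ℝ) ^ (-(3 / 4) : ℝ)) ^ 2 ≤
      ∫ x in (0 : ℝ)..1, component (fun _ => 1) k x ^ 2 := by
  set Y := component (fun _ => 1) k with hY
  set g : ℝ → ℝ := fun x => cos (2 * π * x - π / 4) with hg
  have hgc : Continuous g := by simp only [hg]; fun_prop
  have hYc : Continuous Y := continuous_component (by simp) k
  set b : ℝ := 1 / (π * √2) * ((d k : ℝ) * (k : ℝ) ^ (-(3 / 4) : ℝ)) with hb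
  have h1 : ∫ x in (0 : ℝ)..1, Y x * g x = b / 2 := by
    rw [hY, integral_weightedTerm_mul (by simp) k hgc (fun x => Real.abs_cos_le_one _)]
    have : ∀ r, ∫ x in (0 : ℝ)..1, weightedTerm (fun _ => 1) k x r * g x =
        if r = 1 then (d k : ℝ) / 2 else 0 := by
      intro r
      rcases eq_or_ne r 0 with rfl | hr
      · simp [weightedTerm, innerTerm, d_zero]
      · have e : ∀ x, weightedTerm (fun _ => 1) k x r * g x =
            (d (k * r ^ 2) : ℝ) / (r : ℝ) ^ (3 / 2 : ℝ) *
              (cos (2 * π * r * x - π / 4) * g x) := by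
          intro x; simp only [weightedTerm, innerTerm]; ring
        simp_rw [e]
        rw [intervalIntegral.integral_const_mul, integral_cos_shift_mul r hr]
        split_ifs with h
        · subst h; simp; ring
        · simp
    simp_rw [this]
    rw [tsum_ite_eq, hb, Real.rpow_neg (Nat.cast_nonneg k)]
    ring
  have h2 : ∫ x in (0 : ℝ)..1, g x * g x = 1 / 2 := by
    have := integral_cos_shift_mul 1 one_ne_zero
    simpa [hg] using this
  have h3 : 0 ≤ ∫ x in (0 : ℝ)..1, (Y x - b * g x) ^ 2 :=
    intervalIntegral.integral_nonneg zero_le_one fun x _ => sq_nonneg _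
  have h4 : ∫ x in (0 : ℝ)..1, (Y x - b * g x) ^ 2 =
      (∫ x in (0 : ℝ)..1, Y x ^ 2) - 2 * b * (∫ x in (0 : ℝ)..1, Y x * g x) +
        b ^ 2 * ∫ x in (0 : ℝ)..1, g x * g x := by
    rw [← intervalIntegral.integral_const_mul, ← intervalIntegral.integral_const_mul,
      ← intervalIntegral.integral_sub, ← intervalIntegral.integral_add]
    · refine intervalIntegral.integral_congr fun x _ => ?_
      ring
    all_goals exact Continuous.intervalIntegrable (by fun_prop) _ _
  rw [h4, h1, h2] at h3
  have h5 : b ^ 2 / 2 ≤ ∫ x in (0 : ℝ)..1, Y x ^ 2 := by linarith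
  refine le_trans ?_ h5
  rw [hb, mul_pow (1 / (π * √2)), mul_div_right_comm]
  refine mul_le_mul_of_nonneg_right ?_ (sq_nonneg _)
  have hpi : π ^ 2 ≤ 10 := by
    have := Real.pi_lt_d2
    nlinarith [Real.pi_pos]
  rw [div_pow, mul_pow, Real.sq_sqrt (by norm_num : (0 : ℝ) ≤ 2), one_pow, div_div]
  apply one_div_le_one_div_of_le (by positivity)
  linarith

/-- The Taylor remainder of the exponential on the imaginary axis. -/
lemma norm_exp_mul_sub_sum_le {a : ℂ} (ha : ‖a‖ = 1) (hre : a.re = 0) (K : ℕ) {y : ℝ} (hy : 0 ≤ y) :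
    ‖Complex.exp (y * a) - ∑ m ∈ Finset.range K, (y * a : ℂ) ^ m / (m.factorial : ℂ)‖
      ≤ y ^ K / K.factorial := by
  induction K generalizing y with
  | zero =>
    simp only [Finset.range_zero, Finset.sum_empty, sub_zero, pow_zero, Nat.factorial_zero,
      Nat.cast_one, div_one]
    rw [Complex.norm_exp]; simp [hre]
  | succ K ih =>
    set g : ℝ → ℂ := fun y => Complex.exp (y * a) -
      ∑ m ∈ Finset.range K, (y * a : ℂ) ^ m / (m.factorial : ℂ) with hg
    have hder : ∀ t : ℝ, HasDerivAt (fun y : ℝ => Complex.exp (y * a) -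
        ∑ m ∈ Finset.range (K + 1), (y * a : ℂ) ^ m / (m.factorial : ℂ)) (a * g t) t := by
      intro t
      have h0 : HasDerivAt (fun y : ℝ => (y * a : ℂ)) a t := by
        simpa using ((hasDerivAt_id (t : ℂ)).comp_ofReal).mul_const a
      have h1 := h0.cexp
      have h2 : HasDerivAt (fun y : ℝ => ∑ m ∈ Finset.range (K + 1),
          (y * a : ℂ) ^ m / (m.factorial : ℂ))
          (∑ m ∈ Finset.range (K + 1), (m * (t * a : ℂ) ^ (m - 1) * a) / (m.factorial : ℂ)) t :=
        HasDerivAt.fun_sum fun m _ => (h0.pow m).div_const _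
      refine (h1.sub h2).congr_deriv ?_
      rw [Finset.sum_range_succ']
      simp only [hg, Nat.cast_zero, zero_mul, zero_div, add_zero, Nat.add_sub_cancel]
      rw [mul_sub, Finset.mul_sum]
      congr 1
      · ring
      · refine Finset.sum_congr rfl fun m _ => ?_
        rw [Nat.factorial_succ]
        have : ((m + 1 : ℕ) : ℂ) ≠ 0 := Nat.cast_ne_zero.2 (Nat.succ_ne_zero m)
        have h' : ((m.factorial : ℕ) : ℂ) ≠ 0 := Nat.cast_ne_zero.2 (Nat.factorial_ne_zero m)
        push_cast at this ⊢
        field_simp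
    have hgc : Continuous g := by simp only [hg]; fun_prop
    have hint := intervalIntegral.integral_eq_sub_of_hasDerivAt (a := 0) (b := y)
      (fun t _ => hder t) ((continuous_const.mul hgc).intervalIntegrable _ _)
    have h0 : Complex.exp (((0 : ℝ) : ℂ) * a) -
        ∑ m ∈ Finset.range (K + 1), (((0 : ℝ) : ℂ) * a) ^ m / (m.factorial : ℂ) = 0 := by
      rw [Finset.sum_range_succ']; simp
    rw [h0, sub_zero] at hint
    rw [← hint]
    have hb : ‖∫ t in (0 : ℝ)..y, a * g t‖ ≤ ∫ t in (0 : ℝ)..y, t ^ K / K.factorial := by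
      refine intervalIntegral.norm_integral_le_of_norm_le hy (ae_of_all _ fun t ht => ?_)
        (Continuous.intervalIntegrable (by fun_prop) _ _)
      rw [norm_mul, ha, one_mul]
      exact ih ht.1.le
    refine hb.trans (le_of_eq ?_)
    rw [intervalIntegral.integral_div, integral_pow, Nat.factorial_succ]
    push_cast
    field_simp
    simp

lemma norm_exp_mul_I_sub_sum_le (K : ℕ) (y : ℝ) :
    ‖Complex.exp (y * Complex.I) - ∑ m ∈ Finset.range K, (y * Complex.I : ℂ) ^ m / (m.factorial : ℂ)‖
      ≤ |y| ^ K / K.factorial := by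
  rcases le_total 0 y with h | h
  · rw [abs_of_nonneg h]
    exact norm_exp_mul_sub_sum_le (by simp) (by simp) K h
  · rw [abs_of_nonpos h]
    have := norm_exp_mul_sub_sum_le (a := -Complex.I) (by simp) (by simp) K (neg_nonneg.2 h)
    simpa using this

lemma norm_integral_exp_component_le {k : ℕ} {ξ : ℝ}
    (hξ : |ξ| * (componentConst * (d k * (k : ℝ) ^ (-(3 / 4) : ℝ))) ≤ 1) :
    ‖∫ x in (0 : ℝ)..1, Complex.exp (ξ * component (fun _ => 1) k x * Complex.I)‖ ≤
      exp (-(ξ ^ 2 / 3 * ∫ x in (0 : ℝ)..1, component (fun _ => 1) k x ^ 2)) := by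
  set Y := component (fun _ => 1) k with hY
  have hYc : Continuous Y := continuous_component (by simp) k
  set V := ∫ x in (0 : ℝ)..1, Y x ^ 2 with hV
  have hYb : ∀ x, |ξ * Y x| ≤ 1 := by
    intro x
    rw [abs_mul]
    refine le_trans ?_ hξ
    refine mul_le_mul_of_nonneg_left ?_ (abs_nonneg _)
    have := abs_component_le (u := fun _ => 1) (k := k) (a := 1)
      (weight_bound (u := fun _ => 1) (fun _ => by norm_num) k) x
    rwa [one_mul] at this
  have hpt : ∀ y : ℝ, |y| ≤ 1 →
      ‖Complex.exp (y * Complex.I) - (1 + y * Complex.I - (y : ℂ) ^ 2 / 2)‖ ≤ y ^ 2 / 6 := by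
    intro y hy
    have h := norm_exp_mul_I_sub_sum_le 3 y
    simp only [Finset.sum_range_succ, Finset.sum_range_zero, zero_add, pow_zero, pow_one,
      Nat.factorial_zero, Nat.factorial_one, Nat.factorial_two, Nat.cast_one, div_one, mul_pow,
      Complex.I_sq] at h
    have e : (1 + y * Complex.I - (y : ℂ) ^ 2 / 2) =
        1 + y * Complex.I + (y : ℂ) ^ 2 * -1 / ((2 : ℕ) : ℂ) := by push_cast; ring
    rw [e]
    rw [one_mul] at h
    refine h.trans ?_
    have h6 : ((Nat.factorial 3 : ℕ) : ℝ) = 6 := by norm_num [Nat.factorial]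
    rw [h6, ← sq_abs y]
    have : |y| ^ 3 ≤ |y| ^ 2 := pow_le_pow_of_le_one (abs_nonneg y) hy (by norm_num)
    linarith
  have hexpc : Continuous fun x => Complex.exp (ξ * Y x * Complex.I) := by fun_prop
  have hmain : ∫ x in (0 : ℝ)..1, (1 + ((ξ * Y x : ℝ) : ℂ) * Complex.I - ((ξ * Y x : ℝ) : ℂ) ^ 2 / 2) =
      ((1 - ξ ^ 2 * V / 2 : ℝ) : ℂ) := by
    have e1 : ∀ x, (1 + ((ξ * Y x : ℝ) : ℂ) * Complex.I - ((ξ * Y x : ℝ) : ℂ) ^ 2 / 2) =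
        ((1 - ξ ^ 2 / 2 * Y x ^ 2 : ℝ) : ℂ) + ((Y x : ℝ) : ℂ) * (ξ * Complex.I) := by
      intro x; push_cast; ring
    simp_rw [e1]
    rw [intervalIntegral.integral_add (Continuous.intervalIntegrable (by fun_prop) _ _)
      (Continuous.intervalIntegrable (by fun_prop) _ _), intervalIntegral.integral_mul_const,
      intervalIntegral.integral_ofReal, intervalIntegral.integral_ofReal,
      show ∫ x in (0 : ℝ)..1, Y x = 0 from integral_component (by simp) k,
      intervalIntegral.integral_sub
      (Continuous.intervalIntegrable (by fun_prop) _ _)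
      (Continuous.intervalIntegrable (by fun_prop) _ _), intervalIntegral.integral_const_mul, ← hV]
    simp only [intervalIntegral.integral_const, sub_zero, one_smul, Complex.ofReal_zero, zero_mul,
      add_zero]
    congr 1; ring
  have hdiff : ‖(∫ x in (0 : ℝ)..1, Complex.exp (ξ * Y x * Complex.I)) - ((1 - ξ ^ 2 * V / 2 : ℝ) : ℂ)‖
      ≤ ξ ^ 2 * V / 6 := by
    rw [← hmain, ← intervalIntegral.integral_sub (hexpc.intervalIntegrable _ _)
      (Continuous.intervalIntegrable (by fun_prop) _ _)]
    have : ξ ^ 2 * V / 6 = ∫ x in (0 : ℝ)..1, (ξ * Y x) ^ 2 / 6 := by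
      rw [hV, ← intervalIntegral.integral_const_mul, ← intervalIntegral.integral_div]
      refine intervalIntegral.integral_congr fun x _ => ?_
      ring
    rw [this]
    refine intervalIntegral.norm_integral_le_of_norm_le zero_le_one (ae_of_all _ fun x _ => ?_)
      (Continuous.intervalIntegrable (by fun_prop) _ _)
    have := hpt (ξ * Y x) (hYb x)
    simpa using this
  have hV0 : 0 ≤ ξ ^ 2 * V := mul_nonneg (sq_nonneg _)
    (intervalIntegral.integral_nonneg zero_le_one fun x _ => sq_nonneg _)
  have hV1 : ξ ^ 2 * V ≤ 1 := by
    have : ξ ^ 2 * V = ∫ x in (0 : ℝ)..1, (ξ * Y x) ^ 2 := by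
      rw [hV, ← intervalIntegral.integral_const_mul]
      refine intervalIntegral.integral_congr fun x _ => ?_
      ring
    rw [this]
    calc _ ≤ ∫ x in (0 : ℝ)..1, (1 : ℝ) := by
          refine intervalIntegral.integral_mono_on zero_le_one
            (Continuous.intervalIntegrable (by fun_prop) _ _) (by simp) fun x _ => ?_
          rw [sq_le_one_iff_abs_le_one]; exact hYb x
      _ = 1 := by simp
  have hfin : ‖∫ x in (0 : ℝ)..1, Complex.exp (ξ * Y x * Complex.I)‖ ≤ 1 - ξ ^ 2 * V / 3 := by
    have h1 := norm_sub_norm_le (∫ x in (0 : ℝ)..1, Complex.exp (ξ * Y x * Complex.I))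
      ((1 - ξ ^ 2 * V / 2 : ℝ) : ℂ)
    rw [Complex.norm_real, Real.norm_of_nonneg (by linarith)] at h1
    linarith
  refine hfin.trans ?_
  have := Real.add_one_le_exp (-(ξ ^ 2 / 3 * V))
  linarith

/-! ### Sums of independent components -/

/-- The squarefree numbers up to `N`. -/
def sqfreeUpTo (N : ℕ) : Finset ℕ := (Finset.Icc 1 N).filter Squarefree

lemma mem_sqfreeUpTo {N k : ℕ} : k ∈ sqfreeUpTo N ↔ (1 ≤ k ∧ k ≤ N) ∧ Squarefree k := by
  simp [sqfreeUpTo]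

/-- The sum of the components with index in `S`. -/
def componentSum (u : ℕ → ℝ) (S : Finset ℕ) (x : ℕ → ℝ) : ℝ := ∑ k ∈ S, component u k (x k)

lemma partialSeries_eq (x : ℕ → ℝ) (N : ℕ) :
    partialSeries x N = componentSum (fun _ => 1) (sqfreeUpTo N) x := by
  unfold partialSeries componentSum sqfreeUpTo
  rw [Finset.sum_filter, Finset.mul_sum]
  refine Finset.sum_congr rfl fun n _ => ?_
  split_ifs with h
  · have : ((ArithmeticFunction.moebius n : ℤ) : ℝ) ^ 2 = 1 := by
      have := ArithmeticFunction.moebius_sq_eq_one_of_squarefree h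
      exact_mod_cast this
    rw [this]
    simp [component, weightedTerm]
  · rw [ArithmeticFunction.moebius_eq_zero_of_not_squarefree h]; simp

/-- The size of the component with index `k`. -/
def compSize (k : ℕ) : ℝ := componentConst * (d k * (k : ℝ) ^ (-(3 / 4) : ℝ))

lemma compSize_nonneg (k : ℕ) : 0 ≤ compSize k :=
  mul_nonneg componentConst_nonneg (by positivity)

lemma abs_component_le_compSize {u : ℕ → ℝ} (hu : ∀ n, |u n| ≤ 1) (k : ℕ) (x : ℝ) :
    |component u k x| ≤ compSize k := by
  have := abs_component_le (weight_bound hu k) x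
  rwa [one_mul] at this

section Sums

variable {Ω : Type*} [MeasurableSpace Ω] {P : Measure Ω} {X : ℕ → Ω → ℝ}

lemma measurable_component_comp (h : UniformPhases P X) {u : ℕ → ℝ} (hu : ∀ n, |u n| ≤ 1) {k : ℕ}
    (hk : Squarefree k) : Measurable fun ω => component u k (X k ω) :=
  (continuous_component hu k).measurable.comp (h.measurable k hk)

lemma measurable_componentSum (h : UniformPhases P X) {u : ℕ → ℝ} (hu : ∀ n, |u n| ≤ 1)
    {S : Finset ℕ} (hS : ∀ k ∈ S, Squarefree k) :
    Measurable fun ω => componentSum u S (fun k => X k ω) :=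
  Finset.measurable_fun_sum S fun k hk => measurable_component_comp h hu (hS k hk)

lemma abs_componentSum_le {u : ℕ → ℝ} (hu : ∀ n, |u n| ≤ 1) (S : Finset ℕ) (x : ℕ → ℝ) :
    |componentSum u S x| ≤ ∑ k ∈ S, compSize k :=
  (Finset.abs_sum_le_sum_abs _ _).trans
    (Finset.sum_le_sum fun k _ => abs_component_le_compSize hu k _)

/-- The second moment of a sum of independent components. -/
lemma integral_componentSum_sq_le [IsProbabilityMeasure P] (h : UniformPhases P X) {u : ℕ → ℝ}
    (hu : ∀ n, |u n| ≤ 1) {S : Finset ℕ} (hS : ∀ k ∈ S, Squarefree k) {β : ℕ → ℝ}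
    (hβ : ∀ k ∈ S, ∀ x, |component u k x| ≤ β k) :
    ∫ ω, componentSum u S (fun k => X k ω) ^ 2 ∂P ≤ ∑ k ∈ S, β k ^ 2 := by
  have hint : ∀ k ∈ S, ∀ l ∈ S, Integrable (fun ω => component u k (X k ω) * component u l (X l ω)) P := by
    intro k hk l hl
    refine Integrable.of_bound (C := compSize k * compSize l)
      ((measurable_component_comp h hu (hS k hk)).mul
        (measurable_component_comp h hu (hS l hl))).aestronglyMeasurable (ae_of_all _ fun ω => ?_)
    rw [norm_mul]
    exact mul_le_mul (abs_component_le_compSize hu _ _) (abs_component_le_compSize hu _ _)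
      (abs_nonneg _) (compSize_nonneg k)
  have e : ∀ ω, componentSum u S (fun k => X k ω) ^ 2 =
      ∑ k ∈ S, ∑ l ∈ S, component u k (X k ω) * component u l (X l ω) := by
    intro ω
    rw [sq, componentSum, Finset.sum_mul_sum]
  simp_rw [e]
  rw [integral_finsetSum _ fun k hk => integrable_finsetSum _ fun l hl => hint k hk l hl]
  refine Finset.sum_le_sum fun k hk => ?_
  rw [integral_finsetSum _ fun l hl => hint k hk l hl, Finset.sum_eq_single k]
  · calc _ ≤ ∫ _ω, β k ^ 2 ∂P := by
          refine integral_mono (hint k hk k hk) (integrable_const _) fun ω => ?_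
          simp only
          rw [← sq, ← sq_abs]
          exact pow_le_pow_left₀ (abs_nonneg _) (hβ k hk _) 2
      _ = β k ^ 2 := by simp
  · intro l hl hne
    have key := h.integral_prod (𝕜 := ℝ) (S := {k, l}) (by
      intro i hi
      rcases Finset.mem_insert.1 hi with rfl | hi
      · exact hS _ hk
      · rw [Finset.mem_singleton.1 hi]; exact hS _ hl) (f := component u)
      (fun i => (continuous_component hu i).measurable)
    simp_rw [Finset.prod_pair hne.symm] at key
    rw [key, integral_component hu, zero_mul]
  · exact fun h => absurd hk h

lemma integral_exp_component_le {u : ℕ → ℝ} (hu : ∀ n, |u n| ≤ 1) (k : ℕ) (s : ℝ) :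
    ∫ x in (0 : ℝ)..1, exp (s * component u k x) ≤
      exp (min (|s| * compSize k) (|s| ^ 2 * compSize k ^ 2)) := by
  have hc := continuous_component hu k
  have hbd : ∀ x, |s * component u k x| ≤ |s| * compSize k := fun x => by
    rw [abs_mul]; exact mul_le_mul_of_nonneg_left (abs_component_le_compSize hu k x) (abs_nonneg s)
  have h0 : 0 ≤ |s| * compSize k := mul_nonneg (abs_nonneg s) (compSize_nonneg k)
  rcases le_or_gt (|s| * compSize k) 1 with h1 | h1
  · have hmin : min (|s| * compSize k) (|s| ^ 2 * compSize k ^ 2) = (|s| * compSize k) ^ 2 := by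
      rw [mul_pow]
      refine min_eq_right ?_
      rw [← mul_pow]; nlinarith
    rw [hmin]
    calc _ ≤ ∫ x in (0 : ℝ)..1, (1 + s * component u k x + (|s| * compSize k) ^ 2) := by
          refine intervalIntegral.integral_mono_on zero_le_one
            (Continuous.intervalIntegrable (by fun_prop) _ _)
            (Continuous.intervalIntegrable (by fun_prop) _ _) fun x _ => ?_
          have := Real.abs_exp_sub_one_sub_id_le ((hbd x).trans h1)
          have h2 : (s * component u k x) ^ 2 ≤ (|s| * compSize k) ^ 2 := by
            rw [← sq_abs]; exact pow_le_pow_left₀ (abs_nonneg _) (hbd x) 2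
          have h3 := (abs_le.1 this).2
          linarith
      _ = 1 + (|s| * compSize k) ^ 2 := by
          rw [intervalIntegral.integral_add (Continuous.intervalIntegrable (by fun_prop) _ _) (by simp),
            intervalIntegral.integral_add (by simp) (Continuous.intervalIntegrable (by fun_prop) _ _),
            intervalIntegral.integral_const_mul, integral_component hu]
          simp
      _ ≤ _ := by rw [add_comm]; exact Real.add_one_le_exp _
  · have hmin : min (|s| * compSize k) (|s| ^ 2 * compSize k ^ 2) = |s| * compSize k := by
      refine min_eq_left ?_
      rw [← mul_pow]; nlinarith
    rw [hmin]
    calc _ ≤ ∫ x in (0 : ℝ)..1, exp (|s| * compSize k) := by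
          refine intervalIntegral.integral_mono_on zero_le_one
            (Continuous.intervalIntegrable (by fun_prop) _ _) (by simp) fun x _ => ?_
          exact Real.exp_le_exp.2 ((le_abs_self _).trans (hbd x))
      _ = _ := by simp

lemma integral_exp_componentSum_le (h : UniformPhases P X) {u : ℕ → ℝ} (hu : ∀ n, |u n| ≤ 1)
    {S : Finset ℕ} (hS : ∀ k ∈ S, Squarefree k) (s : ℝ) :
    ∫ ω, exp (s * componentSum u S fun k => X k ω) ∂P ≤
      exp (∑ k ∈ S, min (|s| * compSize k) (|s| ^ 2 * compSize k ^ 2)) := by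
  have e : ∀ ω, exp (s * componentSum u S fun k => X k ω) =
      ∏ k ∈ S, exp (s * component u k (X k ω)) := by
    intro ω
    rw [componentSum, Finset.mul_sum, Real.exp_sum]
  simp_rw [e]
  rw [h.integral_prod (𝕜 := ℝ) hS (f := fun k x => exp (s * component u k x)) (fun k =>
    (Real.continuous_exp.comp (continuous_const.mul (continuous_component hu k))).measurable),
    Real.exp_sum]
  refine Finset.prod_le_prod (fun k _ => ?_) fun k _ => integral_exp_component_le hu k s
  exact intervalIntegral.integral_nonneg zero_le_one fun x _ => (Real.exp_pos _).le

lemma exists_sum_min_le : ∃ C : ℝ, 0 < C ∧ ∀ s : ℝ, 3 ≤ s → ∀ S : Finset ℕ,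
    ∑ k ∈ S, min (s * compSize k) (s ^ 2 * compSize k ^ 2) ≤
      C * (s ^ (4 / 3 : ℝ) * log s ^ (3 : ℝ)) := by
  set B := componentConst with hB
  have hB0 : 0 ≤ B := componentConst_nonneg
  refine ⟨25 * exp 1 * B + 625 * exp 1 * B ^ 2 + 1, by positivity, fun s hs S => ?_⟩
  set L := log s with hL
  have hs0 : 0 < s := by linarith
  have hL1 : 1 ≤ L := by
    rw [hL, Real.le_log_iff_exp_le hs0]
    linarith [Real.exp_one_lt_d9]
  have hL0 : 0 < L := by linarith
  set M := (s * L ^ 2) ^ (4 / 3 : ℝ) with hM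
  have hsL : 0 < s * L ^ 2 := by positivity
  have hM0 : 0 < M := by positivity
  set ε := 1 / (4 * L) with hε
  have hε0 : 0 < ε := by positivity
  have hε1 : ε ≤ 1 / 4 := by
    rw [hε]; apply one_div_le_one_div_of_le <;> linarith
  have hMe : M ^ ε ≤ exp 1 := by
    rw [Real.rpow_def_of_pos hM0]
    apply Real.exp_le_exp.2
    rw [hM, Real.log_rpow hsL, Real.log_mul hs0.ne' (by positivity), Real.log_pow, ← hL]
    have : log L ≤ L := by linarith [Real.log_le_sub_one_of_pos hL0]
    rw [hε, mul_one_div, div_le_one (by positivity)]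
    push_cast
    linarith
  have hterm : ∀ k ∈ S, min (s * compSize k) (s ^ 2 * compSize k ^ 2) ≤
      s * B * M ^ (1 / 4 + ε) * ((d k : ℝ) ^ 1 * (k : ℝ) ^ (-(1 + ε))) +
        s ^ 2 * B ^ 2 * M ^ (-(1 / 2) + ε) * ((d k : ℝ) ^ 2 * (k : ℝ) ^ (-(1 + ε))) := by
    intro k _
    rcases Nat.eq_zero_or_pos k with rfl | hk
    · simp [compSize, d_zero]
    have hk0 : (0 : ℝ) < k := by exact_mod_cast hk
    have hp1 : 0 ≤ s * B * M ^ (1 / 4 + ε) * ((d k : ℝ) ^ 1 * (k : ℝ) ^ (-(1 + ε))) := by positivity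
    have hp2 : 0 ≤ s ^ 2 * B ^ 2 * M ^ (-(1 / 2) + ε) * ((d k : ℝ) ^ 2 * (k : ℝ) ^ (-(1 + ε))) := by
      positivity
    rcases le_or_gt (k : ℝ) M with hkM | hkM
    · have e1 : (k : ℝ) ^ (-(3 / 4) : ℝ) ≤ M ^ (1 / 4 + ε) * (k : ℝ) ^ (-(1 + ε)) := by
        rw [show (-(3 / 4) : ℝ) = (1 / 4 + ε) + -(1 + ε) by ring, Real.rpow_add hk0]
        gcongr
      calc _ ≤ s * compSize k := min_le_left _ _
        _ = s * B * (d k * (k : ℝ) ^ (-(3 / 4) : ℝ)) := by rw [compSize]; ring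
        _ ≤ s * B * (d k * (M ^ (1 / 4 + ε) * (k : ℝ) ^ (-(1 + ε)))) := by gcongr
        _ = s * B * M ^ (1 / 4 + ε) * ((d k : ℝ) ^ 1 * (k : ℝ) ^ (-(1 + ε))) := by ring
        _ ≤ _ := by linarith
    · have e1 : (k : ℝ) ^ (-(3 / 4) : ℝ) * (k : ℝ) ^ (-(3 / 4) : ℝ) ≤
          M ^ (-(1 / 2) + ε) * (k : ℝ) ^ (-(1 + ε)) := by
        rw [← Real.rpow_add hk0, show (-(3 / 4) + -(3 / 4) : ℝ) = (-(1 / 2) + ε) + -(1 + ε) by ring,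
          Real.rpow_add hk0]
        refine mul_le_mul_of_nonneg_right ?_ (by positivity)
        exact Real.rpow_le_rpow_of_nonpos hM0 hkM.le (by linarith)
      calc _ ≤ s ^ 2 * compSize k ^ 2 := min_le_right _ _
        _ = s ^ 2 * B ^ 2 * ((d k : ℝ) ^ 2 * ((k : ℝ) ^ (-(3 / 4) : ℝ) * (k : ℝ) ^ (-(3 / 4) : ℝ))) := by
            rw [compSize]; ring
        _ ≤ s ^ 2 * B ^ 2 * ((d k : ℝ) ^ 2 * (M ^ (-(1 / 2) + ε) * (k : ℝ) ^ (-(1 + ε)))) := by gcongr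
        _ = s ^ 2 * B ^ 2 * M ^ (-(1 / 2) + ε) * ((d k : ℝ) ^ 2 * (k : ℝ) ^ (-(1 + ε))) := by ring
        _ ≤ _ := by linarith
  have hsum : ∀ j : ℕ, ∑ k ∈ S, (d k : ℝ) ^ j * (k : ℝ) ^ (-(1 + ε)) ≤ (5 * L) ^ (2 ^ j) := by
    intro j
    obtain ⟨h1, h2⟩ := summable_d_pow (σ := 1 + ε) (by linarith) j
    refine (h1.sum_le_tsum S fun k _ => by positivity).trans (h2.trans ?_)
    refine pow_le_pow_left₀ ?_ ?_ _
    · have : 0 < 1 + ε - 1 := by linarith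
      positivity
    · rw [add_sub_cancel_left, hε, one_div_one_div]; linarith
  calc _ ≤ ∑ k ∈ S, (s * B * M ^ (1 / 4 + ε) * ((d k : ℝ) ^ 1 * (k : ℝ) ^ (-(1 + ε))) +
        s ^ 2 * B ^ 2 * M ^ (-(1 / 2) + ε) * ((d k : ℝ) ^ 2 * (k : ℝ) ^ (-(1 + ε)))) :=
        Finset.sum_le_sum hterm
    _ = s * B * M ^ (1 / 4 + ε) * ∑ k ∈ S, ((d k : ℝ) ^ 1 * (k : ℝ) ^ (-(1 + ε))) +
        s ^ 2 * B ^ 2 * M ^ (-(1 / 2) + ε) * ∑ k ∈ S, ((d k : ℝ) ^ 2 * (k : ℝ) ^ (-(1 + ε))) := by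
        rw [Finset.sum_add_distrib, Finset.mul_sum, Finset.mul_sum]
    _ ≤ s * B * (M ^ (1 / 4 : ℝ) * exp 1) * (5 * L) ^ (2 ^ 1) +
        s ^ 2 * B ^ 2 * (M ^ (-(1 / 2) : ℝ) * exp 1) * (5 * L) ^ (2 ^ 2) := by
        rw [Real.rpow_add hM0, Real.rpow_add hM0]
        gcongr
        · exact hsum 1
        · exact hsum 2
    _ = (25 * exp 1 * B + 625 * exp 1 * B ^ 2) *
          (s ^ (4 / 3 : ℝ) * L ^ (8 / 3 : ℝ)) := by
        have e1 : M ^ (1 / 4 : ℝ) = s ^ (1 / 3 : ℝ) * L ^ (2 / 3 : ℝ) := by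
          rw [hM, ← Real.rpow_mul hsL.le, Real.mul_rpow hs0.le (by positivity),
            ← Real.rpow_natCast L 2, ← Real.rpow_mul hL0.le]
          norm_num
        have e2 : M ^ (-(1 / 2) : ℝ) = s ^ (-(2 / 3) : ℝ) * L ^ (-(4 / 3) : ℝ) := by
          rw [hM, ← Real.rpow_mul hsL.le, Real.mul_rpow hs0.le (by positivity),
            ← Real.rpow_natCast L 2, ← Real.rpow_mul hL0.le]
          norm_num
        have e3 : s * s ^ (1 / 3 : ℝ) = s ^ (4 / 3 : ℝ) := by
          conv_lhs => rw [← Real.rpow_one s, ← Real.rpow_mul hs0.le, ← Real.rpow_add hs0]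
          norm_num
        have e4 : s ^ 2 * s ^ (-(2 / 3) : ℝ) = s ^ (4 / 3 : ℝ) := by
          rw [← Real.rpow_natCast s 2, ← Real.rpow_add hs0]; norm_num
        have e5 : L ^ (2 / 3 : ℝ) * L ^ 2 = L ^ (8 / 3 : ℝ) := by
          rw [← Real.rpow_natCast L 2, ← Real.rpow_add hL0]; norm_num
        have e6 : L ^ (-(4 / 3) : ℝ) * L ^ 4 = L ^ (8 / 3 : ℝ) := by
          rw [← Real.rpow_natCast L 4, ← Real.rpow_add hL0]; norm_num
        rw [e1, e2]
        calc _ = 25 * exp 1 * B * ((s * s ^ (1 / 3 : ℝ)) * (L ^ (2 / 3 : ℝ) * L ^ 2)) +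
              625 * exp 1 * B ^ 2 * ((s ^ 2 * s ^ (-(2 / 3) : ℝ)) * (L ^ (-(4 / 3) : ℝ) * L ^ 4)) := by
              ring
          _ = _ := by rw [e3, e4, e5, e6]; ring
    _ ≤ (25 * exp 1 * B + 625 * exp 1 * B ^ 2 + 1) * (s ^ (4 / 3 : ℝ) * L ^ (3 : ℝ)) := by
        have : L ^ (8 / 3 : ℝ) ≤ L ^ (3 : ℝ) := Real.rpow_le_rpow_of_exponent_le hL1 (by norm_num)
        exact mul_le_mul (by linarith) (mul_le_mul_of_nonneg_left this (by positivity))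
          (by positivity) (by positivity)

/-- Even moments of sums of components, from a bound for their Laplace transform. -/
lemma exists_even_moment_le : ∃ C : ℝ, 0 < C ∧ ∀ {Ω : Type*} [MeasurableSpace Ω] {P : Measure Ω}
    [IsProbabilityMeasure P] {X : ℕ → Ω → ℝ}, UniformPhases P X → ∀ u : ℕ → ℝ, (∀ n, |u n| ≤ 1) →
    ∀ S : Finset ℕ, (∀ k ∈ S, Squarefree k) → ∀ s : ℝ, 3 ≤ s → ∀ K : ℕ, Even K →
      ∫ ω, componentSum u S (fun k => X k ω) ^ K ∂P ≤
        K.factorial * (2 / s ^ K * exp (C * (s ^ (4 / 3 : ℝ) * log s ^ (3 : ℝ)))) := by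
  obtain ⟨C, hC, hmin⟩ := exists_sum_min_le
  refine ⟨C, hC, ?_⟩
  intro Ω _ P _ X h u hu S hS s hs K hK
  have hs0 : 0 < s := by linarith
  set W : Ω → ℝ := fun ω => componentSum u S fun k => X k ω with hW
  have hWm : Measurable W := measurable_componentSum h hu hS
  have hWb : ∀ ω, |W ω| ≤ ∑ k ∈ S, compSize k := fun ω => abs_componentSum_le hu S _
  have hint : ∀ t : ℝ, Integrable (fun ω => exp (t * W ω)) P := by
    intro t
    refine Integrable.of_bound (C := exp (|t| * ∑ k ∈ S, compSize k))
      (Real.measurable_exp.comp (measurable_const.mul hWm)).aestronglyMeasurable (ae_of_all _ fun ω => ?_)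
    rw [Real.norm_of_nonneg (Real.exp_pos _).le]
    apply Real.exp_le_exp.2
    refine (le_abs_self _).trans ?_
    rw [abs_mul]
    exact mul_le_mul_of_nonneg_left (hWb ω) (abs_nonneg t)
  have hpt : ∀ y : ℝ, y ^ K ≤ K.factorial * (1 / s ^ K * (exp (s * y) + exp (-s * y))) := by
    intro y
    have h1 : |s * y| ^ K / K.factorial ≤ exp |s * y| := Real.pow_div_factorial_le_exp _ (abs_nonneg _) K
    have h2 : exp |s * y| ≤ exp (s * y) + exp (-s * y) := by
      rw [neg_mul]
      exact Real.exp_abs_le _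
    rw [hK.pow_abs, mul_pow, div_le_iff₀ (by positivity)] at h1
    rw [one_div, ← mul_assoc, mul_comm (K.factorial : ℝ), mul_assoc, ← div_eq_inv_mul,
      le_div_iff₀ (by positivity)]
    have h3 : (0 : ℝ) ≤ K.factorial := by positivity
    nlinarith
  have hexp : ∀ t : ℝ, |t| = s → ∫ ω, exp (t * W ω) ∂P ≤
      exp (C * (s ^ (4 / 3 : ℝ) * log s ^ (3 : ℝ))) := by
    intro t ht
    refine (integral_exp_componentSum_le h hu hS t).trans (Real.exp_le_exp.2 ?_)
    rw [ht]; exact hmin s hs S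
  calc ∫ ω, W ω ^ K ∂P
      ≤ ∫ ω, K.factorial * (1 / s ^ K * (exp (s * W ω) + exp (-s * W ω))) ∂P := by
        refine integral_mono_of_nonneg (ae_of_all _ fun ω => hK.pow_nonneg _)
          ((((hint s).add (hint (-s))).const_mul _).const_mul _) (ae_of_all _ fun ω => hpt _)
    _ = K.factorial * (1 / s ^ K * ((∫ ω, exp (s * W ω) ∂P) + ∫ ω, exp (-s * W ω) ∂P)) := by
        rw [integral_const_mul, integral_const_mul, integral_add (hint s) (hint (-s))]
    _ ≤ K.factorial * (1 / s ^ K * (exp (C * (s ^ (4 / 3 : ℝ) * log s ^ (3 : ℝ))) +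
          exp (C * (s ^ (4 / 3 : ℝ) * log s ^ (3 : ℝ))))) := by
        gcongr
        · exact hexp s (abs_of_pos hs0)
        · exact hexp (-s) (by rw [abs_neg, abs_of_pos hs0])
    _ = _ := by ring

end Sums

/-! ### Convergence of the random series -/

lemma sum_compSize_sq_le (S : Finset ℕ) : ∑ k ∈ S, compSize k ^ 2 ≤
    componentConst ^ 2 * ∑' k : ℕ, (d k : ℝ) ^ 2 * (k : ℝ) ^ (-(11 / 8) : ℝ) := by
  have h : ∀ k : ℕ, compSize k ^ 2 ≤ componentConst ^ 2 * ((d k : ℝ) ^ 2 * (k : ℝ) ^ (-(11 / 8) : ℝ)) := by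
    intro k
    rcases Nat.eq_zero_or_pos k with rfl | hk
    · simp [compSize, d_zero]
    have hk1 : (1 : ℝ) ≤ k := by exact_mod_cast hk
    rw [compSize, mul_pow, mul_pow]
    have : ((k : ℝ) ^ (-(3 / 4) : ℝ)) ^ 2 ≤ (k : ℝ) ^ (-(11 / 8) : ℝ) := by
      rw [← Real.rpow_natCast, ← Real.rpow_mul (by linarith)]
      exact Real.rpow_le_rpow_of_exponent_le hk1 (by norm_num)
    gcongr
  calc _ ≤ ∑ k ∈ S, componentConst ^ 2 * ((d k : ℝ) ^ 2 * (k : ℝ) ^ (-(11 / 8) : ℝ)) :=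
        Finset.sum_le_sum fun k _ => h k
    _ = componentConst ^ 2 * ∑ k ∈ S, ((d k : ℝ) ^ 2 * (k : ℝ) ^ (-(11 / 8) : ℝ)) := by
        rw [Finset.mul_sum]
    _ ≤ _ := mul_le_mul_of_nonneg_left (summable_d_sq_rpow.sum_le_tsum S fun k _ => by positivity)
        (sq_nonneg _)

section Convergence

variable {Ω : Type*} [mΩ : MeasurableSpace Ω] {P : Measure Ω} {X : ℕ → Ω → ℝ}

/-- The filtration generated by the phases with squarefree index. -/
def UniformPhases.filtration (h : UniformPhases P X) : Filtration ℕ mΩ where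
  seq n := ⨆ k ∈ {k : {n : ℕ // Squarefree n} | k.1 ≤ n},
    MeasurableSpace.comap (X k.1) (borel ℝ)
  mono' _ _ hij := biSup_mono fun _ hk => le_trans hk hij
  le' n := by
    refine iSup₂_le fun k _ => ?_
    have := h.measurable k.1 k.2
    rw [BorelSpace.measurable_eq (α := ℝ)] at this
    exact this.comap_le

/-- The sum over squarefree numbers up to `N`. -/
lemma componentSum_succ (u : ℕ → ℝ) (x : ℕ → ℝ) (N : ℕ) :
    componentSum u (sqfreeUpTo (N + 1)) x = componentSum u (sqfreeUpTo N) x +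
      if Squarefree (N + 1) then component u (N + 1) (x (N + 1)) else 0 := by
  unfold componentSum sqfreeUpTo
  rw [Finset.sum_filter, Finset.sum_filter, Finset.sum_Icc_succ_top (by omega)]

lemma squarefree_of_mem {N : ℕ} : ∀ k ∈ sqfreeUpTo N, Squarefree k := fun _ hk =>
  (mem_sqfreeUpTo.1 hk).2

lemma UniformPhases.martingale [IsProbabilityMeasure P] (h : UniformPhases P X) :
    Martingale (fun N ω => componentSum (fun _ => 1) (sqfreeUpTo N) fun k => X k ω)
      h.filtration P := by
  have hu : ∀ n : ℕ, |(fun _ : ℕ => (1 : ℝ)) n| ≤ 1 := by simp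
  have hcomp : ∀ n, (hn : Squarefree n) → StronglyMeasurable[MeasurableSpace.comap (X n) (borel ℝ)]
      fun ω => component (fun _ => 1) n (X n ω) := by
    intro n hn
    refine Measurable.stronglyMeasurable ?_
    have h1 : Measurable[MeasurableSpace.comap (X n) (borel ℝ), borel ℝ] (X n) :=
      comap_measurable (X n)
    have h2 := (continuous_component hu n).measurable
    rw [BorelSpace.measurable_eq (α := ℝ)] at h2 ⊢
    exact h2.comp h1
  refine martingale_of_condExp_sub_eq_zero_nat ?_ ?_ ?_
  · intro N
    refine Finset.stronglyMeasurable_fun_sum _ fun k hk => ?_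
    have hk' := mem_sqfreeUpTo.1 hk
    refine (hcomp k hk'.2).mono ?_
    exact le_iSup₂_of_le (⟨k, hk'.2⟩ : {n : ℕ // Squarefree n}) hk'.1.2 le_rfl
  · intro N
    exact Integrable.of_bound (measurable_componentSum h hu squarefree_of_mem).aestronglyMeasurable
      _ (ae_of_all _ fun ω => abs_componentSum_le hu _ _)
  · intro N
    by_cases hsq : Squarefree (N + 1)
    · have e : ((fun ω => componentSum (fun _ => 1) (sqfreeUpTo (N + 1)) fun k => X k ω) -
          fun ω => componentSum (fun _ => 1) (sqfreeUpTo N) fun k => X k ω) =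
          fun ω => component (fun _ => 1) (N + 1) (X (N + 1) ω) := by
        ext ω
        simp only [Pi.sub_apply, componentSum_succ, if_pos hsq]; ring
      rw [e]
      have hle : ∀ k : {n : ℕ // Squarefree n}, MeasurableSpace.comap (X k.1) (borel ℝ) ≤ mΩ := by
        intro k
        have := h.measurable k.1 k.2
        rw [BorelSpace.measurable_eq (α := ℝ)] at this
        exact this.comap_le
      have hi : iIndep (fun k : {n : ℕ // Squarefree n} =>
          MeasurableSpace.comap (X k.1) (borel ℝ)) P := by
        have := h.iIndepFun
        rw [iIndepFun_iff_iIndep] at this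
        simpa only [BorelSpace.measurable_eq (α := ℝ)] using this
      have hind := indep_iSup_of_disjoint hle hi
        (S := {(⟨N + 1, hsq⟩ : {n : ℕ // Squarefree n})})
        (T := {k : {n : ℕ // Squarefree n} | k.1 ≤ N}) (by
          rw [Set.disjoint_singleton_left]
          simp)
      rw [iSup_singleton] at hind
      have key := condExp_indep_eq (hle ⟨N + 1, hsq⟩) (h.filtration.le N) (hcomp (N + 1) hsq) hind
      refine key.trans (ae_of_all _ fun ω => ?_)
      simp only [Pi.zero_apply]
      rw [h.integral_comp hsq (f := component (fun _ => 1) (N + 1))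
        (continuous_component hu _).stronglyMeasurable, integral_component hu]
    · have e : ((fun ω => componentSum (fun _ => 1) (sqfreeUpTo (N + 1)) fun k => X k ω) -
          fun ω => componentSum (fun _ => 1) (sqfreeUpTo N) fun k => X k ω) = 0 := by
        ext ω
        simp only [Pi.sub_apply, componentSum_succ, if_neg hsq]; simp
      rw [e, condExp_zero]

lemma integral_abs_le_sqrt [IsProbabilityMeasure P] {f : Ω → ℝ} (hf : MemLp f 2 P) {A : ℝ}
    (hA : ∫ ω, f ω ^ 2 ∂P ≤ A) : ∫ ω, |f ω| ∂P ≤ √A := by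
  apply Real.le_sqrt_of_sq_le
  refine le_trans ?_ hA
  have hf1 : Integrable (fun ω => |f ω|) P := (hf.integrable (by norm_num)).abs
  have hf2 : Integrable (fun ω => f ω ^ 2) P := hf.integrable_sq
  set a := ∫ ω, |f ω| ∂P with ha
  have h0 : 0 ≤ ∫ ω, (|f ω| - a) ^ 2 ∂P := integral_nonneg fun ω => sq_nonneg _
  have e : ∀ ω, (|f ω| - a) ^ 2 = f ω ^ 2 - 2 * a * |f ω| + a ^ 2 := fun ω => by
    rw [sub_sq, sq_abs]; ring
  simp_rw [e] at h0
  have hf3 : Integrable (fun ω => f ω ^ 2 - 2 * a * |f ω|) P := hf2.sub (hf1.const_mul _)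
  rw [integral_add hf3 (integrable_const _),
    integral_sub hf2 (hf1.const_mul _), integral_const_mul, ← ha] at h0
  simp only [integral_const, probReal_univ, one_smul] at h0
  nlinarith

lemma memLp_componentSum [IsProbabilityMeasure P] (h : UniformPhases P X) {u : ℕ → ℝ}
    (hu : ∀ n, |u n| ≤ 1) {S : Finset ℕ} (hS : ∀ k ∈ S, Squarefree k) :
    MemLp (fun ω => componentSum u S fun k => X k ω) 2 P :=
  MemLp.of_bound (measurable_componentSum h hu hS).aestronglyMeasurable _
    (ae_of_all _ fun _ => abs_componentSum_le hu S _)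

/-- The random series converges almost surely. -/
theorem UniformPhases.ae_tendsto [IsProbabilityMeasure P] (h : UniformPhases P X) :
    ∀ᵐ ω ∂P, ∃ l, Tendsto (partialSeries fun n => X n ω) atTop (𝓝 l) := by
  have hu : ∀ n : ℕ, |(fun _ : ℕ => (1 : ℝ)) n| ≤ 1 := by simp
  set A := componentConst ^ 2 * ∑' k : ℕ, (d k : ℝ) ^ 2 * (k : ℝ) ^ (-(11 / 8) : ℝ)
  have key := h.martingale.submartingale.exists_ae_tendsto_of_bdd (R := Real.toNNReal √A) (by
    intro N
    have hm := memLp_componentSum h hu (squarefree_of_mem (N := N))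
    rw [eLpNorm_one_eq_lintegral_enorm,
      ← ofReal_integral_norm_eq_lintegral_enorm (hm.integrable (by norm_num))]
    refine ENNReal.ofReal_le_ofReal ?_
    refine integral_abs_le_sqrt hm ?_
    exact (integral_componentSum_sq_le h hu squarefree_of_mem
      (fun k _ x => abs_component_le_compSize hu k x)).trans (sum_compSize_sq_le _))
  filter_upwards [key] with ω hω
  obtain ⟨l, hl⟩ := hω
  exact ⟨l, hl.congr fun N => (partialSeries_eq _ N).symm⟩

theorem UniformPhases.ae_seriesConverges [IsProbabilityMeasure P] (h : UniformPhases P X) :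
    ∀ᵐ ω ∂P, SeriesConverges fun n => X n ω := by
  filter_upwards [h.ae_tendsto] with ω hω
  refine ⟨fun n _ => ?_, hω⟩
  have := summable_weightedTerm (u := fun _ => 1) (by simp) n (X n ω)
  exact this.congr fun r => by simp [weightedTerm]

lemma UniformPhases.ae_tendsto_FX [IsProbabilityMeasure P] (h : UniformPhases P X) :
    ∀ᵐ ω ∂P, Tendsto (fun N => componentSum (fun _ => 1) (sqfreeUpTo N) fun k => X k ω) atTop
      (𝓝 (FX X ω)) := by
  filter_upwards [h.ae_tendsto] with ω hω
  exact (tendsto_nhds_limUnder hω).congr fun N => partialSeries_eq _ N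

lemma UniformPhases.aemeasurable_FX [IsProbabilityMeasure P] (h : UniformPhases P X) :
    AEMeasurable (FX X) P :=
  aemeasurable_of_tendsto_metrizable_ae atTop
    (fun _ => (measurable_componentSum h (by simp) squarefree_of_mem).aemeasurable) h.ae_tendsto_FX

/-- Smooth truncation of the random series. -/
lemma exists_integral_FX_sub_le : ∃ C : ℝ, 0 < C ∧ ∀ {Ω : Type*} [MeasurableSpace Ω] {P : Measure Ω}
    [IsProbabilityMeasure P] {X : ℕ → Ω → ℝ}, UniformPhases P X → ∀ (N : ℝ) (Q : ℕ) (u : ℕ → ℝ),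
    1 ≤ N → (∀ n, 0 ≤ u n ∧ u n ≤ 1) → (∀ n : ℕ, (n : ℝ) ≤ N → u n = 1) →
    (∀ n : ℕ, Q < n → u n = 0) →
      Integrable (fun ω => FX X ω - componentSum u (sqfreeUpTo Q) fun k => X k ω) P ∧
      ∫ ω, |FX X ω - componentSum u (sqfreeUpTo Q) fun k => X k ω| ∂P ≤ C * N ^ (-(1 / 16) : ℝ) := by
  set D := ∑' k : ℕ, (d k : ℝ) ^ 2 * (k : ℝ) ^ (-(11 / 8) : ℝ) with hD
  have hD0 : 0 ≤ D := tsum_nonneg fun _ => by positivity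
  refine ⟨componentConst * √D + 1, by have := componentConst_nonneg; positivity, ?_⟩
  intro Ω _ P _ X h N Q u hN hu hu1 hu0
  have hN0 : 0 < N := by linarith
  set v : ℕ → ℝ := fun n => 1 - u n with hv
  have hu' : ∀ n, |u n| ≤ 1 := fun n => abs_le.2 ⟨by linarith [(hu n).1], (hu n).2⟩
  have hv' : ∀ n, |v n| ≤ 1 := fun n => abs_le.2 ⟨by simp only [hv]; linarith [(hu n).2], by
    simp only [hv]; linarith [(hu n).1]⟩
  have h1' : ∀ n : ℕ, |(fun _ : ℕ => (1 : ℝ)) n| ≤ 1 := by simp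
  have hsub : ∀ k x, component (fun _ => 1) k x - component u k x = component v k x := by
    intro k x
    unfold component
    rw [← mul_sub, ← mul_sub, ← (summable_weightedTerm h1' k x).tsum_sub (summable_weightedTerm hu' k x)]
    congr 3
    ext r
    simp only [weightedTerm, hv]; ring
  have hzero : ∀ k, Q < k → ∀ x, component u k x = 0 := by
    intro k hk x
    unfold component
    have : ∀ r, weightedTerm u k x r = 0 := by
      intro r
      rcases Nat.eq_zero_or_pos r with rfl | hr
      · simp [weightedTerm, innerTerm, d_zero]
      · unfold weightedTerm
        rw [hu0 _ (lt_of_lt_of_le hk (Nat.le_mul_of_pos_right k (by positivity))), zero_mul]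
    simp [this]
  have hdiff : ∀ N', Q ≤ N' → ∀ x : ℕ → ℝ, componentSum (fun _ => 1) (sqfreeUpTo N') x -
      componentSum u (sqfreeUpTo Q) x = componentSum v (sqfreeUpTo N') x := by
    intro N' hN' x
    have hext : componentSum u (sqfreeUpTo Q) x = componentSum u (sqfreeUpTo N') x := by
      unfold componentSum
      refine Finset.sum_subset ?_ ?_
      · intro k hk
        rw [mem_sqfreeUpTo] at hk ⊢
        exact ⟨⟨hk.1.1, hk.1.2.trans hN'⟩, hk.2⟩
      · intro k hk hk'
        rw [mem_sqfreeUpTo] at hk hk'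
        apply hzero
        by_contra hcon
        exact hk' ⟨⟨hk.1.1, not_lt.1 hcon⟩, hk.2⟩
    rw [hext, componentSum, componentSum, componentSum, ← Finset.sum_sub_distrib]
    exact Finset.sum_congr rfl fun k _ => hsub k _
  set β : ℕ → ℝ := fun k => ((k : ℝ) / N) ^ (1 / 16 : ℝ) * compSize k with hβ
  have hβb : ∀ k x, |component v k x| ≤ β k := by
    intro k x
    have := abs_component_le (u := v) (k := k) (a := ((k : ℝ) / N) ^ (1 / 16 : ℝ)) (fun r hr => ?_) x
    · simp only [hβ, compSize]
      rw [← mul_assoc]; exact this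
    · have hr0 : (0 : ℝ) < r := by exact_mod_cast Nat.pos_of_ne_zero hr
      rcases le_or_gt ((k * r ^ 2 : ℕ) : ℝ) N with hle | hlt
      · simp only [hv]
        rw [hu1 _ hle]
        simp only [sub_self, abs_zero]
        positivity
      · refine (hv' _).trans ?_
        have e : ((k : ℝ) / N) ^ (1 / 16 : ℝ) * (r : ℝ) ^ (1 / 8 : ℝ) =
            ((k : ℝ) * r ^ 2 / N) ^ (1 / 16 : ℝ) := by
          rw [mul_div_right_comm, Real.mul_rpow (by positivity) (by positivity),
            ← Real.rpow_natCast (r : ℝ) 2, ← Real.rpow_mul hr0.le]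
          norm_num
        rw [e]
        refine Real.one_le_rpow ?_ (by norm_num)
        rw [one_le_div hN0]
        push_cast at hlt
        exact hlt.le
  have hβs : ∀ S : Finset ℕ, ∑ k ∈ S, β k ^ 2 ≤ componentConst ^ 2 * D * N ^ (-(1 / 8) : ℝ) := by
    intro S
    have e : ∀ k : ℕ, β k ^ 2 =
        componentConst ^ 2 * N ^ (-(1 / 8) : ℝ) * ((d k : ℝ) ^ 2 * (k : ℝ) ^ (-(11 / 8) : ℝ)) := by
      intro k
      rcases Nat.eq_zero_or_pos k with rfl | hk
      · simp [hβ, compSize, d_zero]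
      have hk0 : (0 : ℝ) < k := by exact_mod_cast hk
      have e1 : (((k : ℝ) / N) ^ (1 / 16 : ℝ)) ^ 2 = (k : ℝ) ^ (1 / 8 : ℝ) * N ^ (-(1 / 8) : ℝ) := by
        rw [← Real.rpow_natCast, ← Real.rpow_mul (by positivity), Real.div_rpow hk0.le hN0.le,
          Real.rpow_neg hN0.le]
        norm_num
        rfl
      have e2 : ((k : ℝ) ^ (-(3 / 4) : ℝ)) ^ 2 * (k : ℝ) ^ (1 / 8 : ℝ) = (k : ℝ) ^ (-(11 / 8) : ℝ) := by
        rw [← Real.rpow_natCast, ← Real.rpow_mul hk0.le, ← Real.rpow_add hk0]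
        norm_num
      simp only [hβ, compSize]
      rw [← e2, mul_pow, e1]; ring
    simp_rw [e]
    rw [← Finset.mul_sum]
    calc _ ≤ componentConst ^ 2 * N ^ (-(1 / 8) : ℝ) * D :=
          mul_le_mul_of_nonneg_left (summable_d_sq_rpow.sum_le_tsum S fun k _ => by positivity)
            (by positivity)
      _ = _ := by ring
  set A := componentConst ^ 2 * D * N ^ (-(1 / 8) : ℝ) with hA
  have hsqrt : √A = componentConst * √D * N ^ (-(1 / 16) : ℝ) := by
    rw [hA, Real.sqrt_mul (by positivity), Real.sqrt_mul (sq_nonneg _),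
      Real.sqrt_sq componentConst_nonneg, Real.sqrt_eq_rpow (N ^ _), ← Real.rpow_mul hN0.le]
    norm_num
  have hL1 : ∀ N', Q ≤ N' → ∫ ω, |componentSum (fun _ => 1) (sqfreeUpTo N') (fun k => X k ω) -
      componentSum u (sqfreeUpTo Q) fun k => X k ω| ∂P ≤ √A := by
    intro N' hN'
    simp_rw [hdiff N' hN']
    refine integral_abs_le_sqrt (memLp_componentSum h hv' squarefree_of_mem) ?_
    exact (integral_componentSum_sq_le h hv' squarefree_of_mem fun k _ x => hβb k x).trans (hβs _)
  -- Fatou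
  have hmeas : ∀ N', Measurable fun ω => componentSum (fun _ => 1) (sqfreeUpTo N') (fun k => X k ω) -
      componentSum u (sqfreeUpTo Q) fun k => X k ω := fun N' =>
    (measurable_componentSum h h1' squarefree_of_mem).sub
      (measurable_componentSum h hu' squarefree_of_mem)
  have hint : ∀ N', Integrable (fun ω => componentSum (fun _ => 1) (sqfreeUpTo N') (fun k => X k ω) -
      componentSum u (sqfreeUpTo Q) fun k => X k ω) P := fun N' =>
    ((memLp_componentSum h h1' squarefree_of_mem).integrable (by norm_num)).sub
      ((memLp_componentSum h hu' squarefree_of_mem).integrable (by norm_num))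
  have hfatou : ∫⁻ ω, ‖FX X ω - componentSum u (sqfreeUpTo Q) fun k => X k ω‖ₑ ∂P ≤
      ENNReal.ofReal √A := by
    calc _ ≤ ∫⁻ ω, liminf (fun N' => ‖componentSum (fun _ => 1) (sqfreeUpTo N') (fun k => X k ω) -
          componentSum u (sqfreeUpTo Q) fun k => X k ω‖ₑ) atTop ∂P := by
          refine lintegral_mono_ae ?_
          filter_upwards [h.ae_tendsto_FX] with ω hω
          have ht : Tendsto (fun N' => ‖componentSum (fun _ => 1) (sqfreeUpTo N') (fun k => X k ω) -
            componentSum u (sqfreeUpTo Q) fun k => X k ω‖ₑ) atTop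
            (𝓝 ‖FX X ω - componentSum u (sqfreeUpTo Q) fun k => X k ω‖ₑ) :=
            (hω.sub_const _).enorm
          rw [ht.liminf_eq]
      _ ≤ liminf (fun N' => ∫⁻ ω, ‖componentSum (fun _ => 1) (sqfreeUpTo N') (fun k => X k ω) -
          componentSum u (sqfreeUpTo Q) fun k => X k ω‖ₑ ∂P) atTop :=
          lintegral_liminf_le fun N' => (hmeas N').enorm
      _ ≤ ENNReal.ofReal √A := by
          refine liminf_le_of_le (by isBoundedDefault) fun b hb => ?_
          obtain ⟨N', h1, h2⟩ := (hb.and (eventually_ge_atTop Q)).exists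
          refine h1.trans ?_
          rw [← ofReal_integral_norm_eq_lintegral_enorm (hint N')]
          exact ENNReal.ofReal_le_ofReal (hL1 N' h2)
  have hI : Integrable (fun ω => FX X ω - componentSum u (sqfreeUpTo Q) fun k => X k ω) P :=
    ⟨(h.aemeasurable_FX.sub (measurable_componentSum h hu' squarefree_of_mem).aemeasurable).aestronglyMeasurable,
      hfatou.trans_lt ENNReal.ofReal_lt_top⟩
  refine ⟨hI, ?_⟩
  rw [← ofReal_integral_norm_eq_lintegral_enorm hI] at hfatou
  have := (ENNReal.ofReal_le_ofReal_iff (Real.sqrt_nonneg _)).1 hfatou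
  refine this.trans ?_
  rw [hsqrt]
  have : 0 ≤ N ^ (-(1 / 16) : ℝ) := by positivity
  nlinarith

end Convergence

/-! ### The law of the random series has a bounded density -/

lemma sum_one_div_sq_le (n : ℕ) (hn : 1 ≤ n) :
    ∑ r ∈ Finset.Icc 2 n, 1 / (r : ℝ) ^ 2 ≤ 2 / 3 - 1 / ((n : ℝ) + 1 / 2) := by
  induction n, hn using Nat.le_induction with
  | base => norm_num
  | succ n hn ih =>
    rw [Finset.sum_Icc_succ_top (by omega)]
    have hn0 : (0 : ℝ) < n := by exact_mod_cast hn
    have : 1 / ((n + 1 : ℕ) : ℝ) ^ 2 ≤ 1 / ((n : ℝ) + 1 / 2) - 1 / (((n + 1 : ℕ) : ℝ) + 1 / 2) := by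
      push_cast
      rw [div_sub_div _ _ (by positivity) (by positivity), div_le_div_iff₀ (by positivity) (by positivity)]
      nlinarith
    linarith

lemma card_sqfreeUpTo (n : ℕ) : (n : ℝ) / 3 ≤ (sqfreeUpTo n).card := by
  classical
  rcases Nat.eq_zero_or_pos n with rfl | hn
  · simp
  have hsub : (Finset.Icc 1 n).filter (fun k => ¬ Squarefree k) ⊆
      (Finset.Icc 2 n).biUnion fun r => (Finset.Ioc 0 n).filter fun k => r ^ 2 ∣ k := by
    intro k hk
    rw [Finset.mem_filter, Finset.mem_Icc] at hk
    obtain ⟨⟨hk1, hkn⟩, hsq⟩ := hk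
    rw [Nat.squarefree_iff_prime_squarefree] at hsq
    push Not at hsq
    obtain ⟨p, hp, hpk⟩ := hsq
    rw [Finset.mem_biUnion]
    refine ⟨p, Finset.mem_Icc.2 ⟨hp.two_le, ?_⟩, Finset.mem_filter.2 ⟨Finset.mem_Ioc.2 ⟨hk1, hkn⟩, ?_⟩⟩
    · exact (Nat.le_of_dvd hk1 (dvd_of_mul_left_dvd hpk)).trans hkn
    · rwa [sq]
  have h1 : (((Finset.Icc 1 n).filter (fun k => ¬ Squarefree k)).card : ℝ) ≤ 2 / 3 * n := by
    calc _ ≤ (((Finset.Icc 2 n).biUnion fun r => (Finset.Ioc 0 n).filter fun k => r ^ 2 ∣ k).card : ℝ) := by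
          exact_mod_cast Finset.card_le_card hsub
      _ ≤ ((∑ r ∈ Finset.Icc 2 n, ((Finset.Ioc 0 n).filter fun k => r ^ 2 ∣ k).card : ℕ) : ℝ) := by
          exact_mod_cast Finset.card_biUnion_le
      _ = ∑ r ∈ Finset.Icc 2 n, ((n / r ^ 2 : ℕ) : ℝ) := by
          push_cast
          exact Finset.sum_congr rfl fun r _ => by rw [Nat.Ioc_filter_dvd_card_eq_div]
      _ ≤ ∑ r ∈ Finset.Icc 2 n, n * (1 / (r : ℝ) ^ 2) := by
          refine Finset.sum_le_sum fun r _ => ?_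
          refine Nat.cast_div_le.trans (le_of_eq ?_)
          push_cast; ring
      _ = n * ∑ r ∈ Finset.Icc 2 n, 1 / (r : ℝ) ^ 2 := by rw [Finset.mul_sum]
      _ ≤ n * (2 / 3) := by
          have := sum_one_div_sq_le n hn
          have h2 : 0 < 1 / ((n : ℝ) + 1 / 2) := by positivity
          exact mul_le_mul_of_nonneg_left (by linarith) (by positivity)
      _ = _ := by ring
  have h2 := Finset.card_filter_add_card_filter_not (s := Finset.Icc 1 n) Squarefree
  rw [Nat.card_Icc, Nat.add_sub_cancel] at h2
  have h3 : ((sqfreeUpTo n).card : ℝ) +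
      (((Finset.Icc 1 n).filter (fun k => ¬ Squarefree k)).card : ℝ) = n := by
    exact_mod_cast h2
  linarith

section Law

variable {Ω : Type*} [MeasurableSpace Ω] {P : Measure Ω} {X : ℕ → Ω → ℝ}

lemma norm_integral_exp_le_one {f : ℝ → ℝ} :
    ‖∫ x in (0 : ℝ)..1, Complex.exp (f x * Complex.I)‖ ≤ 1 := by
  have := intervalIntegral.norm_integral_le_of_norm_le_const (a := 0) (b := 1) (C := 1)
    (f := fun x => Complex.exp (f x * Complex.I)) (fun t _ => by rw [Complex.norm_exp_ofReal_mul_I])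
  simpa using this

lemma exists_norm_integral_exp_componentSum_le : ∃ C : ℝ, 0 < C ∧ ∀ {Ω : Type*} [MeasurableSpace Ω]
    {P : Measure Ω} {X : ℕ → Ω → ℝ}, UniformPhases P X → ∀ ξ : ℝ, 1 ≤ |ξ| →
    ∀ᶠ N in atTop, ‖∫ ω, Complex.exp (ξ * componentSum (fun _ => 1) (sqfreeUpTo N)
      (fun k => X k ω) * Complex.I) ∂P‖ ≤ C / (1 + ξ ^ 2) := by
  obtain ⟨Cd, hCd1, hCd⟩ := exists_d_le
  set D := componentConst * Cd + 1 with hD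
  have hB := componentConst_nonneg
  have hD1 : 1 ≤ D := by
    rw [hD]; have : 0 ≤ componentConst * Cd := by positivity
    linarith
  have hD0 : 0 < D := by linarith
  refine ⟨4 * (2880 * D) ^ 2, by positivity, ?_⟩
  intro Ω _ P X h ξ hξ
  set M := ⌈(D * |ξ|) ^ 2⌉₊ with hM
  have hDξ : 1 ≤ D * |ξ| := by nlinarith
  have hM1 : (D * |ξ|) ^ 2 ≤ M := Nat.le_ceil _
  have hM2 : (M : ℝ) ≤ 2 * (D * |ξ|) ^ 2 := by
    have := (Nat.ceil_lt_add_one (by positivity : 0 ≤ (D * |ξ|) ^ 2)).le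
    have h1 : 1 ≤ (D * |ξ|) ^ 2 := one_le_pow₀ hDξ
    rw [← hM] at this
    linarith
  have hMpos : (0 : ℝ) < M := by
    have h1 : 1 ≤ (D * |ξ|) ^ 2 := one_le_pow₀ hDξ
    linarith
  filter_upwards [eventually_ge_atTop (6 * M)] with N hN
  have hu : ∀ n : ℕ, |(fun _ : ℕ => (1 : ℝ)) n| ≤ 1 := by simp
  have e : ∀ ω, Complex.exp (ξ * componentSum (fun _ => 1) (sqfreeUpTo N) (fun k => X k ω) * Complex.I) =
      ∏ k ∈ sqfreeUpTo N, Complex.exp (ξ * component (fun _ => 1) k (X k ω) * Complex.I) := by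
    intro ω
    rw [componentSum, ← Complex.exp_sum]
    push_cast
    rw [Finset.mul_sum, Finset.sum_mul]
  simp_rw [e]
  rw [h.integral_prod squarefree_of_mem
    (f := fun k x => Complex.exp (ξ * component (fun _ => 1) k x * Complex.I)) (fun k => by
      have := continuous_component hu k
      exact Continuous.measurable (by fun_prop)), norm_prod]
  set φ : ℕ → ℝ := fun k => ‖∫ x in (0 : ℝ)..1, Complex.exp (ξ * component (fun _ => 1) k x * Complex.I)‖
    with hφ
  have hφ1 : ∀ k, φ k ≤ 1 := by
    intro k
    have hc := continuous_component hu k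
    have := norm_integral_exp_le_one (f := fun x => ξ * component (fun _ => 1) k x)
    simpa [hφ] using this
  set G := (sqfreeUpTo (6 * M)).filter (fun k => M < k) with hG
  have hGN : G ⊆ sqfreeUpTo N := by
    intro k hk
    have := (Finset.mem_filter.1 hk).1
    rw [mem_sqfreeUpTo] at this ⊢
    exact ⟨⟨this.1.1, this.1.2.trans hN⟩, this.2⟩
  have hcard : (M : ℝ) ≤ G.card := by
    have h1 := card_sqfreeUpTo (6 * M)
    have h2 := Finset.card_filter_add_card_filter_not (s := sqfreeUpTo (6 * M)) (fun k => M < k)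
    have h3 : ((sqfreeUpTo (6 * M)).filter (fun k => ¬ M < k)).card ≤ M := by
      calc _ ≤ (Finset.Icc 1 M).card := by
            refine Finset.card_le_card fun k hk => ?_
            rw [Finset.mem_filter, mem_sqfreeUpTo] at hk
            exact Finset.mem_Icc.2 ⟨hk.1.1.1, not_lt.1 hk.2⟩
        _ = M := by simp
    have h4 : ((sqfreeUpTo (6 * M)).card : ℝ) ≤ G.card + M := by
      rw [← h2]; push_cast
      have : (((sqfreeUpTo (6 * M)).filter (fun k => ¬ M < k)).card : ℝ) ≤ M := by exact_mod_cast h3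
      linarith
    push_cast at h1
    linarith
  set y := |ξ| / (2880 * D) with hy
  have hy0 : 0 < y := by positivity
  have hfac : ∀ k ∈ G, φ k ≤ exp (-(y / M)) := by
    intro k hk
    obtain ⟨hk1, hMk⟩ := Finset.mem_filter.1 hk
    have hk6 : k ≤ 6 * M := (mem_sqfreeUpTo.1 hk1).1.2
    have hk0 : (0 : ℝ) < k := by exact_mod_cast (mem_sqfreeUpTo.1 hk1).1.1
    have hMk' : (M : ℝ) ≤ k := by exact_mod_cast hMk.le
    have hsqk : D * |ξ| ≤ (k : ℝ) ^ (1 / 2 : ℝ) := by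
      rw [← Real.sqrt_eq_rpow]
      exact Real.le_sqrt_of_sq_le (hM1.trans hMk')
    have hcond : |ξ| * (componentConst * (d k * (k : ℝ) ^ (-(3 / 4) : ℝ))) ≤ 1 := by
      have hk1' : (1 : ℝ) ≤ k := by exact_mod_cast (mem_sqfreeUpTo.1 hk1).1.1
      have h1 : (d k : ℝ) * (k : ℝ) ^ (-(3 / 4) : ℝ) ≤ Cd * (k : ℝ) ^ (-(1 / 2) : ℝ) := by
        calc _ ≤ Cd * (k : ℝ) ^ (1 / 8 : ℝ) * (k : ℝ) ^ (-(3 / 4) : ℝ) := by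
              gcongr; exact hCd k
          _ = Cd * (k : ℝ) ^ (-(5 / 8) : ℝ) := by
              rw [mul_assoc, ← Real.rpow_add hk0]; norm_num
          _ ≤ _ := by
              exact mul_le_mul_of_nonneg_left
                (Real.rpow_le_rpow_of_exponent_le hk1' (by norm_num)) (by linarith)
      calc _ ≤ |ξ| * (componentConst * (Cd * (k : ℝ) ^ (-(1 / 2) : ℝ))) := by gcongr
        _ ≤ D * |ξ| * (k : ℝ) ^ (-(1 / 2) : ℝ) := by
            have : componentConst * Cd ≤ D := by rw [hD]; linarith
            calc _ = (componentConst * Cd) * |ξ| * (k : ℝ) ^ (-(1 / 2) : ℝ) := by ring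
              _ ≤ _ := by gcongr
        _ ≤ (k : ℝ) ^ (1 / 2 : ℝ) * (k : ℝ) ^ (-(1 / 2) : ℝ) := by gcongr
        _ = 1 := by rw [← Real.rpow_add hk0]; norm_num
    refine (norm_integral_exp_component_le hcond).trans (Real.exp_le_exp.2 (neg_le_neg ?_))
    have hlow := le_integral_component_sq k
    have hd1 : (1 : ℝ) ≤ d k := by exact_mod_cast one_le_d (mem_sqfreeUpTo.1 hk1).2.ne_zero
    have hpow : ((k : ℝ) ^ (-(3 / 4) : ℝ)) ^ 2 = 1 / (k * √k) := by
      rw [← Real.rpow_natCast, ← Real.rpow_mul hk0.le, Real.sqrt_eq_rpow, one_div]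
      nth_rewrite 2 [← Real.rpow_one (k : ℝ)]
      rw [← Real.rpow_add hk0, ← Real.rpow_neg hk0.le]
      norm_num
    have hsk : √(k : ℝ) ≤ 4 * (D * |ξ|) := by
      rw [Real.sqrt_le_left (by positivity)]
      have : (k : ℝ) ≤ 6 * M := by exact_mod_cast hk6
      nlinarith [sq_nonneg (D * |ξ|)]
    have hk6' : (k : ℝ) ≤ 6 * M := by exact_mod_cast hk6
    have h2 : 1 / 40 * (1 / (6 * M * (4 * (D * |ξ|)))) ≤ ∫ x in (0 : ℝ)..1, component (fun _ => 1) k x ^ 2 := by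
      refine le_trans ?_ hlow
      rw [mul_pow, hpow]
      have h3 : 1 / (6 * M * (4 * (D * |ξ|))) ≤ 1 / ((k : ℝ) * √k) := by
        apply one_div_le_one_div_of_le (by positivity)
        gcongr
      have h4 : 1 / ((k : ℝ) * √k) ≤ (d k : ℝ) ^ 2 * (1 / ((k : ℝ) * √k)) :=
        le_mul_of_one_le_left (by positivity) (one_le_pow₀ hd1)
      linarith
    calc y / M = ξ ^ 2 / 3 * (1 / 40 * (1 / (6 * M * (4 * (D * |ξ|))))) := by
          rw [hy, ← sq_abs ξ]
          have : |ξ| ≠ 0 := by positivity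
          field_simp
          norm_num
      _ ≤ _ := by gcongr
  calc ∏ k ∈ sqfreeUpTo N, φ k ≤ ∏ k ∈ G, φ k :=
        by
          rw [← Finset.prod_sdiff hGN]
          exact mul_le_of_le_one_left (Finset.prod_nonneg fun _ _ => norm_nonneg _)
            (Finset.prod_le_one (fun _ _ => norm_nonneg _) fun k _ => hφ1 k)
    _ ≤ ∏ _k ∈ G, exp (-(y / M)) := Finset.prod_le_prod (fun _ _ => norm_nonneg _) hfac
    _ = exp (G.card * (-(y / M))) := by rw [Finset.prod_const, ← Real.exp_nat_mul]
    _ ≤ exp (-y) := by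
        apply Real.exp_le_exp.2
        have : y / M * M ≤ y / M * G.card := by gcongr
        rw [div_mul_cancel₀ _ hMpos.ne'] at this
        linarith
    _ ≤ 2 / y ^ 2 := by
        rw [Real.exp_neg, ← one_div, div_le_div_iff₀ (Real.exp_pos _) (by positivity)]
        have := Real.pow_div_factorial_le_exp y hy0.le 2
        norm_num [Nat.factorial] at this
        linarith
    _ ≤ _ := by
        have hξ2 : 1 ≤ ξ ^ 2 := by rw [← sq_abs]; exact one_le_pow₀ hξ
        rw [hy, div_pow, sq_abs, div_div_eq_mul_div, div_le_div_iff₀ (by positivity) (by positivity)]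
        have : (0 : ℝ) ≤ (2880 * D) ^ 2 := by positivity
        nlinarith

/-- The law of the random series. -/
lemma exists_norm_charFun_FX_le : ∃ C : ℝ, 0 < C ∧ ∀ {Ω : Type*} [MeasurableSpace Ω]
    {P : Measure Ω} [IsProbabilityMeasure P] {X : ℕ → Ω → ℝ}, UniformPhases P X → ∀ ξ : ℝ,
    ‖charFun (P.map (FX X)) ξ‖ ≤ C / (1 + ξ ^ 2) := by
  obtain ⟨C, hC, hC'⟩ := exists_norm_integral_exp_componentSum_le
  refine ⟨max C 2, by positivity, ?_⟩
  intro Ω _ P _ X h ξ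
  have hprob : IsProbabilityMeasure (P.map (FX X)) := Measure.isProbabilityMeasure_map h.aemeasurable_FX
  rcases le_or_gt 1 |ξ| with hξ | hξ
  · rw [charFun_apply_real, integral_map h.aemeasurable_FX (Continuous.aestronglyMeasurable (by fun_prop))]
    have hu : ∀ n : ℕ, |(fun _ : ℕ => (1 : ℝ)) n| ≤ 1 := by simp
    have ht : Tendsto (fun N => ∫ ω, Complex.exp (ξ * componentSum (fun _ => 1) (sqfreeUpTo N)
        (fun k => X k ω) * Complex.I) ∂P) atTop (𝓝 (∫ ω, Complex.exp (ξ * FX X ω * Complex.I) ∂P)) := by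
      refine tendsto_integral_of_dominated_convergence (fun _ => 1) ?_ (integrable_const _) ?_ ?_
      · intro N
        have := measurable_componentSum h hu (squarefree_of_mem (N := N))
        exact Measurable.aestronglyMeasurable (by fun_prop)
      · intro N
        refine ae_of_all _ fun ω => ?_
        rw [← Complex.ofReal_mul, Complex.norm_exp_ofReal_mul_I]
      · filter_upwards [h.ae_tendsto_FX] with ω hω
        have hcont : Continuous fun y : ℝ => Complex.exp (ξ * y * Complex.I) := by fun_prop
        exact (hcont.tendsto _).comp hω
    refine (le_of_tendsto ht.norm (hC' h ξ hξ)).trans ?_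
    gcongr
    exact le_max_left _ _
  · refine (norm_charFun_le_one ξ).trans ?_
    rw [le_div_iff₀ (by positivity), one_mul]
    have : ξ ^ 2 ≤ 1 := by rw [sq_le_one_iff_abs_le_one]; exact hξ.le
    have := le_max_right C 2
    linarith

lemma one_fourth_le_fejer {y : ℝ} (hy : |y| ≤ 1) : 1 / 4 ≤ fejer y := by
  have key : ∀ z : ℝ, 0 < z → z ≤ 1 → 1 / 2 ≤ Real.sinc z := by
    intro z hz hz1
    rw [Real.sinc_of_ne_zero hz.ne', le_div_iff₀ hz]
    have h := Real.mul_le_sin hz.le (by linarith [Real.pi_gt_three])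
    have : 1 / 2 * z ≤ 2 / π * z := by
      gcongr ?_ * z
      rw [div_le_div_iff₀ (by norm_num) Real.pi_pos]
      linarith [Real.pi_le_four]
    linarith
  have hs : 1 / 2 ≤ Real.sinc (y / 2) := by
    rcases lt_trichotomy (y / 2) 0 with h | h | h
    · rw [← Real.sinc_neg]
      exact key _ (by linarith) (by linarith [(abs_le.1 hy).1])
    · rw [h, Real.sinc_zero]; norm_num
    · exact key _ h (by linarith [(abs_le.1 hy).2])
  unfold fejer
  nlinarith

/-- A measure with an integrable characteristic function has a Lipschitz distribution function. -/
lemma real_Ioc_le_of_charFun_le {ν : Measure ℝ} [IsProbabilityMeasure ν] {D : ℝ}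
    (hD : ∀ ξ, ‖charFun ν ξ‖ ≤ D / (1 + ξ ^ 2)) {a b : ℝ} (hab : a ≤ b) :
    ν.real (Set.Ioc a b) ≤ 4 * π * D * (b - a) := by
  rcases hab.eq_or_lt with rfl | hlt
  · simp
  set h := b - a with hh
  have h0 : 0 < h := by linarith
  have hD0 : 0 ≤ D := by
    have := (norm_nonneg _).trans (hD 0)
    simpa using this
  have e1 : ∀ x : ℝ, (fejer ((x - a) / h) : ℂ) = ∫ ξ in (-1 : ℝ)..1, ((1 - |ξ| : ℝ) : ℂ) *
      Complex.exp (Complex.I * a * ξ / h) * Complex.exp (((-(ξ / h) : ℝ) : ℂ) * x * Complex.I) := by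
    intro x
    rw [fejer_eq_integral]
    refine intervalIntegral.integral_congr fun ξ _ => ?_
    rw [mul_assoc ((1 - |ξ| : ℝ) : ℂ), ← Complex.exp_add]
    congr 2
    push_cast
    ring
  have hfint : Integrable (fun x => fejer ((x - a) / h)) ν := by
    refine Integrable.of_bound (C := 8) (continuous_fejer.comp (by fun_prop)).aestronglyMeasurable
      (ae_of_all _ fun x => ?_)
    rw [Real.norm_of_nonneg (fejer_nonneg _)]
    refine (fejer_le _).trans ?_
    have : (1 + ((x - a) / h) ^ 2)⁻¹ ≤ 1 := inv_le_one_of_one_le₀ (by nlinarith [sq_nonneg ((x - a) / h)])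
    linarith
  have e2 : ((∫ x, fejer ((x - a) / h) ∂ν : ℝ) : ℂ) = ∫ ξ in (-1 : ℝ)..1, ((1 - |ξ| : ℝ) : ℂ) *
      Complex.exp (Complex.I * a * ξ / h) * charFun ν (-(ξ / h)) := by
    rw [← integral_complex_ofReal]
    simp_rw [e1]
    rw [← intervalIntegral_integral_swap]
    · refine intervalIntegral.integral_congr fun ξ _ => ?_
      rw [charFun_apply_real, integral_const_mul]
    · have : IsFiniteMeasure (volume.restrict (Set.uIoc (-1 : ℝ) 1)) := by
        rw [Set.uIoc_of_le (by norm_num)]; infer_instance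
      refine Integrable.of_bound (C := 1) (Continuous.aestronglyMeasurable (by
        simp only [Function.uncurry_def]; fun_prop)) ?_
      have hmem : ∀ᵐ p ∂((volume.restrict (Set.uIoc (-1 : ℝ) 1)).prod ν),
          p.1 ∈ Set.uIoc (-1 : ℝ) 1 :=
        Measure.quasiMeasurePreserving_fst.ae (ae_restrict_mem measurableSet_uIoc)
      filter_upwards [hmem] with p hp
      rw [Set.uIoc_of_le (by norm_num)] at hp
      simp only [Function.uncurry_def, norm_mul]
      have h1 : ‖((1 - |p.1| : ℝ) : ℂ)‖ ≤ 1 := by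
        rw [Complex.norm_real, Real.norm_eq_abs, abs_le]
        have := abs_le.2 ⟨hp.1.le, hp.2⟩
        constructor <;> linarith [abs_nonneg p.1]
      have h2 : ‖Complex.exp (Complex.I * a * p.1 / h)‖ = 1 := by
        rw [show Complex.I * a * p.1 / h = ((a * p.1 / h : ℝ) : ℂ) * Complex.I by push_cast; ring,
          Complex.norm_exp_ofReal_mul_I]
      have h3 : ‖Complex.exp (((-(p.1 / h) : ℝ) : ℂ) * p.2 * Complex.I)‖ = 1 := by
        rw [← Complex.ofReal_mul, Complex.norm_exp_ofReal_mul_I]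
      rw [h2, h3]; linarith
  have hle : ∫ x, fejer ((x - a) / h) ∂ν ≤ π * D * h := by
    have hn : ‖((∫ x, fejer ((x - a) / h) ∂ν : ℝ) : ℂ)‖ ≤
        ∫ ξ in (-1 : ℝ)..1, D * (1 + (ξ / h) ^ 2)⁻¹ := by
      rw [e2]
      have hc : Continuous fun ξ : ℝ => D * (1 + (ξ / h) ^ 2)⁻¹ := by
        refine continuous_const.mul (Continuous.inv₀ (by fun_prop) fun ξ => by positivity)
      refine intervalIntegral.norm_integral_le_of_norm_le (by norm_num) (ae_of_all _ fun ξ hξ => ?_)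
        (hc.intervalIntegrable _ _)
      rw [norm_mul, norm_mul]
      have h1 : ‖((1 - |ξ| : ℝ) : ℂ)‖ ≤ 1 := by
        rw [Complex.norm_real, Real.norm_eq_abs, abs_le]
        have := abs_le.2 ⟨hξ.1.le, hξ.2⟩
        constructor <;> linarith [abs_nonneg ξ]
      have h2 : ‖Complex.exp (Complex.I * a * ξ / h)‖ = 1 := by
        rw [show Complex.I * a * ξ / h = ((a * ξ / h : ℝ) : ℂ) * Complex.I by push_cast; ring,
          Complex.norm_exp_ofReal_mul_I]
      have h3 := hD (-(ξ / h))
      rw [neg_sq, div_eq_mul_inv] at h3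
      rw [h2, mul_one]
      exact (mul_le_of_le_one_left (norm_nonneg _) h1).trans h3
    rw [Complex.norm_real, Real.norm_of_nonneg (integral_nonneg fun x => fejer_nonneg _)] at hn
    refine hn.trans ?_
    rw [intervalIntegral.integral_const_mul,
      intervalIntegral.integral_comp_div (fun ξ => (1 + ξ ^ 2)⁻¹) h0.ne', integral_inv_one_add_sq,
      smul_eq_mul]
    have h1 := Real.arctan_lt_pi_div_two (1 / h)
    have h2 := Real.neg_pi_div_two_lt_arctan (-1 / h)
    calc D * (h * (Real.arctan (1 / h) - Real.arctan (-1 / h))) ≤ D * (h * π) := by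
          gcongr; linarith
      _ = _ := by ring
  have hind : ν.real (Set.Ioc a b) ≤ ∫ x, 4 * fejer ((x - a) / h) ∂ν := by
    rw [← integral_indicator_one measurableSet_Ioc]
    refine integral_mono ((integrable_const (1 : ℝ)).indicator measurableSet_Ioc)
      (hfint.const_mul 4) fun x => ?_
    simp only [Set.indicator_apply]
    split_ifs with hx
    · have : |(x - a) / h| ≤ 1 := by
        rw [abs_of_nonneg (div_nonneg (by linarith [hx.1]) h0.le), div_le_one h0]
        linarith [hx.2]
      have := one_fourth_le_fejer this
      simp only [Pi.one_apply]
      linarith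
    · have := fejer_nonneg ((x - a) / h)
      linarith
  rw [integral_const_mul] at hind
  calc _ ≤ _ := hind
    _ ≤ 4 * (π * D * h) := by linarith
    _ = _ := by ring

end Law

/-! ### Smooth cutoffs -/

/-- A smooth cutoff, equal to `1` on `(-∞, -1]` and to `0` on `[1, ∞)`, with
`cutoff y + cutoff (-y) = 1`. -/
def cutoff (y : ℝ) : ℝ := Real.smoothTransition ((1 - y) / 2)

/-- A smooth cutoff, equal to `1` on `(-∞, 0]` and to `0` on `[1, ∞)`. -/
def taper (z : ℝ) : ℝ := Real.smoothTransition (1 - z)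

lemma cutoff_nonneg (y : ℝ) : 0 ≤ cutoff y := Real.smoothTransition.nonneg _
lemma cutoff_le_one (y : ℝ) : cutoff y ≤ 1 := Real.smoothTransition.le_one _
lemma taper_nonneg (y : ℝ) : 0 ≤ taper y := Real.smoothTransition.nonneg _
lemma taper_le_one (y : ℝ) : taper y ≤ 1 := Real.smoothTransition.le_one _

lemma cutoff_of_le {y : ℝ} (hy : y ≤ -1) : cutoff y = 1 :=
  Real.smoothTransition.one_of_one_le (by linarith)

lemma cutoff_of_ge {y : ℝ} (hy : 1 ≤ y) : cutoff y = 0 :=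
  Real.smoothTransition.zero_of_nonpos (by linarith)

lemma taper_of_le {y : ℝ} (hy : y ≤ 0) : taper y = 1 :=
  Real.smoothTransition.one_of_one_le (by linarith)

lemma taper_of_ge {y : ℝ} (hy : 1 ≤ y) : taper y = 0 :=
  Real.smoothTransition.zero_of_nonpos (by linarith)

lemma cutoff_add_cutoff_neg (y : ℝ) : cutoff y + cutoff (-y) = 1 := by
  unfold cutoff Real.smoothTransition
  have h1 : 1 - (1 - y) / 2 = (1 - -y) / 2 := by ring
  have h2 : 1 - (1 - -y) / 2 = (1 - y) / 2 := by ring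
  rw [h1, h2, add_comm (expNegInvGlue ((1 - -y) / 2)), ← add_div]
  have := Real.smoothTransition.pos_denom ((1 - y) / 2)
  rw [h1] at this
  exact div_self this.ne'

lemma contDiff_cutoff : ContDiff ℝ 3 cutoff :=
  (Real.smoothTransition.contDiff (n := 3)).comp (by fun_prop)

lemma contDiff_taper : ContDiff ℝ 3 taper :=
  (Real.smoothTransition.contDiff (n := 3)).comp (by fun_prop)

lemma antitone_cutoff : Antitone cutoff := fun _ _ h =>
  Real.smoothTransition.monotone (by linarith)

lemma deriv_eq_zero_of_const {f : ℝ → ℝ} {a b c₁ c₂ : ℝ} (h₁ : ∀ x ≤ a, f x = c₁)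
    (h₂ : ∀ x, b ≤ x → f x = c₂) {x : ℝ} (hx : x ∉ Set.Icc a b) : deriv f x = 0 := by
  rw [Set.mem_Icc, not_and_or, not_le, not_le] at hx
  rcases hx with hx | hx
  · have : f =ᶠ[𝓝 x] fun _ => c₁ := by
      filter_upwards [Iio_mem_nhds hx] with y hy using h₁ y (le_of_lt hy)
    rw [this.deriv_eq, deriv_const]
  · have : f =ᶠ[𝓝 x] fun _ => c₂ := by
      filter_upwards [Ioi_mem_nhds hx] with y hy using h₂ y (le_of_lt hy)
    rw [this.deriv_eq, deriv_const]

lemma exists_abs_le_of_support {f : ℝ → ℝ} (hf : Continuous f) {a b : ℝ}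
    (h : ∀ x ∉ Set.Icc a b, f x = 0) : ∃ M : ℝ, 0 ≤ M ∧ ∀ x, |f x| ≤ M := by
  obtain ⟨M, hM⟩ := isCompact_Icc.exists_bound_of_continuousOn (hf.continuousOn (s := Set.Icc a b))
  refine ⟨max M 0, le_max_right _ _, fun x => ?_⟩
  by_cases hx : x ∈ Set.Icc a b
  · exact (hM x hx).trans (le_max_left _ _)
  · rw [h x hx, abs_zero]; exact le_max_right _ _

/-- A function that is constant to the left and to the right has bounded derivatives. -/
lemma exists_deriv_bound {f : ℝ → ℝ} (hf : ContDiff ℝ 3 f) {a b c₁ c₂ : ℝ}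
    (h₁ : ∀ x ≤ a, f x = c₁) (h₂ : ∀ x, b ≤ x → f x = c₂) :
    ∃ M : ℝ, 1 ≤ M ∧ (∀ x, |deriv f x| ≤ M) ∧ ∀ x, |deriv (deriv f) x| ≤ M := by
  have hf1 : ContDiff ℝ 2 (deriv f) := by
    have := (contDiff_succ_iff_deriv (n := 2) (f := f)).1 (by norm_num; exact hf)
    exact this.2.2
  have hf2 : ContDiff ℝ 1 (deriv (deriv f)) := by
    have := (contDiff_succ_iff_deriv (n := 1) (f := deriv f)).1 (by norm_num; exact hf1)
    exact this.2.2
  obtain ⟨M, hM0, hM⟩ := exists_abs_le_of_support hf1.continuous (a := a) (b := b)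
    fun x hx => deriv_eq_zero_of_const h₁ h₂ hx
  obtain ⟨M', hM0', hM'⟩ := exists_abs_le_of_support hf2.continuous (a := a - 1) (b := b + 1)
    fun x hx => by
      refine deriv_eq_zero_of_const (a := a - 1) (b := b + 1) (c₁ := 0) (c₂ := 0) ?_ ?_ hx
      · intro y hy; exact deriv_eq_zero_of_const h₁ h₂ fun h => by linarith [h.1]
      · intro y hy; exact deriv_eq_zero_of_const h₁ h₂ fun h => by linarith [h.2]
  exact ⟨1 + M + M', by linarith, fun x => (hM x).trans (by linarith),
    fun x => (hM' x).trans (by linarith)⟩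

/-! ### The hyperbola method -/

lemma sum_d_add_mul (n u v : ℕ) (h1 : u * v ≤ n) (h2 : n < (u + 1) * (v + 1)) :
    ∑ k ∈ Finset.Icc 1 n, d k + u * v =
      ∑ b ∈ Finset.Icc 1 u, n / b + ∑ b ∈ Finset.Icc 1 v, n / b := by
  classical
  set S := (Finset.Icc 1 n ×ˢ Finset.Icc 1 n).filter (fun p => p.1 * p.2 ≤ n) with hS
  have memS : ∀ p : ℕ × ℕ, p ∈ S ↔ 1 ≤ p.1 ∧ 1 ≤ p.2 ∧ p.1 * p.2 ≤ n := by
    intro p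
    simp only [hS, Finset.mem_filter, Finset.mem_product, Finset.mem_Icc]
    constructor
    · rintro ⟨⟨⟨h1, _⟩, h3, _⟩, h5⟩; exact ⟨h1, h3, h5⟩
    · rintro ⟨h1, h3, h5⟩
      exact ⟨⟨⟨h1, (Nat.le_mul_of_pos_right _ h3).trans h5⟩, h3,
        (Nat.le_mul_of_pos_left _ h1).trans h5⟩, h5⟩
  have hd : ∑ k ∈ Finset.Icc 1 n, d k = S.card := by
    rw [Finset.card_eq_sum_card_fiberwise (f := fun p : ℕ × ℕ => p.1 * p.2) (t := Finset.Icc 1 n)]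
    · refine Finset.sum_congr rfl fun k hk => ?_
      rw [Finset.mem_Icc] at hk
      unfold d
      rw [show k.divisors.card = k.divisorsAntidiagonal.card by
        rw [← Nat.map_div_right_divisors, Finset.card_map]]
      congr 1
      ext p
      simp only [Nat.mem_divisorsAntidiagonal, Finset.mem_filter, memS]
      constructor
      · rintro ⟨h, hk0⟩
        have h0 : p.1 * p.2 ≠ 0 := by omega
        refine ⟨⟨?_, ?_, by omega⟩, h⟩
        · exact Nat.pos_of_ne_zero (left_ne_zero_of_mul h0)
        · exact Nat.pos_of_ne_zero (right_ne_zero_of_mul h0)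
      · rintro ⟨_, h⟩; exact ⟨h, by omega⟩
    · intro p hp
      have := (memS p).1 hp
      rw [Finset.mem_coe, Finset.mem_Icc]
      exact ⟨Nat.mul_pos this.1 this.2.1, this.2.2⟩
  have hfib : ∀ b, 1 ≤ b → ∀ s : Finset ℕ, (∀ a, a ∈ s ↔ 1 ≤ a ∧ a * b ≤ n) → s.card = n / b := by
    intro b hb s hs
    have : s = Finset.Icc 1 (n / b) := by
      ext a; rw [hs, Finset.mem_Icc, Nat.le_div_iff_mul_le hb]
    rw [this]; simp
  have hU : (S.filter fun p => p.2 ≤ u).card = ∑ b ∈ Finset.Icc 1 u, n / b := by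
    rw [Finset.card_eq_sum_card_fiberwise (f := fun p : ℕ × ℕ => p.2) (t := Finset.Icc 1 u)]
    · refine Finset.sum_congr rfl fun b hb => ?_
      rw [Finset.mem_Icc] at hb
      rw [← hfib b hb.1 ((((S.filter fun p => p.2 ≤ u).filter fun p => p.2 = b)).image Prod.fst)]
      · rw [Finset.card_image_of_injOn]
        intro p hp q hq h
        simp only [Finset.coe_filter, Set.mem_ofPred_eq] at hp hq
        exact Prod.ext h (hp.2.trans hq.2.symm)
      · intro a
        simp only [Finset.mem_image, Finset.mem_filter, memS]
        constructor
        · rintro ⟨p, ⟨⟨⟨h1, h2, h3⟩, _⟩, rfl⟩, rfl⟩; exact ⟨h1, h3⟩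
        · rintro ⟨h1, h2⟩; exact ⟨(a, b), ⟨⟨⟨h1, hb.1, h2⟩, hb.2⟩, rfl⟩, rfl⟩
    · intro p hp
      simp only [Finset.coe_filter, Set.mem_ofPred_eq, memS] at hp
      rw [Finset.mem_coe, Finset.mem_Icc]; exact ⟨hp.1.2.1, hp.2⟩
  have hV : (S.filter fun p => p.1 ≤ v).card = ∑ b ∈ Finset.Icc 1 v, n / b := by
    rw [Finset.card_eq_sum_card_fiberwise (f := fun p : ℕ × ℕ => p.1) (t := Finset.Icc 1 v)]
    · refine Finset.sum_congr rfl fun b hb => ?_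
      rw [Finset.mem_Icc] at hb
      rw [← hfib b hb.1 ((((S.filter fun p => p.1 ≤ v).filter fun p => p.1 = b)).image Prod.snd)]
      · rw [Finset.card_image_of_injOn]
        intro p hp q hq h
        simp only [Finset.coe_filter, Set.mem_ofPred_eq] at hp hq
        exact Prod.ext (hp.2.trans hq.2.symm) h
      · intro a
        simp only [Finset.mem_image, Finset.mem_filter, memS]
        constructor
        · rintro ⟨p, ⟨⟨⟨h1, h2, h3⟩, _⟩, rfl⟩, rfl⟩; exact ⟨h2, by rwa [mul_comm]⟩
        · rintro ⟨h1, h2⟩; exact ⟨(b, a), ⟨⟨⟨hb.1, h1, by rwa [mul_comm]⟩, hb.2⟩, rfl⟩, rfl⟩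
    · intro p hp
      simp only [Finset.coe_filter, Set.mem_ofPred_eq, memS] at hp
      rw [Finset.mem_coe, Finset.mem_Icc]; exact ⟨hp.1.1, hp.2⟩
  have hUV : ((S.filter fun p => p.2 ≤ u) ∩ (S.filter fun p => p.1 ≤ v)).card = u * v := by
    have : (S.filter fun p => p.2 ≤ u) ∩ (S.filter fun p => p.1 ≤ v) =
        Finset.Icc 1 v ×ˢ Finset.Icc 1 u := by
      ext p
      simp only [Finset.mem_inter, Finset.mem_filter, memS, Finset.mem_product, Finset.mem_Icc]
      constructor
      · rintro ⟨⟨⟨h1, h2, _⟩, h3⟩, _, h4⟩; exact ⟨⟨h1, h4⟩, h2, h3⟩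
      · rintro ⟨⟨h1', h4⟩, h2', h3⟩
        have : p.1 * p.2 ≤ n := (Nat.mul_le_mul h4 h3).trans (by rwa [mul_comm])
        exact ⟨⟨⟨h1', h2', this⟩, h3⟩, ⟨h1', h2', this⟩, h4⟩
    rw [this, Finset.card_product]; simp [mul_comm]
  have hunion : (S.filter fun p => p.2 ≤ u) ∪ (S.filter fun p => p.1 ≤ v) = S := by
    rw [← Finset.filter_or]
    refine Finset.filter_true_of_mem fun p hp => ?_
    by_contra! hcon
    have := (memS p).1 hp
    have h3 : (u + 1) * (v + 1) ≤ p.1 * p.2 := by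
      rw [mul_comm p.1]; exact Nat.mul_le_mul hcon.1 hcon.2
    omega
  rw [hd, ← hU, ← hV, ← Finset.card_union_add_card_inter, hunion, hUV]

lemma log_one_add_le {t : ℝ} (ht : 0 ≤ t) : log (1 + t) ≤ (t + t / (1 + t)) / 2 := by
  have hmono : MonotoneOn (fun t : ℝ => (t + t / (1 + t)) / 2 - log (1 + t)) (Set.Ici 0) := by
    have hder : ∀ x ∈ Set.Ici (0 : ℝ), HasDerivAt
        (fun t : ℝ => (t + t / (1 + t)) / 2 - log (1 + t))
        ((1 + (1 * (1 + x) - x * 1) / (1 + x) ^ 2) / 2 - 1 / (1 + x)) x := by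
      intro x hx
      have hx' : (1 : ℝ) + x ≠ 0 := by have := Set.mem_Ici.1 hx; positivity
      have h1 : HasDerivAt (fun t : ℝ => 1 + t) 1 x := (hasDerivAt_id x).const_add 1
      exact (((hasDerivAt_id x).add ((hasDerivAt_id x).div h1 hx')).div_const 2).sub (h1.log hx')
    refine monotoneOn_of_hasDerivWithinAt_nonneg (convex_Ici 0)
      (fun x hx => (hder x hx).continuousAt.continuousWithinAt)
      (fun x hx => (hder x (interior_subset hx)).hasDerivWithinAt) fun x hx => ?_
    rw [interior_Ici] at hx
    have hx' : (0 : ℝ) < x := hx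
    have : (1 + (1 * (1 + x) - x * 1) / (1 + x) ^ 2) / 2 - 1 / (1 + x) =
        (x / (1 + x)) ^ 2 / 2 := by field_simp; ring
    rw [this]; positivity
  have := hmono (Set.mem_Ici.2 le_rfl) (Set.mem_Ici.2 ht) ht
  simp only [add_zero, Real.log_one, zero_div, sub_zero] at this
  linarith

/-- The harmonic numbers to second order. -/
lemma abs_harmonic_sub_le {n : ℕ} (hn : 1 ≤ n) :
    |∑ b ∈ Finset.Icc 1 n, 1 / (b : ℝ) - log n - Real.eulerMascheroniConstant -
      1 / (2 * n)| ≤ 1 / (2 * (n : ℝ) ^ 2) := by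
  set e : ℕ → ℝ := fun n => ∑ b ∈ Finset.Icc 1 n, 1 / (b : ℝ) - log n with he
  have hlim : Tendsto e atTop (𝓝 Real.eulerMascheroniConstant) := by
    refine Real.tendsto_harmonic_sub_log.congr fun n => ?_
    rw [harmonic_eq_sum_Icc, he]
    push_cast
    simp only [one_div]
  have h0 : Tendsto (fun n : ℕ => 1 / (2 * (n : ℝ))) atTop (𝓝 0) := by
    have := (tendsto_one_div_atTop_nhds_zero_nat (𝕜 := ℝ)).const_mul (1 / 2)
    simp only [mul_zero] at this
    refine this.congr fun n => ?_
    rw [one_div_mul_one_div]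
  have h0' : Tendsto (fun n : ℕ => 1 / (2 * (n : ℝ) ^ 2)) atTop (𝓝 0) := by
    have := ((tendsto_one_div_atTop_nhds_zero_nat (𝕜 := ℝ)).pow 2).const_mul (1 / 2)
    simp only [ne_eq, OfNat.ofNat_ne_zero, not_false_eq_true, zero_pow, mul_zero] at this
    refine this.congr fun n => ?_
    rw [div_pow, one_pow, one_div_mul_one_div]
  have hstep : ∀ k : ℕ, 1 ≤ k → e (k + 1) - e k = 1 / ((k : ℝ) + 1) - log (1 + 1 / k) := by
    intro k hk
    have hk0 : (0 : ℝ) < k := by exact_mod_cast hk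
    have : 1 + 1 / (k : ℝ) = (k + 1) / k := by field_simp
    rw [this, Real.log_div (by positivity) hk0.ne', he]
    simp only
    rw [Finset.sum_Icc_succ_top (by omega)]
    push_cast
    ring
  have hup : e n - 1 / (2 * n) ≤ Real.eulerMascheroniConstant := by
    have hmono : ∀ m : ℕ, n ≤ m → e n - 1 / (2 * n) ≤ e m - 1 / (2 * m) := by
      intro m hm
      induction m, hm using Nat.le_induction with
      | base => exact le_rfl
      | succ k hk ih =>
        have hk1 : 1 ≤ k := hn.trans hk
        have hk0 : (0 : ℝ) < k := by exact_mod_cast hk1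
        have h1 := hstep k hk1
        have h2 := log_one_add_le (t := 1 / (k : ℝ)) (by positivity)
        have h3 : 1 / (k : ℝ) / (1 + 1 / k) = 1 / (k + 1) := by field_simp
        rw [h3] at h2
        have h4 : 1 / (2 * (k : ℝ)) = 1 / k / 2 := by field_simp
        have h5 : 1 / (2 * ((k + 1 : ℕ) : ℝ)) = 1 / ((k : ℝ) + 1) / 2 := by push_cast; field_simp
        rw [h5]; rw [h4] at ih
        linarith
    have := hlim.sub h0
    rw [sub_zero] at this
    exact ge_of_tendsto this (eventually_atTop.2 ⟨n, hmono⟩)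
  have hlow : Real.eulerMascheroniConstant ≤ e n - 1 / (2 * n) + 1 / (2 * (n : ℝ) ^ 2) := by
    have hmono : ∀ m : ℕ, n ≤ m → e m - 1 / (2 * m) + 1 / (2 * (m : ℝ) ^ 2) ≤
        e n - 1 / (2 * n) + 1 / (2 * (n : ℝ) ^ 2) := by
      intro m hm
      induction m, hm using Nat.le_induction with
      | base => exact le_rfl
      | succ k hk ih =>
        have hk1 : 1 ≤ k := hn.trans hk
        have hk0 : (0 : ℝ) < k := by exact_mod_cast hk1
        have h1 := hstep k hk1
        have h2 := Real.le_log_one_add_of_nonneg (x := 1 / (k : ℝ)) (by positivity)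
        have h6 : 1 / ((k : ℝ) + 1) - 2 * (1 / (k : ℝ)) / (1 / k + 2) - 1 / (2 * ((k : ℝ) + 1)) +
            1 / (2 * ((k : ℝ) + 1) ^ 2) ≤ - (1 / (2 * (k : ℝ))) + 1 / (2 * (k : ℝ) ^ 2) := by
          rw [← sub_nonneg]
          have : - (1 / (2 * (k : ℝ))) + 1 / (2 * (k : ℝ) ^ 2) - (1 / ((k : ℝ) + 1) -
              2 * (1 / (k : ℝ)) / (1 / k + 2) - 1 / (2 * ((k : ℝ) + 1)) +
              1 / (2 * ((k : ℝ) + 1) ^ 2)) =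
              ((2 * k + 1) ^ 2 - k * (k + 1)) / (2 * k ^ 2 * (k + 1) ^ 2 * (2 * k + 1)) := by
            field_simp
            ring
          rw [this]
          apply div_nonneg
          · nlinarith
          · positivity
        push_cast
        linarith
    have := (hlim.sub h0).add h0'
    rw [sub_zero, add_zero] at this
    exact le_of_tendsto this (eventually_atTop.2 ⟨n, hmono⟩)
  rw [abs_le]
  have : (0 : ℝ) ≤ 1 / (2 * (n : ℝ) ^ 2) := by positivity
  simp only [he] at hup hlow
  constructor <;> linarith

/-- The sawtooth function. -/
def saw (u : ℝ) : ℝ := Int.fract u - 1 / 2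

lemma abs_saw_le (u : ℝ) : |saw u| ≤ 1 / 2 := by
  have h1 := Int.fract_nonneg u
  have h2 := Int.fract_lt_one u
  rw [saw, abs_le]; constructor <;> linarith

lemma natFloor_eq_sub_saw {u : ℝ} (hu : 0 ≤ u) : (⌊u⌋₊ : ℝ) = u - 1 / 2 - saw u := by
  have h1 : (⌊u⌋₊ : ℝ) = (⌊u⌋ : ℝ) := by
    rw [← Int.natCast_floor_eq_floor hu]; simp
  rw [h1, saw, Int.fract]; ring

lemma abs_sum_one_div_sub_le {U : ℝ} (hU : 2 ≤ U) :
    |∑ b ∈ Finset.Icc 1 ⌊U⌋₊, 1 / (b : ℝ) - log U - Real.eulerMascheroniConstant +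
      saw U / U| ≤ 5 / U ^ 2 := by
  have hU0 : 0 < U := by linarith
  set n := ⌊U⌋₊ with hn
  have hn1 : 1 ≤ n := Nat.le_floor (by push_cast; linarith)
  have hn0 : (0 : ℝ) < n := by exact_mod_cast hn1
  have hnU : (n : ℝ) ≤ U := Nat.floor_le hU0.le
  have hnU' : U < n + 1 := Nat.lt_floor_add_one U
  have hsaw : saw U = U - 1 / 2 - n := by rw [hn, natFloor_eq_sub_saw hU0.le]; ring
  have hUn : U ≤ 3 / 2 * n := by
    have : (2 : ℝ) ≤ n := by exact_mod_cast (Nat.le_floor (by push_cast; linarith) : 2 ≤ n)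
    linarith
  have h1 := abs_harmonic_sub_le hn1
  set t := (U - n) / U with ht
  have ht0 : 0 ≤ t := div_nonneg (by linarith) hU0.le
  have htU : t ≤ 1 / U := by rw [ht]; gcongr; linarith
  have ht2 : t ≤ 1 / 2 := htU.trans (by rw [div_le_div_iff₀ hU0 (by norm_num)]; linarith)
  have hlog : log n = log U + log (1 - t) := by
    have : 1 - t = n / U := by rw [ht]; field_simp; ring
    rw [this, Real.log_div hn0.ne' hU0.ne']; ring
  have h2 : |t + log (1 - t)| ≤ 2 * t ^ 2 := by
    have := Real.abs_log_sub_add_sum_range_le (x := t) (by rw [abs_of_nonneg ht0]; linarith) 1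
    simp only [Finset.sum_range_one, zero_add, pow_one, Nat.cast_zero, div_one, abs_of_nonneg ht0]
      at this
    refine this.trans ?_
    rw [div_le_iff₀ (by linarith)]
    norm_num
    nlinarith [sq_nonneg t]
  have h3 : |1 / (2 * (n : ℝ)) - 1 / (2 * U)| ≤ 3 / 4 / U ^ 2 := by
    have : 1 / (2 * (n : ℝ)) - 1 / (2 * U) = (U - n) / (2 * n * U) := by field_simp
    rw [this, abs_of_nonneg (div_nonneg (by linarith) (by positivity)),
      div_le_div_iff₀ (by positivity) (by positivity)]
    have : (U - n) * U ^ 2 ≤ 1 * U ^ 2 := by gcongr; linarith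
    nlinarith
  have h4 : 1 / (2 * (n : ℝ) ^ 2) ≤ 9 / 8 / U ^ 2 := by
    rw [div_le_div_iff₀ (by positivity) (by positivity)]
    nlinarith
  have h5 : 2 * t ^ 2 ≤ 2 / U ^ 2 := by
    have : t ^ 2 ≤ (1 / U) ^ 2 := by gcongr
    rw [div_pow 1 U, one_pow] at this
    calc _ ≤ 2 * (1 / U ^ 2) := by linarith
      _ = _ := by ring
  have h6 : ∑ b ∈ Finset.Icc 1 n, 1 / (b : ℝ) - log U - Real.eulerMascheroniConstant +
      saw U / U = (∑ b ∈ Finset.Icc 1 n, 1 / (b : ℝ) - log n -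
        Real.eulerMascheroniConstant - 1 / (2 * n)) + (t + log (1 - t)) +
        (1 / (2 * (n : ℝ)) - 1 / (2 * U)) := by
    rw [hlog, hsaw, ht]
    field_simp
    ring
  rw [h6]
  refine (abs_add_three _ _ _).trans ?_
  have : 5 / U ^ 2 = 9 / 8 / U ^ 2 + 2 / U ^ 2 + 3 / 4 / U ^ 2 + (9 / 8) / U ^ 2 := by ring
  have : 0 ≤ 9 / 8 / U ^ 2 := by positivity
  linarith

lemma abs_Delta_add_le {U V : ℝ} (hU : 2 ≤ U) (hV : 2 ≤ V) (hUV : U ≤ 8 * V) (hVU : V ≤ 8 * U) :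
    |Delta (U * V) + ∑ b ∈ Finset.Icc 1 ⌊U⌋₊, saw (U * V / b) +
      ∑ b ∈ Finset.Icc 1 ⌊V⌋₊, saw (U * V / b)| ≤ 81 := by
  set x := U * V with hx
  have hU0 : 0 < U := by linarith
  have hV0 : 0 < V := by linarith
  have hx0 : 0 < x := mul_pos hU0 hV0
  have hcount := sum_d_add_mul ⌊x⌋₊ ⌊U⌋₊ ⌊V⌋₊
    (Nat.le_floor (by
      push_cast
      exact mul_le_mul (Nat.floor_le hU0.le) (Nat.floor_le hV0.le) (by positivity) hU0.le))
    ((Nat.floor_lt hx0.le).2 (by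
      push_cast
      exact mul_lt_mul'' (Nat.lt_floor_add_one U) (Nat.lt_floor_add_one V) hU0.le hV0.le))
  have hdiv : ∀ n : ℕ, ((∑ b ∈ Finset.Icc 1 n, ⌊x⌋₊ / b : ℕ) : ℝ) =
      x * ∑ b ∈ Finset.Icc 1 n, 1 / (b : ℝ) - n / 2 - ∑ b ∈ Finset.Icc 1 n, saw (x / b) := by
    intro n
    have hn : (n : ℝ) / 2 = ∑ b ∈ Finset.Icc 1 n, (1 / 2 : ℝ) := by simp; ring
    rw [hn, Finset.mul_sum, ← Finset.sum_sub_distrib, ← Finset.sum_sub_distrib, Nat.cast_sum]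
    refine Finset.sum_congr rfl fun b _ => ?_
    rw [← Nat.floor_div_natCast, natFloor_eq_sub_saw (by positivity)]
    ring
  have hcount' : (∑ k ∈ Finset.Icc 1 ⌊x⌋₊, (d k : ℝ)) + (⌊U⌋₊ : ℝ) * ⌊V⌋₊ =
      ((∑ b ∈ Finset.Icc 1 ⌊U⌋₊, ⌊x⌋₊ / b : ℕ) : ℝ) +
        ((∑ b ∈ Finset.Icc 1 ⌊V⌋₊, ⌊x⌋₊ / b : ℕ) : ℝ) := by exact_mod_cast hcount
  rw [hdiv, hdiv] at hcount'
  have eU := natFloor_eq_sub_saw hU0.le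
  have eV := natFloor_eq_sub_saw hV0.le
  have aU := abs_sum_one_div_sub_le hU
  have aV := abs_sum_one_div_sub_le hV
  set EU := ∑ b ∈ Finset.Icc 1 ⌊U⌋₊, 1 / (b : ℝ) - log U - Real.eulerMascheroniConstant +
      saw U / U with hEU
  set EV := ∑ b ∈ Finset.Icc 1 ⌊V⌋₊, 1 / (b : ℝ) - log V - Real.eulerMascheroniConstant +
      saw V / V with hEV
  have hHU : x * ∑ b ∈ Finset.Icc 1 ⌊U⌋₊, 1 / (b : ℝ) = x * EU + x * log U +
      x * Real.eulerMascheroniConstant - V * saw U := by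
    rw [hEU, hx]; field_simp; ring
  have hHV : x * ∑ b ∈ Finset.Icc 1 ⌊V⌋₊, 1 / (b : ℝ) = x * EV + x * log V +
      x * Real.eulerMascheroniConstant - U * saw V := by
    rw [hEV, hx]; field_simp; ring
  have hlog : log x = log U + log V := Real.log_mul hU0.ne' hV0.ne'
  have key : Delta x + ∑ b ∈ Finset.Icc 1 ⌊U⌋₊, saw (x / b) +
      ∑ b ∈ Finset.Icc 1 ⌊V⌋₊, saw (x / b) = x * EU + x * EV - saw U * saw V + 1 / 4 := by
    rw [hHU, hHV, eU, eV] at hcount'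
    unfold Delta
    rw [hlog]
    have h2 : x = U * V := hx
    linear_combination hcount' - h2
  rw [key]
  have b1 : |x * EU| ≤ 40 := by
    rw [abs_mul, abs_of_pos hx0]
    calc _ ≤ x * (5 / U ^ 2) := by gcongr
      _ = 5 * (V / U) := by rw [hx]; field_simp
      _ ≤ 5 * 8 := by
          gcongr; rw [div_le_iff₀ hU0]; exact hVU
      _ = 40 := by norm_num
  have b2 : |x * EV| ≤ 40 := by
    rw [abs_mul, abs_of_pos hx0]
    calc _ ≤ x * (5 / V ^ 2) := by gcongr
      _ = 5 * (U / V) := by rw [hx]; field_simp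
      _ ≤ 5 * 8 := by
          gcongr; rw [div_le_iff₀ hV0]; exact hUV
      _ = 40 := by norm_num
  have b3 : |saw U * saw V| ≤ 1 / 4 := by
    rw [abs_mul]
    calc _ ≤ (1 / 2 : ℝ) * (1 / 2) :=
          mul_le_mul (abs_saw_le U) (abs_saw_le V) (abs_nonneg _) (by norm_num)
      _ = 1 / 4 := by norm_num
  rw [abs_le] at b1 b2 b3 ⊢
  constructor <;> linarith [b1.1, b1.2, b2.1, b2.2, b3.1, b3.2]

lemma intervalIntegrable_mul_of_bound {f g : ℝ → ℝ} (hf : Continuous f) (hg : Measurable g)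
    {C : ℝ} (hC : ∀ x, |g x| ≤ C) (a b : ℝ) :
    IntervalIntegrable (fun x => f x * g x) volume a b :=
  ⟨(hf.intervalIntegrable a b).1.mul_bdd hg.aestronglyMeasurable (ae_of_all _ hC),
    (hf.intervalIntegrable a b).2.mul_bdd hg.aestronglyMeasurable (ae_of_all _ hC)⟩

lemma integral_neg_deriv_cutoff (c : ℝ) :
    ∫ s in (-1 : ℝ)..1, -deriv cutoff s * (if c ≤ s then 1 else 0) = cutoff c := by
  have hd : ∀ s, HasDerivAt (fun s => -cutoff s) (-deriv cutoff s) s := fun s =>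
    ((contDiff_cutoff.differentiable (by norm_num)).differentiableAt.hasDerivAt).neg
  have hcont : Continuous fun s => -deriv cutoff s :=
    (contDiff_cutoff.continuous_deriv (by norm_num)).neg
  have hFTC : ∀ a b : ℝ, ∫ s in a..b, -deriv cutoff s = cutoff a - cutoff b := by
    intro a b
    rw [intervalIntegral.integral_eq_sub_of_hasDerivAt (fun s _ => hd s)
      (hcont.intervalIntegrable _ _)]
    ring
  have h1 : cutoff 1 = 0 := cutoff_of_ge le_rfl
  rcases le_or_gt c (-1) with hc | hc
  · rw [intervalIntegral.integral_congr (g := fun s => -deriv cutoff s), hFTC, h1,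
      cutoff_of_le le_rfl, cutoff_of_le hc, sub_zero]
    intro s hs
    rw [Set.uIcc_of_le (by norm_num)] at hs
    simp [hc.trans hs.1]
  rcases le_or_gt 1 c with hc' | hc'
  · rw [intervalIntegral.integral_congr_ae (g := fun _ => 0)]
    · simp [cutoff_of_ge hc']
    · have : ∀ᵐ s : ℝ, s ≠ 1 := by simp [ae_iff, measure_singleton]
      filter_upwards [this] with s hs1 hs
      rw [Set.uIoc_of_le (by norm_num)] at hs
      have : s < 1 := lt_of_le_of_ne hs.2 hs1
      rw [if_neg (by linarith)]; simp
  · have i1 : ∀ a b : ℝ, IntervalIntegrable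
        (fun s => -deriv cutoff s * (if c ≤ s then 1 else 0)) volume a b := by
      intro a b
      refine intervalIntegrable_mul_of_bound hcont (Measurable.ite measurableSet_Ici
        measurable_const measurable_const) (C := 1) (fun s => ?_) a b
      split_ifs <;> simp
    rw [← intervalIntegral.integral_add_adjacent_intervals (i1 (-1) c) (i1 c 1)]
    have e1 : ∫ s in (-1 : ℝ)..c, -deriv cutoff s * (if c ≤ s then 1 else 0) = 0 := by
      rw [intervalIntegral.integral_congr_ae (g := fun _ => 0)]
      · simp
      · have : ∀ᵐ s : ℝ, s ≠ c := by simp [ae_iff, measure_singleton]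
        filter_upwards [this] with s hs1 hs
        rw [Set.uIoc_of_le hc.le] at hs
        have : s < c := lt_of_le_of_ne hs.2 hs1
        rw [if_neg (by linarith)]; simp
    have e2 : ∫ s in c..1, -deriv cutoff s * (if c ≤ s then 1 else 0) =
        ∫ s in c..1, -deriv cutoff s := by
      refine intervalIntegral.integral_congr fun s hs => ?_
      rw [Set.uIcc_of_le hc'.le] at hs
      simp [hs.1]
    rw [e1, e2, hFTC, h1]; ring

/-- A smoothed form of Dirichlet's hyperbola method. -/
lemma abs_Delta_add_sum_cutoff_le {x : ℝ} (hx : 36 ≤ x) {B : ℕ} (hB : exp 1 * √x ≤ B) :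
    |Delta x + 2 * ∑ b ∈ Finset.Icc 1 B, cutoff (log (b / √x)) * saw (x / b)| ≤ 81 := by
  set X := √x with hX
  have hX6 : 6 ≤ X := by rw [hX]; exact Real.le_sqrt_of_sq_le (by linarith)
  have hX0 : 0 < X := by linarith
  have hXX : X * X = x := Real.mul_self_sqrt (by linarith)
  have he1 := Real.exp_one_lt_d9
  have hg0 : ∀ s, 0 ≤ -deriv cutoff s := fun s => neg_nonneg.2 (antitone_cutoff.deriv_nonpos)
  have hcont : Continuous fun s => -deriv cutoff s :=
    (contDiff_cutoff.continuous_deriv (by norm_num)).neg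
  have hd : ∀ s, HasDerivAt (fun s => -cutoff s) (-deriv cutoff s) s := fun s =>
    ((contDiff_cutoff.differentiable (by norm_num)).differentiableAt.hasDerivAt).neg
  have hone : ∫ s in (-1 : ℝ)..1, -deriv cutoff s = 1 := by
    rw [intervalIntegral.integral_eq_sub_of_hasDerivAt (fun s _ => hd s)
      (hcont.intervalIntegrable _ _), cutoff_of_ge le_rfl, cutoff_of_le le_rfl]
    ring
  have heven : ∀ s, deriv cutoff (-s) = deriv cutoff s := by
    intro s
    have h1 : cutoff = fun y => 1 - cutoff (-y) := by
      funext y; linarith [cutoff_add_cutoff_neg y]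
    have h2 : HasDerivAt (fun y => 1 - cutoff (-y)) (deriv cutoff (-s)) s := by
      have h3 : HasDerivAt cutoff (deriv cutoff (-s)) (-s) :=
        (contDiff_cutoff.differentiable (by norm_num)).differentiableAt.hasDerivAt
      have := (h3.scomp s (hasDerivAt_neg s)).const_sub 1
      simpa using this
    rw [← h1] at h2
    exact h2.deriv.symm
  have hsum : ∀ s ∈ Set.Icc (-1 : ℝ) 1, ∑ b ∈ Finset.Icc 1 ⌊X * exp s⌋₊, saw (x / b) =
      ∑ b ∈ Finset.Icc 1 B, (if log (b / X) ≤ s then 1 else 0) * saw (x / b) := by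
    intro s hs
    have : Finset.Icc 1 ⌊X * exp s⌋₊ =
        (Finset.Icc 1 B).filter fun b : ℕ => log (b / X) ≤ s := by
      ext b
      simp only [Finset.mem_Icc, Finset.mem_filter]
      have hiff : 1 ≤ b → (b ≤ ⌊X * exp s⌋₊ ↔ log (b / X) ≤ s) := by
        intro hb
        have hb0 : (0 : ℝ) < b := by exact_mod_cast hb
        rw [Nat.le_floor_iff (by positivity), Real.log_le_iff_le_exp (by positivity),
          div_le_iff₀ hX0, mul_comm]
      constructor
      · rintro ⟨h1, h2⟩
        refine ⟨⟨h1, ?_⟩, (hiff h1).1 h2⟩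
        have h3 : (b : ℝ) ≤ X * exp s := (Nat.le_floor_iff (by positivity)).1 h2
        have h4 : X * exp s ≤ X * exp 1 := by gcongr; exact hs.2
        have : (b : ℝ) ≤ B := by linarith [mul_comm X (exp 1)]
        exact_mod_cast this
      · rintro ⟨⟨h1, _⟩, h2⟩; exact ⟨h1, (hiff h1).2 h2⟩
    rw [this, Finset.sum_filter]
    refine Finset.sum_congr rfl fun b _ => ?_
    split_ifs <;> simp
  set A : ℝ → ℝ := fun s => ∑ b ∈ Finset.Icc 1 B,
    (if log (b / X) ≤ s then 1 else 0) * saw (x / b) with hA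
  have hbound : ∀ s ∈ Set.Icc (-1 : ℝ) 1, |Delta x + A s + A (-s)| ≤ 81 := by
    intro s hs
    have hs' : -s ∈ Set.Icc (-1 : ℝ) 1 := ⟨by linarith [hs.2], by linarith [hs.1]⟩
    have hxe : X * exp s * (X * exp (-s)) = x := by
      have : exp s * exp (-s) = 1 := by rw [← Real.exp_add]; simp
      calc _ = X * X * (exp s * exp (-s)) := by ring
        _ = x := by rw [this, mul_one, hXX]
    have hexp : ∀ s ∈ Set.Icc (-1 : ℝ) 1, 1 / 3 ≤ exp s := by
      intro s hs
      have h1 : exp (-1) ≤ exp s := Real.exp_le_exp.2 hs.1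
      have h2 : (1 : ℝ) / 3 ≤ exp (-1) := by
        rw [Real.exp_neg, ← one_div]
        exact one_div_le_one_div_of_le (Real.exp_pos 1) (by linarith)
      linarith
    have hexp2 : ∀ s ∈ Set.Icc (-1 : ℝ) 1, exp s ≤ 8 * exp (-s) := by
      intro s hs
      have h1 : exp s = exp (2 * s) * exp (-s) := by rw [← Real.exp_add]; ring_nf
      have h2 : exp (2 * s) ≤ exp 1 * exp 1 := by
        rw [← Real.exp_add]; exact Real.exp_le_exp.2 (by linarith [hs.2])
      have h3 : exp (2 * s) ≤ 8 := by nlinarith [Real.exp_pos 1]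
      rw [h1]; gcongr
    have := abs_Delta_add_le (U := X * exp s) (V := X * exp (-s))
      (by nlinarith [hexp s hs]) (by nlinarith [hexp _ hs'])
      (by nlinarith [hexp2 s hs]) (by have := hexp2 _ hs'; rw [neg_neg] at this; nlinarith)
    rw [hxe, hsum s hs, hsum _ hs'] at this
    exact this
  have hAm : Measurable A := by
    refine Finset.measurable_sum _ fun b _ => Measurable.mul_const ?_ _
    exact Measurable.ite measurableSet_Ici measurable_const measurable_const
  have hAi : IntervalIntegrable (fun s => -deriv cutoff s * A s) volume (-1) 1 := by
    refine intervalIntegrable_mul_of_bound hcont hAm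
      (C := ∑ b ∈ Finset.Icc 1 B, |saw (x / b)|) (fun s => ?_) _ _
    refine (Finset.abs_sum_le_sum_abs _ _).trans (Finset.sum_le_sum fun b _ => ?_)
    split_ifs <;> simp
  have hAint : ∫ s in (-1 : ℝ)..1, -deriv cutoff s * A s =
      ∑ b ∈ Finset.Icc 1 B, cutoff (log (b / X)) * saw (x / b) := by
    simp_rw [hA, Finset.mul_sum, ← mul_assoc]
    rw [intervalIntegral.integral_finsetSum]
    · refine Finset.sum_congr rfl fun b _ => ?_
      rw [intervalIntegral.integral_mul_const, integral_neg_deriv_cutoff]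
    · intro b _
      refine IntervalIntegrable.mul_const ?_ _
      refine intervalIntegrable_mul_of_bound hcont (Measurable.ite measurableSet_Ici
        measurable_const measurable_const) (C := 1) (fun s => ?_) _ _
      split_ifs <;> simp
  have hAneg : (fun s => -deriv cutoff s * A (-s)) = fun s => (fun t => -deriv cutoff t * A t) (-s) := by
    funext s; simp only [heven]
  have hAint' : ∫ s in (-1 : ℝ)..1, -deriv cutoff s * A (-s) =
      ∑ b ∈ Finset.Icc 1 B, cutoff (log (b / X)) * saw (x / b) := by
    rw [hAneg, intervalIntegral.integral_comp_neg (fun t => -deriv cutoff t * A t), neg_neg, hAint]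
  have hAi' : IntervalIntegrable (fun s => -deriv cutoff s * A (-s)) volume (-1) 1 := by
    rw [hAneg]
    have := hAi.comp_sub_left 0
    simp only [zero_sub, sub_neg_eq_add, zero_add] at this
    exact this.symm
  have htot : Delta x + 2 * ∑ b ∈ Finset.Icc 1 B, cutoff (log (b / X)) * saw (x / b) =
      ∫ s in (-1 : ℝ)..1, -deriv cutoff s * (Delta x + A s + A (-s)) := by
    have hci : IntervalIntegrable (fun s => -deriv cutoff s * Delta x) volume (-1) 1 :=
      (hcont.mul continuous_const).intervalIntegrable _ _
    simp_rw [mul_add]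
    rw [intervalIntegral.integral_add (hci.add hAi) hAi', intervalIntegral.integral_add hci hAi,
      hAint, hAint', intervalIntegral.integral_mul_const, hone]
    ring
  rw [htot]
  have h81 : ∫ s in (-1 : ℝ)..1, -deriv cutoff s * 81 = 81 := by
    rw [intervalIntegral.integral_mul_const, hone, one_mul]
  rw [← h81, ← Real.norm_eq_abs]
  refine intervalIntegral.norm_integral_le_of_norm_le (by norm_num) ?_
    ((hcont.mul continuous_const).intervalIntegrable _ _)
  refine ae_of_all _ fun s hs => ?_
  rw [norm_mul, Real.norm_of_nonneg (hg0 s)]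
  exact mul_le_mul_of_nonneg_left (hbound s (Set.Ioc_subset_Icc_self hs)) (hg0 s)

/-! ### A large sieve inequality -/

lemma summable_one_div_one_add_sq : Summable fun n : ℤ => 1 / (1 + (n : ℝ) ^ 2) := by
  have h : Summable fun n : ℕ => 1 / (1 + (n : ℝ) ^ 2) := by
    refine Summable.of_nonneg_of_le (fun n => by positivity) (fun n => ?_)
      ((Real.summable_one_div_nat_pow (p := 2)).2 (by norm_num) |>.add
        (summable_of_ne_finset_zero (s := {0}) (f := fun n : ℕ => if n = 0 then (1 : ℝ) else 0)
          (by intro b hb; simp at hb; simp [hb])))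
    rcases Nat.eq_zero_or_pos n with rfl | hn
    · simp
    · have hn0 : (0 : ℝ) < n := by exact_mod_cast hn
      rw [if_neg hn.ne', add_zero]
      apply one_div_le_one_div_of_le (by positivity); linarith
  refine Summable.of_nat_of_neg h ?_
  simpa using h

lemma exists_sum_gaussian_le : ∃ C : ℝ, 0 < C ∧ ∀ {ι : Type} (S : Finset ι) (β : ι → ℝ) (δ : ℝ),
    0 < δ → δ ≤ 1 → (∀ i ∈ S, ∀ j ∈ S, i ≠ j → δ ≤ |β i - β j|) → ∀ i ∈ S,
    ∑ j ∈ S, exp (-π * (β i - β j) ^ 2) ≤ C / δ ^ 2 := by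
  refine ⟨3 * ∑' n : ℤ, 1 / (1 + (n : ℝ) ^ 2), ?_, ?_⟩
  · have : (1 : ℝ) / (1 + ((0 : ℤ) : ℝ) ^ 2) ≤ ∑' n : ℤ, 1 / (1 + (n : ℝ) ^ 2) :=
      summable_one_div_one_add_sq.le_tsum 0 fun n _ => by positivity
    norm_num at this
    have h2 : (0 : ℝ) < ∑' n : ℤ, 1 / (1 + (n : ℝ) ^ 2) := by
      simp only [one_div]; linarith
    positivity
  intro ι S β δ hδ hδ1 hsep i hi
  classical
  set f : ι → ℤ := fun j => ⌊β i / δ⌋ - ⌊β j / δ⌋ with hf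
  have hinj : Set.InjOn f S := by
    intro j hj k hk hjk
    by_contra hne
    have h1 : ⌊β j / δ⌋ = ⌊β k / δ⌋ := by simp only [hf] at hjk; omega
    have h2 : |β j / δ - β k / δ| < 1 := Int.abs_sub_lt_one_of_floor_eq_floor h1
    rw [← sub_div, abs_div, abs_of_pos hδ, div_lt_one hδ] at h2
    exact absurd (hsep j hj k hk hne) (not_le.2 h2)
  have hterm : ∀ j ∈ S, exp (-π * (β i - β j) ^ 2) ≤
      3 / δ ^ 2 * (1 / (1 + (f j : ℝ) ^ 2)) := by
    intro j _
    set D := β i - β j with hD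
    have h1 : exp (-π * D ^ 2) ≤ 1 / (1 + D ^ 2) := by
      rw [neg_mul, Real.exp_neg, ← one_div]
      apply one_div_le_one_div_of_le (by positivity)
      have := Real.add_one_le_exp (π * D ^ 2)
      nlinarith [Real.pi_gt_three, sq_nonneg D]
    refine h1.trans ?_
    rw [div_mul_div_comm, div_le_div_iff₀ (by positivity) (by positivity)]
    have h3 : |(f j : ℝ) - D / δ| ≤ 1 := by
      have e : (f j : ℝ) - D / δ = Int.fract (β j / δ) - Int.fract (β i / δ) := by
        simp only [hf, Int.fract, hD]; push_cast; ring
      rw [e, abs_le]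
      constructor <;> linarith [Int.fract_nonneg (β j / δ), Int.fract_lt_one (β j / δ),
        Int.fract_nonneg (β i / δ), Int.fract_lt_one (β i / δ)]
    have h4 : (f j : ℝ) ^ 2 ≤ 2 * (D / δ) ^ 2 + 2 := by
      have : ((f j : ℝ) - D / δ) ^ 2 ≤ 1 := by rw [sq_le_one_iff_abs_le_one]; exact h3
      nlinarith [sq_nonneg ((f j : ℝ) - 2 * (D / δ))]
    have h5 : δ ^ 2 * (D / δ) ^ 2 = D ^ 2 := by field_simp
    have h6 : δ ^ 2 ≤ 1 := by nlinarith
    have h7 : δ ^ 2 * (f j : ℝ) ^ 2 ≤ 2 * D ^ 2 + 2 * δ ^ 2 := by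
      have := mul_le_mul_of_nonneg_left h4 (sq_nonneg δ)
      nlinarith
    nlinarith [sq_nonneg D]
  calc _ ≤ ∑ j ∈ S, 3 / δ ^ 2 * (1 / (1 + (f j : ℝ) ^ 2)) := Finset.sum_le_sum hterm
    _ = 3 / δ ^ 2 * ∑ n ∈ S.image f, 1 / (1 + (n : ℝ) ^ 2) := by
        rw [Finset.sum_image hinj, Finset.mul_sum]
    _ ≤ 3 / δ ^ 2 * ∑' n : ℤ, 1 / (1 + (n : ℝ) ^ 2) := by
        gcongr
        exact summable_one_div_one_add_sq.sum_le_tsum _ fun n _ => by positivity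
    _ = _ := by ring

lemma integral_gaussian_mul_ee (β : ℝ) :
    ∫ y : ℝ, (exp (-π * y ^ 2) : ℂ) * ee (β * y) = exp (-π * β ^ 2) := by
  have h := fourierIntegral_gaussian (b := (π : ℂ)) (by simpa using Real.pi_pos)
    (2 * π * β)
  have hpi : (π : ℂ) ≠ 0 := by exact_mod_cast Real.pi_ne_zero
  rw [div_self hpi, Complex.one_cpow, one_mul] at h
  calc _ = ∫ y : ℝ, Complex.exp (Complex.I * (2 * π * β) * y) *
        Complex.exp (-(π : ℂ) * y ^ 2) := by
        refine integral_congr_ae (ae_of_all _ fun y => ?_)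
        simp only [ee]
        rw [mul_comm]
        push_cast
        congr 2
        ring
    _ = _ := by
        rw [h]
        push_cast
        congr 1
        field_simp
        ring

lemma integrable_gaussian_mul_ee (β : ℝ) :
    Integrable fun y : ℝ => (exp (-π * y ^ 2) : ℂ) * ee (β * y) := by
  have h : Integrable fun y : ℝ => (exp (-π * y ^ 2) : ℂ) :=
    (integrable_exp_neg_mul_sq Real.pi_pos).ofReal
  refine h.mul_bdd (c := 1) ?_ (ae_of_all _ fun y => (norm_ee _).le)
  exact (continuous_ee.comp (by fun_prop)).aestronglyMeasurable

/-- The large sieve for frequencies separated by `δ`, over an interval of length one. -/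
lemma exists_large_sieve : ∃ C : ℝ, 0 < C ∧ ∀ {ι : Type} (S : Finset ι) (β : ι → ℝ) (δ : ℝ),
    0 < δ → δ ≤ 1 → (∀ i ∈ S, ∀ j ∈ S, i ≠ j → δ ≤ |β i - β j|) → ∀ c : ι → ℂ,
    ∫ y in (0 : ℝ)..1, ‖∑ i ∈ S, c i * ee (β i * y)‖ ^ 2 ≤ C / δ ^ 2 * ∑ i ∈ S, ‖c i‖ ^ 2 := by
  obtain ⟨C, hC, hC'⟩ := exists_sum_gaussian_le
  refine ⟨exp π * C, by positivity, ?_⟩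
  intro ι S β δ hδ hδ1 hsep c
  set G : ℝ → ℂ := fun y => ∑ i ∈ S, c i * ee (β i * y) with hG
  have hGc : Continuous G := by
    refine continuous_finsetSum _ fun i _ => continuous_const.mul (continuous_ee.comp (by fun_prop))
  have hexpand : ∀ y : ℝ, ((exp (-π * y ^ 2) * ‖G y‖ ^ 2 : ℝ) : ℂ) =
      ∑ i ∈ S, ∑ j ∈ S, c i * (starRingEnd ℂ) (c j) *
        ((exp (-π * y ^ 2) : ℂ) * ee ((β i - β j) * y)) := by
    intro y
    have hconj : ∀ x : ℝ, (starRingEnd ℂ) (ee x) = ee (-x) := by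
      intro x; unfold ee; rw [← Complex.exp_conj, map_mul, Complex.conj_ofReal, Complex.conj_I]
      congr 1; push_cast; ring
    rw [Complex.ofReal_mul, Complex.ofReal_pow, ← Complex.conj_mul', mul_comm _ (G y), hG]
    simp only [map_sum, map_mul, hconj]
    rw [Finset.sum_mul_sum, Finset.mul_sum]
    refine Finset.sum_congr rfl fun i _ => ?_
    rw [Finset.mul_sum]
    refine Finset.sum_congr rfl fun j _ => ?_
    rw [show (β i - β j) * y = β i * y + -(β j * y) by ring, ee_add]
    ring
  have hint : Integrable fun y : ℝ => ((exp (-π * y ^ 2) * ‖G y‖ ^ 2 : ℝ) : ℂ) := by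
    simp_rw [hexpand]
    exact integrable_finsetSum _ fun i _ => integrable_finsetSum _ fun j _ =>
      (integrable_gaussian_mul_ee _).const_mul _
  have hintR : Integrable fun y : ℝ => exp (-π * y ^ 2) * ‖G y‖ ^ 2 := by
    have := hint.re
    simp only [RCLike.re_to_complex, Complex.ofReal_re] at this
    exact this
  have hval : ((∫ y : ℝ, exp (-π * y ^ 2) * ‖G y‖ ^ 2 : ℝ) : ℂ) =
      ∑ i ∈ S, ∑ j ∈ S, c i * (starRingEnd ℂ) (c j) * exp (-π * (β i - β j) ^ 2) := by
    rw [← integral_complex_ofReal]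
    simp_rw [hexpand]
    rw [integral_finsetSum _ fun i _ => integrable_finsetSum _ fun j _ =>
      (integrable_gaussian_mul_ee _).const_mul _]
    refine Finset.sum_congr rfl fun i _ => ?_
    rw [integral_finsetSum _ fun j _ => (integrable_gaussian_mul_ee _).const_mul _]
    refine Finset.sum_congr rfl fun j _ => ?_
    rw [integral_const_mul, integral_gaussian_mul_ee]
  have hbound : ∫ y : ℝ, exp (-π * y ^ 2) * ‖G y‖ ^ 2 ≤ C / δ ^ 2 * ∑ i ∈ S, ‖c i‖ ^ 2 := by
    have h0 : 0 ≤ ∫ y : ℝ, exp (-π * y ^ 2) * ‖G y‖ ^ 2 :=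
      integral_nonneg fun y => by positivity
    have h1 : ∫ y : ℝ, exp (-π * y ^ 2) * ‖G y‖ ^ 2 =
        ‖((∫ y : ℝ, exp (-π * y ^ 2) * ‖G y‖ ^ 2 : ℝ) : ℂ)‖ := by
      rw [Complex.norm_real, Real.norm_of_nonneg h0]
    rw [h1, hval]
    set E : ι → ι → ℝ := fun i j => exp (-π * (β i - β j) ^ 2) with hE
    have hsym : ∀ i j, E i j = E j i := fun i j => by
      simp only [hE]; congr 1; ring
    have h2 : ‖∑ i ∈ S, ∑ j ∈ S, c i * (starRingEnd ℂ) (c j) * (E i j : ℂ)‖ ≤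
        ∑ i ∈ S, ∑ j ∈ S, (‖c i‖ ^ 2 / 2 * E i j + ‖c j‖ ^ 2 / 2 * E i j) := by
      refine (norm_sum_le _ _).trans (Finset.sum_le_sum fun i _ => (norm_sum_le _ _).trans
        (Finset.sum_le_sum fun j _ => ?_))
      have hEp : 0 ≤ E i j := (Real.exp_pos _).le
      rw [norm_mul, norm_mul, RCLike.norm_conj, Complex.norm_real, Real.norm_of_nonneg hEp, ← add_mul]
      gcongr
      nlinarith [sq_nonneg (‖c i‖ - ‖c j‖)]
    refine h2.trans ?_
    have h3 : ∑ i ∈ S, ∑ j ∈ S, ‖c i‖ ^ 2 / 2 * E i j ≤ ∑ i ∈ S, ‖c i‖ ^ 2 / 2 * (C / δ ^ 2) := by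
      refine Finset.sum_le_sum fun i hi => ?_
      rw [← Finset.mul_sum]
      gcongr
      exact hC' S β δ hδ hδ1 hsep i hi
    have h4 : ∑ i ∈ S, ∑ j ∈ S, ‖c j‖ ^ 2 / 2 * E i j = ∑ i ∈ S, ∑ j ∈ S, ‖c i‖ ^ 2 / 2 * E i j := by
      rw [Finset.sum_comm]
      exact Finset.sum_congr rfl fun i _ => Finset.sum_congr rfl fun j _ => by rw [hsym]
    simp_rw [Finset.sum_add_distrib]
    rw [h4, Finset.mul_sum]
    rw [← Finset.sum_mul, ← Finset.sum_div] at h3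
    rw [← Finset.mul_sum]
    linarith
  have hmono : ∫ y in (0 : ℝ)..1, ‖G y‖ ^ 2 ≤
      ∫ y in (0 : ℝ)..1, exp π * (exp (-π * y ^ 2) * ‖G y‖ ^ 2) := by
    refine intervalIntegral.integral_mono_on (by norm_num)
      ((hGc.norm.pow 2).intervalIntegrable _ _)
      ((hintR.const_mul _).intervalIntegrable) fun y hy => ?_
    rw [← mul_assoc, ← Real.exp_add]
    refine le_mul_of_one_le_left (by positivity) (Real.one_le_exp ?_)
    have : y ^ 2 ≤ 1 := by nlinarith [hy.1, hy.2]
    nlinarith [Real.pi_pos]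
  calc _ ≤ _ := hmono
    _ = exp π * ∫ y in Set.Ioc (0 : ℝ) 1, exp (-π * y ^ 2) * ‖G y‖ ^ 2 := by
        rw [intervalIntegral.integral_const_mul, intervalIntegral.integral_of_le (by norm_num)]
    _ ≤ exp π * ∫ y : ℝ, exp (-π * y ^ 2) * ‖G y‖ ^ 2 := by
        exact mul_le_mul_of_nonneg_left (setIntegral_le_integral hintR
          (ae_of_all _ fun y => mul_nonneg (Real.exp_pos _).le (sq_nonneg _))) (Real.exp_pos _).le
    _ ≤ _ := by
        rw [mul_div_assoc, mul_assoc]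
        gcongr

lemma sq_integral_le {g : ℝ → ℝ} (hg : Continuous g) (hg0 : ∀ s, 0 ≤ g s) {y : ℝ} (h0 : 0 ≤ y)
    (h1 : y ≤ 1) : (∫ s in (0 : ℝ)..y, g s) ^ 2 ≤ ∫ s in (0 : ℝ)..1, g s ^ 2 := by
  have hi : ∀ a b : ℝ, IntervalIntegrable g volume a b := fun a b => hg.intervalIntegrable a b
  have hi2 : ∀ a b : ℝ, IntervalIntegrable (fun s => g s ^ 2) volume a b :=
    fun a b => (hg.pow 2).intervalIntegrable a b
  have hle : ∫ s in (0 : ℝ)..y, g s ≤ ∫ s in (0 : ℝ)..1, g s :=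
    intervalIntegral.integral_mono_interval le_rfl h0 h1 (ae_of_all _ hg0) (hi _ _)
  have hnn : 0 ≤ ∫ s in (0 : ℝ)..y, g s := intervalIntegral.integral_nonneg h0 fun s _ => hg0 s
  refine (pow_le_pow_left₀ hnn hle 2).trans ?_
  set a := ∫ s in (0 : ℝ)..1, g s with ha
  have h2 : 0 ≤ ∫ s in (0 : ℝ)..1, (g s - a) ^ 2 :=
    intervalIntegral.integral_nonneg (by norm_num) fun s _ => sq_nonneg _
  have e : (fun s => (g s - a) ^ 2) = fun s => (g s ^ 2 - 2 * a * g s) + a ^ 2 := by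
    funext s; ring
  rw [e, intervalIntegral.integral_add ((hi2 _ _).sub ((hi _ _).const_mul _)) (by simp),
    intervalIntegral.integral_sub (hi2 _ _) ((hi _ _).const_mul _),
    intervalIntegral.integral_const_mul, ← ha] at h2
  simp only [intervalIntegral.integral_const, sub_zero, smul_eq_mul, one_mul] at h2
  nlinarith

/-- The large sieve with amplitudes that vary slowly. -/
lemma exists_large_sieve_amplitude : ∃ C : ℝ, 0 < C ∧ ∀ {ι : Type} (S : Finset ι) (β : ι → ℝ)
    (δ : ℝ), 0 < δ → δ ≤ 1 → (∀ i ∈ S, ∀ j ∈ S, i ≠ j → δ ≤ |β i - β j|) →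
    ∀ (θ : ι → ℂ) (c c' : ι → ℝ → ℝ) (A : ι → ℝ), (∀ i, ‖θ i‖ ≤ 1) →
    (∀ i ∈ S, ∀ y ∈ Set.Icc (0 : ℝ) 1, HasDerivAt (c i) (c' i y) y) →
    (∀ i ∈ S, Continuous (c' i)) → (∀ i ∈ S, |c i 0| ≤ A i) →
    (∀ i ∈ S, ∀ y ∈ Set.Icc (0 : ℝ) 1, |c' i y| ≤ A i) →
    ∫ y in (0 : ℝ)..1, ‖∑ i ∈ S, c i y * (θ i * ee (β i * y))‖ ^ 2 ≤
      C / δ ^ 2 * ∑ i ∈ S, A i ^ 2 := by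
  obtain ⟨C, hC, hC'⟩ := exists_large_sieve
  refine ⟨4 * C, by positivity, ?_⟩
  intro ι S β δ hδ hδ1 hsep θ c c' A hθ hc hcc hA hA'
  set G : ℝ → ℝ → ℂ := fun s y => ∑ i ∈ S, (c' i s * θ i) * ee (β i * y) with hG
  set G0 : ℝ → ℂ := fun y => ∑ i ∈ S, (c i 0 * θ i) * ee (β i * y) with hG0
  have hGc : Continuous (Function.uncurry G) := by
    refine continuous_finsetSum _ fun i hi => ?_
    have h1 : Continuous fun p : ℝ × ℝ => (c' i p.1 : ℂ) :=
      Complex.continuous_ofReal.comp ((hcc i hi).comp continuous_fst)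
    exact (h1.mul continuous_const).mul (continuous_ee.comp (by fun_prop))
  have hG0c : Continuous G0 := by
    refine continuous_finsetSum _ fun i _ => continuous_const.mul (continuous_ee.comp (by fun_prop))
  have hGs : ∀ y, Continuous fun s => G s y := fun y =>
    hGc.comp (continuous_id.prodMk continuous_const)
  have hGy : ∀ s, Continuous fun y => G s y := fun s =>
    hGc.comp (continuous_const.prodMk continuous_id)
  have hdecomp : ∀ y ∈ Set.Icc (0 : ℝ) 1, ∑ i ∈ S, (c i y : ℂ) * (θ i * ee (β i * y)) =
      G0 y + ∫ s in (0 : ℝ)..y, G s y := by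
    intro y hy
    simp only [hG, hG0]
    rw [intervalIntegral.integral_finsetSum]
    · rw [← Finset.sum_add_distrib]
      refine Finset.sum_congr rfl fun i hi => ?_
      have h1 : ∫ s in (0 : ℝ)..y, c' i s = c i y - c i 0 := by
        refine intervalIntegral.integral_eq_sub_of_hasDerivAt (fun s hs => hc i hi s ?_)
          ((hcc i hi).intervalIntegrable _ _)
        rw [Set.uIcc_of_le hy.1] at hs
        exact ⟨hs.1, hs.2.trans hy.2⟩
      simp_rw [mul_assoc]
      rw [intervalIntegral.integral_mul_const, intervalIntegral.integral_ofReal, h1]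
      push_cast
      ring
    · intro i hi
      have h1 : Continuous fun s : ℝ => (c' i s : ℂ) := Complex.continuous_ofReal.comp (hcc i hi)
      exact ((h1.mul continuous_const).mul continuous_const).intervalIntegrable _ _
  have hpt : ∀ y ∈ Set.Icc (0 : ℝ) 1, ‖∑ i ∈ S, (c i y : ℂ) * (θ i * ee (β i * y))‖ ^ 2 ≤
      2 * ‖G0 y‖ ^ 2 + 2 * ∫ s in (0 : ℝ)..1, ‖G s y‖ ^ 2 := by
    intro y hy
    rw [hdecomp y hy]
    have h1 : ‖∫ s in (0 : ℝ)..y, G s y‖ ≤ ∫ s in (0 : ℝ)..y, ‖G s y‖ :=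
      intervalIntegral.norm_integral_le_integral_norm hy.1
    have h2 := sq_integral_le (hGs y).norm (fun s => norm_nonneg _) hy.1 hy.2
    have h3 := norm_add_le (G0 y) (∫ s in (0 : ℝ)..y, G s y)
    have h4 : ‖∫ s in (0 : ℝ)..y, G s y‖ ^ 2 ≤ ∫ s in (0 : ℝ)..1, ‖G s y‖ ^ 2 :=
      (pow_le_pow_left₀ (norm_nonneg _) h1 2).trans h2
    have h5 := pow_le_pow_left₀ (norm_nonneg _) h3 2
    nlinarith [sq_nonneg (‖G0 y‖ - ‖∫ s in (0 : ℝ)..y, G s y‖)]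
  have hcoef : ∀ f : ι → ℝ, (∀ i ∈ S, |f i| ≤ A i) →
      ∫ y in (0 : ℝ)..1, ‖∑ i ∈ S, (f i * θ i) * ee (β i * y)‖ ^ 2 ≤
        C / δ ^ 2 * ∑ i ∈ S, A i ^ 2 := by
    intro f hf
    refine (hC' S β δ hδ hδ1 hsep _).trans ?_
    gcongr with i hi
    rw [norm_mul, Complex.norm_real, Real.norm_eq_abs]
    exact (mul_le_of_le_one_right (abs_nonneg _) (hθ i)).trans (hf i hi)
  have hcontI : Continuous fun y => ∫ s in (0 : ℝ)..1, ‖G s y‖ ^ 2 := by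
    refine intervalIntegral.continuous_parametric_intervalIntegral_of_continuous' ?_ 0 1
    have : Continuous fun p : ℝ × ℝ => G p.2 p.1 := hGc.comp continuous_swap
    exact this.norm.pow 2
  have hLHSc : IntervalIntegrable (fun y => ‖∑ i ∈ S, (c i y : ℂ) * (θ i * ee (β i * y))‖ ^ 2)
      volume 0 1 := by
    refine ContinuousOn.intervalIntegrable ?_
    refine ContinuousOn.pow (ContinuousOn.norm ?_) 2
    refine continuousOn_finsetSum _ fun i hi => ContinuousOn.mul ?_ ?_
    · intro y hy
      rw [Set.uIcc_of_le (by norm_num)] at hy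
      exact (Complex.continuous_ofReal.continuousAt.comp
        (hc i hi y hy).continuousAt).continuousWithinAt
    · exact (continuous_const.mul (continuous_ee.comp (by fun_prop))).continuousOn
  calc _ ≤ ∫ y in (0 : ℝ)..1, (2 * ‖G0 y‖ ^ 2 + 2 * ∫ s in (0 : ℝ)..1, ‖G s y‖ ^ 2) :=
        intervalIntegral.integral_mono_on (by norm_num) hLHSc
          ((((hG0c.norm.pow 2).const_mul 2).add (hcontI.const_mul 2)).intervalIntegrable _ _) hpt
    _ = 2 * (∫ y in (0 : ℝ)..1, ‖G0 y‖ ^ 2) +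
          2 * ∫ y in (0 : ℝ)..1, ∫ s in (0 : ℝ)..1, ‖G s y‖ ^ 2 := by
        have i1 : IntervalIntegrable (fun y => 2 * ‖G0 y‖ ^ 2) volume 0 1 :=
          ((hG0c.norm.pow 2).const_mul 2).intervalIntegrable _ _
        rw [intervalIntegral.integral_add i1 ((hcontI.const_mul 2).intervalIntegrable _ _),
          intervalIntegral.integral_const_mul, intervalIntegral.integral_const_mul]
    _ = 2 * (∫ y in (0 : ℝ)..1, ‖G0 y‖ ^ 2) +
          2 * ∫ s in (0 : ℝ)..1, ∫ y in (0 : ℝ)..1, ‖G s y‖ ^ 2 := by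
        rw [intervalIntegral_intervalIntegral_swap]
        have h1 : Continuous (Function.uncurry fun y s => ‖G s y‖ ^ 2) := by
          have : Continuous fun p : ℝ × ℝ => G p.2 p.1 := hGc.comp continuous_swap
          exact this.norm.pow 2
        rw [Set.uIoc_of_le (by norm_num)]
        refine (h1.continuousOn.integrableOn_compact
          (isCompact_Icc.prod isCompact_Icc (s := Set.Icc (0 : ℝ) 1) (t := Set.Icc (0 : ℝ) 1))).mono_set ?_
        exact Set.prod_mono Set.Ioc_subset_Icc_self Set.Ioc_subset_Icc_self
    _ ≤ 2 * (C / δ ^ 2 * ∑ i ∈ S, A i ^ 2) + 2 * ∫ _s in (0 : ℝ)..1, C / δ ^ 2 * ∑ i ∈ S, A i ^ 2 := by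
        have hcontJ : Continuous fun s => ∫ y in (0 : ℝ)..1, ‖G s y‖ ^ 2 :=
          intervalIntegral.continuous_parametric_intervalIntegral_of_continuous'
            (hGc.norm.pow 2) 0 1
        gcongr
        · exact hcoef _ hA
        · refine intervalIntegral.integral_mono_on (by norm_num) (hcontJ.intervalIntegrable _ _)
            (by simp) fun s hs => ?_
          exact hcoef _ fun i hi => hA' i hi s hs
    _ = _ := by
        rw [intervalIntegral.integral_const, sub_zero, one_smul]; ring

/-! ### The Fourier series of the sawtooth function -/

/-- The partial sums of the Fourier series of `-saw`. -/
def sawSum (M : ℕ) (u : ℝ) : ℝ :=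
  1 / π * ∑ m ∈ Finset.Icc 1 M, sin (2 * π * m * u) / m

lemma continuous_sawSum (M : ℕ) : Continuous (sawSum M) := by unfold sawSum; fun_prop

lemma measurable_saw : Measurable saw := measurable_fract.sub_const _

lemma integral_cos_int {k : ℤ} (hk : k ≠ 0) :
    ∫ u in (0 : ℝ)..1, cos (2 * π * k * u) = 0 := by
  have hk' : (2 * π * k : ℝ) ≠ 0 := by
    have : (k : ℝ) ≠ 0 := by exact_mod_cast hk
    have := Real.pi_ne_zero
    positivity
  rw [intervalIntegral.integral_comp_mul_left (fun x => cos x) hk']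
  simp only [mul_zero, mul_one, integral_cos, Real.sin_zero, sub_zero]
  have : sin (2 * π * k) = 0 := by
    have := Real.sin_int_mul_pi (2 * k)
    push_cast at this
    rw [← this]; congr 1; ring
  rw [this, smul_zero]

lemma integral_sin_mul_sin_int {m n : ℕ} (hm : 1 ≤ m) (hn : 1 ≤ n) :
    ∫ u in (0 : ℝ)..1, sin (2 * π * m * u) * sin (2 * π * n * u) =
      if m = n then 1 / 2 else 0 := by
  have e : (fun u : ℝ => sin (2 * π * m * u) * sin (2 * π * n * u)) =
      fun u => 1 / 2 * cos (2 * π * ((m : ℤ) - n : ℤ) * u) -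
        1 / 2 * cos (2 * π * ((m : ℤ) + n : ℤ) * u) := by
    funext u
    push_cast
    rw [show 2 * π * ((m : ℝ) - n) * u = 2 * π * m * u - 2 * π * n * u by ring,
      show 2 * π * ((m : ℝ) + n) * u = 2 * π * m * u + 2 * π * n * u by ring,
      Real.cos_sub, Real.cos_add]
    ring
  have hc : ∀ k : ℤ, IntervalIntegrable (fun u : ℝ => 1 / 2 * cos (2 * π * k * u))
      volume 0 1 := fun k => Continuous.intervalIntegrable (by fun_prop) _ _
  rw [e, intervalIntegral.integral_sub (hc _) (hc _), intervalIntegral.integral_const_mul,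
    intervalIntegral.integral_const_mul, integral_cos_int (by omega : (m : ℤ) + n ≠ 0)]
  split_ifs with h
  · subst h; simp
  · rw [integral_cos_int (by omega)]; simp

lemma integral_saw_mul_sin {m : ℕ} (hm : 1 ≤ m) :
    ∫ u in (0 : ℝ)..1, saw u * sin (2 * π * m * u) = -(1 / (2 * π * m)) := by
  have hm0 : (0 : ℝ) < m := by exact_mod_cast hm
  set a := 2 * π * (m : ℝ) with ha
  have ha0 : a ≠ 0 := by have := Real.pi_pos; positivity
  have h1 : ∫ u in (0 : ℝ)..1, saw u * sin (a * u) =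
      ∫ u in (0 : ℝ)..1, (u - 1 / 2) * sin (a * u) := by
    refine intervalIntegral.integral_congr_ae ?_
    have : ∀ᵐ s : ℝ, s ≠ 1 := by simp [ae_iff, measure_singleton]
    filter_upwards [this] with u hu1 hu
    rw [Set.uIoc_of_le (by norm_num)] at hu
    rw [saw, Int.fract_eq_self.2 ⟨hu.1.le, lt_of_le_of_ne hu.2 hu1⟩]
  have hd : ∀ u : ℝ, HasDerivAt (fun u => -((u - 1 / 2) * cos (a * u)) / a +
      sin (a * u) / a ^ 2) ((u - 1 / 2) * sin (a * u)) u := by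
    intro u
    have hau : HasDerivAt (fun u : ℝ => a * u) a u := by
      simpa using (hasDerivAt_id u).const_mul a
    have := (((((hasDerivAt_id u).sub_const (1 / 2)).mul hau.cos).neg).div_const a).add
      (hau.sin.div_const (a ^ 2))
    refine this.congr_deriv ?_
    simp only [id]
    field_simp
    ring
  rw [h1, intervalIntegral.integral_eq_sub_of_hasDerivAt (fun u _ => hd u)
    (Continuous.intervalIntegrable (by fun_prop) _ _)]
  have hs : sin a = 0 := by
    have := Real.sin_int_mul_pi (2 * m)
    push_cast at this
    rw [← this, ha]; congr 1; ring
  have hcs : cos a = 1 := by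
    rw [ha, mul_comm]; exact Real.cos_nat_mul_two_pi m
  simp only [mul_one, mul_zero, Real.sin_zero, Real.cos_zero, hs, hcs]
  field_simp
  ring

lemma intervalIntegrable_saw_mul {g : ℝ → ℝ} (hg : Continuous g) (a b : ℝ) :
    IntervalIntegrable (fun u => saw u * g u) volume a b := by
  have := intervalIntegrable_mul_of_bound hg measurable_saw abs_saw_le a b
  simpa only [mul_comm] using this

lemma integral_saw_sq : ∫ u in (0 : ℝ)..1, saw u ^ 2 = 1 / 12 := by
  have h1 : ∫ u in (0 : ℝ)..1, saw u ^ 2 = ∫ u in (0 : ℝ)..1, (u - 1 / 2) ^ 2 := by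
    refine intervalIntegral.integral_congr_ae ?_
    have : ∀ᵐ s : ℝ, s ≠ 1 := by simp [ae_iff, measure_singleton]
    filter_upwards [this] with u hu1 hu
    rw [Set.uIoc_of_le (by norm_num)] at hu
    rw [saw, Int.fract_eq_self.2 ⟨hu.1.le, lt_of_le_of_ne hu.2 hu1⟩]
  rw [h1, intervalIntegral.integral_comp_sub_right (fun x => x ^ 2), integral_pow]
  norm_num

lemma intervalIntegrable_saw_add_sq {g : ℝ → ℝ} (hg : Continuous g) (a b : ℝ) :
    IntervalIntegrable (fun u => (saw u + g u) ^ 2) volume a b := by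
  have e : (fun u => (saw u + g u) ^ 2) = fun u => 1 * saw u ^ 2 + 2 * (saw u * g u) + g u ^ 2 := by
    funext u; ring
  rw [e]
  refine ((intervalIntegrable_mul_of_bound continuous_const (measurable_saw.pow_const 2)
    (C := 1) (fun u => ?_) a b).add ((intervalIntegrable_saw_mul hg a b).const_mul 2)).add
    ((hg.pow 2).intervalIntegrable _ _)
  rw [abs_pow]
  have := abs_saw_le u
  nlinarith [abs_nonneg (saw u)]

lemma integral_saw_add_sawSum_sq (M : ℕ) :
    ∫ u in (0 : ℝ)..1, (saw u + sawSum M u) ^ 2 =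
      1 / 12 - 1 / (2 * π ^ 2) * ∑ m ∈ Finset.Icc 1 M, 1 / (m : ℝ) ^ 2 := by
  induction M with
  | zero => simp [sawSum, integral_saw_sq]
  | succ M ih =>
    set n : ℕ := M + 1 with hn
    have hn0 : (0 : ℝ) < n := by positivity
    have hpi := Real.pi_pos
    set s : ℝ → ℝ := fun u => sin (2 * π * n * u) with hs
    have hsc : Continuous s := by fun_prop
    have e : (fun u => (saw u + sawSum n u) ^ 2) = fun u => (saw u + sawSum M u) ^ 2 +
        2 / (π * n) * (saw u * s u) + 2 / (π * n) * (sawSum M u * s u) +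
          1 / (π * n) ^ 2 * (s u * s u) := by
      funext u
      have : sawSum n u = sawSum M u + 1 / (π * n) * s u := by
        simp only [sawSum, hn, hs]
        rw [Finset.sum_Icc_succ_top (by omega), mul_add]
        congr 1
        field_simp
      rw [this]
      field_simp
      ring
    have horth : ∫ u in (0 : ℝ)..1, sawSum M u * s u = 0 := by
      simp only [sawSum, hs]
      simp_rw [mul_assoc (1 / π), Finset.sum_mul]
      rw [intervalIntegral.integral_const_mul, intervalIntegral.integral_finsetSum]
      · rw [Finset.sum_eq_zero, mul_zero]
        intro m hm
        rw [Finset.mem_Icc] at hm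
        simp_rw [div_mul_eq_mul_div]
        rw [intervalIntegral.integral_div, integral_sin_mul_sin_int hm.1 (by omega),
          if_neg (by omega), zero_div]
      · intro m _
        exact Continuous.intervalIntegrable (by fun_prop) _ _
    have i1 := intervalIntegrable_saw_add_sq (continuous_sawSum M) 0 1
    have i2 := (intervalIntegrable_saw_mul hsc 0 1).const_mul (2 / (π * n))
    have i3 : IntervalIntegrable (fun u => 2 / (π * n) * (sawSum M u * s u)) volume 0 1 :=
      (((continuous_sawSum M).mul hsc).const_mul _).intervalIntegrable _ _
    have i4 : IntervalIntegrable (fun u => 1 / (π * n) ^ 2 * (s u * s u)) volume 0 1 :=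
      ((hsc.mul hsc).const_mul _).intervalIntegrable _ _
    rw [e, intervalIntegral.integral_add ((i1.add i2).add i3) i4,
      intervalIntegral.integral_add (i1.add i2) i3, intervalIntegral.integral_add i1 i2, ih,
      intervalIntegral.integral_const_mul, intervalIntegral.integral_const_mul,
      intervalIntegral.integral_const_mul, horth, integral_saw_mul_sin (by omega),
      integral_sin_mul_sin_int (by omega) (by omega), if_pos rfl,
      Finset.sum_Icc_succ_top (by omega)]
    rw [← hn]
    field_simp
    ring

lemma tendsto_integral_saw_add_sawSum_sq :
    Tendsto (fun M => ∫ u in (0 : ℝ)..1, (saw u + sawSum M u) ^ 2) atTop (𝓝 0) := by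
  simp_rw [integral_saw_add_sawSum_sq]
  have h := hasSum_zeta_two.tendsto_sum_nat
  have h2 : Tendsto (fun M : ℕ => ∑ m ∈ Finset.Icc 1 M, 1 / (m : ℝ) ^ 2) atTop
      (𝓝 (π ^ 2 / 6)) := by
    refine ((tendsto_add_atTop_iff_nat 1).2 h).congr fun M => ?_
    rw [Finset.sum_range_succ', Finset.range_eq_Ico,
      Finset.sum_Ico_add' (fun k : ℕ => 1 / (k : ℝ) ^ 2) 0 M 1]
    simp
    rfl
  have h3 := (h2.const_mul (1 / (2 * π ^ 2))).const_sub (1 / 12)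
  have hpi := Real.pi_ne_zero
  have e : (1 : ℝ) / 12 - 1 / (2 * π ^ 2) * (π ^ 2 / 6) = 0 := by
    field_simp; norm_num
  rwa [e] at h3

/-- The Fourier series of the sawtooth function converges to it in mean. -/
lemma tendsto_integral_abs_saw_add_sawSum {T : ℝ} (hT : 0 < T) {b : ℕ} (hb : 1 ≤ b) :
    Tendsto (fun M => ∫ x in T..2 * T, |saw (x / b) + sawSum M (x / b)|) atTop (𝓝 0) := by
  have hb0 : (0 : ℝ) < b := by exact_mod_cast hb
  set n : ℕ := ⌈2 * T / b⌉₊ with hn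
  set h : ℕ → ℝ → ℝ := fun M u => |saw u + sawSum M u| with hh
  have hmeas : ∀ M, Measurable (h M) := fun M =>
    (measurable_saw.add (continuous_sawSum M).measurable).abs
  have hint : ∀ M (a c : ℝ), IntervalIntegrable (h M) volume a c := by
    intro M a c
    have h1 : IntervalIntegrable (fun u => saw u * 1) volume a c :=
      intervalIntegrable_saw_mul continuous_const a c
    simp only [mul_one] at h1
    exact (h1.add ((continuous_sawSum M).intervalIntegrable _ _)).abs
  have hper : ∀ M, Function.Periodic (h M) 1 := by
    intro M u
    simp only [hh, saw, sawSum, Int.fract_add_one]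
    congr 3
    refine Finset.sum_congr rfl fun m _ => ?_
    congr 1
    rw [show 2 * π * m * (u + 1) = 2 * π * m * u + m * (2 * π) by ring,
      Real.sin_add_nat_mul_two_pi]
  have hle : ∀ M, ∫ x in T..2 * T, h M (x / b) ≤ b * n * ∫ u in (0 : ℝ)..1, h M u := by
    intro M
    rw [intervalIntegral.integral_comp_div _ hb0.ne', smul_eq_mul, mul_assoc]
    gcongr
    have h1 : ∫ u in (0 : ℝ)..(n : ℝ), h M u = n * ∫ u in (0 : ℝ)..1, h M u := by
      have := (hper M).intervalIntegral_add_zsmul_eq n 0 (hint M)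
      simpa using this
    rw [← h1]
    have h2 : (0 : ℝ) ≤ T / b := by positivity
    exact intervalIntegral.integral_mono_interval h2 (by gcongr; linarith) (Nat.le_ceil _)
      (ae_of_all _ fun u => abs_nonneg _) (hint M _ _)
  have hL : ∀ M, ∫ u in (0 : ℝ)..1, h M u ≤ √(∫ u in (0 : ℝ)..1, (saw u + sawSum M u) ^ 2) := by
    intro M
    have : IsProbabilityMeasure (volume.restrict (Set.Ioc (0 : ℝ) 1)) := ⟨by simp⟩
    rw [intervalIntegral.integral_of_le (by norm_num), intervalIntegral.integral_of_le (by norm_num)]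
    refine integral_abs_le_sqrt ?_ le_rfl
    have hm : AEStronglyMeasurable (fun u => saw u + sawSum M u)
      (volume.restrict (Set.Ioc (0 : ℝ) 1)) :=
      (measurable_saw.add (continuous_sawSum M).measurable).aestronglyMeasurable
    rw [memLp_two_iff_integrable_sq hm]
    exact (intervalIntegrable_saw_add_sq (continuous_sawSum M) 0 1).1
  have hlim : Tendsto (fun M => (b * n : ℝ) * √(∫ u in (0 : ℝ)..1, (saw u + sawSum M u) ^ 2))
      atTop (𝓝 0) := by
    have := (tendsto_integral_saw_add_sawSum_sq.sqrt).const_mul (b * n : ℝ)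
    simpa using this
  refine squeeze_zero (fun M => ?_) (fun M => ?_) hlim
  · exact intervalIntegral.integral_nonneg (by linarith) fun x _ => abs_nonneg _
  · exact (hle M).trans (by gcongr; exact hL M)

/-! ### The high frequencies -/

lemma sum_rpow_neg_three_fourths_le (B : ℕ) :
    ∑ q ∈ Finset.Icc 1 B, (q : ℝ) ^ (-(3 / 4) : ℝ) ≤ 4 * (B : ℝ) ^ (1 / 4 : ℝ) := by
  induction B with
  | zero => simp
  | succ B ih =>
    rw [Finset.sum_Icc_succ_top (by omega)]
    set u := (B : ℝ) ^ (1 / 4 : ℝ) with hu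
    set v := ((B + 1 : ℕ) : ℝ) ^ (1 / 4 : ℝ) with hv
    have hu0 : 0 ≤ u := by positivity
    have hv0 : 0 < v := by positivity
    have huv : u ≤ v := by
      rw [hu, hv]; gcongr; linarith
    have hu4 : u ^ 4 = B := by
      rw [hu, ← Real.rpow_natCast, ← Real.rpow_mul (by positivity)]; norm_num
    have hv4 : v ^ 4 = B + 1 := by
      rw [hv, ← Real.rpow_natCast, ← Real.rpow_mul (by positivity)]; norm_num
    have hv3 : ((B + 1 : ℕ) : ℝ) ^ (-(3 / 4) : ℝ) = 1 / v ^ 3 := by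
      rw [hv, ← Real.rpow_natCast, ← Real.rpow_mul (by positivity), one_div,
        ← Real.rpow_neg (by positivity)]
      norm_num
    rw [hv3]
    have h1 : 1 / v ^ 3 ≤ 4 * (v - u) := by
      rw [div_le_iff₀ (by positivity)]
      have h2 : 1 = (v - u) * (v ^ 3 + v ^ 2 * u + v * u ^ 2 + u ^ 3) := by
        linear_combination hu4 - hv4
      have h3 : v ^ 3 + v ^ 2 * u + v * u ^ 2 + u ^ 3 ≤ 4 * v ^ 3 := by
        have a1 : v ^ 2 * u ≤ v ^ 2 * v := by gcongr
        have a2 : v * u ^ 2 ≤ v * v ^ 2 := by gcongr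
        have a3 : u ^ 3 ≤ v ^ 3 := by gcongr
        nlinarith
      nlinarith [mul_le_mul_of_nonneg_left h3 (sub_nonneg.2 huv)]
    linarith

/-- A pair of positive integers divided by its greatest common divisor. -/
def reduceFrac (p : ℕ × ℕ) : ℕ × ℕ := (p.1 / p.1.gcd p.2, p.2 / p.1.gcd p.2)

lemma gcd_mul_reduceFrac (p : ℕ × ℕ) :
    p.1 = p.1.gcd p.2 * (reduceFrac p).1 ∧ p.2 = p.1.gcd p.2 * (reduceFrac p).2 :=
  ⟨(Nat.mul_div_cancel' (Nat.gcd_dvd_left _ _)).symm,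
    (Nat.mul_div_cancel' (Nat.gcd_dvd_right _ _)).symm⟩

lemma reduceFrac_pos {p : ℕ × ℕ} (h1 : 1 ≤ p.1) (h2 : 1 ≤ p.2) :
    1 ≤ (reduceFrac p).1 ∧ 1 ≤ (reduceFrac p).2 := by
  obtain ⟨e1, e2⟩ := gcd_mul_reduceFrac p
  constructor
  · by_contra h
    rw [Nat.lt_one_iff.1 (not_le.1 h), mul_zero] at e1; omega
  · by_contra h
    rw [Nat.lt_one_iff.1 (not_le.1 h), mul_zero] at e2; omega

lemma reduceFrac_div {p : ℕ × ℕ} (h1 : 1 ≤ p.1) :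
    ((reduceFrac p).2 : ℝ) / (reduceFrac p).1 = (p.2 : ℝ) / p.1 := by
  obtain ⟨e1, e2⟩ := gcd_mul_reduceFrac p
  have hg : ((p.1.gcd p.2 : ℕ) : ℝ) ≠ 0 := by
    have := Nat.gcd_pos_of_pos_left p.2 h1
    positivity
  have e1' : (p.1 : ℝ) = (p.1.gcd p.2 : ℕ) * ((reduceFrac p).1 : ℝ) := by exact_mod_cast e1
  have e2' : (p.2 : ℝ) = (p.1.gcd p.2 : ℕ) * ((reduceFrac p).2 : ℝ) := by exact_mod_cast e2
  rw [e1', e2', mul_div_mul_left _ _ hg]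

lemma coprime_reduceFrac {p : ℕ × ℕ} (h1 : 1 ≤ p.1) : Nat.Coprime (reduceFrac p).1 (reduceFrac p).2 :=
  Nat.coprime_div_gcd_div_gcd (Nat.gcd_pos_of_pos_left p.2 h1)

lemma eq_of_coprime_of_mul_eq {q a q' a' : ℕ} (h : q.Coprime a) (h' : q'.Coprime a')
    (hq : 1 ≤ q) (e : a * q' = a' * q) : q = q' ∧ a = a' := by
  have d1 : q ∣ q' := h.dvd_of_dvd_mul_left (Dvd.intro_left a' e.symm)
  have d2 : q' ∣ q := h'.dvd_of_dvd_mul_left (Dvd.intro_left a e)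
  have e1 := Nat.dvd_antisymm d1 d2
  subst e1
  exact ⟨rfl, Nat.eq_of_mul_eq_mul_right hq e⟩

lemma one_div_le_abs_div_sub_div {q a q' a' : ℕ} (hq : 1 ≤ q) (hq' : 1 ≤ q')
    (e : a * q' ≠ a' * q) : 1 / ((q : ℝ) * q') ≤ |(a : ℝ) / q - a' / q'| := by
  have hq0 : (0 : ℝ) < q := by exact_mod_cast hq
  have hq0' : (0 : ℝ) < q' := by exact_mod_cast hq'
  rw [div_sub_div _ _ hq0.ne' hq0'.ne', abs_div, abs_of_pos (mul_pos hq0 hq0')]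
  gcongr
  have h1 : ((a : ℤ) * q' - q * a') ≠ 0 := by
    intro h
    apply e
    have : (a : ℤ) * q' = a' * q := by linarith
    exact_mod_cast this
  have h2 : 1 ≤ |(a : ℤ) * q' - q * a'| := Int.one_le_abs h1
  exact_mod_cast h2

lemma one_add_log_le_rpow {t : ℝ} (ht : 1 ≤ t) : 1 + log t ≤ 8 * t ^ (1 / 8 : ℝ) := by
  have h1 : log (t ^ (1 / 8 : ℝ)) = 1 / 8 * log t := Real.log_rpow (by linarith) _
  have h2 := Real.log_le_sub_one_of_pos (x := t ^ (1 / 8 : ℝ)) (by positivity)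
  linarith

lemma sum_fiber_reduceFrac_le {D : Finset (ℕ × ℕ)} {B : ℕ}
    (hD : ∀ p ∈ D, 1 ≤ p.1 ∧ 1 ≤ p.2 ∧ p.1 ≤ B) {k : ℕ × ℕ} (hk : k ∈ D.image reduceFrac) :
    ∑ p ∈ D with reduceFrac p = k, 1 / (p.2 : ℝ) ≤
      8 / k.2 * ((B : ℝ) / k.1) ^ (1 / 8 : ℝ) := by
  obtain ⟨p₀, hp₀, rfl⟩ := Finset.mem_image.1 hk
  set k := reduceFrac p₀ with hkdef
  obtain ⟨hk1, hk2⟩ := reduceFrac_pos (hD p₀ hp₀).1 (hD p₀ hp₀).2.1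
  rw [← hkdef] at hk1 hk2
  have hk1' : (0 : ℝ) < k.1 := by exact_mod_cast hk1
  have hk2' : (0 : ℝ) < k.2 := by exact_mod_cast hk2
  set n := B / k.1 with hn
  have hkB : k.1 ≤ B := by
    have h1 := (gcd_mul_reduceFrac p₀).1
    have h2 := (hD p₀ hp₀)
    have h3 := Nat.gcd_pos_of_pos_left p₀.2 h2.1
    calc k.1 ≤ p₀.1.gcd p₀.2 * k.1 := Nat.le_mul_of_pos_left _ h3
      _ = p₀.1 := h1.symm
      _ ≤ B := h2.2.2
  set s := D.filter fun p => reduceFrac p = k with hs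
  have hmem : ∀ p ∈ s, p.1 = p.1.gcd p.2 * k.1 ∧ p.2 = p.1.gcd p.2 * k.2 := by
    intro p hp
    have := gcd_mul_reduceFrac p
    rwa [(Finset.mem_filter.1 hp).2] at this
  have hinj : Set.InjOn (fun p : ℕ × ℕ => p.1.gcd p.2) s := by
    intro p hp q hq h
    simp only at h
    have h1 := hmem p hp
    have h2 := hmem q hq
    rw [← h] at h2
    exact Prod.ext (h1.1.trans h2.1.symm) (h1.2.trans h2.2.symm)
  have himg : s.image (fun p : ℕ × ℕ => p.1.gcd p.2) ⊆ Finset.Icc 1 n := by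
    intro g hg
    obtain ⟨p, hp, rfl⟩ := Finset.mem_image.1 hg
    have h2 := hD p (Finset.mem_filter.1 hp).1
    rw [Finset.mem_Icc, hn, Nat.le_div_iff_mul_le hk1]
    refine ⟨Nat.gcd_pos_of_pos_left p.2 h2.1, ?_⟩
    rw [← (hmem p hp).1]; exact h2.2.2
  have hBk : (1 : ℝ) ≤ (B : ℝ) / k.1 := by
    rw [le_div_iff₀ hk1', one_mul]; exact_mod_cast hkB
  calc ∑ p ∈ s, 1 / (p.2 : ℝ) = ∑ p ∈ s, 1 / k.2 * (1 / ((p.1.gcd p.2 : ℕ) : ℝ)) := by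
        refine Finset.sum_congr rfl fun p hp => ?_
        have : (p.2 : ℝ) = (p.1.gcd p.2 : ℕ) * (k.2 : ℝ) := by exact_mod_cast (hmem p hp).2
        rw [this, one_div_mul_one_div, mul_comm]
    _ = 1 / k.2 * ∑ g ∈ s.image (fun p : ℕ × ℕ => p.1.gcd p.2), 1 / (g : ℝ) := by
        rw [Finset.sum_image hinj, Finset.mul_sum]
    _ ≤ 1 / k.2 * ∑ g ∈ Finset.Icc 1 n, 1 / (g : ℝ) := by
        gcongr
    _ ≤ 1 / k.2 * (1 + log n) := by
        gcongr
        have := harmonic_le_one_add_log n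
        rw [harmonic_eq_sum_Icc] at this
        push_cast at this
        simpa only [one_div] using this
    _ ≤ 1 / k.2 * (8 * ((B : ℝ) / k.1) ^ (1 / 8 : ℝ)) := by
        gcongr
        refine le_trans ?_ (one_add_log_le_rpow hBk)
        have hn1 : 1 ≤ n := by
          rw [hn]; exact Nat.div_pos hkB hk1
        have : (n : ℝ) ≤ B / k.1 := Nat.cast_div_le
        have hn0 : (0 : ℝ) < n := by exact_mod_cast hn1
        gcongr
    _ = _ := by ring

/-- The amplitude of the frequency `m / b` in the high part, as a function of `t = log x / 2`. -/
def highWeight (N : ℝ) (b m : ℕ) (t : ℝ) : ℝ :=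
  cutoff (log b - t) * (1 - taper (log m - log b + t - log N / 2))

/-- The amplitude of the frequency `m / b` in the low part, as a function of `t = log x / 2`. -/
def lowWeight (N : ℝ) (b m : ℕ) (t : ℝ) : ℝ :=
  cutoff (log b - t) * taper (log m - log b + t - log N / 2)

/-- The derivative of `highWeight`. -/
def highWeight' (N : ℝ) (b m : ℕ) (t : ℝ) : ℝ :=
  -deriv cutoff (log b - t) * (1 - taper (log m - log b + t - log N / 2)) -
    cutoff (log b - t) * deriv taper (log m - log b + t - log N / 2)

lemma hasDerivAt_highWeight (N : ℝ) (b m : ℕ) (t : ℝ) :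
    HasDerivAt (highWeight N b m) (highWeight' N b m t) t := by
  have h1 : HasDerivAt (fun t => cutoff (log b - t)) (-deriv cutoff (log b - t)) t := by
    have h3 : HasDerivAt cutoff (deriv cutoff (log b - t)) (log b - t) :=
      (contDiff_cutoff.differentiable (by norm_num)).differentiableAt.hasDerivAt
    have := h3.comp t ((hasDerivAt_id t).const_sub (log b))
    simpa [Function.comp_def] using this
  have h2 : HasDerivAt (fun t => 1 - taper (log m - log b + t - log N / 2))
      (-deriv taper (log m - log b + t - log N / 2)) t := by
    have h3 : HasDerivAt taper (deriv taper (log m - log b + t - log N / 2))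
        (log m - log b + t - log N / 2) :=
      (contDiff_taper.differentiable (by norm_num)).differentiableAt.hasDerivAt
    have := (h3.comp t (((hasDerivAt_id t).const_add (log m - log b)).sub_const
      (log N / 2))).const_sub 1
    simpa [Function.comp_def] using this
  exact (h1.mul h2).congr_deriv (by unfold highWeight'; ring)

lemma continuous_highWeight' (N : ℝ) (b m : ℕ) : Continuous (highWeight' N b m) := by
  have h1 := contDiff_cutoff.continuous
  have h2 := contDiff_taper.continuous
  have h3 := contDiff_cutoff.continuous_deriv (by norm_num)
  have h4 := contDiff_taper.continuous_deriv (by norm_num)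
  unfold highWeight'
  fun_prop

lemma abs_highWeight_le (N : ℝ) (b m : ℕ) (t : ℝ) : |highWeight N b m t| ≤ 1 := by
  unfold highWeight
  have h1 := cutoff_nonneg (log b - t)
  have h2 := cutoff_le_one (log b - t)
  have h3 := taper_nonneg (log m - log b + t - log N / 2)
  have h4 := taper_le_one (log m - log b + t - log N / 2)
  rw [abs_of_nonneg (mul_nonneg h1 (by linarith))]
  exact mul_le_one₀ h2 (by linarith) (by linarith)

lemma exists_abs_highWeight'_le : ∃ M : ℝ, 1 ≤ M ∧ ∀ N b m t, |highWeight' N b m t| ≤ M := by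
  obtain ⟨M₁, hM₁, hM₁', _⟩ := exists_deriv_bound contDiff_cutoff
    (fun x hx => cutoff_of_le hx) (fun x hx => cutoff_of_ge hx)
  obtain ⟨M₂, hM₂, hM₂', _⟩ := exists_deriv_bound contDiff_taper
    (fun x hx => taper_of_le hx) (fun x hx => taper_of_ge hx)
  refine ⟨M₁ + M₂, by linarith, fun N b m t => ?_⟩
  unfold highWeight'
  have h1 := cutoff_nonneg (log b - t)
  have h2 := cutoff_le_one (log b - t)
  have h3 := taper_nonneg (log m - log b + t - log N / 2)
  have h4 := taper_le_one (log m - log b + t - log N / 2)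
  refine (abs_sub _ _).trans (add_le_add ?_ ?_)
  · rw [abs_mul, abs_neg, abs_of_nonneg (show 0 ≤ 1 - taper _ by linarith)]
    exact (mul_le_of_le_one_right (abs_nonneg _) (by linarith)).trans (hM₁' _)
  · rw [abs_mul, abs_of_nonneg h1]
    exact (mul_le_of_le_one_left (abs_nonneg _) h2).trans (hM₂' _)

/-- The trigonometric polynomial with the frequencies in `D` and amplitudes `highWeight`. -/
def highSum (N : ℝ) (D : Finset (ℕ × ℕ)) (x : ℝ) : ℝ :=
  ∑ p ∈ D, 1 / (p.2 : ℝ) * highWeight N p.1 p.2 (log x / 2) *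
    sin (2 * π * (p.2 / p.1 * x))

lemma exists_integral_highSum_sq_le : ∃ C : ℝ, 0 < C ∧ ∀ (T N : ℝ) (B : ℕ) (D : Finset (ℕ × ℕ)),
    1 ≤ T → 1 ≤ N → (B : ℝ) ≤ 5 * √T →
    (∀ p ∈ D, 1 ≤ p.1 ∧ 1 ≤ p.2 ∧ p.1 ≤ B ∧ (p.1 : ℝ) * √N ≤ p.2 * √(2 * T)) →
    ∫ x in T..2 * T, highSum N D x ^ 2 ≤ C * (T * √T * N ^ (-(1 / 4) : ℝ)) := by
  obtain ⟨C, hC, hC'⟩ := exists_large_sieve_amplitude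
  obtain ⟨M, hM1, hM⟩ := exists_abs_highWeight'_le
  refine ⟨C * 25 ^ 2 * (M ^ 2 * 64 * 12 * 3), by positivity, ?_⟩
  intro T N B D hT hN hB hD
  classical
  have hT0 : 0 < T := by linarith
  have hN0 : 0 < N := by linarith
  set S := D.image reduceFrac with hS
  set F : ℕ × ℕ → Finset (ℕ × ℕ) := fun k => D.filter fun p => reduceFrac p = k with hF
  set t : ℝ → ℝ := fun y => log (T + T * y) / 2 with ht
  set c : ℕ × ℕ → ℝ → ℝ := fun k y =>
    ∑ p ∈ F k, 1 / (p.2 : ℝ) * highWeight N p.1 p.2 (t y) with hc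
  set c' : ℕ × ℕ → ℝ → ℝ := fun k y => ∑ p ∈ F k, 1 / (p.2 : ℝ) *
    (highWeight' N p.1 p.2 (t (max y 0)) * (1 / (2 * (1 + max y 0)))) with hc'
  set A : ℕ × ℕ → ℝ := fun k => M * ∑ p ∈ F k, 1 / (p.2 : ℝ) with hA
  set α : ℕ × ℕ → ℝ := fun k => (k.2 : ℝ) / k.1 with hα
  have hSpos : ∀ k ∈ S, 1 ≤ k.1 ∧ 1 ≤ k.2 ∧ k.1 ≤ B ∧ k.1.Coprime k.2 ∧
      (k.1 : ℝ) * √N ≤ k.2 * √(2 * T) := by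
    intro k hk
    obtain ⟨p, hp, rfl⟩ := Finset.mem_image.1 hk
    obtain ⟨h1, h2, h3, h4⟩ := hD p hp
    obtain ⟨h5, h6⟩ := reduceFrac_pos h1 h2
    refine ⟨h5, h6, (Nat.div_le_self _ _).trans h3, coprime_reduceFrac h1, ?_⟩
    have h7 := reduceFrac_div h1
    have hp1 : (0 : ℝ) < p.1 := by exact_mod_cast h1
    have hk1 : (0 : ℝ) < (reduceFrac p).1 := by exact_mod_cast h5
    rw [← le_div_iff₀' hp1] at h4
    rw [← le_div_iff₀' hk1, mul_div_right_comm, h7, ← mul_div_right_comm]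
    exact h4
  have hlogder : ∀ y ∈ Set.Icc (0 : ℝ) 1, HasDerivAt t (1 / (2 * (1 + max y 0))) y := by
    intro y hy
    have h1 : HasDerivAt (fun y : ℝ => T + T * y) T y := by
      simpa using ((hasDerivAt_id y).const_mul T).const_add T
    have hpos : 0 < T + T * y := by nlinarith [hy.1]
    refine ((h1.log hpos.ne').div_const 2).congr_deriv ?_
    rw [max_eq_left hy.1]
    have : (1 : ℝ) + y ≠ 0 := by linarith [hy.1]
    have e : T + T * y = T * (1 + y) := by ring
    rw [e]; field_simp
  have hsieve := hC' S (fun k => α k * T) (1 / 25) (by norm_num) (by norm_num) ?_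
    (fun k => ee (α k * T)) c c' A (fun k => (norm_ee _).le) ?_ ?_ ?_ ?_
  rotate_left
  · intro k hk l hl hkl
    obtain ⟨k1, k2, k3, k4, _⟩ := hSpos k hk
    obtain ⟨l1, l2, l3, l4, _⟩ := hSpos l hl
    have hne : k.2 * l.1 ≠ l.2 * k.1 := fun e => hkl (by
      obtain ⟨e1, e2⟩ := eq_of_coprime_of_mul_eq k4 l4 k1 e
      exact Prod.ext e1 e2)
    have h1 := one_div_le_abs_div_sub_div k1 l1 hne
    rw [← sub_mul, abs_mul, abs_of_pos hT0]
    have hk1' : (0 : ℝ) < k.1 := by exact_mod_cast k1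
    have hl1' : (0 : ℝ) < l.1 := by exact_mod_cast l1
    have hBB : (k.1 : ℝ) * l.1 ≤ 25 * T := by
      have hkB : (k.1 : ℝ) ≤ 5 * √T := le_trans (by exact_mod_cast k3) hB
      have hlB : (l.1 : ℝ) ≤ 5 * √T := le_trans (by exact_mod_cast l3) hB
      calc (k.1 : ℝ) * l.1 ≤ 5 * √T * (5 * √T) := by gcongr
        _ = 25 * (√T * √T) := by ring
        _ = 25 * T := by rw [Real.mul_self_sqrt hT0.le]
    calc (1 : ℝ) / 25 = 1 / (25 * T) * T := by field_simp
      _ ≤ 1 / ((k.1 : ℝ) * l.1) * T := by gcongr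
      _ ≤ _ := by gcongr
  · intro k _ y hy
    have hs : HasDerivAt (fun y => ∑ p ∈ F k, 1 / (p.2 : ℝ) * highWeight N p.1 p.2 (t y))
        (∑ p ∈ F k, 1 / (p.2 : ℝ) *
          (highWeight' N p.1 p.2 (t y) * (1 / (2 * (1 + max y 0))))) y := by
      refine HasDerivAt.fun_sum fun p _ => ?_
      exact ((hasDerivAt_highWeight N p.1 p.2 (t y)).comp y (hlogder y hy)).const_mul _
    refine hs.congr_deriv ?_
    simp only [hc']
    rw [max_eq_left hy.1]
  · intro k _
    have htc : Continuous fun y : ℝ => t (max y 0) := by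
      simp only [ht]
      refine Continuous.div_const (Continuous.log (by fun_prop) fun y => ?_) 2
      have : 0 ≤ max y 0 := le_max_right _ _
      positivity
    refine continuous_finsetSum _ fun p _ => continuous_const.mul (Continuous.mul ?_ ?_)
    · exact (continuous_highWeight' N p.1 p.2).comp htc
    · refine continuous_const.div (by fun_prop) fun y => ?_
      have : 0 ≤ max y 0 := le_max_right _ _
      positivity
  · intro k _
    simp only [hc, hA]
    rw [Finset.mul_sum]
    refine (Finset.abs_sum_le_sum_abs _ _).trans (Finset.sum_le_sum fun p _ => ?_)
    rw [abs_mul, abs_of_nonneg (by positivity : (0 : ℝ) ≤ 1 / (p.2 : ℝ)), mul_comm]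
    gcongr
    exact (abs_highWeight_le _ _ _ _).trans hM1
  · intro k _ y hy
    simp only [hc', hA]
    rw [Finset.mul_sum]
    refine (Finset.abs_sum_le_sum_abs _ _).trans (Finset.sum_le_sum fun p _ => ?_)
    rw [abs_mul, abs_of_nonneg (by positivity : (0 : ℝ) ≤ 1 / (p.2 : ℝ)), mul_comm, abs_mul]
    gcongr
    have h0 : 0 ≤ max y 0 := le_max_right _ _
    have h1 : |1 / (2 * (1 + max y 0))| ≤ 1 := by
      rw [abs_of_nonneg (by positivity), div_le_one (by positivity)]; linarith
    calc _ ≤ M * 1 := by gcongr; exact hM _ _ _ _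
      _ = M := mul_one M
  -- the square sum of the amplitudes
  set z := √(2 * T) / √N with hz
  have hz0 : 0 < z := by positivity
  have hSsum : ∑ k ∈ S, A k ^ 2 ≤ M ^ 2 * 64 * 12 * (z * B) ^ (1 / 2 : ℝ) := by
    have hterm : ∀ k ∈ S, A k ^ 2 ≤ M ^ 2 * 64 * (z ^ (1 / 2 : ℝ) * (B : ℝ) ^ (1 / 4 : ℝ)) *
        ((k.1 : ℝ) ^ (-(3 / 4) : ℝ) * (k.2 : ℝ) ^ (-(3 / 2) : ℝ)) := by
      intro k hk
      obtain ⟨k1, k2, k3, _, k5⟩ := hSpos k hk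
      have hk1 : (0 : ℝ) < k.1 := by exact_mod_cast k1
      have hk2 : (0 : ℝ) < k.2 := by exact_mod_cast k2
      have hB0 : (0 : ℝ) < B := by exact_mod_cast k1.trans k3
      have h1 := sum_fiber_reduceFrac_le (D := D) (B := B)
        (fun p hp => ⟨(hD p hp).1, (hD p hp).2.1, (hD p hp).2.2.1⟩) hk
      have h2 : A k ≤ M * (8 / k.2 * ((B : ℝ) / k.1) ^ (1 / 8 : ℝ)) := by
        simp only [hA]; gcongr
      have hA0 : 0 ≤ A k := by
        simp only [hA]
        exact mul_nonneg (by linarith) (Finset.sum_nonneg fun p _ => by positivity)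
      have h3 : 1 ≤ ((k.2 : ℝ) * z / k.1) ^ (1 / 2 : ℝ) := by
        refine Real.one_le_rpow ?_ (by norm_num)
        rw [le_div_iff₀ hk1, one_mul, hz, mul_div_assoc', le_div_iff₀ (by positivity)]
        exact k5
      calc A k ^ 2 ≤ (M * (8 / k.2 * ((B : ℝ) / k.1) ^ (1 / 8 : ℝ))) ^ 2 := by gcongr
        _ = M ^ 2 * 64 * (((B : ℝ) / k.1) ^ (1 / 8 : ℝ)) ^ 2 * (1 / (k.2 : ℝ) ^ 2) * 1 := by
            field_simp; norm_num
        _ ≤ M ^ 2 * 64 * (((B : ℝ) / k.1) ^ (1 / 8 : ℝ)) ^ 2 * (1 / (k.2 : ℝ) ^ 2) *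
            ((k.2 : ℝ) * z / k.1) ^ (1 / 2 : ℝ) := by gcongr
        _ = _ := by
            have e1 : (((B : ℝ) / k.1) ^ (1 / 8 : ℝ)) ^ 2 =
                (B : ℝ) ^ (1 / 4 : ℝ) * (k.1 : ℝ) ^ (-(1 / 4) : ℝ) := by
              rw [← Real.rpow_natCast, ← Real.rpow_mul (by positivity),
                Real.div_rpow hB0.le hk1.le, Real.rpow_neg hk1.le, div_eq_mul_inv]
              norm_num
            have e2 : ((k.2 : ℝ) * z / k.1) ^ (1 / 2 : ℝ) =
                (k.2 : ℝ) ^ (1 / 2 : ℝ) * z ^ (1 / 2 : ℝ) * (k.1 : ℝ) ^ (-(1 / 2) : ℝ) := by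
              rw [Real.div_rpow (by positivity) hk1.le, Real.mul_rpow hk2.le hz0.le,
                Real.rpow_neg hk1.le, div_eq_mul_inv]
            have e3 : 1 / (k.2 : ℝ) ^ 2 = (k.2 : ℝ) ^ (-2 : ℝ) := by
              rw [Real.rpow_neg hk2.le, one_div]; norm_num
            have e4 : (k.1 : ℝ) ^ (-(3 / 4) : ℝ) =
                (k.1 : ℝ) ^ (-(1 / 4) : ℝ) * (k.1 : ℝ) ^ (-(1 / 2) : ℝ) := by
              rw [← Real.rpow_add hk1]; norm_num
            have e5 : (k.2 : ℝ) ^ (-(3 / 2) : ℝ) =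
                (k.2 : ℝ) ^ (-2 : ℝ) * (k.2 : ℝ) ^ (1 / 2 : ℝ) := by
              rw [← Real.rpow_add hk2]; norm_num
            rw [e1, e2, e3, e4, e5]
            ring
    set Y := S.sup Prod.snd with hY
    have hsub : S ⊆ Finset.Icc 1 B ×ˢ Finset.Icc 1 Y := by
      intro k hk
      obtain ⟨k1, k2, k3, _⟩ := hSpos k hk
      rw [Finset.mem_product, Finset.mem_Icc, Finset.mem_Icc]
      exact ⟨⟨k1, k3⟩, k2, Finset.le_sup (f := Prod.snd) hk⟩
    calc ∑ k ∈ S, A k ^ 2 ≤ ∑ k ∈ S, M ^ 2 * 64 * (z ^ (1 / 2 : ℝ) * (B : ℝ) ^ (1 / 4 : ℝ)) *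
          ((k.1 : ℝ) ^ (-(3 / 4) : ℝ) * (k.2 : ℝ) ^ (-(3 / 2) : ℝ)) := Finset.sum_le_sum hterm
      _ ≤ ∑ k ∈ Finset.Icc 1 B ×ˢ Finset.Icc 1 Y,
          M ^ 2 * 64 * (z ^ (1 / 2 : ℝ) * (B : ℝ) ^ (1 / 4 : ℝ)) *
          ((k.1 : ℝ) ^ (-(3 / 4) : ℝ) * (k.2 : ℝ) ^ (-(3 / 2) : ℝ)) :=
          Finset.sum_le_sum_of_subset_of_nonneg hsub fun k _ _ => by positivity
      _ = M ^ 2 * 64 * (z ^ (1 / 2 : ℝ) * (B : ℝ) ^ (1 / 4 : ℝ)) *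
          ((∑ q ∈ Finset.Icc 1 B, (q : ℝ) ^ (-(3 / 4) : ℝ)) *
            ∑ a ∈ Finset.Icc 1 Y, (a : ℝ) ^ (-(3 / 2) : ℝ)) := by
          rw [← Finset.mul_sum, Finset.sum_mul_sum, Finset.sum_product]
      _ ≤ M ^ 2 * 64 * (z ^ (1 / 2 : ℝ) * (B : ℝ) ^ (1 / 4 : ℝ)) *
          ((4 * (B : ℝ) ^ (1 / 4 : ℝ)) * 3) := by
          gcongr
          · exact sum_rpow_neg_three_fourths_le B
          · have h1 := sum_rpow_neg_le (σ := 3 / 2) (by norm_num)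
            exact (h1 _).trans (by norm_num)
      _ = _ := by
          rw [Real.mul_rpow hz0.le (by positivity)]
          have : (B : ℝ) ^ (1 / 2 : ℝ) = (B : ℝ) ^ (1 / 4 : ℝ) * (B : ℝ) ^ (1 / 4 : ℝ) := by
            rw [← Real.rpow_add_of_nonneg (by positivity) (by norm_num) (by norm_num)]; norm_num
          rw [this]; ring
  have hzB : (z * B) ^ (1 / 2 : ℝ) ≤ 3 * (√T * N ^ (-(1 / 4) : ℝ)) := by
    have h1 : z * B ≤ 9 * (T / √N) := by
      have hs2 : √2 ≤ 1.5 := by rw [Real.sqrt_le_left (by norm_num)]; norm_num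
      calc z * B ≤ z * (5 * √T) := by gcongr
        _ = √2 * 5 * (√T * √T / √N) := by
            rw [hz, Real.sqrt_mul (by norm_num)]; ring
        _ = √2 * 5 * (T / √N) := by rw [Real.mul_self_sqrt hT0.le]
        _ ≤ 9 * (T / √N) := by gcongr; linarith
    calc (z * B) ^ (1 / 2 : ℝ) ≤ (9 * (T / √N)) ^ (1 / 2 : ℝ) := by gcongr
      _ = 9 ^ (1 / 2 : ℝ) * (T ^ (1 / 2 : ℝ) / √N ^ (1 / 2 : ℝ)) := by
          rw [Real.mul_rpow (by norm_num) (by positivity), Real.div_rpow hT0.le (by positivity)]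
      _ = _ := by
          have e1 : (9 : ℝ) ^ (1 / 2 : ℝ) = 3 := by
            rw [show (9 : ℝ) = 3 ^ (2 : ℝ) by norm_num, ← Real.rpow_mul (by norm_num)]; norm_num
          rw [e1, Real.sqrt_eq_rpow N, ← Real.rpow_mul hN0.le, Real.sqrt_eq_rpow T,
            Real.rpow_neg hN0.le, div_eq_mul_inv]
          norm_num
  -- change of variables
  have hsub : ∫ x in T..2 * T, highSum N D x ^ 2 =
      T * ∫ y in (0 : ℝ)..1, highSum N D (T + T * y) ^ 2 := by
    have := intervalIntegral.integral_comp_add_mul (a := 0) (b := 1)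
      (fun x => highSum N D x ^ 2) hT0.ne' T
    rw [this, smul_eq_mul, ← mul_assoc, mul_inv_cancel₀ hT0.ne', one_mul]
    congr 1 <;> ring
  have hrep : ∀ y : ℝ, highSum N D (T + T * y) =
      (∑ k ∈ S, (c k y : ℂ) * (ee (α k * T) * ee (α k * T * y))).im := by
    intro y
    rw [Complex.im_sum]
    have h1 : highSum N D (T + T * y) = ∑ k ∈ S, ∑ p ∈ F k, 1 / (p.2 : ℝ) *
        highWeight N p.1 p.2 (t y) * sin (2 * π * (p.2 / p.1 * (T + T * y))) := by
      rw [highSum, Finset.sum_fiberwise_of_maps_to fun p hp => Finset.mem_image_of_mem _ hp]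
    rw [h1]
    refine Finset.sum_congr rfl fun k _ => ?_
    rw [← ee_add, Complex.im_ofReal_mul, ee, Complex.exp_ofReal_mul_I_im]
    simp only [hc]
    rw [Finset.sum_mul]
    refine Finset.sum_congr rfl fun p hp => ?_
    obtain ⟨hp1, hp2⟩ := Finset.mem_filter.1 hp
    have h2 : α k = (p.2 : ℝ) / p.1 := by
      simp only [hα]; rw [← hp2]; exact reduceFrac_div (hD p hp1).1
    rw [h2]
    congr 2
    ring
  have hct : ∀ k ∈ S, ContinuousOn (c k) (Set.Icc 0 1) := by
    intro k _
    refine continuousOn_finsetSum _ fun p _ => ContinuousOn.mul continuousOn_const ?_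
    intro y hy
    exact ((hasDerivAt_highWeight N p.1 p.2 (t y)).comp y
      (hlogder y hy)).continuousAt.continuousWithinAt
  have hint : IntervalIntegrable
      (fun y => ‖∑ k ∈ S, (c k y : ℂ) * (ee (α k * T) * ee (α k * T * y))‖ ^ 2) volume 0 1 := by
    refine ContinuousOn.intervalIntegrable_of_Icc (by norm_num) ?_
    refine ContinuousOn.pow (ContinuousOn.norm ?_) 2
    refine continuousOn_finsetSum _ fun k hk => ContinuousOn.mul ?_ ?_
    · exact Complex.continuous_ofReal.comp_continuousOn (hct k hk)
    · exact (continuous_const.mul (continuous_ee.comp (by fun_prop))).continuousOn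
  have hmono : ∫ y in (0 : ℝ)..1, highSum N D (T + T * y) ^ 2 ≤
      ∫ y in (0 : ℝ)..1, ‖∑ k ∈ S, (c k y : ℂ) * (ee (α k * T) * ee (α k * T * y))‖ ^ 2 := by
    rw [intervalIntegral.integral_of_le (by norm_num), intervalIntegral.integral_of_le (by norm_num)]
    refine integral_mono_of_nonneg (ae_of_all _ fun y => sq_nonneg _) hint.1
      (ae_of_all _ fun y => ?_)
    simp only
    rw [hrep, ← sq_abs]
    exact pow_le_pow_left₀ (abs_nonneg _) (Complex.abs_im_le_norm _) 2
  calc _ = T * ∫ y in (0 : ℝ)..1, highSum N D (T + T * y) ^ 2 := hsub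
    _ ≤ T * (C / (1 / 25) ^ 2 * (M ^ 2 * 64 * 12 * (3 * (√T * N ^ (-(1 / 4) : ℝ))))) := by
        gcongr
        refine hmono.trans (hsieve.trans ?_)
        gcongr
        exact hSsum.trans (by gcongr)
    _ = _ := by ring

lemma continuousOn_highSum (N : ℝ) (D : Finset (ℕ × ℕ)) {T : ℝ} (hT : 0 < T) :
    ContinuousOn (highSum N D) (Set.Icc T (2 * T)) := by
  refine continuousOn_finsetSum _ fun p _ => ContinuousOn.mul (ContinuousOn.mul continuousOn_const ?_)
    (Continuous.continuousOn (by fun_prop))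
  intro x hx
  have hx0 : x ≠ 0 := by have := hx.1; intro h; linarith
  exact ((hasDerivAt_highWeight N p.1 p.2 _).continuousAt.comp
    ((Real.continuousAt_log hx0).div_const 2)).continuousWithinAt

/-- The smoothed sum of sawtooth functions is close in mean to a short trigonometric sum. -/
lemma exists_integral_sum_saw_add_low_le : ∃ C : ℝ, 0 < C ∧ ∀ (T N : ℝ) (B Q : ℕ),
    1 ≤ T → 1 ≤ N → (B : ℝ) ≤ 5 * √T → 9 * √N ≤ Q →
    ∫ x in T..2 * T, |2 * ∑ b ∈ Finset.Icc 1 B, cutoff (log b - log x / 2) * saw (x / b) +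
      2 / π * ∑ m ∈ Finset.Icc 1 Q, ∑ b ∈ Finset.Icc 1 B, 1 / (m : ℝ) *
        lowWeight N b m (log x / 2) * sin (2 * π * (m / b * x))| ≤
      C * (T * (T ^ (1 / 4 : ℝ) * N ^ (-(1 / 8) : ℝ))) := by
  obtain ⟨C, hC, hC'⟩ := exists_integral_highSum_sq_le
  refine ⟨√C, by positivity, ?_⟩
  intro T N B Q hT hN hB' hQ
  have hT0 : 0 < T := by linarith
  have hN0 : 0 < N := by linarith
  have hTT : T ≤ 2 * T := by linarith
  set R : ℝ → ℝ := fun x => 2 * ∑ b ∈ Finset.Icc 1 B, cutoff (log b - log x / 2) * saw (x / b) +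
      2 / π * ∑ m ∈ Finset.Icc 1 Q, ∑ b ∈ Finset.Icc 1 B, 1 / (m : ℝ) *
        lowWeight N b m (log x / 2) * sin (2 * π * (m / b * x)) with hR
  set D : ℕ → Finset (ℕ × ℕ) := fun Y => (Finset.Icc 1 B ×ˢ Finset.Icc 1 Y).filter
    fun p => (p.1 : ℝ) * √N ≤ p.2 * √(2 * T) with hD
  -- vanishing of the weights
  have hhigh : ∀ b m : ℕ, 1 ≤ b → 1 ≤ m → ¬((b : ℝ) * √N ≤ m * √(2 * T)) →
      ∀ x ∈ Set.Icc T (2 * T), highWeight N b m (log x / 2) = 0 := by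
    intro b m hb hm hlt x hx
    have hb0 : (0 : ℝ) < b := by exact_mod_cast hb
    have hm0 : (0 : ℝ) < m := by exact_mod_cast hm
    have hx0 : 0 < x := by linarith [hx.1]
    rw [not_le] at hlt
    have h1 : (m : ℝ) * √x ≤ b * √N := by
      have : √x ≤ √(2 * T) := Real.sqrt_le_sqrt hx.2
      nlinarith
    have h2 := Real.log_le_log (by positivity) h1
    rw [Real.log_mul hm0.ne' (by positivity), Real.log_mul hb0.ne' (by positivity),
      Real.log_sqrt hx0.le, Real.log_sqrt hN0.le] at h2
    rw [highWeight, taper_of_le (by linarith)]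
    simp
  have hlow : ∀ b m : ℕ, 1 ≤ b → Q < m → ∀ x ∈ Set.Icc T (2 * T),
      lowWeight N b m (log x / 2) = 0 := by
    intro b m hb hm x hx
    have hb0 : (0 : ℝ) < b := by exact_mod_cast hb
    have hm0 : (0 : ℝ) < m := by exact_mod_cast (Nat.zero_le Q).trans_lt hm
    by_cases h1 : 1 ≤ log b - log x / 2
    · rw [lowWeight, cutoff_of_ge h1, zero_mul]
    · have h2 : 9 * √N ≤ m := hQ.trans (by exact_mod_cast hm.le)
      have h3 := Real.log_le_log (by positivity) h2
      rw [Real.log_mul (by norm_num) (by positivity), Real.log_sqrt hN0.le] at h3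
      have h4 : 2 ≤ log 9 := by
        rw [Real.le_log_iff_exp_le (by norm_num)]
        have := Real.exp_one_lt_d9
        rw [show (2 : ℝ) = 1 + 1 by norm_num, Real.exp_add]
        nlinarith [Real.exp_pos 1]
      rw [lowWeight, taper_of_ge (by linarith), mul_zero]
  have hsplit : ∀ Y, Q ≤ Y → ∀ x ∈ Set.Icc T (2 * T), R x =
      2 * ∑ b ∈ Finset.Icc 1 B, cutoff (log b - log x / 2) *
        (saw (x / b) + sawSum Y (x / b)) - 2 / π * highSum N (D Y) x := by
    intro Y hY x hx
    have h1 : highSum N (D Y) x = ∑ b ∈ Finset.Icc 1 B, ∑ m ∈ Finset.Icc 1 Y, 1 / (m : ℝ) *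
        highWeight N b m (log x / 2) * sin (2 * π * (m / b * x)) := by
      rw [highSum, hD, Finset.sum_filter_of_ne, Finset.sum_product]
      intro p hp hne
      by_contra hcon
      rw [Finset.mem_product, Finset.mem_Icc, Finset.mem_Icc] at hp
      apply hne
      rw [hhigh p.1 p.2 hp.1.1 hp.2.1 hcon x hx]
      simp
    have h2 : ∑ m ∈ Finset.Icc 1 Q, ∑ b ∈ Finset.Icc 1 B, 1 / (m : ℝ) *
        lowWeight N b m (log x / 2) * sin (2 * π * (m / b * x)) =
        ∑ b ∈ Finset.Icc 1 B, ∑ m ∈ Finset.Icc 1 Y, 1 / (m : ℝ) *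
        lowWeight N b m (log x / 2) * sin (2 * π * (m / b * x)) := by
      rw [Finset.sum_comm]
      refine Finset.sum_congr rfl fun b hb => ?_
      refine Finset.sum_subset (Finset.Icc_subset_Icc_right hY) fun m _ hm' => ?_
      rw [Finset.mem_Icc] at hb hm'
      by_cases hmz : m = 0
      · simp [hmz]
      · rw [hlow b m hb.1 (by omega) x hx]; simp
    have h3 : ∀ b ∈ Finset.Icc 1 B, cutoff (log b - log x / 2) * sawSum Y (x / b) =
        1 / π * (∑ m ∈ Finset.Icc 1 Y, 1 / (m : ℝ) *
          lowWeight N b m (log x / 2) * sin (2 * π * (m / b * x)) +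
        ∑ m ∈ Finset.Icc 1 Y, 1 / (m : ℝ) *
          highWeight N b m (log x / 2) * sin (2 * π * (m / b * x))) := by
      intro b _
      rw [← Finset.sum_add_distrib, sawSum, Finset.mul_sum, Finset.mul_sum, Finset.mul_sum]
      refine Finset.sum_congr rfl fun m _ => ?_
      rw [show 2 * π * m * (x / b) = 2 * π * (m / b * x) by ring]
      unfold lowWeight highWeight
      ring
    simp only [hR]
    rw [h1, h2]
    simp_rw [mul_add]
    rw [Finset.sum_add_distrib, Finset.sum_congr rfl h3, ← Finset.mul_sum, Finset.sum_add_distrib]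
    ring
  have hY : ∀ Y, Q ≤ Y → ∫ x in T..2 * T, |R x| ≤
      2 * ∑ b ∈ Finset.Icc 1 B, (∫ x in T..2 * T, |saw (x / b) + sawSum Y (x / b)|) +
        √C * (T * (T ^ (1 / 4 : ℝ) * N ^ (-(1 / 8) : ℝ))) := by
    intro Y hQY
    have i1 : ∀ b ∈ Finset.Icc 1 B, IntervalIntegrable
        (fun x => |saw (x / b) + sawSum Y (x / b)|) volume T (2 * T) := by
      intro b _
      have hc : Continuous fun x : ℝ => sawSum Y (x / b) := (continuous_sawSum Y).comp (by fun_prop)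
      have h1 := intervalIntegrable_mul_of_bound (f := fun _ => (1 : ℝ)) continuous_const
        (measurable_saw.comp (measurable_id.div_const (b : ℝ))) (C := 1 / 2)
        (fun x => abs_saw_le _) T (2 * T)
      simp only [one_mul, Function.comp_def, id] at h1
      exact (h1.add (hc.intervalIntegrable _ _)).abs
    have i2 : IntervalIntegrable (fun x => |highSum N (D Y) x|) volume T (2 * T) :=
      (continuousOn_highSum N _ hT0).abs.intervalIntegrable_of_Icc hTT
    have hptw : ∀ x ∈ Set.Ioc T (2 * T), |R x| ≤
        2 * ∑ b ∈ Finset.Icc 1 B, |saw (x / b) + sawSum Y (x / b)| + |highSum N (D Y) x| := by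
      intro x hx
      rw [hsplit Y hQY x (Set.Ioc_subset_Icc_self hx)]
      refine (abs_sub _ _).trans (add_le_add ?_ ?_)
      · rw [abs_mul, abs_two]
        gcongr
        refine (Finset.abs_sum_le_sum_abs _ _).trans (Finset.sum_le_sum fun b _ => ?_)
        rw [abs_mul, abs_of_nonneg (cutoff_nonneg _)]
        exact mul_le_of_le_one_left (abs_nonneg _) (cutoff_le_one _)
      · rw [abs_mul, abs_of_pos (by positivity)]
        refine mul_le_of_le_one_left (abs_nonneg _) ?_
        rw [div_le_one Real.pi_pos]
        linarith [Real.pi_gt_three]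
    have i3 : IntervalIntegrable (fun x => ∑ b ∈ Finset.Icc 1 B, |saw (x / b) + sawSum Y (x / b)|)
        volume T (2 * T) := by
      have := IntervalIntegrable.sum (μ := volume) (a := T) (b := 2 * T) (Finset.Icc 1 B) (f := fun (b : ℕ) x =>
        |saw (x / b) + sawSum Y (x / b)|) i1
      simpa only [Finset.sum_fn] using this
    have h1 : ∫ x in T..2 * T, |R x| ≤ ∫ x in T..2 * T,
        (2 * ∑ b ∈ Finset.Icc 1 B, |saw (x / b) + sawSum Y (x / b)| + |highSum N (D Y) x|) := by
      rw [intervalIntegral.integral_of_le hTT, intervalIntegral.integral_of_le hTT]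
      refine integral_mono_of_nonneg (ae_of_all _ fun x => abs_nonneg _)
        ((i3.const_mul 2).add i2).1 ?_
      exact (ae_restrict_iff' measurableSet_Ioc).2 (ae_of_all _ hptw)
    refine h1.trans ?_
    rw [intervalIntegral.integral_add (i3.const_mul 2) i2, intervalIntegral.integral_const_mul,
      intervalIntegral.integral_finsetSum i1]
    gcongr
    -- Cauchy-Schwarz for the high part
    have h2 := hC' T N B (D Y) hT hN hB' (by
      intro p hp
      rw [hD, Finset.mem_filter, Finset.mem_product, Finset.mem_Icc, Finset.mem_Icc] at hp
      exact ⟨hp.1.1.1, hp.1.2.1, hp.1.1.2, hp.2⟩)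
    have hcov : ∀ g : ℝ → ℝ, ∫ x in T..2 * T, g x = T * ∫ y in (0 : ℝ)..1, g (T + T * y) := by
      intro g
      have := intervalIntegral.integral_comp_add_mul (a := 0) (b := 1) g hT0.ne' T
      rw [this, smul_eq_mul, ← mul_assoc, mul_inv_cancel₀ hT0.ne', one_mul]
      congr 1 <;> ring
    rw [hcov] at h2 ⊢
    have h3 : ∫ y in (0 : ℝ)..1, highSum N (D Y) (T + T * y) ^ 2 ≤
        C * (√T * N ^ (-(1 / 4) : ℝ)) := by
      refine le_of_mul_le_mul_left (h2.trans_eq ?_) hT0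
      ring
    have hcomp : ContinuousOn (fun y => highSum N (D Y) (T + T * y)) (Set.Icc 0 1) := by
      refine (continuousOn_highSum N (D Y) hT0).comp (Continuous.continuousOn (by fun_prop)) ?_
      intro y hy
      constructor <;> nlinarith [hy.1, hy.2]
    have h4 : ∫ y in (0 : ℝ)..1, |highSum N (D Y) (T + T * y)| ≤
        √(C * (√T * N ^ (-(1 / 4) : ℝ))) := by
      have hprob : IsProbabilityMeasure (volume.restrict (Set.Ioc (0 : ℝ) 1)) := ⟨by simp⟩
      rw [intervalIntegral.integral_of_le (by norm_num)] at h3 ⊢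
      refine integral_abs_le_sqrt ?_ h3
      have hi := (hcomp.intervalIntegrable_of_Icc (μ := volume) (by norm_num)).1
      rw [memLp_two_iff_integrable_sq hi.aestronglyMeasurable]
      exact ((hcomp.pow 2).intervalIntegrable_of_Icc (μ := volume) (by norm_num)).1
    have h5 : √(C * (√T * N ^ (-(1 / 4) : ℝ))) = √C * (T ^ (1 / 4 : ℝ) * N ^ (-(1 / 8) : ℝ)) := by
      rw [Real.sqrt_mul hC.le, Real.sqrt_mul (by positivity)]
      congr 2
      · rw [Real.sqrt_eq_rpow, Real.sqrt_eq_rpow, ← Real.rpow_mul hT0.le]; norm_num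
      · rw [Real.sqrt_eq_rpow, ← Real.rpow_mul hN0.le]; norm_num
    rw [h5] at h4
    calc _ ≤ T * (√C * (T ^ (1 / 4 : ℝ) * N ^ (-(1 / 8) : ℝ))) := by gcongr
      _ = _ := by ring
  have hlim : Tendsto (fun Y => 2 * ∑ b ∈ Finset.Icc 1 B,
      (∫ x in T..2 * T, |saw (x / b) + sawSum Y (x / b)|) +
        √C * (T * (T ^ (1 / 4 : ℝ) * N ^ (-(1 / 8) : ℝ)))) atTop
      (𝓝 (2 * ∑ b ∈ Finset.Icc 1 B, (0 : ℝ) +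
        √C * (T * (T ^ (1 / 4 : ℝ) * N ^ (-(1 / 8) : ℝ))))) := by
    refine Tendsto.add_const _ (Tendsto.const_mul 2 (tendsto_finsetSum _ fun b hb => ?_))
    exact tendsto_integral_abs_saw_add_sawSum hT0 (Finset.mem_Icc.1 hb).1
  simp only [Finset.sum_const_zero, mul_zero, zero_add] at hlim
  exact ge_of_tendsto hlim (eventually_atTop.2 ⟨Q, hY⟩)

/-! ### Stationary phase -/

lemma hasDerivAt_ee_comp {φ : ℝ → ℝ} {φ' z : ℝ} (h : HasDerivAt φ φ' z) :
    HasDerivAt (fun z => ee (φ z)) (2 * π * φ' * Complex.I * ee (φ z)) z := by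
  have h1 : HasDerivAt (fun z => ((2 * π * φ z : ℝ) : ℂ) * Complex.I)
      (((2 * π * φ' : ℝ) : ℂ) * Complex.I) z :=
    ((h.const_mul (2 * π)).ofReal_comp).mul_const _
  refine h1.cexp.congr_deriv ?_
  unfold ee
  push_cast
  ring

lemma one_div_one_add_cosh_le (z : ℝ) : 1 / (1 + cosh z) ≤ 2 * exp (-z) := by
  have h1 : exp z / 2 ≤ cosh z := by
    rw [Real.cosh_eq]; linarith [Real.exp_pos (-z)]
  have h2 := Real.exp_pos z
  rw [Real.exp_neg, div_le_iff₀ (by linarith), mul_assoc, ← div_eq_inv_mul,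
    mul_div_assoc', le_div_iff₀ h2]
  linarith

lemma abs_mul_sinh_sub_mul_cosh_le {H H₁ H₂ : ℝ → ℝ} {M : ℝ} (h0 : H 0 = 0)
    (hd : ∀ z, HasDerivAt H (H₁ z) z) (hd₁ : ∀ z, HasDerivAt H₁ (H₂ z) z)
    (hM : ∀ z, |H₂ z - H z| ≤ M) {z : ℝ} (hz : 0 ≤ z) :
    |H₁ z * sinh z - H z * cosh z| ≤ M * (cosh z - 1) := by
  have key : ∀ s : ℝ, |s| = 1 → s * (H₁ z * sinh z - H z * cosh z) ≤
      M * (cosh z - 1) := by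
    intro s hs
    have hder : ∀ z, HasDerivAt (fun z => M * (cosh z - 1) -
        s * (H₁ z * sinh z - H z * cosh z))
        ((M - s * (H₂ z - H z)) * sinh z) z := by
      intro z
      have := (((Real.hasDerivAt_cosh z).sub_const 1).const_mul M).sub
        ((((hd₁ z).mul (Real.hasDerivAt_sinh z)).sub ((hd z).mul (Real.hasDerivAt_cosh z))).const_mul s)
      exact this.congr_deriv (by ring)
    have hmono : MonotoneOn (fun z => M * (cosh z - 1) -
        s * (H₁ z * sinh z - H z * cosh z)) (Set.Ici 0) := by
      refine monotoneOn_of_hasDerivWithinAt_nonneg (convex_Ici 0)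
        (fun x _ => (hder x).continuousAt.continuousWithinAt)
        (fun x _ => (hder x).hasDerivWithinAt) fun x hx => ?_
      rw [interior_Ici] at hx
      refine mul_nonneg ?_ (Real.sinh_nonneg_iff.2 (le_of_lt hx))
      have h1 : |s * (H₂ x - H x)| ≤ M := by rw [abs_mul, hs, one_mul]; exact hM x
      linarith [le_abs_self (s * (H₂ x - H x))]
    have := hmono (Set.mem_Ici.2 le_rfl) (Set.mem_Ici.2 hz) hz
    simp only [Real.cosh_zero, Real.sinh_zero, h0, sub_self, mul_zero, zero_mul] at this
    linarith
  rw [abs_le]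
  have h1 := key 1 (by simp)
  have h2 := key (-1) (by simp)
  constructor <;> linarith

/-- The integral of `H` against the oscillation `ee (2 λ cosh z)` on a half-line, when the
amplitude vanishes at the stationary point. -/
lemma norm_integral_Ioi_ee_cosh_le {H H₁ H₂ : ℝ → ℝ} {M M' l : ℝ} (hl : 0 < l) (h0 : H 0 = 0)
    (hd : ∀ z, HasDerivAt H (H₁ z) z) (hd₁ : ∀ z, HasDerivAt H₁ (H₂ z) z)
    (hM : ∀ z, |H₂ z - H z| ≤ M) (hM₁ : |H₁ 0| ≤ M) (hM' : ∀ z, |H z| ≤ M')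
    (hint : IntegrableOn (fun z => (H z : ℂ) * ee (2 * l * cosh z)) (Set.Ioi 0)) :
    ‖∫ z in Set.Ioi (0 : ℝ), (H z : ℂ) * ee (2 * l * cosh z)‖ ≤ M / l := by
  have hM0 : 0 ≤ M := (abs_nonneg _).trans hM₁
  set q' : ℝ → ℝ := fun z => (H₁ z * sinh z - H z * cosh z) / sinh z ^ 2 with hq'
  set Φ : ℝ → ℂ := fun z => if z = 0 then (H₁ 0 : ℂ) * ee (2 * l * cosh z) else
    ((H z / sinh z : ℝ) : ℂ) * ee (2 * l * cosh z) with hΦ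
  have hphase : ∀ z, HasDerivAt (fun z => ee (2 * l * cosh z))
      (2 * π * (2 * l * sinh z : ℝ) * Complex.I * ee (2 * l * cosh z)) z :=
    fun z => hasDerivAt_ee_comp ((Real.hasDerivAt_cosh z).const_mul (2 * l))
  have hphc : Continuous fun z => ee (2 * l * cosh z) :=
    continuous_ee.comp (by fun_prop)
  have hsinh : ∀ z ∈ Set.Ioi (0 : ℝ), 0 < sinh z := fun z hz => Real.sinh_pos_iff.2 hz
  have hq'b : ∀ z ∈ Set.Ioi (0 : ℝ), |q' z| ≤ 2 * M * exp (-z) := by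
    intro z hz
    have hs := hsinh z hz
    simp only [hq']
    rw [abs_div, abs_of_pos (pow_pos hs 2), div_le_iff₀ (pow_pos hs 2)]
    have h1 := abs_mul_sinh_sub_mul_cosh_le h0 hd hd₁ hM (le_of_lt hz)
    have h2 : sinh z ^ 2 = (cosh z - 1) * (1 + cosh z) := by
      rw [Real.sinh_sq]; ring
    have h3 := one_div_one_add_cosh_le z
    have h4 : 0 < 1 + cosh z := by linarith [Real.one_le_cosh z]
    rw [div_le_iff₀ h4] at h3
    have h5 : 0 ≤ M * (cosh z - 1) := mul_nonneg hM0 (by linarith [Real.one_le_cosh z])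
    calc _ ≤ M * (cosh z - 1) * 1 := by linarith
      _ ≤ M * (cosh z - 1) * (2 * exp (-z) * (1 + cosh z)) := by gcongr
      _ = _ := by rw [h2]; ring
  have hq'c : ContinuousOn q' (Set.Ioi 0) := by
    intro z hz
    have hs := hsinh z hz
    have hs2 : sinh z ^ 2 ≠ 0 := (pow_pos hs 2).ne'
    refine ContinuousAt.continuousWithinAt (ContinuousAt.div (f := fun z =>
      H₁ z * sinh z - H z * cosh z) (g := fun z => sinh z ^ 2) ?_ ?_ hs2)
    · exact ((hd₁ z).continuousAt.mul Real.continuous_sinh.continuousAt).sub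
        ((hd z).continuousAt.mul Real.continuous_cosh.continuousAt)
    · exact (Real.continuous_sinh.pow 2).continuousAt
  have hexpint : IntegrableOn (fun z : ℝ => 2 * M * exp (-z)) (Set.Ioi 0) :=
    (integrableOn_exp_neg_Ioi 0).const_mul _
  have hq'int : IntegrableOn (fun z => (q' z : ℂ) * ee (2 * l * cosh z)) (Set.Ioi 0) := by
    refine Integrable.mono' hexpint ?_ ?_
    · exact ((Complex.continuous_ofReal.comp_continuousOn hq'c).mul
        hphc.continuousOn).aestronglyMeasurable measurableSet_Ioi
    · refine (ae_restrict_iff' measurableSet_Ioi).2 (ae_of_all _ fun z hz => ?_)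
      rw [norm_mul, norm_ee, mul_one, Complex.norm_real]
      exact hq'b z hz
  have hq : ∀ z ∈ Set.Ioi (0 : ℝ), HasDerivAt (fun z => H z / sinh z) (q' z) z :=
    fun z hz => (hd z).div (Real.hasDerivAt_sinh z) (hsinh z hz).ne'
  have hΦd : ∀ z ∈ Set.Ioi (0 : ℝ), HasDerivAt Φ ((q' z : ℂ) * ee (2 * l * cosh z) +
      4 * π * l * Complex.I * ((H z : ℂ) * ee (2 * l * cosh z))) z := by
    intro z hz
    have h1 := (hq z hz).ofReal_comp.mul (hphase z)
    have h2 : Φ =ᶠ[𝓝 z] fun z => ((H z / sinh z : ℝ) : ℂ) * ee (2 * l * cosh z) := by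
      filter_upwards [Ioi_mem_nhds (Set.mem_Ioi.1 hz)] with y hy
      simp only [hΦ]
      rw [if_neg (ne_of_gt hy)]
    refine (h1.congr_of_eventuallyEq h2).congr_deriv ?_
    have h3 : (sinh z : ℂ) ≠ 0 := by exact_mod_cast (hsinh z hz).ne'
    push_cast
    push_cast at h3
    field_simp
    ring
  have hΦ0 : ContinuousWithinAt Φ (Set.Ici 0) 0 := by
    rw [← continuousWithinAt_Ioi_iff_Ici]
    have h1 : Tendsto (fun z => H z / sinh z) (𝓝[>] 0) (𝓝 (H₁ 0)) := by
      refine HasDerivAt.lhopital_zero_nhdsGT (f' := H₁) (g' := cosh)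
        (Eventually.of_forall hd) (Eventually.of_forall Real.hasDerivAt_sinh)
        (Eventually.of_forall fun z => (Real.cosh_pos z).ne') ?_ ?_ ?_
      · have := (hd 0).continuousAt.tendsto.mono_left (nhdsWithin_le_nhds (s := Set.Ioi 0))
        rwa [h0] at this
      · have := (Real.continuous_sinh.tendsto 0).mono_left
          (nhdsWithin_le_nhds (s := Set.Ioi (0 : ℝ)))
        rwa [Real.sinh_zero] at this
      · have : ContinuousAt (fun z => H₁ z / cosh z) 0 :=
          (hd₁ 0).continuousAt.div Real.continuous_cosh.continuousAt (Real.cosh_pos 0).ne'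
        have h2 := this.tendsto.mono_left (nhdsWithin_le_nhds (s := Set.Ioi (0 : ℝ)))
        rwa [Real.cosh_zero, div_one] at h2
    have h2 : Tendsto (fun z => ((H z / sinh z : ℝ) : ℂ) * ee (2 * l * cosh z)) (𝓝[>] 0)
        (𝓝 (Φ 0)) := by
      simp only [hΦ, if_true]
      exact ((Complex.continuous_ofReal.tendsto _).comp h1).mul
        (hphc.continuousAt.tendsto.mono_left nhdsWithin_le_nhds)
    refine Tendsto.congr' ?_ h2
    filter_upwards [self_mem_nhdsWithin] with z hz
    simp only [hΦ]
    rw [if_neg (ne_of_gt hz)]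
  have hΦinf : Tendsto Φ atTop (𝓝 0) := by
    rw [tendsto_zero_iff_norm_tendsto_zero]
    have h1 : Tendsto (fun z => M' / sinh z) atTop (𝓝 0) :=
      tendsto_const_nhds.div_atTop (tendsto_atTop_mono' _ (by
        filter_upwards [eventually_ge_atTop 0] with z hz using Real.self_le_sinh_iff.2 hz)
        tendsto_id)
    refine squeeze_zero' (Eventually.of_forall fun z => norm_nonneg _) ?_ h1
    filter_upwards [eventually_gt_atTop 0] with z hz
    simp only [hΦ]
    rw [if_neg hz.ne', norm_mul, norm_ee, mul_one, Complex.norm_real, Real.norm_eq_abs, abs_div,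
      abs_of_pos (hsinh z hz)]
    exact div_le_div_of_nonneg_right (hM' z) (hsinh z hz).le
  have hFTC := integral_Ioi_of_hasDerivAt_of_tendsto hΦ0 hΦd
    (hq'int.add (hint.const_mul (4 * π * l * Complex.I))) hΦinf
  rw [integral_add hq'int (hint.const_mul _), integral_const_mul] at hFTC
  have hb1 : ‖∫ z in Set.Ioi (0 : ℝ), (q' z : ℂ) * ee (2 * l * cosh z)‖ ≤ 2 * M := by
    refine (norm_integral_le_integral_norm _).trans ?_
    have h1 : ∫ z in Set.Ioi (0 : ℝ), 2 * M * exp (-z) = 2 * M := by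
      rw [integral_const_mul, integral_exp_neg_Ioi_zero, mul_one]
    rw [← h1]
    refine setIntegral_mono_on hq'int.norm hexpint measurableSet_Ioi fun z hz => ?_
    rw [norm_mul, norm_ee, mul_one, Complex.norm_real]
    exact hq'b z hz
  have hb2 : ‖Φ 0‖ ≤ M := by
    simp only [hΦ, if_true]
    rw [norm_mul, norm_ee, mul_one, Complex.norm_real]
    exact hM₁
  set J := ∫ z in Set.Ioi (0 : ℝ), (H z : ℂ) * ee (2 * l * cosh z) with hJ
  have h1 : 4 * π * l * Complex.I * J = 0 - Φ 0 -
      ∫ z in Set.Ioi (0 : ℝ), (q' z : ℂ) * ee (2 * l * cosh z) := by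
    rw [← hFTC]; ring
  have h2 : 4 * π * l * ‖J‖ ≤ M + 2 * M := by
    have e : ‖4 * π * l * Complex.I * J‖ = 4 * π * l * ‖J‖ := by
      simp [abs_of_pos hl, abs_of_pos Real.pi_pos]
    rw [← e, h1, zero_sub]
    refine (norm_sub_le _ _).trans ?_
    rw [norm_neg]
    linarith
  rw [le_div_iff₀ hl]
  have h3 := Real.pi_gt_three
  have h4 : 0 ≤ ‖J‖ * l := by positivity
  nlinarith

/-- The model amplitude for the stationary phase method. -/
def bump (z : ℝ) : ℝ := cosh (z / 2) * exp (-(4 * π * sinh (z / 2) ^ 2))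

lemma hasDerivAt_sinh_half (z : ℝ) :
    HasDerivAt (fun z => sinh (z / 2)) (cosh (z / 2) / 2) z := by
  have := ((hasDerivAt_id z).div_const 2).sinh
  exact this.congr_deriv (by simp; ring)

lemma hasDerivAt_cosh_half (z : ℝ) :
    HasDerivAt (fun z => cosh (z / 2)) (sinh (z / 2) / 2) z := by
  have := ((hasDerivAt_id z).div_const 2).cosh
  exact this.congr_deriv (by simp; ring)

lemma hasDerivAt_exp_sinh_half (z : ℝ) :
    HasDerivAt (fun z => exp (-(4 * π * sinh (z / 2) ^ 2)))
      (-(4 * π * sinh (z / 2) * cosh (z / 2)) *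
        exp (-(4 * π * sinh (z / 2) ^ 2))) z := by
  have := ((((hasDerivAt_sinh_half z).pow 2).const_mul (4 * π)).neg).exp
  refine this.congr_deriv ?_
  simp
  ring

/-- The derivative of `bump`. -/
def bump₁ (z : ℝ) : ℝ := ((1 / 2 - 4 * π) * sinh (z / 2) -
  4 * π * sinh (z / 2) ^ 3) * exp (-(4 * π * sinh (z / 2) ^ 2))

/-- The second derivative of `bump`. -/
def bump₂ (z : ℝ) : ℝ := (((1 / 2 - 4 * π) - 12 * π * sinh (z / 2) ^ 2) / 2 -
    4 * π * sinh (z / 2) * ((1 / 2 - 4 * π) * sinh (z / 2) -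
      4 * π * sinh (z / 2) ^ 3)) * cosh (z / 2) *
  exp (-(4 * π * sinh (z / 2) ^ 2))

lemma hasDerivAt_bump (z : ℝ) : HasDerivAt bump (bump₁ z) z := by
  refine ((hasDerivAt_cosh_half z).mul (hasDerivAt_exp_sinh_half z)).congr_deriv ?_
  have h := Real.cosh_sq (z / 2)
  unfold bump₁
  linear_combination (-(4 * π * sinh (z / 2)) *
    exp (-(4 * π * sinh (z / 2) ^ 2))) * h

lemma hasDerivAt_bump₁ (z : ℝ) : HasDerivAt bump₁ (bump₂ z) z := by
  have h1 := ((hasDerivAt_sinh_half z).const_mul (1 / 2 - 4 * π)).sub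
    (((hasDerivAt_sinh_half z).pow 3).const_mul (4 * π))
  refine (h1.mul (hasDerivAt_exp_sinh_half z)).congr_deriv ?_
  unfold bump₂
  simp
  ring

lemma exists_abs_bump_le : ∃ M : ℝ, 1 ≤ M ∧ (∀ z, |bump z| ≤ M) ∧ ∀ z, |bump₂ z - bump z| ≤ M := by
  have key : ∀ s : ℝ, (1 + s ^ 2) ^ 3 * exp (-(4 * π * s ^ 2)) ≤ 6 * exp 1 := by
    intro s
    have h1 := Real.pow_div_factorial_le_exp (1 + s ^ 2) (by positivity) 3
    have h2 : exp (-(4 * π * s ^ 2)) ≤ exp (-s ^ 2) := by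
      apply Real.exp_le_exp.2
      nlinarith [Real.pi_gt_three, sq_nonneg s]
    have h3 : (1 + s ^ 2) ^ 3 ≤ 6 * exp (1 + s ^ 2) := by
      norm_num [Nat.factorial] at h1
      linarith
    calc _ ≤ 6 * exp (1 + s ^ 2) * exp (-s ^ 2) := by gcongr
      _ = 6 * exp 1 := by rw [mul_assoc, ← Real.exp_add]; congr 2; ring
  have hcosh : ∀ z : ℝ, cosh z ≤ 1 + sinh z ^ 2 := by
    intro z
    have := Real.cosh_sq z
    nlinarith [Real.one_le_cosh z]
  have hb : ∀ z, |bump z| ≤ 6 * exp 1 := by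
    intro z
    unfold bump
    rw [abs_of_nonneg (mul_nonneg (Real.cosh_pos _).le (Real.exp_pos _).le)]
    refine le_trans ?_ (key (sinh (z / 2)))
    gcongr
    refine (hcosh _).trans (le_self_pow₀ ?_ (by norm_num))
    nlinarith [sq_nonneg (sinh (z / 2))]
  set K : ℝ := 16 * π ^ 2 + 24 * π + 10 with hK
  have hpi := Real.pi_gt_three
  have hb2 : ∀ z, |bump₂ z| ≤ K * (6 * exp 1) := by
    intro z
    unfold bump₂
    set s := sinh (z / 2) with hs
    rw [abs_mul, abs_mul, abs_of_pos (Real.cosh_pos _), abs_of_pos (Real.exp_pos _)]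
    have h1 : |((1 / 2 - 4 * π) - 12 * π * s ^ 2) / 2 -
        4 * π * s * ((1 / 2 - 4 * π) * s - 4 * π * s ^ 3)| ≤
        K * (1 + s ^ 2) ^ 2 := by
      have hs2 := sq_nonneg s
      have hp2 : 0 ≤ π ^ 2 * s ^ 2 := by positivity
      have hp4 : 0 ≤ π ^ 2 * s ^ 4 := by positivity
      have hp5 : 0 ≤ π * s ^ 2 := by positivity
      have hp6 : 0 ≤ π * s ^ 4 := by positivity
      have hp7 : 0 ≤ s ^ 4 := by positivity
      rw [hK, abs_le]
      constructor <;> nlinarith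
    calc _ ≤ K * (1 + s ^ 2) ^ 2 * (1 + s ^ 2) * exp (-(4 * π * s ^ 2)) := by
          gcongr
          exact hcosh _
      _ = K * ((1 + s ^ 2) ^ 3 * exp (-(4 * π * s ^ 2))) := by ring
      _ ≤ K * (6 * exp 1) := mul_le_mul_of_nonneg_left (key s) (by positivity)
  have he : 1 ≤ exp 1 := Real.one_le_exp (by norm_num)
  have hK0 : 0 ≤ K := by positivity
  refine ⟨K * (6 * exp 1) + 6 * exp 1, by nlinarith, fun z => (hb z).trans ?_, fun z => ?_⟩
  · nlinarith
  · exact (abs_sub _ _).trans (add_le_add (hb2 z) (hb z))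

lemma cosh_eq_one_add (z : ℝ) : cosh z = 1 + 2 * sinh (z / 2) ^ 2 := by
  have h := Real.cosh_two_mul (z / 2)
  rw [Real.cosh_sq, show 2 * (z / 2) = z by ring] at h
  linarith

lemma bump_mul_ee (l z : ℝ) : (bump z : ℂ) * ee (2 * l * cosh z) = 2 * ee (2 * l) *
    (|cosh (z / 2) / 2| • Complex.exp (-(4 * π * (1 - 2 * l * Complex.I)) *
      ((sinh (z / 2) : ℝ) : ℂ) ^ 2)) := by
  rw [abs_of_pos (by have := Real.cosh_pos (z / 2); positivity), cosh_eq_one_add z, bump, ee, ee,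
    Complex.real_smul, Complex.ofReal_mul, Complex.ofReal_exp]
  have e : Complex.exp (((-(4 * π * sinh (z / 2) ^ 2) : ℝ) : ℂ)) *
      Complex.exp (((2 * π * (2 * l * (1 + 2 * sinh (z / 2) ^ 2)) : ℝ) : ℂ) * Complex.I) =
      Complex.exp (((2 * π * (2 * l) : ℝ) : ℂ) * Complex.I) *
        Complex.exp (-(4 * π * (1 - 2 * l * Complex.I)) * ((sinh (z / 2) : ℝ) : ℂ) ^ 2) := by
    rw [← Complex.exp_add, ← Complex.exp_add]
    congr 1
    push_cast
    ring
  rw [mul_assoc, e]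
  push_cast
  ring

lemma integral_bump (l : ℝ) :
    Integrable (fun z => (bump z : ℂ) * ee (2 * l * cosh z)) ∧
    ∫ z, (bump z : ℂ) * ee (2 * l * cosh z) =
      2 * ee (2 * l) * (π / (4 * π * (1 - 2 * l * Complex.I))) ^ (1 / 2 : ℂ) := by
  set b : ℂ := 4 * π * (1 - 2 * l * Complex.I) with hb
  have hbre : 0 < b.re := by
    rw [hb]
    have := Real.pi_pos
    simp
    positivity
  have hinj : Set.InjOn (fun z : ℝ => sinh (z / 2)) Set.univ := by
    intro x _ y _ h
    have := Real.sinh_injective h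
    linarith
  have himg : (fun z : ℝ => sinh (z / 2)) '' Set.univ = Set.univ := by
    rw [Set.image_univ, Set.range_eq_univ]
    intro y
    obtain ⟨x, hx⟩ := Real.sinh_surjective y
    exact ⟨2 * x, by simp only; rw [← hx]; congr 1; ring⟩
  have hder : ∀ x ∈ (Set.univ : Set ℝ), HasDerivWithinAt (fun z : ℝ => sinh (z / 2))
      (cosh (x / 2) / 2) Set.univ x := fun x _ => (hasDerivAt_sinh_half x).hasDerivWithinAt
  have h1 := integral_image_eq_integral_abs_deriv_smul MeasurableSet.univ hder hinj
    (fun s : ℝ => Complex.exp (-b * (s : ℂ) ^ 2))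
  have h2 := integrableOn_image_iff_integrableOn_abs_deriv_smul MeasurableSet.univ hder hinj
    (fun s : ℝ => Complex.exp (-b * (s : ℂ) ^ 2))
  rw [himg, integrableOn_univ, integrableOn_univ] at h2
  rw [himg, setIntegral_univ, setIntegral_univ] at h1
  constructor
  · simp_rw [bump_mul_ee]
    exact (h2.1 (integrable_cexp_neg_mul_sq hbre)).const_mul _
  · simp_rw [bump_mul_ee]
    rw [integral_const_mul, ← h1, integral_gaussian_complex hbre]

lemma cpow_half_sq_and_re (w : ℂ) : (w ^ (1 / 2 : ℂ)) ^ 2 = w ∧ 0 ≤ (w ^ (1 / 2 : ℂ)).re := by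
  constructor
  · have := Complex.cpow_nat_inv_pow w (n := 2) (by norm_num)
    convert this using 3
    norm_num
  · by_cases hw : w = 0
    · rw [hw, Complex.zero_cpow (by norm_num)]; simp
    · rw [Complex.cpow_def_of_ne_zero hw, Complex.exp_re]
      refine mul_nonneg (Real.exp_pos _).le (Real.cos_nonneg_of_mem_Icc ?_)
      have h1 : (Complex.log w * (1 / 2)).im = w.arg / 2 := by
        rw [show (1 / 2 : ℂ) = ((1 / 2 : ℝ) : ℂ) by push_cast; rfl, mul_comm, Complex.im_ofReal_mul,
          Complex.log_im]
        ring
      rw [h1]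
      have h2 := Complex.neg_pi_lt_arg w
      have h3 := Complex.arg_le_pi w
      constructor <;> linarith

lemma norm_two_mul_cpow_sub_le {l : ℝ} (hl : 1 ≤ l) :
    ‖2 * (π / (4 * π * (1 - 2 * l * Complex.I))) ^ (1 / 2 : ℂ) -
      ee (1 / 8) / √(2 * l)‖ ≤ 1 / l := by
  have hl0 : 0 < l := by linarith
  set w := (π / (4 * π * (1 - 2 * l * Complex.I)) : ℂ) ^ (1 / 2 : ℂ) with hw
  obtain ⟨hsq, hre⟩ := cpow_half_sq_and_re (π / (4 * π * (1 - 2 * l * Complex.I)) : ℂ)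
  rw [← hw] at hsq hre
  have hpi : (π : ℂ) ≠ 0 := by exact_mod_cast Real.pi_ne_zero
  have hden : (1 - 2 * l * Complex.I : ℂ) ≠ 0 := by
    intro h
    have := congrArg Complex.re h
    simp at this
  have hlc : (l : ℂ) ≠ 0 := by exact_mod_cast hl0.ne'
  have hs2 : ((√(2 * l) : ℝ) : ℂ) ^ 2 = 2 * l := by
    rw [← Complex.ofReal_pow, Real.sq_sqrt (by linarith)]; push_cast; rfl
  have hee : ee (1 / 8) ^ 2 = Complex.I := by
    rw [sq, ← ee_add, ee]
    have : (2 * π * (1 / 8 + 1 / 8) : ℝ) = π / 2 := by ring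
    rw [this]
    push_cast
    exact Complex.exp_pi_div_two_mul_I
  have hdiff : (2 * w - ee (1 / 8) / √(2 * l)) * (2 * w + ee (1 / 8) / √(2 * l)) =
      -Complex.I / (2 * l * (1 - 2 * l * Complex.I)) := by
    have : (2 * w - ee (1 / 8) / √(2 * l)) * (2 * w + ee (1 / 8) / √(2 * l)) =
        4 * w ^ 2 - ee (1 / 8) ^ 2 / ((√(2 * l) : ℝ) : ℂ) ^ 2 := by ring
    rw [this, hsq, hs2, hee]
    field_simp
    ring_nf
    rw [Complex.I_sq]
    ring
  have hnd : 2 * l ≤ ‖(1 - 2 * l * Complex.I : ℂ)‖ := by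
    have := Complex.abs_im_le_norm (1 - 2 * l * Complex.I : ℂ)
    simp at this
    rw [abs_of_pos hl0] at this
    exact this
  have hn : ‖-Complex.I / (2 * l * (1 - 2 * l * Complex.I))‖ ≤ 1 / (4 * l ^ 2) := by
    rw [norm_div, norm_neg, Complex.norm_I, norm_mul, norm_mul, Complex.norm_real,
      Real.norm_of_nonneg hl0.le]
    apply one_div_le_one_div_of_le (by positivity)
    simp only [Complex.norm_ofNat]
    nlinarith
  have hlow : 1 / (2 * √l) ≤ ‖2 * w + ee (1 / 8) / √(2 * l)‖ := by
    refine le_trans ?_ (Complex.re_le_norm _)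
    rw [Complex.add_re]
    have h1 : 0 ≤ (2 * w).re := by simp; exact hre
    have h2 : (ee (1 / 8) / √(2 * l) : ℂ).re = 1 / (2 * √l) := by
      rw [Complex.div_ofReal_re, ee, Complex.exp_ofReal_mul_I_re]
      have : (2 * π * (1 / 8) : ℝ) = π / 4 := by ring
      rw [this, Real.cos_pi_div_four, Real.sqrt_mul (by norm_num)]
      have : √2 * √2 = 2 := Real.mul_self_sqrt (by norm_num)
      have h2 : (0 : ℝ) < √2 := by positivity
      have h3 : 0 < √l := by positivity
      field_simp
    linarith
  have hprod : ‖2 * w - ee (1 / 8) / √(2 * l)‖ * ‖2 * w + ee (1 / 8) / √(2 * l)‖ ≤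
      1 / (4 * l ^ 2) := by rw [← norm_mul, hdiff]; exact hn
  have h5 : ‖2 * w - ee (1 / 8) / √(2 * l)‖ * (1 / (2 * √l)) ≤ 1 / (4 * l ^ 2) :=
    (mul_le_mul_of_nonneg_left hlow (norm_nonneg _)).trans hprod
  have hsl : 0 < √l := by positivity
  have hsl1 : √l ≤ l := by
    rw [Real.sqrt_le_left hl0.le]; nlinarith
  rw [mul_one_div, div_le_div_iff₀ (by positivity) (by positivity)] at h5
  rw [le_div_iff₀ hl0]
  have h6 : ‖2 * w - ee (1 / 8) / √(2 * l)‖ * l * (4 * l) ≤ 1 * (4 * l) := by nlinarith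
  exact le_of_mul_le_mul_right h6 (by positivity)

/-- Stationary phase for the oscillation `ee (2 λ cosh z)`. -/
lemma exists_stationary_phase : ∃ C : ℝ, 0 < C ∧ ∀ (A A₁ A₂ : ℝ → ℝ) (M L l : ℝ), 1 ≤ l →
    (∀ z, HasDerivAt A (A₁ z) z) → (∀ z, HasDerivAt A₁ (A₂ z) z) →
    (∀ z, |A z| ≤ M) → (∀ z, |A₁ z| ≤ M) → (∀ z, |A₂ z| ≤ M) →
    (∀ z, z ∉ Set.Icc (-L) L → A z = 0) →
    ‖(∫ z, (A z : ℂ) * ee (2 * l * cosh z)) - A 0 * (ee (2 * l) * (ee (1 / 8) / √(2 * l)))‖ ≤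
      C * M / l := by
  obtain ⟨Mb, hMb1, hMb, hMb2⟩ := exists_abs_bump_le
  refine ⟨2 * (2 + Mb) + 1, by linarith, ?_⟩
  intro A A₁ A₂ M L l hl hd hd₁ hM hM₁ hM₂ hsupp
  have hl0 : 0 < l := by linarith
  have hM0 : 0 ≤ M := (abs_nonneg _).trans (hM 0)
  have hAc : Continuous A := continuous_iff_continuousAt.2 fun z => (hd z).continuousAt
  have hphc : Continuous fun z => ee (2 * l * cosh z) := continuous_ee.comp (by fun_prop)
  have hAint : Integrable fun z => (A z : ℂ) * ee (2 * l * cosh z) := by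
    refine Continuous.integrable_of_hasCompactSupport
      ((Complex.continuous_ofReal.comp hAc).mul hphc) ?_
    refine HasCompactSupport.intro (isCompact_Icc (a := -L) (b := L)) fun z hz => ?_
    rw [hsupp z hz]; simp
  obtain ⟨hbint, hbval⟩ := integral_bump l
  set H : ℝ → ℝ := fun z => A z - A 0 * bump z with hH
  have hHint : Integrable fun z => (H z : ℂ) * ee (2 * l * cosh z) := by
    have := hAint.sub (hbint.const_mul (A 0 : ℂ))
    refine this.congr (ae_of_all _ fun z => ?_)
    simp only [hH, Pi.sub_apply]; push_cast; ring
  have hHd : ∀ z, HasDerivAt H (A₁ z - A 0 * bump₁ z) z := fun z =>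
    (hd z).sub ((hasDerivAt_bump z).const_mul _)
  have hHd₁ : ∀ z, HasDerivAt (fun z => A₁ z - A 0 * bump₁ z) (A₂ z - A 0 * bump₂ z) z := fun z =>
    (hd₁ z).sub ((hasDerivAt_bump₁ z).const_mul _)
  have hH0 : H 0 = 0 := by simp [hH, bump]
  have hb10 : bump₁ 0 = 0 := by simp [bump₁]
  have hHM : ∀ z, |(A₂ z - A 0 * bump₂ z) - H z| ≤ (2 + Mb) * M := by
    intro z
    have e : (A₂ z - A 0 * bump₂ z) - H z = A₂ z - A z - A 0 * (bump₂ z - bump z) := by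
      simp only [hH]; ring
    rw [e]
    have h1 : |A 0 * (bump₂ z - bump z)| ≤ M * Mb := by
      rw [abs_mul]; exact mul_le_mul (hM 0) (hMb2 z) (abs_nonneg _) hM0
    have h2 := abs_sub (A₂ z - A z) (A 0 * (bump₂ z - bump z))
    have h3 := abs_sub (A₂ z) (A z)
    have h4 := hM₂ z
    have h5 := hM z
    nlinarith
  have hHM₁ : |A₁ 0 - A 0 * bump₁ 0| ≤ (2 + Mb) * M := by
    rw [hb10, mul_zero, sub_zero]
    have := hM₁ 0
    nlinarith
  have hHb : ∀ z, |H z| ≤ M + M * Mb := by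
    intro z
    refine (abs_sub _ _).trans (add_le_add (hM z) ?_)
    rw [abs_mul]; exact mul_le_mul (hM 0) (hMb z) (abs_nonneg _) hM0
  have hpos := norm_integral_Ioi_ee_cosh_le hl0 hH0 hHd hHd₁ hHM hHM₁ hHb hHint.integrableOn
  have hneg : ‖∫ z in Set.Iic (0 : ℝ), (H z : ℂ) * ee (2 * l * cosh z)‖ ≤
      (2 + Mb) * M / l := by
    have h1 : ∫ z in Set.Iic (0 : ℝ), (H z : ℂ) * ee (2 * l * cosh z) =
        ∫ z in Set.Ioi (0 : ℝ), (H (-z) : ℂ) * ee (2 * l * cosh z) := by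
      have := integral_comp_neg_Ioi (0 : ℝ) (fun z => (H z : ℂ) * ee (2 * l * cosh z))
      rw [neg_zero] at this
      rw [← this]
      simp only [Real.cosh_neg]
    rw [h1]
    refine norm_integral_Ioi_ee_cosh_le (H := fun z => H (-z))
      (H₁ := fun z => -(A₁ (-z) - A 0 * bump₁ (-z)))
      (H₂ := fun z => A₂ (-z) - A 0 * bump₂ (-z)) (M' := M + M * Mb) hl0 (by simp [hH0]) ?_ ?_
      (fun z => hHM (-z)) ?_ (fun z => hHb (-z)) ?_
    · intro z
      have := (hHd (-z)).scomp z (hasDerivAt_neg z)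
      simpa [Function.comp_def] using this
    · intro z
      have := ((hHd₁ (-z)).scomp z (hasDerivAt_neg z)).fun_neg
      simpa [Function.comp_def] using this
    · rw [abs_neg, neg_zero]; exact hHM₁
    · have := hHint.comp_neg
      simp only [Real.cosh_neg] at this
      exact this.integrableOn
  have hsplit : ∫ z, (A z : ℂ) * ee (2 * l * cosh z) =
      (∫ z in Set.Iic (0 : ℝ), (H z : ℂ) * ee (2 * l * cosh z)) +
        (∫ z in Set.Ioi (0 : ℝ), (H z : ℂ) * ee (2 * l * cosh z)) +
        A 0 * (2 * ee (2 * l) *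
          (π / (4 * π * (1 - 2 * l * Complex.I))) ^ (1 / 2 : ℂ)) := by
    rw [← hbval, ← integral_const_mul, intervalIntegral.integral_Iic_add_Ioi hHint.integrableOn
      hHint.integrableOn, ← integral_add hHint (hbint.const_mul _)]
    refine integral_congr_ae (ae_of_all _ fun z => ?_)
    simp only [hH]; push_cast; ring
  rw [hsplit]
  set I₁ := ∫ z in Set.Iic (0 : ℝ), (H z : ℂ) * ee (2 * l * cosh z)
  set I₂ := ∫ z in Set.Ioi (0 : ℝ), (H z : ℂ) * ee (2 * l * cosh z)
  set w := (π / (4 * π * (1 - 2 * l * Complex.I)) : ℂ) ^ (1 / 2 : ℂ) with hw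
  have e : I₁ + I₂ + A 0 * (2 * ee (2 * l) * w) - A 0 * (ee (2 * l) * (ee (1 / 8) / √(2 * l))) =
      I₁ + I₂ + A 0 * ee (2 * l) * (2 * w - ee (1 / 8) / √(2 * l)) := by ring
  rw [e]
  refine (norm_add_le _ _).trans ((add_le_add (norm_add_le _ _) le_rfl).trans ?_)
  have h3 : ‖(A 0 : ℂ) * ee (2 * l) * (2 * w - ee (1 / 8) / √(2 * l))‖ ≤ M * (1 / l) := by
    rw [norm_mul, norm_mul, norm_ee, mul_one, Complex.norm_real]
    exact mul_le_mul (hM 0) (norm_two_mul_cpow_sub_le hl) (norm_nonneg _) hM0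
  calc _ ≤ (2 + Mb) * M / l + (2 + Mb) * M / l + M * (1 / l) := by gcongr
    _ = _ := by ring

/-! ### Oscillatory integrals with a smooth amplitude -/

/-- A twice differentiable amplitude supported in `[-L, 1]`, bounded by `K` together with its
derivatives. -/
structure IsAmplitude (W W₁ W₂ : ℝ → ℝ) (K L : ℝ) : Prop where
  hasDerivAt : ∀ y, HasDerivAt W (W₁ y) y
  hasDerivAt₁ : ∀ y, HasDerivAt W₁ (W₂ y) y
  abs_le : ∀ y, |W y| ≤ K
  abs_le₁ : ∀ y, |W₁ y| ≤ K
  abs_le₂ : ∀ y, |W₂ y| ≤ K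
  eq_zero : ∀ y, y ∉ Set.Icc (-L) 1 → W y = 0

lemma hasDerivAt_eq_zero_of_eqOn_compl {E : Type*} [NormedAddCommGroup E] [NormedSpace ℝ E]
    {g g' : ℝ → E} {a b : ℝ} (hd : ∀ y, HasDerivAt g (g' y) y)
    (h : ∀ y, y ∉ Set.Icc a b → g y = 0) {y : ℝ} (hy : y ∉ Set.Icc a b) : g' y = 0 := by
  have h1 : g =ᶠ[𝓝 y] fun _ => 0 := by
    filter_upwards [isClosed_Icc.isOpen_compl.mem_nhds hy] with z hz using h z hz
  exact (hd y).unique ((hasDerivAt_const y 0).congr_of_eventuallyEq h1)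

lemma measurable_of_hasDerivAt {g g' : ℝ → ℝ} (hd : ∀ y, HasDerivAt g (g' y) y) :
    Measurable g' := by
  have : g' = deriv g := funext fun y => (hd y).deriv.symm
  rw [this]
  exact measurable_deriv g

lemma norm_integral_mul_ee_le {u u' φ ψ g : ℝ → ℝ} {a b : ℝ} (hu : ∀ y, HasDerivAt u (u' y) y)
    (hφ : ∀ y, HasDerivAt φ (ψ y) y) (hψ : Continuous ψ) (hsupp : ∀ y, y ∉ Set.Icc a b → u y = 0)
    (hg : Integrable g) (hb : ∀ y, |u' y| ≤ g y) :
    ‖∫ y, ((u y * ψ y : ℝ) : ℂ) * ee (φ y)‖ ≤ (∫ y, g y) / (2 * π) := by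
  have huc : Continuous u := continuous_iff_continuousAt.2 fun z => (hu z).continuousAt
  have hφc : Continuous φ := continuous_iff_continuousAt.2 fun z => (hφ z).continuousAt
  have hec : Continuous fun y => ee (φ y) := continuous_ee.comp hφc
  have hcs : ∀ k : ℝ → ℂ, Continuous k → Integrable fun y => (u y : ℂ) * k y := by
    intro k hk
    refine Continuous.integrable_of_hasCompactSupport
      ((Complex.continuous_ofReal.comp huc).mul hk) ?_
    refine HasCompactSupport.intro (isCompact_Icc (a := a) (b := b)) fun z hz => ?_
    rw [hsupp z hz]; simp
  have h1 : Integrable fun y => ((u y * ψ y : ℝ) : ℂ) * ee (φ y) := by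
    refine (hcs (fun y => (ψ y : ℂ) * ee (φ y)) ?_).congr (ae_of_all _ fun y => ?_)
    · exact (Complex.continuous_ofReal.comp hψ).mul hec
    · simp only; push_cast; ring
  have h2n : ∀ y, ‖(u' y : ℂ) * ee (φ y)‖ ≤ g y := fun y => by
    rw [norm_mul, norm_ee, mul_one, Complex.norm_real]; exact hb y
  have h2 : Integrable fun y => (u' y : ℂ) * ee (φ y) :=
    hg.mono' ((Complex.measurable_ofReal.comp (measurable_of_hasDerivAt hu)).mul
      hec.measurable).aestronglyMeasurable (ae_of_all _ h2n)
  have hd : ∀ y, HasDerivAt (fun y => (u y : ℂ) * ee (φ y)) ((u' y : ℂ) * ee (φ y) +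
      2 * π * Complex.I * (((u y * ψ y : ℝ) : ℂ) * ee (φ y))) y := fun y =>
    ((hu y).ofReal_comp.mul (hasDerivAt_ee_comp (hφ y))).congr_deriv (by push_cast; ring)
  have h3 := integral_eq_zero_of_hasDerivAt_of_integrable hd (h2.add (h1.const_mul _)) (hcs _ hec)
  rw [integral_add h2 (h1.const_mul _), integral_const_mul] at h3
  have h4 : ‖2 * π * Complex.I * ∫ y, ((u y * ψ y : ℝ) : ℂ) * ee (φ y)‖ ≤ ∫ y, g y := by
    rw [← neg_eq_of_add_eq_zero_right h3, norm_neg]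
    exact norm_integral_le_of_norm_le hg (ae_of_all _ h2n)
  rw [le_div_iff₀ Real.two_pi_pos]
  simp only [norm_mul, Complex.norm_I, Complex.norm_real, Complex.norm_ofNat,
    Real.norm_of_nonneg Real.pi_pos.le] at h4
  linarith

lemma half_mul_exp_le {y k ρ : ℝ} (hρ : 1 ≤ ρ) (hk : k = 0 ∧ ρ = 1 ∨ k = ρ ^ 4) (hy : y ≤ 1) :
    ρ / 2 * exp (-(1 / 2 * y)) ≤ exp (-y) + k * exp y := by
  set a := exp (-(1 / 2 * y)) with ha
  have ha0 : 0 < a := Real.exp_pos _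
  have h1 : exp (-y) = a ^ 2 := by rw [ha, ← Real.exp_nat_mul]; congr 1; push_cast; ring
  have h2 : exp y = (a ^ 2)⁻¹ := by rw [← h1, Real.exp_neg, inv_inv]
  rw [h1, h2]
  rcases hk with ⟨rfl, rfl⟩ | rfl
  · have : (1 : ℝ) / 2 ≤ a := by
      have := Real.add_one_le_exp (-(1 / 2 * y))
      linarith
    nlinarith
  · have ha2 : 0 < a ^ 2 := by positivity
    rw [← div_eq_mul_inv, ← sub_nonneg]
    have : a ^ 2 + ρ ^ 4 / a ^ 2 - ρ / 2 * a = (a ^ 4 + ρ ^ 4 - ρ / 2 * a ^ 3) / a ^ 2 := by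
      field_simp
    rw [this]
    apply div_nonneg _ ha2.le
    rcases le_total ρ a with h | h
    · have : ρ * a ^ 3 ≤ a * a ^ 3 := by gcongr
      have : 0 ≤ ρ * a ^ 3 := by positivity
      have : 0 ≤ ρ ^ 4 := by positivity
      nlinarith
    · have : ρ * a ^ 3 ≤ ρ * ρ ^ 3 := by gcongr
      have : 0 ≤ ρ * a ^ 3 := by positivity
      have : 0 ≤ a ^ 4 := by positivity
      nlinarith

lemma IsAmplitude.norm_integral_nonstationary_le {W W₁ W₂ : ℝ → ℝ} {K L : ℝ}
    (h : IsAmplitude W W₁ W₂ K L) {X m k ρ : ℝ} (hX : 0 < X) (hm : 1 ≤ m) (hρ : 1 ≤ ρ)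
    (hk : k = 0 ∧ ρ = 1 ∨ k = ρ ^ 4) :
    ‖∫ y, (W y : ℂ) * ee (X * (m * exp (-y) - k * exp y))‖ ≤ 4 * K / (X * ρ) := by
  have hK0 : 0 ≤ K := (abs_nonneg _).trans (h.abs_le 0)
  have hk0 : 0 ≤ k := by
    rcases hk with ⟨rfl, _⟩ | rfl <;> positivity
  have hex : ∀ y, HasDerivAt (fun y => exp (-y)) (-exp (-y)) y := fun y =>
    ((hasDerivAt_neg y).exp).congr_deriv (by ring)
  set s : ℝ → ℝ := fun y => m * exp (-y) + k * exp y with hs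
  have hs0 : ∀ y, 0 < s y := fun y => by
    have := Real.exp_pos (-y); have := Real.exp_pos y; simp only [hs]; positivity
  have hsd : ∀ y, HasDerivAt s (-(m * exp (-y)) + k * exp y) y := fun y =>
    (((hex y).const_mul m).add ((Real.hasDerivAt_exp y).const_mul k)).congr_deriv (by ring)
  set u' : ℝ → ℝ := fun y => -((W₁ y * s y - W y * (-(m * exp (-y)) + k * exp y)) /
    s y ^ 2 / X) with hu'
  have hu : ∀ y, HasDerivAt (fun y => -(W y / s y / X)) (u' y) y := fun y =>
    (((h.hasDerivAt y).div (hsd y) (hs0 y).ne').div_const X).neg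
  have hφ : ∀ y, HasDerivAt (fun y => X * (m * exp (-y) - k * exp y)) (-(X * s y)) y :=
    fun y => ((((hex y).const_mul m).sub ((Real.hasDerivAt_exp y).const_mul k)).const_mul
      X).congr_deriv (by simp only [hs]; ring)
  have hI : ∫ y, (W y : ℂ) * ee (X * (m * exp (-y) - k * exp y)) =
      ∫ y, ((-(W y / s y / X) * -(X * s y) : ℝ) : ℂ) *
        ee (X * (m * exp (-y) - k * exp y)) := by
    congr 1 with y
    congr 2
    have := (hs0 y).ne'
    field_simp
  rw [hI]
  set g : ℝ → ℝ := (Set.Iic 1).indicator fun y => 4 * K / (X * ρ) * exp (1 / 2 * y) with hg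
  have hint : IntegrableOn (fun y => 4 * K / (X * ρ) * exp (1 / 2 * y)) (Set.Iic (1 : ℝ)) :=
    (integrableOn_exp_mul_Iic (by norm_num) 1).const_mul _
  refine (norm_integral_mul_ee_le (g := g) (a := -L) (b := 1) hu hφ ?_ ?_
    (hint.integrable_indicator measurableSet_Iic) ?_).trans ?_
  · simp only [hs]; fun_prop
  · intro y hy; simp [h.eq_zero y hy]
  · intro y
    by_cases hy : y ∈ Set.Icc (-L) 1
    · rw [hg, Set.indicator_of_mem (Set.mem_Iic.2 hy.2)]
      have h1 : |W₁ y * s y - W y * (-(m * exp (-y)) + k * exp y)| ≤ 2 * K * s y := by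
        refine (abs_sub _ _).trans ?_
        rw [abs_mul, abs_mul, abs_of_pos (hs0 y)]
        have h2 : |-(m * exp (-y)) + k * exp y| ≤ s y := by
          have e1 := Real.exp_pos (-y); have e2 := Real.exp_pos y
          have : 0 ≤ m * exp (-y) := by positivity
          have : 0 ≤ k * exp y := by positivity
          simp only [hs]
          rw [_root_.abs_le]; constructor <;> linarith
        have := mul_le_mul (h.abs_le y) h2 (abs_nonneg _) hK0
        have := mul_le_mul_of_nonneg_right (h.abs_le₁ y) (hs0 y).le
        linarith
      have h3 : ρ / 2 * exp (-(1 / 2 * y)) ≤ s y := by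
        refine (half_mul_exp_le hρ hk hy.2).trans ?_
        simp only [hs]
        have := Real.exp_pos (-y)
        nlinarith
      simp only [hu']
      rw [abs_neg, abs_div, abs_div, abs_of_pos hX, abs_of_pos (pow_pos (hs0 y) 2), div_div]
      refine (div_le_div_of_nonneg_right h1 (by have := hs0 y; positivity)).trans ?_
      have e : 2 * K * s y / (s y ^ 2 * X) = 2 * K / X * (1 / s y) := by
        have := (hs0 y).ne'; field_simp
      rw [e]
      have h4 : 1 / s y ≤ 2 / ρ * exp (1 / 2 * y) := by
        refine (one_div_le_one_div_of_le (by positivity) h3).trans (le_of_eq ?_)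
        rw [Real.exp_neg]
        have := (Real.exp_pos (1 / 2 * y)).ne'
        field_simp
      calc 2 * K / X * (1 / s y) ≤ 2 * K / X * (2 / ρ * exp (1 / 2 * y)) := by gcongr
        _ = _ := by field_simp; ring
    · have e : u' y = 0 := by
        simp only [hu', h.eq_zero y hy,
          hasDerivAt_eq_zero_of_eqOn_compl h.hasDerivAt h.eq_zero hy]
        simp
      rw [e, abs_zero]
      exact Set.indicator_nonneg (fun _ _ => by positivity) _
  · rw [hg, integral_indicator measurableSet_Iic, integral_const_mul,
      integral_exp_mul_Iic (by norm_num), mul_div_assoc]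
    refine mul_le_of_le_one_right (by positivity) ?_
    rw [div_le_one Real.two_pi_pos]
    have h1 : exp (1 / 2 * 1) ≤ exp 1 := Real.exp_le_exp.2 (by norm_num)
    have h2 := Real.exp_one_lt_d9
    have h3 := Real.pi_gt_three
    linarith

lemma exists_integral_stationary : ∃ C : ℝ, 0 < C ∧ ∀ (W W₁ W₂ : ℝ → ℝ) (K L X m l : ℝ),
    IsAmplitude W W₁ W₂ K L → 1 ≤ X → 1 ≤ m → 1 ≤ l →
    ‖(∫ y, (W y : ℂ) * ee (X * (m * exp (-y) + l * exp y))) -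
      W (log (m / l) / 2) * (ee (2 * (X * √(m * l))) *
        (ee (1 / 8) / √(2 * (X * √(m * l)))))‖ ≤ C * K / (X * √l) := by
  obtain ⟨C, hC, hst⟩ := exists_stationary_phase
  refine ⟨C, hC, fun W W₁ W₂ K L X m l h hX hm hl => ?_⟩
  have hK0 : 0 ≤ K := (abs_nonneg _).trans (h.abs_le 0)
  have hm0 : 0 < m := by linarith
  have hl0 : 0 < l := by linarith
  set y₀ := log (m / l) / 2 with hy₀
  have hsl : √l ≤ √(m * l) := Real.sqrt_le_sqrt (by nlinarith)
  have hsl1 : 1 ≤ √l := Real.one_le_sqrt.2 hl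
  have he : exp y₀ = √m / √l := by
    rw [hy₀, Real.exp_half, Real.exp_log (by positivity), Real.sqrt_div hm0.le]
  have hphase : ∀ z, X * (m * exp (-(y₀ + z)) + l * exp (y₀ + z)) =
      2 * (X * √(m * l)) * cosh z := by
    intro z
    have h1 : exp (-(y₀ + z)) = √l / √m * exp (-z) := by
      rw [neg_add, Real.exp_add, Real.exp_neg y₀, he, inv_div]
    have e1 : m = √m * √m := (Real.mul_self_sqrt hm0.le).symm
    have e2 : l = √l * √l := (Real.mul_self_sqrt hl0.le).symm
    have p1 : √m ≠ 0 := by positivity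
    have p2 : √l ≠ 0 := by positivity
    have a1 : m * (√l / √m) = √m * √l := by
      nth_rewrite 1 [e1]; field_simp
    have a2 : l * (√m / √l) = √m * √l := by
      nth_rewrite 1 [e2]; field_simp
    rw [h1, Real.exp_add, he, Real.cosh_eq, Real.sqrt_mul hm0.le]
    linear_combination X * exp (-z) * a1 + X * exp z * a2
  have h1 := hst (fun z => W (y₀ + z)) (fun z => W₁ (y₀ + z)) (fun z => W₂ (y₀ + z)) K
    (|L| + 1 + |y₀|) (X * √(m * l)) (by nlinarith)
    (fun z => (h.hasDerivAt (y₀ + z)).comp_const_add y₀ z)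
    (fun z => (h.hasDerivAt₁ (y₀ + z)).comp_const_add y₀ z)
    (fun z => h.abs_le _) (fun z => h.abs_le₁ _) (fun z => h.abs_le₂ _)
    (fun z hz => h.eq_zero _ fun hy => hz (by
      have a1 := le_abs_self y₀
      have a2 := neg_abs_le y₀
      have a3 := le_abs_self L
      have a4 := abs_nonneg L
      exact ⟨by linarith [hy.1], by linarith [hy.2]⟩))
  rw [add_zero] at h1
  rw [← integral_add_left_eq_self _ y₀]
  simp_rw [hphase]
  refine h1.trans ?_
  gcongr

/-! ### Poisson summation for the low frequencies -/

/-- The amplitude, in the logarithmic variable, of the low frequencies. -/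
def amp (c y : ℝ) : ℝ := cutoff y * taper (c - y)

lemma abs_amp_le (c y : ℝ) : |amp c y| ≤ 1 := by
  unfold amp
  rw [abs_of_nonneg (mul_nonneg (cutoff_nonneg _) (taper_nonneg _))]
  exact mul_le_one₀ (cutoff_le_one _) (taper_nonneg _) (taper_le_one _)

lemma amp_eq_zero {c y : ℝ} (hy : y ≤ c - 1 ∨ 1 ≤ y) : amp c y = 0 := by
  unfold amp
  rcases hy with h | h
  · rw [taper_of_ge (by linarith), mul_zero]
  · rw [cutoff_of_ge h, zero_mul]

lemma amp_eq_zero_of_notMem {c y : ℝ} (hy : y ∉ Set.Icc (c - 1) 1) : amp c y = 0 := by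
  rw [Set.mem_Icc, not_and_or, not_le, not_le] at hy
  exact amp_eq_zero (hy.imp le_of_lt le_of_lt)

lemma lowWeight_eq_amp (N : ℝ) (b m : ℕ) (t : ℝ) :
    lowWeight N b m t = amp (log m - log N / 2) (log b - t) := by
  unfold lowWeight amp
  congr 2
  ring

lemma hasDerivAt_deriv_of_contDiff {f : ℝ → ℝ} (hf : ContDiff ℝ 3 f) (y : ℝ) :
    HasDerivAt f (deriv f y) y ∧ HasDerivAt (deriv f) (deriv (deriv f) y) y := by
  have hf1 : ContDiff ℝ 2 (deriv f) :=
    ((contDiff_succ_iff_deriv (n := 2) (f := f)).1 (by norm_num; exact hf)).2.2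
  exact ⟨(hf.differentiable (by norm_num) y).hasDerivAt,
    (hf1.differentiable (by norm_num) y).hasDerivAt⟩

lemma exists_hasDerivAt_amp : ∃ M : ℝ, 1 ≤ M ∧ ∀ c : ℝ, ∃ a₁ a₂ : ℝ → ℝ,
    (∀ y, HasDerivAt (amp c) (a₁ y) y) ∧ (∀ y, HasDerivAt a₁ (a₂ y) y) ∧
    (∀ y, |a₁ y| ≤ M) ∧ ∀ y, |a₂ y| ≤ M := by
  obtain ⟨M, hM1, hM, hM'⟩ := exists_deriv_bound contDiff_cutoff (a := -1) (b := 1)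
    (fun _ h => cutoff_of_le h) fun _ h => cutoff_of_ge h
  obtain ⟨V, hV1, hV, hV'⟩ := exists_deriv_bound contDiff_taper (a := 0) (b := 1)
    (fun _ h => taper_of_le h) fun _ h => taper_of_ge h
  have hw0 : ∀ y, |cutoff y| ≤ 1 := fun y => by
    rw [abs_of_nonneg (cutoff_nonneg y)]; exact cutoff_le_one y
  have hv0 : ∀ y, |taper y| ≤ 1 := fun y => by
    rw [abs_of_nonneg (taper_nonneg y)]; exact taper_le_one y
  have hmul : ∀ {p q P Q : ℝ}, |p| ≤ P → |q| ≤ Q → |p * q| ≤ P * Q := by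
    intro p q P Q h1 h2
    rw [abs_mul]
    exact mul_le_mul h1 h2 (abs_nonneg _) ((abs_nonneg _).trans h1)
  refine ⟨M + V + 2 * (M * V), by nlinarith, fun c => ⟨
    fun y => deriv cutoff y * taper (c - y) - cutoff y * deriv taper (c - y),
    fun y => deriv (deriv cutoff) y * taper (c - y) - 2 * (deriv cutoff y * deriv taper (c - y)) +
      cutoff y * deriv (deriv taper) (c - y), fun y => ?_, fun y => ?_, fun y => ?_, fun y => ?_⟩⟩
  · have h1 := (hasDerivAt_deriv_of_contDiff contDiff_cutoff y).1
    have h2 := (hasDerivAt_deriv_of_contDiff contDiff_taper (c - y)).1.comp_const_sub c y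
    exact (h1.mul h2).congr_deriv (by ring)
  · have h1 := hasDerivAt_deriv_of_contDiff contDiff_cutoff y
    have h2 := hasDerivAt_deriv_of_contDiff contDiff_taper (c - y)
    exact ((h1.2.mul (h2.1.comp_const_sub c y)).sub
      (h1.1.mul (h2.2.comp_const_sub c y))).congr_deriv (by ring)
  · have e1 := hmul (hM y) (hv0 (c - y))
    have e2 := hmul (hw0 y) (hV (c - y))
    refine (abs_sub _ _).trans ?_
    nlinarith
  · have e1 := hmul (hM' y) (hv0 (c - y))
    have e2 := hmul (hM y) (hV (c - y))
    have e3 := hmul (hw0 y) (hV' (c - y))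
    refine (abs_add_le _ _).trans ((add_le_add (abs_sub _ _) le_rfl).trans ?_)
    rw [abs_mul 2, abs_of_pos (two_pos : (0 : ℝ) < 2)]
    nlinarith

lemma exists_isAmplitude_amp : ∃ K : ℝ, 0 < K ∧ ∀ c : ℝ, ∃ W₁ W₂ : ℝ → ℝ,
    IsAmplitude (fun y => amp c y * exp y) W₁ W₂ K (1 - c) := by
  obtain ⟨M, hM1, hM⟩ := exists_hasDerivAt_amp
  refine ⟨4 * M * exp 1, by positivity, fun c => ?_⟩
  obtain ⟨a₁, a₂, h1, h2, b1, b2⟩ := hM c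
  have hz : ∀ y, y ∉ Set.Icc (c - 1) 1 → amp c y = 0 := fun y hy => amp_eq_zero_of_notMem hy
  have hz1 : ∀ y, y ∉ Set.Icc (c - 1) 1 → a₁ y = 0 := fun y hy =>
    hasDerivAt_eq_zero_of_eqOn_compl h1 hz hy
  have hz2 : ∀ y, y ∉ Set.Icc (c - 1) 1 → a₂ y = 0 := fun y hy =>
    hasDerivAt_eq_zero_of_eqOn_compl h2 hz1 hy
  have key : ∀ (g : ℝ → ℝ), (∀ y, |g y| ≤ 4 * M) → (∀ y, y ∉ Set.Icc (c - 1) 1 → g y = 0) →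
      ∀ y, |g y * exp y| ≤ 4 * M * exp 1 := by
    intro g hg hg0 y
    by_cases hy : y ∈ Set.Icc (c - 1) 1
    · rw [abs_mul, abs_of_pos (Real.exp_pos y)]
      exact mul_le_mul (hg y) (Real.exp_le_exp.2 hy.2) (Real.exp_pos y).le (by linarith)
    · rw [hg0 y hy, zero_mul, abs_zero]; positivity
  refine ⟨fun y => (amp c y + a₁ y) * exp y, fun y => (amp c y + 2 * a₁ y + a₂ y) * exp y,
    fun y => ?_, fun y => ?_, ?_, ?_, ?_, fun y hy => ?_⟩
  · exact ((h1 y).mul (Real.hasDerivAt_exp y)).congr_deriv (by ring)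
  · exact (((h1 y).add (h2 y)).mul (Real.hasDerivAt_exp y)).congr_deriv (by simp; ring)
  · exact key _ (fun y => (abs_amp_le c y).trans (by linarith)) hz
  · refine key _ (fun y => (abs_add_le _ _).trans ?_) fun y hy => by rw [hz y hy, hz1 y hy, add_zero]
    linarith [abs_amp_le c y, b1 y]
  · refine key _ (fun y => (abs_add_le _ _).trans ((add_le_add (abs_add_le _ _) le_rfl).trans ?_))
      fun y hy => by rw [hz y hy, hz1 y hy, hz2 y hy]; ring
    rw [abs_mul 2, abs_of_pos (two_pos : (0 : ℝ) < 2)]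
    linarith [abs_amp_le c y, b1 y, b2 y]
  · rw [neg_sub] at hy
    rw [hz y hy, zero_mul]

/-- The function whose values at the integers are summed by the Poisson formula. -/
def waveform (X N m u : ℝ) : ℂ :=
  if 0 < u then (amp (log m - log N / 2) (log u - log X) : ℂ) *
    ee (m * X ^ 2 / u) else 0

lemma fourier_waveform {X : ℝ} (hX : 0 < X) (N m l : ℝ) : 𝓕 (waveform X N m) (-l) =
    X * ∫ y, ((amp (log m - log N / 2) y * exp y : ℝ) : ℂ) *
      ee (X * (m * exp (-y) + l * exp y)) := by
  set c := log m - log N / 2 with hc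
  have himg : (fun y => X * exp y) '' Set.univ = Set.Ioi 0 := by
    ext u
    simp only [Set.image_univ, Set.mem_range, Set.mem_Ioi]
    constructor
    · rintro ⟨y, rfl⟩; exact mul_pos hX (Real.exp_pos y)
    · intro hu
      refine ⟨log (u / X), ?_⟩
      rw [Real.exp_log (by positivity)]; field_simp
  have hcv := integral_image_eq_integral_abs_deriv_smul (s := Set.univ)
    (f := fun y => X * exp y) (f' := fun y => X * exp y) MeasurableSet.univ
    (fun y _ => ((Real.hasDerivAt_exp y).const_mul X).hasDerivWithinAt)
    (fun y _ z _ h => Real.exp_injective (mul_left_cancel₀ hX.ne' h))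
    (fun v => Complex.exp (((-2 * π * v * (-l) : ℝ) : ℂ) * Complex.I) • waveform X N m v)
  rw [Real.fourier_real_eq_integral_exp_smul, ← integral_const_mul]
  rw [himg, setIntegral_univ] at hcv
  rw [← setIntegral_eq_integral_of_forall_compl_eq_zero (s := Set.Ioi (0 : ℝ)), hcv]
  · congr 1 with y
    have hpos : 0 < X * exp y := mul_pos hX (Real.exp_pos y)
    have h1 : log (X * exp y) - log X = y := by
      rw [Real.log_mul hX.ne' (Real.exp_pos y).ne', Real.log_exp]; ring
    have h2 : Complex.exp (((-2 * π * (X * exp y) * (-l) : ℝ) : ℂ) * Complex.I) =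
        ee (l * (X * exp y)) := by
      unfold ee; congr 3; ring
    have h3 : X * (m * exp (-y) + l * exp y) =
        m * X ^ 2 / (X * exp y) + l * (X * exp y) := by
      rw [Real.exp_neg]
      have := (Real.exp_pos y).ne'
      field_simp
    rw [abs_of_pos hpos, h2, waveform, if_pos hpos, h1, h3, ee_add, Complex.real_smul, smul_eq_mul]
    push_cast
    ring
  · intro v hv
    rw [waveform, if_neg (show ¬0 < v from hv), smul_zero]

lemma waveform_eq_zero {X N m u : ℝ} (hX : 0 < X) (hN : 0 < N) (hm : 0 < m)
    (hu : u ≤ m / (exp 1 * √N) * X ∨ exp 1 * X ≤ u) : waveform X N m u = 0 := by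
  unfold waveform
  split_ifs with h
  · rw [amp_eq_zero, Complex.ofReal_zero, zero_mul]
    refine hu.imp (fun hu => ?_) fun hu => ?_
    · have h1 := Real.log_le_log h hu
      rw [Real.log_mul (by positivity) hX.ne', Real.log_div hm.ne' (by positivity),
        Real.log_mul (Real.exp_pos 1).ne' (by positivity), Real.log_exp, Real.log_sqrt hN.le] at h1
      linarith
    · have h1 := Real.log_le_log (by positivity) hu
      rw [Real.log_mul (Real.exp_pos 1).ne' hX.ne', Real.log_exp] at h1
      linarith
  · rfl

lemma hasDerivAt_ite_pos {g g' : ℝ → ℂ} {δ : ℝ} (hδ : 0 < δ)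
    (hd : ∀ u, 0 < u → HasDerivAt g (g' u) u) (hz : ∀ u, 0 < u → u < δ → g u = 0) (u : ℝ) :
    HasDerivAt (fun u => if 0 < u then g u else 0) (if 0 < u then g' u else 0) u := by
  by_cases hu : 0 < u
  · rw [if_pos hu]
    refine (hd u hu).congr_of_eventuallyEq ?_
    filter_upwards [Ioi_mem_nhds hu] with v hv using if_pos hv
  · rw [if_neg hu]
    refine (hasDerivAt_const u (0 : ℂ)).congr_of_eventuallyEq ?_
    filter_upwards [Iio_mem_nhds (show u < δ by linarith)] with v hv
    split_ifs with h
    · exact hz v h hv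
    · rfl

lemma norm_fourier_le_of_norm_le {f : ℝ → ℂ} {f₁ f₂ : ℝ → ℂ} {a b B : ℝ} (hab : a ≤ b)
    (hd : ∀ u, HasDerivAt f (f₁ u) u) (hd₁ : ∀ u, HasDerivAt f₁ (f₂ u) u)
    (h0 : ∀ u, u ∉ Set.Icc a b → f u = 0) (hB : ∀ u ∈ Set.Icc a b, ‖f₂ u‖ ≤ B) {w : ℝ} (hw : w ≠ 0) :
    ‖𝓕 f w‖ ≤ B * (b - a) / w ^ 2 := by
  have h1 : ∀ u, u ∉ Set.Icc a b → f₁ u = 0 := fun u hu => hasDerivAt_eq_zero_of_eqOn_compl hd h0 hu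
  have h2 : ∀ u, u ∉ Set.Icc a b → f₂ u = 0 := fun u hu => hasDerivAt_eq_zero_of_eqOn_compl hd₁ h1 hu
  have e1 : deriv f = f₁ := funext fun u => (hd u).deriv
  have e2 : deriv f₁ = f₂ := funext fun u => (hd₁ u).deriv
  have hint : ∀ {k k' : ℝ → ℂ}, (∀ u, HasDerivAt k (k' u) u) →
      (∀ u, u ∉ Set.Icc a b → k u = 0) → Integrable k := fun hk hk0 =>
    Continuous.integrable_of_hasCompactSupport
      (continuous_iff_continuousAt.2 fun z => (hk z).continuousAt)
      (HasCompactSupport.intro (isCompact_Icc (a := a) (b := b)) fun z hz => hk0 z hz)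
  set g : ℝ → ℝ := (Set.Icc a b).indicator fun _ => B with hg
  have hgint : Integrable g :=
    (integrableOn_const (by simp)).integrable_indicator measurableSet_Icc
  have hfg : ∀ u, ‖f₂ u‖ ≤ g u := by
    intro u
    by_cases hu : u ∈ Set.Icc a b
    · rw [hg, Set.indicator_of_mem hu]; exact hB u hu
    · rw [hg, Set.indicator_of_notMem hu, h2 u hu, norm_zero]
  have hint2 : Integrable f₂ :=
    hgint.mono' (by rw [← e2]; exact (measurable_deriv f₁).aestronglyMeasurable) (ae_of_all _ hfg)
  have hF1 := congrFun (Real.fourier_deriv (hint hd h0) (fun u => (hd u).differentiableAt)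
    (by rw [e1]; exact hint hd₁ h1)) w
  have hF2 := congrFun (Real.fourier_deriv (hint hd₁ h1) (fun u => (hd₁ u).differentiableAt)
    (by rw [e2]; exact hint2)) w
  rw [e1] at hF1
  simp only [e2, hF1, smul_eq_mul] at hF2
  have h3 : ‖𝓕 f₂ w‖ ≤ B * (b - a) := by
    rw [Real.fourier_real_eq_integral_exp_smul]
    refine (norm_integral_le_of_norm_le hgint (ae_of_all _ fun v => ?_)).trans (le_of_eq ?_)
    · rw [norm_smul, Complex.norm_exp_ofReal_mul_I, one_mul]; exact hfg v
    · rw [hg, integral_indicator measurableSet_Icc, setIntegral_const, smul_eq_mul,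
        Real.volume_real_Icc_of_le hab, mul_comm]
  rw [hF2] at h3
  simp only [norm_mul, Complex.norm_I, Complex.norm_real, Complex.norm_ofNat,
    Real.norm_of_nonneg Real.pi_pos.le, Real.norm_eq_abs] at h3
  rw [le_div_iff₀ (by positivity), ← sq_abs]
  have h4 : 0 ≤ ‖𝓕 f w‖ * |w| ^ 2 := by positivity
  have h5 := Real.pi_gt_three
  have h6 : 1 ≤ (2 * π) ^ 2 := by nlinarith
  nlinarith

lemma exists_norm_fourier_waveform_le : ∃ C : ℝ, 0 < C ∧ ∀ X N m : ℝ, 1 ≤ X → 1 ≤ N → 1 ≤ m →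
    Continuous (waveform X N m) ∧
    ∀ w : ℝ, w ≠ 0 → ‖𝓕 (waveform X N m) w‖ ≤ C * (N ^ 2 * X) / w ^ 2 := by
  obtain ⟨M, hM1, hM⟩ := exists_hasDerivAt_amp
  refine ⟨9600 * M, by positivity, fun X N m hX hN hm => ?_⟩
  have hX0 : 0 < X := by linarith
  have hN0 : 0 < N := by linarith
  have hm0 : 0 < m := by linarith
  set c := log m - log N / 2 with hc
  obtain ⟨a₁, a₂, h1, h2, b1, b2⟩ := hM c
  have he := Real.exp_one_lt_d9
  have he0 := Real.exp_pos 1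
  have hsN : 1 ≤ √N := Real.one_le_sqrt.2 hN
  set δ := m / (exp 1 * √N) * X with hδ
  have hδ0 : 0 < δ := by positivity
  set P := m * X ^ 2 with hP
  set a : ℝ → ℝ := amp c
  have hlog : ∀ u, 0 < u → u < δ → log u - log X ∉ Set.Icc (c - 1) 1 := by
    intro u hu hud hmem
    have h3 := Real.log_lt_log hu hud
    rw [hδ, Real.log_mul (by positivity) hX0.ne', Real.log_div hm0.ne' (by positivity),
      Real.log_mul he0.ne' (by positivity), Real.log_exp, Real.log_sqrt hN0.le] at h3
    linarith [hmem.1]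
  have hz : ∀ y, y ∉ Set.Icc (c - 1) 1 → a y = 0 := fun y hy => amp_eq_zero_of_notMem hy
  have hz1 : ∀ y, y ∉ Set.Icc (c - 1) 1 → a₁ y = 0 := fun y hy =>
    hasDerivAt_eq_zero_of_eqOn_compl h1 hz hy
  have hcomp : ∀ {k k' : ℝ → ℝ}, (∀ y, HasDerivAt k (k' y) y) → ∀ u, 0 < u →
      HasDerivAt (fun u => (k (log u - log X) : ℂ))
        ((k' (log u - log X) * u⁻¹ : ℝ) : ℂ) u := fun hk u hu =>
    ((hk _).comp u ((Real.hasDerivAt_log hu.ne').sub_const _)).ofReal_comp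
  have hp : ∀ u, 0 < u → HasDerivAt (fun u => P / u) (-(P / u ^ 2)) u := fun u hu => by
    have := (hasDerivAt_inv hu.ne').const_mul P
    simp only [← div_eq_mul_inv] at this
    exact this.congr_deriv (by ring)
  have hpc : ∀ u, 0 < u → HasDerivAt (fun u => ((P / u : ℝ) : ℂ)) ((-(P / u ^ 2) : ℝ) : ℂ) u :=
    fun u hu => (hp u hu).ofReal_comp
  have hi : ∀ u, 0 < u → HasDerivAt (fun u : ℝ => ((u⁻¹ : ℝ) : ℂ)) ((-(u ^ 2)⁻¹ : ℝ) : ℂ) u :=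
    fun u hu => (hasDerivAt_inv hu.ne').ofReal_comp
  set A : ℝ → ℂ := fun u => (a (log u - log X) : ℂ) with hA
  set A₁ : ℝ → ℂ := fun u => (a₁ (log u - log X) : ℂ) with hA₁
  set A₂ : ℝ → ℂ := fun u => (a₂ (log u - log X) : ℂ) with hA₂
  set f : ℝ → ℂ := fun u => A u * ee (P / u) with hf
  set f₁ : ℝ → ℂ := fun u => ((u⁻¹ : ℝ) : ℂ) * (A₁ u - 2 * π * Complex.I *
    (((P / u : ℝ) : ℂ) * A u)) * ee (P / u) with hf₁
  set f₂ : ℝ → ℂ := fun u => ((u⁻¹ : ℝ) : ℂ) ^ 2 * (A₂ u - A₁ u -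
    4 * π * Complex.I * ((P / u : ℝ) : ℂ) * A₁ u +
    4 * π * Complex.I * ((P / u : ℝ) : ℂ) * A u -
    4 * π ^ 2 * ((P / u : ℝ) : ℂ) ^ 2 * A u) * ee (P / u) with hf₂
  have hfd : ∀ u, 0 < u → HasDerivAt f (f₁ u) u := fun u hu => by
    refine ((hcomp h1 u hu).mul (hasDerivAt_ee_comp (hp u hu))).congr_deriv ?_
    have : (u : ℂ) ≠ 0 := by exact_mod_cast hu.ne'
    simp only [hf₁, hA, hA₁]
    push_cast
    field_simp
    ring
  have hfd₁ : ∀ u, 0 < u → HasDerivAt f₁ (f₂ u) u := fun u hu => by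
    refine (((hi u hu).mul ((hcomp h2 u hu).sub (((hpc u hu).mul (hcomp h1 u hu)).const_mul
      (2 * π * Complex.I)))).mul (hasDerivAt_ee_comp (hp u hu))).congr_deriv ?_
    have : (u : ℂ) ≠ 0 := by exact_mod_cast hu.ne'
    simp only [hf₂, hA, hA₁, hA₂, Pi.mul_apply, Pi.sub_apply]
    push_cast
    field_simp
    ring_nf
    simp only [Complex.I_sq]
    ring
  have hwf : waveform X N m = fun u => if 0 < u then f u else 0 := rfl
  have hD := hasDerivAt_ite_pos hδ0 hfd fun u hu hud => by
    simp only [hf, hA, hz _ (hlog u hu hud)]; simp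
  have hD₁ := hasDerivAt_ite_pos hδ0 hfd₁ fun u hu hud => by
    simp only [hf₁, hA, hA₁, hz _ (hlog u hu hud), hz1 _ (hlog u hu hud)]; simp
  rw [← hwf] at hD
  refine ⟨continuous_iff_continuousAt.2 fun u => (hD u).continuousAt, fun w hw => ?_⟩
  have hfar := norm_fourier_le_of_norm_le (a := min δ (exp 1 * X)) (b := exp 1 * X)
    (B := 3200 * M * N ^ 2) (min_le_right _ _) hD hD₁ (fun u hu => ?_) (fun u hu => ?_) hw
  · refine hfar.trans (div_le_div_of_nonneg_right ?_ (by positivity))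
    have h0 : 0 < min δ (exp 1 * X) := by positivity
    have : exp 1 * X ≤ 3 * X := by nlinarith
    calc 3200 * M * N ^ 2 * (exp 1 * X - min δ (exp 1 * X)) ≤
        3200 * M * N ^ 2 * (3 * X) := by gcongr; linarith
      _ = _ := by ring
  · rw [Set.mem_Icc, not_and_or, not_le, not_le] at hu
    refine waveform_eq_zero hX0 hN0 hm0 (hu.imp (fun h => ?_) le_of_lt)
    exact (le_of_lt h).trans (min_le_left _ _)
  · have hu0 : 0 < u := lt_of_lt_of_le (by positivity) hu.1
    rw [if_pos hu0]
    by_cases hy : log u - log X ∈ Set.Icc (c - 1) 1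
    swap
    · have hz2 : a₂ (log u - log X) = 0 := hasDerivAt_eq_zero_of_eqOn_compl h2 hz1 hy
      simp only [hf₂, hA, hA₁, hA₂, hz _ hy, hz1 _ hy, hz2]
      simp
      positivity
    have hδu : δ ≤ u := by
      by_contra h
      exact hlog u hu0 (not_le.1 h) hy
    set p := P / u with hp'
    have hp0 : 0 ≤ p := by positivity
    have hpδ : p ≤ exp 1 * (X * √N) := by
      calc p ≤ P / δ := by rw [hp']; gcongr
        _ = _ := by rw [hP, hδ]; field_simp
    have hui : u⁻¹ ^ 2 ≤ 8 * N / X ^ 2 := by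
      have h3 : u⁻¹ ≤ δ⁻¹ := inv_anti₀ hδ0 hδu
      have h4 : δ⁻¹ ≤ exp 1 * √N / X := by
        rw [hδ, mul_inv, inv_div, ← div_eq_mul_inv]
        gcongr
        exact div_le_self (by positivity) hm
      calc u⁻¹ ^ 2 ≤ (exp 1 * √N / X) ^ 2 := by
            have := h3.trans h4; gcongr
        _ = exp 1 ^ 2 * N / X ^ 2 := by rw [div_pow, mul_pow, Real.sq_sqrt hN0.le]
        _ ≤ _ := by gcongr; nlinarith
    have hpi := Real.pi_gt_three
    have hpi2 := Real.pi_lt_d2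
    have hnA : ‖A u‖ ≤ M := by
      rw [hA, Complex.norm_real]; exact (abs_amp_le _ _).trans hM1
    have hnA₁ : ‖A₁ u‖ ≤ M := by rw [hA₁, Complex.norm_real]; exact b1 _
    have hnA₂ : ‖A₂ u‖ ≤ M := by rw [hA₂, Complex.norm_real]; exact b2 _
    have hbr : ‖A₂ u - A₁ u - 4 * π * Complex.I * (p : ℂ) * A₁ u +
        4 * π * Complex.I * (p : ℂ) * A u - 4 * π ^ 2 * (p : ℂ) ^ 2 * A u‖ ≤
        M * (2 + 2 * π * p) ^ 2 := by
      refine (norm_sub_le _ _).trans ((add_le_add ((norm_add_le _ _).trans (add_le_add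
        ((norm_sub_le _ _).trans (add_le_add (norm_sub_le _ _) le_rfl)) le_rfl)) le_rfl).trans ?_)
      simp only [norm_mul, norm_pow, Complex.norm_I, Complex.norm_real, Complex.norm_ofNat,
        Real.norm_of_nonneg Real.pi_pos.le, Real.norm_of_nonneg hp0, mul_one]
      have q1 : 4 * π * p * ‖A₁ u‖ ≤ 4 * π * p * M := by gcongr
      have q2 : 4 * π * p * ‖A u‖ ≤ 4 * π * p * M := by gcongr
      have q3 : 4 * π ^ 2 * p ^ 2 * ‖A u‖ ≤ 4 * π ^ 2 * p ^ 2 * M := by gcongr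
      nlinarith
    have h20 : 2 + 2 * π * p ≤ 20 * (X * √N) := by
      have hXN : 1 ≤ X * √N := by nlinarith
      have q1 : exp 1 * (X * √N) ≤ 2.72 * (X * √N) := by gcongr; linarith
      have q2 : 2 * π * p ≤ 2 * 3.15 * (2.72 * (X * √N)) := by
        gcongr
        exact hpδ.trans q1
      linarith
    simp only [hf₂]
    rw [norm_mul, norm_mul, norm_ee, mul_one, norm_pow, Complex.norm_real,
      Real.norm_of_nonneg (inv_pos.2 hu0).le]
    calc _ ≤ 8 * N / X ^ 2 * (M * (20 * (X * √N)) ^ 2) := by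
          refine mul_le_mul hui (hbr.trans ?_) (norm_nonneg _) (by positivity)
          gcongr
      _ = 3200 * M * N ^ 2 := by
        rw [mul_pow, mul_pow, Real.sq_sqrt hN0.le]
        field_simp
        ring

/-- The contribution of the stationary point of the `l`-th dual frequency. -/
def mainTerm (X N m l : ℝ) : ℂ :=
  X * (((amp (log m - log N / 2) (log (m / l) / 2) *
    exp (log (m / l) / 2) : ℝ) : ℂ) * (ee (2 * (X * √(m * l))) *
      (ee (1 / 8) / √(2 * (X * √(m * l))))))

lemma mainTerm_eq_zero {X N m l : ℝ} (hN : 0 < N) (hm : 1 ≤ m) (hl : 9 * N ≤ l) :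
    mainTerm X N m l = 0 := by
  have hm0 : 0 < m := by linarith
  have hl0 : 0 < l := by linarith
  unfold mainTerm
  rw [amp_eq_zero (Or.inl ?_)]
  · simp
  · have h1 := Real.exp_one_lt_d9
    have h2 : log (exp 1 ^ 2 * N) ≤ log l := by
      apply Real.log_le_log (by positivity)
      refine le_trans ?_ hl
      gcongr
      nlinarith [Real.exp_pos 1]
    rw [Real.log_mul (by positivity) hN.ne', Real.log_pow, Real.log_exp] at h2
    rw [Real.log_div hm0.ne' hl0.ne']
    have h3 := Real.log_nonneg hm
    push_cast at h2
    linarith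

lemma tsum_int_eq_sum_Icc {f : ℤ → ℂ} {B : ℕ} (h0 : ∀ n ≤ 0, f n = 0)
    (hB : ∀ n : ℤ, (B : ℤ) < n → f n = 0) : ∑' n, f n = ∑ b ∈ Finset.Icc 1 B, f (b : ℤ) := by
  rw [tsum_eq_sum (s := (Finset.Icc 1 B).map Nat.castEmbedding), Finset.sum_map]
  · rfl
  · intro n hn
    rcases le_or_gt n 0 with h | h
    · exact h0 n h
    · refine hB n ?_
      by_contra hc
      apply hn
      rw [Finset.mem_map]
      refine ⟨n.toNat, ?_, ?_⟩
      · rw [Finset.mem_Icc]; omega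
      · simp [h.le]

lemma le_rpow_mul_rpow {x a b : ℝ} (hx : 0 ≤ x) (ha : x ≤ a) (hb : x ≤ b) :
    x ≤ a ^ (11 / 20 : ℝ) * b ^ (9 / 20 : ℝ) := by
  rcases hx.eq_or_lt with rfl | hx
  · positivity
  have ha0 := hx.le.trans ha
  calc x = x ^ (11 / 20 : ℝ) * x ^ (9 / 20 : ℝ) := by rw [← Real.rpow_add hx]; norm_num
    _ ≤ _ := by gcongr

lemma summable_max_abs_int_rpow {b : ℝ} (hb : 1 < b) :
    Summable fun n : ℤ => (max |(n : ℝ)| 1) ^ (-b) := by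
  have h1 : Summable fun n : ℤ => if n = 0 then (1 : ℝ) else 0 :=
    summable_of_hasFiniteSupport ((Set.finite_singleton 0).subset fun n hn => by
      by_contra h
      exact hn (if_neg h))
  refine Summable.of_nonneg_of_le (fun n => by positivity) (fun n => ?_)
    ((Real.summable_abs_int_rpow hb).add h1)
  by_cases hn : n = 0
  · subst hn
    simp
    positivity
  · have : (1 : ℝ) ≤ |(n : ℝ)| := by exact_mod_cast Int.one_le_abs hn
    rw [if_neg hn, add_zero, max_eq_left this]

/-- Transformation of the low frequencies by the Poisson summation formula. -/
lemma exists_norm_sum_lowWeight_sub_le : ∃ C : ℝ, 0 < C ∧ ∀ (X N : ℝ) (m B Q : ℕ), 1 ≤ X → 1 ≤ N →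
    1 ≤ m → exp 1 * X ≤ B → 9 * N ≤ Q → (Q : ℝ) ≤ 10 * N →
    ‖∑ b ∈ Finset.Icc 1 B, (lowWeight N b m (log X) : ℂ) * ee (m * X ^ 2 / b) -
      ∑ l ∈ Finset.Icc 1 Q, mainTerm X N m l‖ ≤ C * (N * X ^ (9 / 20 : ℝ)) := by
  obtain ⟨K, hK, hamp⟩ := exists_isAmplitude_amp
  obtain ⟨C₁, hC₁, hstat⟩ := exists_integral_stationary
  obtain ⟨C₂, hC₂, hfar⟩ := exists_norm_fourier_waveform_le
  set C₀ := 100 * (4 * K + C₁ * K) + C₂ with hC₀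
  set S := ∑' n : ℤ, (max |(n : ℝ)| 1) ^ (-(83 / 80) : ℝ) with hS
  have hSs := summable_max_abs_int_rpow (b := 83 / 80) (by norm_num)
  have hS0 : 0 ≤ S := tsum_nonneg fun n => by positivity
  refine ⟨C₀ * (S + 1), by positivity, fun X N m B Q hX hN hm hB hQ hQ' => ?_⟩
  have hX0 : 0 < X := by linarith
  have hN0 : 0 < N := by linarith
  have hm1 : (1 : ℝ) ≤ m := by exact_mod_cast hm
  have hm0 : (0 : ℝ) < m := by linarith
  set c := log m - log N / 2 with hc
  obtain ⟨W₁, W₂, hW⟩ := hamp c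
  obtain ⟨hcont, hfar⟩ := hfar X N m hX hN hm1
  set f := waveform X N m with hf
  have hNX : 1 ≤ N ^ 2 * X := by nlinarith
  set g : ℤ → ℂ := fun l => if 1 ≤ l ∧ l ≤ (Q : ℤ) then mainTerm X N m l else 0 with hg
  set E : ℤ → ℂ := fun l => 𝓕 f (-(l : ℝ)) - g l with hE
  have hbd1 : ∀ l : ℤ, ‖E l‖ ≤ (4 * K + C₁ * K) * (max |(l : ℝ)| 1) ^ (-(1 / 4) : ℝ) := by
    intro l
    set κ := max |(l : ℝ)| 1 with hκ
    have hκ1 : 1 ≤ κ := le_max_right _ _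
    have hκ0 : 0 < κ := by linarith
    set ρ := κ ^ (1 / 4 : ℝ) with hρ
    have hρ1 : 1 ≤ ρ := Real.one_le_rpow hκ1 (by norm_num)
    have hρi : κ ^ (-(1 / 4) : ℝ) = 1 / ρ := by
      rw [Real.rpow_neg hκ0.le, ← hρ]; exact (one_div ρ).symm
    have hρ4 : ρ ^ 4 = κ := by
      rw [hρ, ← Real.rpow_natCast, ← Real.rpow_mul hκ0.le]; norm_num
    rw [hρi]
    simp only [hE, hf]
    rw [fourier_waveform hX0]
    rcases le_or_gt l 0 with hl | hl
    · have hg0 : g l = 0 := if_neg fun h => by omega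
      rw [hg0, sub_zero, norm_mul, Complex.norm_real, Real.norm_of_nonneg hX0.le]
      have hlr : (l : ℝ) ≤ 0 := by exact_mod_cast hl
      have h1 := hW.norm_integral_nonstationary_le (X := X) (m := m) (k := -(l : ℝ)) (ρ := ρ) hX0 hm1
        hρ1 ?_
      · simp only [neg_mul, sub_neg_eq_add] at h1
        calc _ ≤ X * (4 * K / (X * ρ)) := mul_le_mul_of_nonneg_left h1 hX0.le
          _ = 4 * K * (1 / ρ) := by field_simp
          _ ≤ _ := by
            gcongr
            have := mul_pos hC₁ hK
            linarith
      · rcases hl.eq_or_lt with rfl | hl'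
        · left
          refine ⟨by simp, ?_⟩
          rw [hρ, hκ]; simp
        · right
          have : (1 : ℝ) ≤ |(l : ℝ)| := by exact_mod_cast Int.one_le_abs hl'.ne
          rw [hρ4, hκ, max_eq_left this, abs_of_nonpos hlr]
    · have hl1 : (1 : ℝ) ≤ l := by exact_mod_cast hl
      have hg1 : g l = mainTerm X N m l := by
        simp only [hg]
        split_ifs with h
        · rfl
        · rw [mainTerm_eq_zero hN0 hm1]
          have : (Q : ℤ) < l := by
            by_contra h'
            exact h ⟨hl, not_lt.1 h'⟩
          have : (Q : ℝ) < l := by exact_mod_cast this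
          linarith
      have h1 := hstat _ W₁ W₂ K (1 - c) X m l hW hX hm1 hl1
      rw [hg1, mainTerm, ← mul_sub, norm_mul, Complex.norm_real, Real.norm_of_nonneg hX0.le]
      have hκl : κ = l := by rw [hκ, abs_of_nonneg (by linarith), max_eq_left hl1]
      have hρl : ρ ≤ √l := by
        rw [Real.sqrt_eq_rpow, hρ, hκl]
        exact Real.rpow_le_rpow_of_exponent_le hl1 (by norm_num)
      calc _ ≤ X * (C₁ * K / (X * √l)) := mul_le_mul_of_nonneg_left h1 hX0.le
        _ = C₁ * K * (1 / √l) := by field_simp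
        _ ≤ (4 * K + C₁ * K) * (1 / ρ) := by
          gcongr
          linarith
  have hbd2 : ∀ l : ℤ, ‖E l‖ ≤ C₀ * (N ^ 2 * X) * (max |(l : ℝ)| 1) ^ (-2 : ℝ) := by
    intro l
    set κ := max |(l : ℝ)| 1 with hκ
    have hκ1 : 1 ≤ κ := le_max_right _ _
    have hκ0 : 0 < κ := by linarith
    have hκ2 : κ ^ (-2 : ℝ) = 1 / κ ^ 2 := by
      rw [Real.rpow_neg hκ0.le, one_div]; norm_num
    rw [hκ2, mul_one_div, le_div_iff₀ (by positivity)]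
    have h1 : ‖E l‖ ≤ 4 * K + C₁ * K := (hbd1 l).trans
      (mul_le_of_le_one_right (by positivity) (Real.rpow_le_one_of_one_le_of_nonpos hκ1 (by norm_num)))
    by_cases hl : κ ≤ 10 * N
    · calc ‖E l‖ * κ ^ 2 ≤ (4 * K + C₁ * K) * (10 * N) ^ 2 := by gcongr
        _ = 100 * (4 * K + C₁ * K) * N ^ 2 * 1 := by ring
        _ ≤ C₀ * N ^ 2 * X := by gcongr; linarith
        _ = _ := by ring
    · rw [not_le] at hl
      have hlne : (l : ℝ) ≠ 0 := by
        intro h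
        rw [hκ, h] at hl; simp at hl; linarith
      have hκl : κ ^ 2 = (l : ℝ) ^ 2 := by
        have : (1 : ℝ) ≤ |(l : ℝ)| := by
          have : l ≠ 0 := by exact_mod_cast hlne
          exact_mod_cast Int.one_le_abs this
        rw [hκ, max_eq_left this, sq_abs]
      have hg0 : g l = 0 := if_neg fun h => by
        have a1 : (1 : ℝ) ≤ l := by exact_mod_cast h.1
        have a2 : (l : ℝ) ≤ Q := by exact_mod_cast h.2
        rw [hκ, abs_of_nonneg (by linarith), max_eq_left a1] at hl
        linarith
      simp only [hE]
      rw [hg0, sub_zero, hκl]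
      have h2 := hfar (-(l : ℝ)) (neg_ne_zero.2 hlne)
      rw [neg_sq, le_div_iff₀ (by positivity)] at h2
      refine h2.trans ?_
      gcongr
      rw [hC₀]
      have := mul_pos hC₁ hK
      linarith
  have hbd : ∀ l : ℤ, ‖E l‖ ≤ C₀ * (N * X ^ (9 / 20 : ℝ)) *
      (max |(l : ℝ)| 1) ^ (-(83 / 80) : ℝ) := by
    intro l
    set κ := max |(l : ℝ)| 1 with hκ
    have hκ1 : 1 ≤ κ := le_max_right _ _
    have hκ0 : 0 < κ := by linarith
    have h1 : ‖E l‖ ≤ C₀ * κ ^ (-(1 / 4) : ℝ) := (hbd1 l).trans (by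
      gcongr
      rw [hC₀]
      have := mul_pos hC₁ hK
      linarith)
    refine (le_rpow_mul_rpow (norm_nonneg _) h1 (hbd2 l)).trans ?_
    rw [Real.mul_rpow (by positivity) (by positivity), Real.mul_rpow (by positivity) (by positivity),
      Real.mul_rpow (by positivity) (by positivity), Real.mul_rpow (by positivity) (by positivity),
      ← Real.rpow_mul hκ0.le, ← Real.rpow_mul hκ0.le]
    have e1 : C₀ ^ (11 / 20 : ℝ) * C₀ ^ (9 / 20 : ℝ) = C₀ := by
      rw [← Real.rpow_add (by positivity)]; norm_num
    have e2 : κ ^ (-(1 / 4) * (11 / 20) : ℝ) * κ ^ (-2 * (9 / 20) : ℝ) = κ ^ (-(83 / 80) : ℝ) := by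
      rw [← Real.rpow_add hκ0]; norm_num
    have e3 : (N ^ 2) ^ (9 / 20 : ℝ) ≤ N := by
      rw [← Real.rpow_natCast, ← Real.rpow_mul hN0.le]
      calc N ^ (((2 : ℕ) : ℝ) * (9 / 20)) ≤ N ^ (1 : ℝ) :=
            Real.rpow_le_rpow_of_exponent_le hN (by norm_num)
        _ = N := Real.rpow_one N
    calc _ = (C₀ ^ (11 / 20 : ℝ) * C₀ ^ (9 / 20 : ℝ)) * ((N ^ 2) ^ (9 / 20 : ℝ) *
          X ^ (9 / 20 : ℝ)) * (κ ^ (-(1 / 4) * (11 / 20) : ℝ) * κ ^ (-2 * (9 / 20) : ℝ)) := by ring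
      _ ≤ _ := by
        rw [e1, e2]
        gcongr
  have hEs : Summable E := Summable.of_norm_bounded (hSs.mul_left _) hbd
  have hgs : Summable g := summable_of_hasFiniteSupport
    ((Set.finite_Icc (1 : ℤ) Q).subset fun l hl => by
      by_contra h
      exact hl (if_neg fun h' => h ⟨h'.1, h'.2⟩))
  have hFs : Summable fun l : ℤ => 𝓕 f (-(l : ℝ)) := (hEs.add hgs).congr fun l => by simp [hE]
  have hFs' : Summable fun l : ℤ => 𝓕 f (l : ℝ) := by
    have := (Equiv.neg ℤ).summable_iff.2 hFs
    simpa [Function.comp_def] using this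
  have hzero : ∀ u : ℝ, u ≤ 0 ∨ exp 1 * X ≤ u → f u = 0 := fun u hu =>
    waveform_eq_zero hX0 hN0 hm0 (hu.imp (fun h => h.trans (by positivity)) id)
  have hO : f =O[cocompact ℝ] fun x => |x| ^ (-2 : ℝ) := by
    refine Asymptotics.IsBigO.of_bound 1 ?_
    rw [Filter.eventually_iff, mem_cocompact]
    refine ⟨Set.Icc 0 (exp 1 * X), isCompact_Icc, fun u hu => ?_⟩
    rw [Set.mem_ofPred_eq, hzero u, norm_zero]
    · positivity
    · by_contra h
      rw [not_or, not_le, not_le] at h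
      exact hu ⟨h.1.le, h.2.le⟩
  have hP := Real.tsum_eq_tsum_fourier_of_rpow_decay_of_summable hcont (by norm_num) hO hFs' 0
  simp only [zero_add, QuotientAddGroup.mk_zero, fourier_eval_zero, mul_one] at hP
  rw [tsum_int_eq_sum_Icc (f := fun n : ℤ => f n) (B := B)
    (fun n hn => hzero n (Or.inl (by exact_mod_cast hn)))
    (fun n hn => hzero n (Or.inr (hB.trans (by exact_mod_cast hn.le)))),
    ← (Equiv.neg ℤ).tsum_eq] at hP
  simp only [Equiv.neg_apply, Int.cast_neg, Int.cast_natCast] at hP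
  have hlow : ∑ b ∈ Finset.Icc 1 B, (lowWeight N b m (log X) : ℂ) * ee (m * X ^ 2 / b) =
      ∑ b ∈ Finset.Icc 1 B, f b := by
    refine Finset.sum_congr rfl fun b hb => ?_
    have : (0 : ℝ) < b := by exact_mod_cast (Finset.mem_Icc.1 hb).1
    rw [hf, waveform, if_pos this, lowWeight_eq_amp]
  have hmain : ∑ l ∈ Finset.Icc 1 Q, mainTerm X N m l = ∑' l, g l := by
    rw [tsum_int_eq_sum_Icc (f := g) (B := Q) (fun n hn => if_neg fun h => by omega)
      (fun n hn => if_neg fun h => by omega)]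
    refine Finset.sum_congr rfl fun l hl => ?_
    rw [Finset.mem_Icc] at hl
    change _ = if 1 ≤ (l : ℤ) ∧ (l : ℤ) ≤ Q then mainTerm X N m ((l : ℤ) : ℝ) else 0
    rw [if_pos (by omega), Int.cast_natCast]
  rw [hlow, hmain, hP, ← hFs.tsum_sub hgs]
  have hfin := tsum_of_norm_bounded (hSs.hasSum.mul_left (C₀ * (N * X ^ (9 / 20 : ℝ)))) hbd
  refine hfin.trans ?_
  rw [← hS]
  have : 0 ≤ C₀ * (N * X ^ (9 / 20 : ℝ)) := by positivity
  nlinarith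

/-! ### Approximation of `F` by a trigonometric polynomial -/

/-- The smooth weight of the truncated Voronoi formula. -/
def smoothWeight (N : ℝ) (n : ℕ) : ℝ := taper (log (n / N) / 2)

lemma smoothWeight_eq_zero {N : ℝ} (hN : 0 < N) {n : ℕ} (hn : 9 * N ≤ n) : smoothWeight N n = 0 := by
  refine taper_of_ge ?_
  have h1 := Real.exp_one_lt_d9
  have h2 : log (exp 1 ^ 2) ≤ log (n / N) := by
    apply Real.log_le_log (by positivity)
    rw [le_div_iff₀ hN]
    refine le_trans ?_ hn
    gcongr
    nlinarith [Real.exp_pos 1]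
  rw [Real.log_pow, Real.log_exp] at h2
  push_cast at h2
  linarith

/-- The truncated Voronoi formula for `F`. -/
def approxF (N : ℝ) (Q : ℕ) (t : ℝ) : ℝ :=
  1 / (π * √2) * ∑ n ∈ Finset.Icc 1 Q, (d n : ℝ) * (smoothWeight N n / (n : ℝ) ^ (3 / 4 : ℝ) *
    cos (4 * π * √(n * t) - π / 4))

lemma im_mainTerm {X N : ℝ} (hX : 0 < X) (hN : 0 < N) {m l : ℕ} (hm : 1 ≤ m) (hl : 1 ≤ l) :
    1 / (m : ℝ) * (mainTerm X N m l).im = √X / √2 * (cutoff (log (m / l) / 2) *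
      (smoothWeight N (m * l) / ((m * l : ℕ) : ℝ) ^ (3 / 4 : ℝ) *
        cos (4 * π * √((m * l : ℕ) * X ^ 2) - π / 4))) := by
  have hm0 : (0 : ℝ) < m := by exact_mod_cast hm
  have hl0 : (0 : ℝ) < l := by exact_mod_cast hl
  set n : ℝ := (m : ℝ) * l with hn
  have hn0 : 0 < n := by positivity
  set lam := X * √n with hlam
  have hamp : amp (log m - log N / 2) (log (m / l) / 2) =
      cutoff (log (m / l) / 2) * smoothWeight N (m * l) := by
    unfold amp smoothWeight
    congr 2
    push_cast
    rw [Real.log_div hm0.ne' hl0.ne', Real.log_div (by positivity) hN.ne',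
      Real.log_mul hm0.ne' hl0.ne']
    ring
  have hee : ee (2 * lam) * (ee (1 / 8) / (√(2 * lam) : ℝ)) =
      ((1 / √(2 * lam) : ℝ) : ℂ) * ee (2 * lam + 1 / 8) := by
    rw [ee_add]; push_cast; ring
  have him : (ee (2 * lam + 1 / 8)).im = cos (4 * π * lam - π / 4) := by
    unfold ee
    rw [Complex.exp_ofReal_mul_I_im, ← Real.cos_pi_div_two_sub, ← Real.cos_neg]
    congr 1
    ring
  have hsq : √((m * l : ℕ) * X ^ 2) = lam := by
    push_cast
    rw [Real.sqrt_mul hn0.le, Real.sqrt_sq hX.le, mul_comm]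
  have hexp : exp (log (m / l) / 2) = √m / √l := by
    rw [Real.exp_half, Real.exp_log (by positivity), Real.sqrt_div hm0.le]
  have hcoef : 1 / (m : ℝ) * (X * (√m / √l * (1 / √(2 * lam)))) = √X / √2 / n ^ (3 / 4 : ℝ) := by
    have e1 : √(2 * lam) = √2 * √X * √(√n) := by
      rw [hlam, ← mul_assoc, Real.sqrt_mul (by positivity), Real.sqrt_mul (by norm_num)]
    have e2 : n ^ (3 / 4 : ℝ) = √n * √(√n) := by
      rw [Real.sqrt_eq_rpow, Real.sqrt_eq_rpow, ← Real.rpow_mul hn0.le, ← Real.rpow_add hn0]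
      norm_num
    have e3 : √n = √m * √l := Real.sqrt_mul hm0.le _
    have e4 : (m : ℝ) = √m * √m := (Real.mul_self_sqrt hm0.le).symm
    have e5 : X = √X * √X := (Real.mul_self_sqrt hX.le).symm
    have p1 : 0 < √(√n) := by positivity
    have p2 : 0 < √(m : ℝ) := by positivity
    have p3 : 0 < √(l : ℝ) := by positivity
    have p4 : 0 < √X := by positivity
    rw [e1, e2]
    nth_rewrite 1 [e4]
    nth_rewrite 1 [e5]
    rw [show √n * √(√n) = √m * √l * √(√n) by rw [← e3]]
    field_simp
  unfold mainTerm
  rw [hee, hamp, hexp, hsq, Nat.cast_mul]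
  have e : (X : ℂ) * (((cutoff (log (m / l) / 2) * smoothWeight N (m * l) * (√m / √l) : ℝ) : ℂ) *
      (((1 / √(2 * lam) : ℝ) : ℂ) * ee (2 * lam + 1 / 8))) =
      ((X * (√m / √l * (1 / √(2 * lam))) * (cutoff (log (m / l) / 2) *
        smoothWeight N (m * l)) : ℝ) : ℂ) * ee (2 * lam + 1 / 8) := by
    push_cast; ring
  rw [e, Complex.im_ofReal_mul, him, ← mul_assoc, ← mul_assoc, hcoef]
  ring

lemma sum_product_Icc_eq_sum_d {h : ℕ → ℝ} {Q : ℕ} (hh : ∀ n, Q < n → h n = 0) :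
    ∑ m ∈ Finset.Icc 1 Q, ∑ l ∈ Finset.Icc 1 Q, h (m * l) =
      ∑ n ∈ Finset.Icc 1 Q, (d n : ℝ) * h n := by
  rw [← Finset.sum_product', ← Finset.sum_filter_of_ne (p := fun p : ℕ × ℕ => p.1 * p.2 ≤ Q)
    fun p _ hp => not_lt.1 fun hlt => hp (hh _ hlt)]
  rw [← Finset.sum_fiberwise_of_maps_to (t := Finset.Icc 1 Q) (g := fun p : ℕ × ℕ => p.1 * p.2)]
  · refine Finset.sum_congr rfl fun n hn => ?_
    rw [Finset.sum_congr rfl (g := fun _ => h n)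
      fun p hp => by rw [(Finset.mem_filter.1 hp).2], Finset.sum_const, nsmul_eq_mul]
    congr 2
    rw [Finset.mem_Icc] at hn
    unfold d
    rw [show n.divisors.card = n.divisorsAntidiagonal.card by
      rw [← Nat.map_div_right_divisors, Finset.card_map]]
    congr 1
    ext p
    simp only [Nat.mem_divisorsAntidiagonal, Finset.mem_filter, Finset.mem_product, Finset.mem_Icc]
    constructor
    · rintro ⟨_, h⟩; exact ⟨h, by omega⟩
    · rintro ⟨rfl, h0⟩
      have h1 : 1 ≤ p.1 := Nat.pos_of_ne_zero (left_ne_zero_of_mul h0)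
      have h2 : 1 ≤ p.2 := Nat.pos_of_ne_zero (right_ne_zero_of_mul h0)
      exact ⟨⟨⟨⟨h1, (Nat.le_mul_of_pos_right _ h2).trans hn.2⟩, h2,
        (Nat.le_mul_of_pos_left _ h1).trans hn.2⟩, hn.2⟩, rfl⟩
  · intro p hp
    simp only [Finset.mem_filter, Finset.mem_product, Finset.mem_Icc] at hp ⊢
    exact ⟨Nat.mul_pos hp.1.1.1 hp.1.2.1, hp.2⟩

lemma sum_cutoff_mul_eq {h : ℕ → ℝ} (Q : ℕ) :
    ∑ m ∈ Finset.Icc 1 Q, ∑ l ∈ Finset.Icc 1 Q, cutoff (log ((m : ℝ) / l) / 2) * h (m * l) =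
      1 / 2 * ∑ m ∈ Finset.Icc 1 Q, ∑ l ∈ Finset.Icc 1 Q, h (m * l) := by
  set S := ∑ m ∈ Finset.Icc 1 Q, ∑ l ∈ Finset.Icc 1 Q,
    cutoff (log ((m : ℝ) / l) / 2) * h (m * l) with hS
  have h1 : S = ∑ m ∈ Finset.Icc 1 Q, ∑ l ∈ Finset.Icc 1 Q,
      cutoff (-(log ((m : ℝ) / l) / 2)) * h (m * l) := by
    rw [hS, Finset.sum_comm]
    refine Finset.sum_congr rfl fun m _ => Finset.sum_congr rfl fun l _ => ?_
    rw [mul_comm l m, show log ((l : ℝ) / m) = -log ((m : ℝ) / l) by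
      rw [← inv_div, Real.log_inv], neg_div]
  have h2 : S + S = ∑ m ∈ Finset.Icc 1 Q, ∑ l ∈ Finset.Icc 1 Q, h (m * l) := by
    nth_rewrite 2 [h1]
    rw [hS, ← Finset.sum_add_distrib]
    refine Finset.sum_congr rfl fun m _ => ?_
    rw [← Finset.sum_add_distrib]
    refine Finset.sum_congr rfl fun l _ => ?_
    rw [← add_mul, cutoff_add_cutoff_neg, one_mul]
  linarith

lemma sum_im_mainTerm {X N : ℝ} (hX : 0 < X) (hN : 0 < N) {Q : ℕ} (hQ : 9 * N ≤ Q) :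
    2 / π * ∑ m ∈ Finset.Icc 1 Q, 1 / (m : ℝ) * (∑ l ∈ Finset.Icc 1 Q, mainTerm X N m l).im =
      √X * approxF N Q (X ^ 2) := by
  set h : ℕ → ℝ := fun n => smoothWeight N n / (n : ℝ) ^ (3 / 4 : ℝ) *
    cos (4 * π * √(n * X ^ 2) - π / 4) with hh
  have h1 : ∑ m ∈ Finset.Icc 1 Q, 1 / (m : ℝ) * (∑ l ∈ Finset.Icc 1 Q, mainTerm X N m l).im =
      √X / √2 * ∑ m ∈ Finset.Icc 1 Q, ∑ l ∈ Finset.Icc 1 Q,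
        cutoff (log ((m : ℝ) / l) / 2) * h (m * l) := by
    rw [Finset.mul_sum]
    refine Finset.sum_congr rfl fun m hm => ?_
    rw [Complex.im_sum, Finset.mul_sum, Finset.mul_sum]
    exact Finset.sum_congr rfl fun l hl =>
      im_mainTerm hX hN (Finset.mem_Icc.1 hm).1 (Finset.mem_Icc.1 hl).1
  rw [h1, sum_cutoff_mul_eq, sum_product_Icc_eq_sum_d fun n hn => ?_,
    show approxF N Q (X ^ 2) = 1 / (π * √2) * ∑ n ∈ Finset.Icc 1 Q, (d n : ℝ) * h n from rfl]
  · have := Real.pi_ne_zero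
    field_simp
  · have : (Q : ℝ) < n := by exact_mod_cast hn
    simp only [hh]
    rw [smoothWeight_eq_zero hN (by linarith)]
    simp

lemma measurable_F : Measurable F := by
  unfold F Delta
  have h1 : Measurable fun x : ℝ => ∑ n ∈ Finset.Icc 1 ⌊x⌋₊, (d n : ℝ) :=
    (measurable_from_nat (f := fun k => ∑ n ∈ Finset.Icc 1 k, (d n : ℝ))).comp Nat.measurable_floor
  have h2 : Measurable fun t : ℝ => t ^ (-(1 / 4) : ℝ) := measurable_id.pow_const _
  exact h2.mul (h1.sub (measurable_id.mul
    ((Real.measurable_log.add_const _).sub_const _)))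

lemma continuous_approxF (N : ℝ) (Q : ℕ) : Continuous (approxF N Q) := by
  unfold approxF
  fun_prop

lemma measurable_lowWeight (N : ℝ) (b m : ℕ) : Measurable (lowWeight N b m) := by
  have h1 : Continuous cutoff := contDiff_cutoff.continuous
  have h2 : Continuous taper := contDiff_taper.continuous
  unfold lowWeight
  fun_prop

lemma abs_lowWeight_le (N : ℝ) (b m : ℕ) (t : ℝ) : |lowWeight N b m t| ≤ 1 := by
  rw [lowWeight_eq_amp]; exact abs_amp_le _ _

lemma intervalIntegrable_sum_saw_add_low (N : ℝ) (B Q : ℕ) (a b : ℝ) : IntervalIntegrable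
    (fun x : ℝ => 2 * ∑ b ∈ Finset.Icc 1 B, cutoff (log b - log x / 2) * saw (x / b) +
      2 / π * ∑ m ∈ Finset.Icc 1 Q, ∑ b ∈ Finset.Icc 1 B,
        1 / (m : ℝ) * lowWeight N b m (log x / 2) * sin (2 * π * (m / b * x)))
    volume a b := by
  have key : ∀ (f : ℝ → ℝ) (M : ℝ), Measurable f → (∀ x, |f x| ≤ M) →
      IntervalIntegrable f volume a b := fun f M hf hM =>
    (intervalIntegrable_const (c := M)).mono_fun' hf.aestronglyMeasurable (ae_of_all _ hM)
  have hsum : ∀ (s : Finset ℕ) (f : ℕ → ℝ → ℝ), (∀ i ∈ s, IntervalIntegrable (f i) volume a b) →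
      IntervalIntegrable (fun x => ∑ i ∈ s, f i x) volume a b := by
    intro s f h
    have := IntervalIntegrable.sum s h
    rwa [Finset.sum_fn] at this
  have h1 : Continuous cutoff := contDiff_cutoff.continuous
  refine IntervalIntegrable.add (IntervalIntegrable.const_mul ?_ _)
    (IntervalIntegrable.const_mul ?_ _)
  · refine hsum _ _ fun b _ => key _ 1 ?_ fun x => ?_
    · have := measurable_saw
      fun_prop
    · rw [abs_mul, abs_of_nonneg (cutoff_nonneg _)]
      exact mul_le_one₀ (cutoff_le_one _) (abs_nonneg _) ((abs_saw_le _).trans (by norm_num))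
  · refine hsum _ _ fun m _ => hsum _ _ fun b _ =>
      key _ |1 / (m : ℝ)| ?_ fun x => ?_
    · have := measurable_lowWeight N b m
      fun_prop
    · rw [abs_mul, abs_mul, mul_assoc]
      exact mul_le_of_le_one_right (abs_nonneg _)
        (mul_le_one₀ (abs_lowWeight_le _ _ _ _) (abs_nonneg _) (Real.abs_sin_le_one _))

lemma exists_integral_F_sub_le : ∃ C : ℝ, 0 < C ∧ ∀ (T N : ℝ) (Q : ℕ), 36 ≤ T → 1 ≤ N →
    9 * N ≤ Q → (Q : ℝ) ≤ 10 * N →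
    IntervalIntegrable (fun t => F t - approxF N Q t) volume T (2 * T) ∧
    ∫ t in T..2 * T, |F t - approxF N Q t| ≤
      C * (T * (N ^ (-(1 / 8) : ℝ) + N ^ 2 * T ^ (-(1 / 40) : ℝ))) := by
  obtain ⟨C₁, hC₁, hlow⟩ := exists_integral_sum_saw_add_low_le
  obtain ⟨C₂, hC₂, hpoi⟩ := exists_norm_sum_lowWeight_sub_le
  refine ⟨81 + C₁ + 20 * C₂, by positivity, fun T N Q hT hN hQ hQ' => ?_⟩
  have hT0 : 0 < T := by linarith
  have hN0 : 0 < N := by linarith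
  set B := ⌈4 * √T⌉₊ with hB
  have hBl : 4 * √T ≤ B := Nat.le_ceil _
  have hsT : 1 ≤ √T := Real.one_le_sqrt.2 (by linarith)
  have hBu : (B : ℝ) ≤ 5 * √T := by
    have := (Nat.ceil_lt_add_one (show 0 ≤ 4 * √T by positivity)).le
    linarith
  have hsN : √N ≤ N := by rw [Real.sqrt_le_left hN0.le]; nlinarith
  have hI := hlow T N B Q (by linarith) hN hBu (by linarith)
  set G : ℝ → ℝ := fun x => 2 * ∑ b ∈ Finset.Icc 1 B, cutoff (log b - log x / 2) *
      saw (x / b) + 2 / π * ∑ m ∈ Finset.Icc 1 Q, ∑ b ∈ Finset.Icc 1 B,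
        1 / (m : ℝ) * lowWeight N b m (log x / 2) * sin (2 * π * (m / b * x)) with hG
  have hGi : IntervalIntegrable G volume T (2 * T) := intervalIntegrable_sum_saw_add_low N B Q _ _
  set Z := N ^ 2 * T ^ (9 / 40 : ℝ) with hZ
  have hpt : ∀ x ∈ Set.Icc T (2 * T), |F x - approxF N Q x| ≤
      T ^ (-(1 / 4) : ℝ) * (81 + |G x| + 20 * C₂ * Z) := by
    intro x hx
    have hx0 : 0 < x := hT0.trans_le hx.1
    set X := √x with hX
    have hX1 : 1 ≤ X := Real.one_le_sqrt.2 (by linarith [hx.1])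
    have hX0 : 0 < X := by linarith
    have hXx : X ^ 2 = x := Real.sq_sqrt hx0.le
    have hlogX : log X = log x / 2 := Real.log_sqrt hx0.le
    have heX : exp 1 * X ≤ B := by
      refine le_trans ?_ hBl
      have h1 : X ≤ √2 * √T := by
        rw [← Real.sqrt_mul (by norm_num)]; exact Real.sqrt_le_sqrt hx.2
      have h2 := Real.exp_one_lt_d9
      have h3 : √2 < 1.42 := by
        rw [Real.sqrt_lt' (by norm_num)]; norm_num
      have h4 : exp 1 * X ≤ 2.72 * (1.42 * √T) := by
        refine mul_le_mul (by linarith) (h1.trans ?_) hX0.le (by norm_num)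
        exact mul_le_mul_of_nonneg_right h3.le (by positivity)
      linarith
    have hD := abs_Delta_add_sum_cutoff_le (show 36 ≤ x by linarith [hx.1]) heX
    have hcut : ∑ b ∈ Finset.Icc 1 B, cutoff (log (b / √x)) * saw (x / b) =
        ∑ b ∈ Finset.Icc 1 B, cutoff (log b - log x / 2) * saw (x / b) := by
      refine Finset.sum_congr rfl fun b hb => ?_
      have : (0 : ℝ) < b := by exact_mod_cast (Finset.mem_Icc.1 hb).1
      rw [← hX, Real.log_div this.ne' hX0.ne', hlogX]
    rw [hcut] at hD
    have hL : |2 / π * (∑ m ∈ Finset.Icc 1 Q, ∑ b ∈ Finset.Icc 1 B,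
        1 / (m : ℝ) * lowWeight N b m (log x / 2) * sin (2 * π * (m / b * x))) -
        √X * approxF N Q x| ≤ 20 * C₂ * Z := by
      have hmain := sum_im_mainTerm hX0 hN0 hQ
      rw [hXx] at hmain
      rw [← hmain, ← mul_sub, ← Finset.sum_sub_distrib, abs_mul,
        abs_of_pos (div_pos two_pos Real.pi_pos)]
      have hterm : ∀ m ∈ Finset.Icc 1 Q, |(∑ b ∈ Finset.Icc 1 B, 1 / (m : ℝ) *
          lowWeight N b m (log x / 2) * sin (2 * π * (m / b * x))) -
          1 / (m : ℝ) * (∑ l ∈ Finset.Icc 1 Q, mainTerm X N m l).im| ≤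
          C₂ * (N * X ^ (9 / 20 : ℝ)) := by
        intro m hm
        have hm1 := (Finset.mem_Icc.1 hm).1
        have hm1' : (1 : ℝ) ≤ m := by exact_mod_cast hm1
        have h1 := hpoi X N m B Q hX1 hN hm1 heX hQ hQ'
        have h2 : ∑ b ∈ Finset.Icc 1 B, 1 / (m : ℝ) * lowWeight N b m (log x / 2) *
            sin (2 * π * (m / b * x)) = 1 / (m : ℝ) * (∑ b ∈ Finset.Icc 1 B,
              (lowWeight N b m (log X) : ℂ) * ee (m * X ^ 2 / b)).im := by
          rw [Complex.im_sum, Finset.mul_sum]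
          refine Finset.sum_congr rfl fun b _ => ?_
          rw [Complex.im_ofReal_mul, ee, Complex.exp_ofReal_mul_I_im, hlogX, hXx, mul_assoc]
          congr 4
          ring
        rw [h2, ← mul_sub, ← Complex.sub_im, abs_mul, abs_of_nonneg (by positivity)]
        calc _ ≤ 1 * (C₂ * (N * X ^ (9 / 20 : ℝ))) := by
              refine mul_le_mul ?_ ((Complex.abs_im_le_norm _).trans h1) (abs_nonneg _) (by norm_num)
              rw [div_le_one (by linarith)]; exact hm1'
          _ = _ := one_mul _
      have hsum := (Finset.abs_sum_le_sum_abs _ _).trans (Finset.sum_le_sum hterm)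
      rw [Finset.sum_const, Nat.card_Icc, Nat.add_sub_cancel, nsmul_eq_mul] at hsum
      have hXT : X ^ (9 / 20 : ℝ) ≤ 2 * T ^ (9 / 40 : ℝ) := by
        rw [hX, Real.sqrt_eq_rpow, ← Real.rpow_mul hx0.le]
        calc x ^ (1 / 2 * (9 / 20) : ℝ) = x ^ (9 / 40 : ℝ) := by norm_num
          _ ≤ (2 * T) ^ (9 / 40 : ℝ) := Real.rpow_le_rpow hx0.le hx.2 (by norm_num)
          _ = 2 ^ (9 / 40 : ℝ) * T ^ (9 / 40 : ℝ) := Real.mul_rpow (by norm_num) hT0.le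
          _ ≤ 2 * T ^ (9 / 40 : ℝ) := by
            gcongr
            calc (2 : ℝ) ^ (9 / 40 : ℝ) ≤ 2 ^ (1 : ℝ) :=
                  Real.rpow_le_rpow_of_exponent_le (by norm_num) (by norm_num)
              _ = 2 := Real.rpow_one 2
      have hpi : 2 / π ≤ 1 := by
        rw [div_le_one Real.pi_pos]; linarith [Real.pi_gt_three]
      calc _ ≤ 1 * ((10 * N) * (C₂ * (N * (2 * T ^ (9 / 40 : ℝ))))) := by
            refine mul_le_mul hpi (hsum.trans ?_) (abs_nonneg _) (by norm_num)
            gcongr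
        _ = _ := by rw [hZ]; ring
    have hxX : x ^ (-(1 / 4) : ℝ) * √X = 1 := by
      rw [hX, Real.sqrt_eq_rpow, Real.sqrt_eq_rpow, ← Real.rpow_mul hx0.le, ← Real.rpow_add hx0]
      norm_num
    have e : F x - approxF N Q x = x ^ (-(1 / 4) : ℝ) * (Delta x - √X * approxF N Q x) := by
      rw [F, mul_sub, ← mul_assoc, hxX, one_mul]
    rw [e, abs_mul, abs_of_nonneg (by positivity)]
    refine mul_le_mul (Real.rpow_le_rpow_of_nonpos hT0 hx.1 (by norm_num)) ?_ (abs_nonneg _)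
      (by positivity)
    have hGx : G x = _ := rfl
    simp only [hG] at hGx
    rw [abs_le] at hD hL ⊢
    have g1 := le_abs_self (G x)
    have g2 := neg_abs_le (G x)
    constructor <;> linarith
  have hTle : T ≤ 2 * T := by linarith
  have hRi : IntervalIntegrable (fun x => T ^ (-(1 / 4) : ℝ) * (81 + |G x| + 20 * C₂ * Z)) volume
      T (2 * T) := ((intervalIntegrable_const.add hGi.abs).add intervalIntegrable_const).const_mul _
  have hi : IntervalIntegrable (fun t => F t - approxF N Q t) volume T (2 * T) := by
    refine hRi.mono_fun' (measurable_F.sub (continuous_approxF N Q).measurable).aestronglyMeasurable ?_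
    rw [Set.uIoc_of_le hTle]
    refine (ae_restrict_iff' measurableSet_Ioc).2 (ae_of_all _ fun x hx => ?_)
    exact hpt x (Set.Ioc_subset_Icc_self hx)
  refine ⟨hi, (intervalIntegral.integral_mono_on hTle hi.abs hRi hpt).trans ?_⟩
  rw [intervalIntegral.integral_const_mul,
    intervalIntegral.integral_add (intervalIntegrable_const.add hGi.abs) intervalIntegrable_const,
    intervalIntegral.integral_add intervalIntegrable_const hGi.abs,
    intervalIntegral.integral_const, intervalIntegral.integral_const, smul_eq_mul, smul_eq_mul]
  have hq : T ^ (-(1 / 4) : ℝ) ≤ N ^ 2 * T ^ (-(1 / 40) : ℝ) := by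
    have h1 : T ^ (-(1 / 4) : ℝ) ≤ T ^ (-(1 / 40) : ℝ) :=
      Real.rpow_le_rpow_of_exponent_le (by linarith) (by norm_num)
    exact h1.trans (le_mul_of_one_le_left (by positivity) (one_le_pow₀ hN))
  have e1 : T ^ (-(1 / 4) : ℝ) * T ^ (1 / 4 : ℝ) = 1 := by
    rw [← Real.rpow_add hT0]; norm_num
  have e2 : T ^ (-(1 / 4) : ℝ) * Z = N ^ 2 * T ^ (-(1 / 40) : ℝ) := by
    rw [hZ, mul_left_comm, ← Real.rpow_add hT0]; norm_num
  set q := T ^ (-(1 / 4) : ℝ) with hqdef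
  set r := N ^ 2 * T ^ (-(1 / 40) : ℝ) with hr
  set s := N ^ (-(1 / 8) : ℝ) with hs
  have hs0 : 0 ≤ s := by positivity
  have hr0 : 0 ≤ r := by positivity
  have hq0 : 0 ≤ q := by positivity
  calc _ ≤ q * ((2 * T - T) * 81 + C₁ * (T * (T ^ (1 / 4 : ℝ) * s)) +
        (2 * T - T) * (20 * C₂ * Z)) := by gcongr
    _ = T * (81 * q + C₁ * s * (q * T ^ (1 / 4 : ℝ)) + 20 * C₂ * (q * Z)) := by ring
    _ = T * (81 * q + C₁ * s + 20 * C₂ * r) := by rw [e1, e2, mul_one]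
    _ ≤ T * ((81 + C₁ + 20 * C₂) * (s + r)) := by
      gcongr
      nlinarith [mul_nonneg hC₁.le hr0, mul_nonneg hC₂.le hs0]
    _ = _ := by ring

/-! ### Comparison of the two trigonometric polynomials -/

lemma smoothWeight_mem (N : ℝ) (n : ℕ) : 0 ≤ smoothWeight N n ∧ smoothWeight N n ≤ 1 :=
  ⟨taper_nonneg _, taper_le_one _⟩

lemma smoothWeight_eq_one {N : ℝ} (hN : 0 < N) {n : ℕ} (hn : (n : ℝ) ≤ N) : smoothWeight N n = 1 := by
  refine taper_of_le ?_
  have : log (n / N) ≤ 0 := Real.log_nonpos (by positivity) ((div_le_one hN).2 hn)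
  linarith

/-- The pairs `(k, r)` with `k` squarefree and `k r² ≤ Q`. -/
def indexSet (Q : ℕ) : Finset (ℕ × ℕ) :=
  (sqfreeUpTo Q ×ˢ Finset.Icc 1 Q).filter fun p => p.1 * p.2 ^ 2 ≤ Q

lemma mem_indexSet {Q : ℕ} {p : ℕ × ℕ} :
    p ∈ indexSet Q ↔ Squarefree p.1 ∧ 1 ≤ p.2 ∧ p.1 * p.2 ^ 2 ≤ Q := by
  simp only [indexSet, Finset.mem_filter, Finset.mem_product, mem_sqfreeUpTo, Finset.mem_Icc]
  constructor
  · rintro ⟨⟨⟨_, h1⟩, h2, _⟩, h3⟩; exact ⟨h1, h2, h3⟩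
  · rintro ⟨h1, h2, h3⟩
    have h4 : 1 ≤ p.1 := Nat.pos_of_ne_zero h1.ne_zero
    have h5 : 1 ≤ p.2 ^ 2 := Nat.one_le_pow _ _ h2
    refine ⟨⟨⟨⟨h4, ?_⟩, h1⟩, h2, ?_⟩, h3⟩ <;> nlinarith

/-- The coefficients of the trigonometric polynomial `approxF`. -/
def coef (N : ℝ) (p : ℕ × ℕ) : ℝ := 1 / (π * √2) * ((d (p.1 * p.2 ^ 2) : ℝ) *
  (smoothWeight N (p.1 * p.2 ^ 2) / ((p.1 * p.2 ^ 2 : ℕ) : ℝ) ^ (3 / 4 : ℝ)))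

lemma approxF_eq_trigSum (N : ℝ) (Q : ℕ) (t : ℝ) :
    approxF N Q t = trigSum (indexSet Q) (coef N) fun k => 2 * √(k * t) := by
  unfold approxF trigSum
  rw [Finset.mul_sum]
  symm
  refine Finset.sum_bij (fun p _ => p.1 * p.2 ^ 2) (fun p hp => ?_) (fun p hp q hq h => ?_)
    (fun n hn => ?_) fun p hp => ?_
  · rw [mem_indexSet] at hp
    exact Finset.mem_Icc.2 ⟨Nat.mul_pos (Nat.pos_of_ne_zero hp.1.ne_zero) (pow_pos hp.2.1 2), hp.2.2⟩
  · rw [mem_indexSet] at hp hq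
    obtain ⟨h1, h2⟩ := eq_of_squarefree_mul_sq hp.1 hq.1 (by omega) (by omega) h
    exact Prod.ext h1 h2
  · rw [Finset.mem_Icc] at hn
    obtain ⟨k, r, h1, h2⟩ := Nat.sq_mul_squarefree n
    have hr : r ≠ 0 := by rintro rfl; simp at h1; omega
    have h3 : k * r ^ 2 = n := by rw [mul_comm]; exact h1
    exact ⟨(k, r), mem_indexSet.2 ⟨h2, Nat.pos_of_ne_zero hr, by rw [h3]; exact hn.2⟩, h3⟩
  · have h1 : √((p.1 * p.2 ^ 2 : ℕ) * t) = p.2 * √(p.1 * t) := by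
      rw [show ((p.1 * p.2 ^ 2 : ℕ) : ℝ) * t = (p.2 : ℝ) ^ 2 * (p.1 * t) by push_cast; ring,
        Real.sqrt_mul (by positivity), Real.sqrt_sq (by positivity)]
    have h2 : 2 * π * p.2 * (2 * √(p.1 * t)) = 4 * π * √((p.1 * p.2 ^ 2 : ℕ) * t) := by
      rw [h1]; ring
    rw [h2, coef]
    ring

lemma componentSum_eq_trigSum {N : ℝ} {Q : ℕ} (hQ : ∀ n, Q < n → smoothWeight N n = 0) (x : ℕ → ℝ) :
    componentSum (smoothWeight N) (sqfreeUpTo Q) x = trigSum (indexSet Q) (coef N) x := by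
  unfold trigSum indexSet componentSum
  rw [Finset.sum_filter_of_ne fun p _ hp => not_lt.1 fun hlt => hp (by rw [coef, hQ _ hlt]; simp),
    Finset.sum_product]
  refine Finset.sum_congr rfl fun k hk => ?_
  have hk1 := (mem_sqfreeUpTo.1 hk).1.1
  rw [component, tsum_eq_sum (s := Finset.Icc 1 Q), Finset.mul_sum, Finset.mul_sum]
  · refine Finset.sum_congr rfl fun r hr => ?_
    have h1 : ((k * r ^ 2 : ℕ) : ℝ) ^ (3 / 4 : ℝ) = (k : ℝ) ^ (3 / 4 : ℝ) * (r : ℝ) ^ (3 / 2 : ℝ) := by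
      push_cast
      rw [Real.mul_rpow (by positivity) (by positivity), ← Real.rpow_natCast (r : ℝ) 2,
        ← Real.rpow_mul (by positivity)]
      norm_num
    simp only [weightedTerm, innerTerm, coef, h1]
    ring
  · intro r hr
    rcases Nat.eq_zero_or_pos r with rfl | h0
    · simp [weightedTerm, innerTerm, d_zero]
    · have : Q < r := by
        by_contra h
        exact hr (Finset.mem_Icc.2 ⟨h0, not_lt.1 h⟩)
      rw [weightedTerm, hQ _ (by nlinarith), zero_mul]

lemma sum_abs_coef_le (N : ℝ) (Q : ℕ) : ∑ p ∈ indexSet Q, |coef N p| ≤ (Q : ℝ) ^ 3 := by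
  have h1 : ∀ p ∈ indexSet Q, |coef N p| ≤ (Q : ℝ) := by
    intro p hp
    obtain ⟨ha, hb, hc⟩ := mem_indexSet.1 hp
    set n := p.1 * p.2 ^ 2 with hn
    have hn1 : 1 ≤ n := Nat.mul_pos (Nat.pos_of_ne_zero ha.ne_zero) (pow_pos hb 2)
    have hw := smoothWeight_mem N n
    have hp1 : 1 ≤ (n : ℝ) ^ (3 / 4 : ℝ) := Real.one_le_rpow (by exact_mod_cast hn1) (by norm_num)
    have hd : (d n : ℝ) ≤ Q := by exact_mod_cast (Nat.card_divisors_le_self n).trans hc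
    have h2 : smoothWeight N n / (n : ℝ) ^ (3 / 4 : ℝ) ≤ 1 := by
      rw [div_le_one (by linarith)]; linarith
    have h3 : 1 / (π * √2) ≤ 1 := by
      rw [div_le_one (by positivity)]
      nlinarith [Real.pi_gt_three, Real.one_le_sqrt.2 (one_le_two (α := ℝ))]
    have h4 : 0 ≤ smoothWeight N n / (n : ℝ) ^ (3 / 4 : ℝ) := div_nonneg hw.1 (by linarith)
    rw [coef, ← hn, abs_of_nonneg (by positivity)]
    calc _ ≤ 1 * ((Q : ℝ) * 1) := by gcongr
      _ = Q := by ring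
  refine (Finset.sum_le_sum h1).trans ?_
  rw [Finset.sum_const, nsmul_eq_mul]
  have h2 : (indexSet Q).card ≤ Q * Q := by
    refine (Finset.card_filter_le _ _).trans ?_
    rw [Finset.card_product]
    refine Nat.mul_le_mul ((Finset.card_filter_le _ _).trans ?_) ?_ <;> simp
  calc _ ≤ ((Q * Q : ℕ) : ℝ) * Q := by gcongr
    _ = _ := by push_cast; ring

lemma abs_trigSum_le (I : Finset (ℕ × ℕ)) (c : ℕ × ℕ → ℝ) (x : ℕ → ℝ) :
    |trigSum I c x| ≤ ∑ p ∈ I, |c p| :=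
  (Finset.abs_sum_le_sum_abs _ _).trans (Finset.sum_le_sum fun p _ => by
    rw [abs_mul]; exact mul_le_of_le_one_right (abs_nonneg _) (Real.abs_cos_le_one _))

lemma norm_integral_cexp_sub_sum_le {Ω : Type*} [MeasurableSpace Ω] {P : Measure Ω}
    [IsProbabilityMeasure P] {h : Ω → ℝ} {A : ℝ} (hh : Measurable h) (hA : ∀ ω, |h ω| ≤ A) {K : ℕ}
    (hK : Even K) (ξ : ℝ) :
    ‖(∫ ω, Complex.exp ((ξ * h ω : ℝ) * Complex.I) ∂P) - ∑ m ∈ Finset.range K,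
      (ξ * Complex.I) ^ m / (m.factorial : ℂ) * ((∫ ω, h ω ^ m ∂P : ℝ) : ℂ)‖ ≤
      |ξ| ^ K / K.factorial * ∫ ω, h ω ^ K ∂P := by
  have hpow : ∀ m : ℕ, Integrable (fun ω => h ω ^ m) P := fun m =>
    Integrable.of_bound (hh.pow_const m).aestronglyMeasurable (A ^ m) (ae_of_all _ fun ω => by
      rw [norm_pow]; exact pow_le_pow_left₀ (norm_nonneg _) (hA ω) m)
  have hi : Integrable (fun ω => Complex.exp ((ξ * h ω : ℝ) * Complex.I)) P :=
    Integrable.of_bound (by fun_prop) 1 (ae_of_all _ fun ω => by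
      rw [Complex.norm_exp_ofReal_mul_I])
  have hm : ∀ m, Integrable (fun ω => (ξ * Complex.I) ^ m / (m.factorial : ℂ) *
      ((h ω ^ m : ℝ) : ℂ)) P := fun m => (hpow m).ofReal.const_mul _
  have e : ∑ m ∈ Finset.range K, (ξ * Complex.I) ^ m / (m.factorial : ℂ) *
      ((∫ ω, h ω ^ m ∂P : ℝ) : ℂ) = ∫ ω, ∑ m ∈ Finset.range K,
        (ξ * Complex.I) ^ m / (m.factorial : ℂ) * ((h ω ^ m : ℝ) : ℂ) ∂P := by
    rw [integral_finsetSum _ fun m _ => hm m]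
    refine Finset.sum_congr rfl fun m _ => ?_
    rw [integral_const_mul, integral_complex_ofReal]
  rw [e, ← integral_sub hi (integrable_finsetSum _ fun m _ => hm m), ← integral_const_mul]
  refine norm_integral_le_of_norm_le ((hpow K).const_mul _) (ae_of_all _ fun ω => ?_)
  have h1 := norm_exp_mul_I_sub_sum_le K (ξ * h ω)
  have h2 : ∀ m : ℕ, (((ξ * h ω : ℝ) : ℂ) * Complex.I) ^ m / (m.factorial : ℂ) =
      (ξ * Complex.I) ^ m / (m.factorial : ℂ) * ((h ω ^ m : ℝ) : ℂ) := fun m => by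
    push_cast; ring
  simp only [h2] at h1
  refine h1.trans (le_of_eq ?_)
  rw [abs_mul, mul_pow, hK.pow_abs (h ω)]
  ring

/-- Comparison of characteristic functions through moments. -/
lemma norm_integral_cexp_sub_le {Ω₁ Ω₂ : Type*} [MeasurableSpace Ω₁] [MeasurableSpace Ω₂]
    {μ : Measure Ω₁} {ν : Measure Ω₂} [IsProbabilityMeasure μ] [IsProbabilityMeasure ν]
    {f : Ω₁ → ℝ} {g : Ω₂ → ℝ} {A : ℝ} (hf : Measurable f) (hg : Measurable g)
    (hfA : ∀ ω, |f ω| ≤ A) (hgA : ∀ ω, |g ω| ≤ A) {K : ℕ} (hK : Even K) (hK1 : 1 ≤ K) {ε E R ξ : ℝ}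
    (hε : ∀ j ≤ K, |(∫ ω, f ω ^ j ∂μ) - ∫ ω, g ω ^ j ∂ν| ≤ ε)
    (hE : ∫ ω, g ω ^ K ∂ν ≤ K.factorial * E) (hR : 1 ≤ R) (hξ : |ξ| ≤ R) :
    ‖(∫ ω, Complex.exp ((ξ * f ω : ℝ) * Complex.I) ∂μ) -
      ∫ ω, Complex.exp ((ξ * g ω : ℝ) * Complex.I) ∂ν‖ ≤
      |ξ| * (exp R * ε + 2 * (R ^ K * E)) := by
  have hε0 : 0 ≤ ε := (abs_nonneg _).trans (hε 0 (Nat.zero_le _))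
  set a : ℕ → ℂ := fun m => (ξ * Complex.I) ^ m / (m.factorial : ℂ) with ha
  have hna : ∀ m, ‖a m‖ = |ξ| ^ m / m.factorial := fun m => by
    simp [ha]
  set Sf := ∑ m ∈ Finset.range K, a m * ((∫ ω, f ω ^ m ∂μ : ℝ) : ℂ) with hSf
  set Sg := ∑ m ∈ Finset.range K, a m * ((∫ ω, g ω ^ m ∂ν : ℝ) : ℂ) with hSg
  have hpw : ∀ m : ℕ, 1 ≤ m → |ξ| ^ m ≤ |ξ| * R ^ m := by
    intro m hm
    obtain ⟨n, rfl⟩ := Nat.exists_eq_add_of_le' hm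
    rw [pow_succ']
    refine mul_le_mul_of_nonneg_left ?_ (abs_nonneg _)
    exact (pow_le_pow_left₀ (abs_nonneg _) hξ n).trans (pow_le_pow_right₀ hR (Nat.le_succ n))
  have hS : ‖Sf - Sg‖ ≤ |ξ| * ε * ∑ m ∈ Finset.range K, R ^ m / m.factorial := by
    rw [hSf, hSg, ← Finset.sum_sub_distrib, Finset.mul_sum]
    refine (norm_sum_le _ _).trans (Finset.sum_le_sum fun m hm => ?_)
    rw [← mul_sub, norm_mul, hna, ← Complex.ofReal_sub, Complex.norm_real]
    rcases Nat.eq_zero_or_pos m with rfl | hm0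
    · simp; positivity
    · calc _ ≤ |ξ| * R ^ m / m.factorial * ε := by
            refine mul_le_mul ?_ (hε m (Finset.mem_range.1 hm).le) (norm_nonneg _) (by positivity)
            gcongr
            exact hpw m hm0
        _ = _ := by ring
  have h1 := norm_integral_cexp_sub_sum_le hf hfA hK ξ (P := μ)
  have h2 := norm_integral_cexp_sub_sum_le hg hgA hK ξ (P := ν)
  have h3 : ∫ ω, f ω ^ K ∂μ ≤ ε + K.factorial * E := by
    have := (abs_le.1 (hε K le_rfl)).2
    linarith
  have hsum : ∑ m ∈ Finset.range K, R ^ m / m.factorial + R ^ K / K.factorial ≤ exp R := by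
    rw [← Finset.sum_range_succ]
    exact Real.sum_le_exp_of_nonneg (by linarith) _
  have hfac : (0 : ℝ) < K.factorial := by exact_mod_cast K.factorial_pos
  have hEn : 0 ≤ K.factorial * E := le_trans (integral_nonneg fun ω => hK.pow_nonneg _) hE
  set U := ∫ ω, Complex.exp ((ξ * f ω : ℝ) * Complex.I) ∂μ
  set V := ∫ ω, Complex.exp ((ξ * g ω : ℝ) * Complex.I) ∂ν
  calc ‖U - V‖ = ‖(U - Sf) + (Sf - Sg) + -(V - Sg)‖ := by congr 1; ring
    _ ≤ ‖U - Sf‖ + ‖Sf - Sg‖ + ‖V - Sg‖ := by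
      refine (norm_add_le _ _).trans ?_
      rw [norm_neg]
      gcongr
      exact norm_add_le _ _
    _ ≤ |ξ| ^ K / K.factorial * (ε + K.factorial * E) +
        |ξ| * ε * (∑ m ∈ Finset.range K, R ^ m / m.factorial) +
        |ξ| ^ K / K.factorial * (K.factorial * E) := by
      gcongr
      · exact h1.trans (by gcongr)
      · exact h2.trans (by gcongr)
    _ = |ξ| ^ K * (ε / K.factorial + 2 * (K.factorial * E) / K.factorial) +
        |ξ| * ε * (∑ m ∈ Finset.range K, R ^ m / m.factorial) := by ring
    _ ≤ |ξ| * R ^ K * (ε / K.factorial + 2 * (K.factorial * E) / K.factorial) +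
        |ξ| * ε * (∑ m ∈ Finset.range K, R ^ m / m.factorial) := by
      gcongr
      exact hpw K hK1
    _ = |ξ| * (ε * (∑ m ∈ Finset.range K, R ^ m / m.factorial + R ^ K / K.factorial) +
        2 * (R ^ K * E)) := by field_simp; ring
    _ ≤ |ξ| * (ε * exp R + 2 * (R ^ K * E)) := by gcongr
    _ = _ := by ring

lemma norm_integral_cexp_sub_le_integral_abs {Ω : Type*} [MeasurableSpace Ω] {P : Measure Ω}
    [IsProbabilityMeasure P] {f g : Ω → ℝ} (hf : AEMeasurable f P) (hg : Measurable g)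
    (hi : Integrable (fun ω => f ω - g ω) P) (ξ : ℝ) :
    ‖(∫ ω, Complex.exp ((ξ * f ω : ℝ) * Complex.I) ∂P) -
      ∫ ω, Complex.exp ((ξ * g ω : ℝ) * Complex.I) ∂P‖ ≤ |ξ| * ∫ ω, |f ω - g ω| ∂P := by
  have hint : ∀ {h : Ω → ℝ}, AEMeasurable h P →
      Integrable (fun ω => Complex.exp ((ξ * h ω : ℝ) * Complex.I)) P := fun hh =>
    Integrable.of_bound (by fun_prop) 1 (ae_of_all _ fun ω => by rw [Complex.norm_exp_ofReal_mul_I])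
  rw [← integral_sub (hint hf) (hint hg.aemeasurable), ← integral_const_mul]
  refine norm_integral_le_of_norm_le (hi.abs.const_mul _) (ae_of_all _ fun ω => ?_)
  have h1 := norm_exp_mul_I_sub_sum_le 1 (ξ * (f ω - g ω))
  simp only [Finset.sum_range_one, pow_zero, Nat.factorial_zero, Nat.cast_one, div_one, pow_one,
    Nat.factorial_one] at h1
  have e : Complex.exp ((ξ * f ω : ℝ) * Complex.I) - Complex.exp ((ξ * g ω : ℝ) * Complex.I) =
      Complex.exp ((ξ * g ω : ℝ) * Complex.I) *
        (Complex.exp ((ξ * (f ω - g ω) : ℝ) * Complex.I) - 1) := by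
    rw [mul_sub, ← Complex.exp_add, mul_one]
    congr 2
    push_cast; ring
  rw [e, norm_mul, Complex.norm_exp_ofReal_mul_I, one_mul]
  exact h1.trans (abs_mul _ _).le

/-! ### The discrepancy -/

/-- The normalized Lebesgue measure on `[T, 2T]`. -/
def normalizedVolume (T : ℝ) : Measure ℝ := (ENNReal.ofReal T)⁻¹ • volume.restrict (Set.Icc T (2 * T))

lemma isProbabilityMeasure_normalizedVolume {T : ℝ} (hT : 0 < T) :
    IsProbabilityMeasure (normalizedVolume T) := by
  refine ⟨?_⟩
  rw [normalizedVolume, Measure.smul_apply, Measure.restrict_apply_univ, Real.volume_Icc, smul_eq_mul,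
    show 2 * T - T = T by ring]
  exact ENNReal.inv_mul_cancel (by simpa using hT) ENNReal.ofReal_ne_top

lemma integral_normalizedVolume {T : ℝ} (hT : 0 < T) (f : ℝ → ℝ) :
    ∫ t, f t ∂normalizedVolume T = 1 / T * ∫ t in T..2 * T, f t := by
  rw [normalizedVolume, integral_smul_measure, integral_Icc_eq_integral_Ioc,
    intervalIntegral.integral_of_le (by linarith), ENNReal.toReal_inv, ENNReal.toReal_ofReal hT.le,
    smul_eq_mul, one_div]

lemma probT_eq {T : ℝ} (hT : 0 < T) (u : ℝ) :
    probT T F (Set.Iic u) = ((normalizedVolume T).map F).real (Set.Iic u) := by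
  rw [map_measureReal_apply measurable_F measurableSet_Iic, probT, normalizedVolume,
    measureReal_ennreal_smul_apply, measureReal_restrict_apply (measurable_F measurableSet_Iic),
    ENNReal.toReal_inv, ENNReal.toReal_ofReal hT.le, one_div]
  congr 2
  ext t
  exact and_comm

lemma charFun_map_eq {Ω : Type*} [MeasurableSpace Ω] {P : Measure Ω} {f : Ω → ℝ}
    (hf : AEMeasurable f P) (ξ : ℝ) :
    charFun (P.map f) ξ = ∫ ω, Complex.exp ((ξ * f ω : ℝ) * Complex.I) ∂P := by
  rw [charFun_apply_real, integral_map hf (Continuous.aestronglyMeasurable (by fun_prop))]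
  simp only [Complex.ofReal_mul]

lemma exists_abs_probT_sub_le : ∃ C : ℝ, 0 < C ∧ ∃ C' : ℝ, 0 < C' ∧ ∀ {Ω : Type*}
    [MeasurableSpace Ω] {P : Measure Ω} [IsProbabilityMeasure P] {X : ℕ → Ω → ℝ},
    UniformPhases P X → ∀ (T N R s : ℝ) (Q K : ℕ), 36 ≤ T → 1 ≤ N → 9 * N ≤ Q → (Q : ℝ) ≤ 10 * N →
    Even K → 1 ≤ K → 3 ≤ s → 1 ≤ R → ∀ u,
    |probT T F (Set.Iic u) - P.real {ω | FX X ω ≤ u}| ≤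
      C * (1 / R + R * (N ^ (-(1 / 16) : ℝ) + N ^ 2 * T ^ (-(1 / 40) : ℝ) +
        exp R * (((Q : ℝ) ^ 3) ^ K * (((K + 1) * Q) ^ (2 ^ K) / √T)) +
        (R / s) ^ K * exp (C' * (s ^ (4 / 3 : ℝ) * log s ^ (3 : ℝ))))) := by
  obtain ⟨C₁, hC₁, hsm⟩ := exists_smoothing
  obtain ⟨C₂, hC₂, hcf⟩ := exists_norm_charFun_FX_le
  obtain ⟨C₃, hC₃, hFX⟩ := exists_integral_FX_sub_le
  obtain ⟨C₄, hC₄, hF⟩ := exists_integral_F_sub_le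
  obtain ⟨C₅, hC₅, hmom⟩ := exists_even_moment_le
  refine ⟨C₁ * (4 * π * C₂ + C₄ + C₃ + 4), by positivity, C₅, hC₅, ?_⟩
  intro Ω _ P _ X h T N R s Q K hT hN hQ hQ' hK hK1 hs hR u
  have hT0 : 0 < T := by linarith
  have hN0 : 0 < N := by linarith
  have hR0 : 0 < R := by linarith
  have hs0 : 0 < s := by linarith
  have hQ1 : (1 : ℝ) ≤ Q := by linarith
  have := isProbabilityMeasure_normalizedVolume hT0
  set m := normalizedVolume T with hm
  have : IsProbabilityMeasure (m.map F) := Measure.isProbabilityMeasure_map measurable_F.aemeasurable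
  have : IsProbabilityMeasure (P.map (FX X)) := Measure.isProbabilityMeasure_map h.aemeasurable_FX
  have hw0 : ∀ n, Q < n → smoothWeight N n = 0 := fun n hn =>
    smoothWeight_eq_zero hN0 (hQ.trans (by exact_mod_cast hn.le))
  have hw1 : ∀ n, |smoothWeight N n| ≤ 1 := fun n => by
    rw [abs_of_nonneg (smoothWeight_mem N n).1]; exact (smoothWeight_mem N n).2
  obtain ⟨hFi, hFb⟩ := hF T N Q hT hN hQ hQ'
  obtain ⟨hXi, hXb⟩ := hFX h N Q (smoothWeight N) hN (smoothWeight_mem N)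
    (fun n hn => smoothWeight_eq_one hN0 hn) hw0
  set g : Ω → ℝ := fun ω => componentSum (smoothWeight N) (sqfreeUpTo Q) fun k => X k ω with hg
  have hgm : Measurable g := measurable_componentSum h hw1 squarefree_of_mem
  have hfm : Measurable (approxF N Q) := (continuous_approxF N Q).measurable
  have hgt : ∀ ω, g ω = trigSum (indexSet Q) (coef N) fun k => X k ω := fun ω =>
    componentSum_eq_trigSum hw0 _
  set A := ∑ p ∈ indexSet Q, |coef N p| with hA
  have hAQ : A ≤ (Q : ℝ) ^ 3 := sum_abs_coef_le N Q
  have hA0 : 0 ≤ A := Finset.sum_nonneg fun _ _ => abs_nonneg _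
  set ε := ((Q : ℝ) ^ 3) ^ K * (((K + 1) * Q) ^ (2 ^ K) / √T) with hε
  have hmoments : ∀ j ≤ K, |(∫ t, approxF N Q t ^ j ∂m) - ∫ ω, g ω ^ j ∂P| ≤ ε := by
    intro j hj
    rw [hm, integral_normalizedVolume hT0]
    simp only [hgt, approxF_eq_trigSum]
    refine (abs_moment_sub_moment_le h (fun p hp => (mem_indexSet.1 hp).1) (coef N) hQ1 ?_ hT0
      j).trans ?_
    · intro p hp
      have h1 : ((p.1 * p.2 ^ 2 : ℕ) : ℝ) ≤ Q := by exact_mod_cast (mem_indexSet.1 hp).2.2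
      rw [Real.sqrt_le_left (by linarith)]
      nlinarith
    · have h1 : A ^ j ≤ ((Q : ℝ) ^ 3) ^ K := (pow_le_pow_left₀ hA0 hAQ j).trans
        (pow_le_pow_right₀ (one_le_pow₀ hQ1) hj)
      have hjK : (j : ℝ) ≤ K := by exact_mod_cast hj
      have h2 : (((j : ℝ) + 1) * Q) ^ 2 ^ j ≤ (((K : ℝ) + 1) * Q) ^ 2 ^ K := by
        calc (((j : ℝ) + 1) * Q) ^ 2 ^ j ≤ (((K : ℝ) + 1) * Q) ^ 2 ^ j := by gcongr
          _ ≤ _ := pow_le_pow_right₀ (by nlinarith [(Nat.cast_nonneg K : (0 : ℝ) ≤ K)])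
            (Nat.pow_le_pow_right (by norm_num) hj)
      rw [hε]
      gcongr
  set E := 2 / s ^ K * exp (C₅ * (s ^ (4 / 3 : ℝ) * log s ^ (3 : ℝ))) with hE
  have hEK := hmom h (smoothWeight N) hw1 (sqfreeUpTo Q) squarefree_of_mem s hs K hK
  have hmi : Integrable (fun t => F t - approxF N Q t) m := by
    have h1 := (intervalIntegrable_iff_integrableOn_Icc_of_le (by linarith)).1 hFi
    exact Integrable.smul_measure h1 (by simpa using hT0)
  have hm1 : ∫ t, |F t - approxF N Q t| ∂m ≤
      C₄ * (N ^ (-(1 / 16) : ℝ) + N ^ 2 * T ^ (-(1 / 40) : ℝ)) := by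
    rw [hm, integral_normalizedVolume hT0, one_div, ← div_eq_inv_mul, div_le_iff₀ hT0]
    refine hFb.trans ?_
    have : N ^ (-(1 / 8) : ℝ) ≤ N ^ (-(1 / 16) : ℝ) :=
      Real.rpow_le_rpow_of_exponent_le hN (by norm_num)
    calc _ ≤ C₄ * (T * (N ^ (-(1 / 16) : ℝ) + N ^ 2 * T ^ (-(1 / 40) : ℝ))) := by gcongr
      _ = _ := by ring
  set Z₁ := N ^ (-(1 / 16) : ℝ) with hZ₁
  set Z₂ := N ^ 2 * T ^ (-(1 / 40) : ℝ) with hZ₂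
  set Z₄ := (R / s) ^ K * exp (C₅ * (s ^ (4 / 3 : ℝ) * log s ^ (3 : ℝ))) with hZ₄
  have hZE : 2 * (R ^ K * E) = 4 * Z₄ := by
    rw [hE, hZ₄, div_pow]; ring
  have hmain := hsm (m.map F) (P.map (FX X)) (4 * π * C₂)
    (C₄ * (Z₁ + Z₂) + C₃ * Z₁ + (exp R * ε + 4 * Z₄)) R (by positivity) hR0
    (fun a b hab => real_Ioc_le_of_charFun_le (hcf h) hab) (fun ξ hξ => ?_) u
  · have hPu : (P.map (FX X)).real (Set.Iic u) = P.real {ω | FX X ω ≤ u} :=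
      map_measureReal_apply_of_aemeasurable h.aemeasurable_FX measurableSet_Iic
    rw [← probT_eq hT0, hPu] at hmain
    refine hmain.trans ?_
    rw [mul_assoc C₁]
    refine mul_le_mul_of_nonneg_left ?_ hC₁.le
    have p1 : 0 ≤ Z₁ := by positivity
    have p2 : 0 ≤ Z₂ := by positivity
    have p3 : 0 ≤ exp R * ε := by positivity
    have p4 : 0 ≤ Z₄ := by positivity
    have p5 : 0 ≤ 4 * π * C₂ := by positivity
    set a := 4 * π * C₂
    have h1 : a / R ≤ (a + C₄ + C₃ + 4) * (1 / R) := by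
      rw [div_eq_mul_one_div]
      gcongr
      linarith
    have h2 : C₄ * (Z₁ + Z₂) + C₃ * Z₁ + (exp R * ε + 4 * Z₄) ≤
        (a + C₄ + C₃ + 4) * (Z₁ + Z₂ + exp R * ε + Z₄) := by
      have q1 : 0 ≤ (a + 4) * Z₁ + (a + C₃ + 4) * Z₂ := by positivity
      have q2 : 0 ≤ (a + C₄ + C₃ + 3) * (exp R * ε) + (a + C₄ + C₃) * Z₄ := by positivity
      linarith
    calc _ ≤ (a + C₄ + C₃ + 4) * (1 / R) +
          (a + C₄ + C₃ + 4) * (Z₁ + Z₂ + exp R * ε + Z₄) * R := by gcongr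
      _ = _ := by ring
  · rw [charFun_map_eq measurable_F.aemeasurable, charFun_map_eq h.aemeasurable_FX]
    have t1 := norm_integral_cexp_sub_le_integral_abs measurable_F.aemeasurable hfm hmi ξ
    have t2 := norm_integral_cexp_sub_le (μ := m) (ν := P) (A := A) hfm hgm
      (fun t => by rw [approxF_eq_trigSum]; exact abs_trigSum_le _ _ _)
      (fun ω => by rw [hgt]; exact abs_trigSum_le _ _ _) hK hK1 hmoments hEK hR (abs_le.2 hξ)
    have t3 := norm_integral_cexp_sub_le_integral_abs h.aemeasurable_FX hgm hXi ξ
    rw [hZE] at t2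
    set c₁ := ∫ t, Complex.exp ((ξ * F t : ℝ) * Complex.I) ∂m
    set c₂ := ∫ t, Complex.exp ((ξ * approxF N Q t : ℝ) * Complex.I) ∂m
    set c₃ := ∫ ω, Complex.exp ((ξ * g ω : ℝ) * Complex.I) ∂P
    set c₄ := ∫ ω, Complex.exp ((ξ * FX X ω : ℝ) * Complex.I) ∂P
    have e : c₁ - c₄ = (c₁ - c₂) + (c₂ - c₃) + -(c₄ - c₃) := by ring
    have h1 : |ξ| * ∫ t, |F t - approxF N Q t| ∂m ≤ |ξ| * (C₄ * (Z₁ + Z₂)) := by gcongr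
    have h2 : |ξ| * ∫ ω, |FX X ω - g ω| ∂P ≤ |ξ| * (C₃ * Z₁) :=
      mul_le_mul_of_nonneg_left hXb (abs_nonneg _)
    have h3 := (norm_add_le (c₁ - c₂ + (c₂ - c₃)) (-(c₄ - c₃))).trans
      (add_le_add (norm_add_le (c₁ - c₂) (c₂ - c₃)) (norm_neg (c₄ - c₃)).le)
    rw [e]
    linarith

/-- The error terms of `exists_abs_probT_sub_le` for the truncation at `N = K ^ 32`. -/
lemma sq_mul_error_le {K Q : ℕ} {T R s : ℝ} (hK : 3 ≤ K) (hT : 0 < T)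
    (hKT : 3000 * ((K : ℝ) * 2 ^ K) ≤ log T) (hQ : (Q : ℝ) ≤ 10 * (K : ℝ) ^ 32) (hR : 1 ≤ R)
    (hRs : R = s / 8) (hsK : s ≤ K) {z : ℝ} (hz : z ≤ K) :
    R ^ 2 * (((K : ℝ) ^ 32) ^ (-(1 / 16) : ℝ) + ((K : ℝ) ^ 32) ^ 2 * T ^ (-(1 / 40) : ℝ) +
        exp R * (((Q : ℝ) ^ 3) ^ K * (((K + 1) * Q) ^ (2 ^ K) / √T)) +
        (R / s) ^ K * exp z) ≤ 5 := by
  have hK3 : (3 : ℝ) ≤ K := by exact_mod_cast hK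
  have hK0 : (0 : ℝ) < K := by linarith
  have hRK : R ≤ K := by linarith
  have hR2 : R ^ 2 ≤ (K : ℝ) ^ 2 := by gcongr
  set x := exp K with hx
  have hKx : (K : ℝ) + 1 ≤ x := Real.add_one_le_exp _
  have hx1 : 1 ≤ x := by linarith
  have hx0 : 0 < x := by linarith
  have h2K : (K : ℝ) ≤ 2 ^ K := by exact_mod_cast Nat.lt_two_pow_self.le
  have h2K1 : (1 : ℝ) ≤ 2 ^ K := one_le_pow₀ (by norm_num)
  have h10 : (10 : ℝ) ≤ x := by
    have h1 : exp 3 ≤ x := Real.exp_le_exp.2 hK3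
    have h2 : exp 3 = exp 1 ^ 3 := by rw [← Real.exp_nat_mul]; norm_num
    have h3 := Real.exp_one_gt_d9
    have h4 : (2.7 : ℝ) ^ 3 ≤ exp 1 ^ 3 := by gcongr; linarith
    norm_num at h4
    linarith
  have hKxle : (K : ℝ) ≤ x := by linarith
  have hQx : (Q : ℝ) ≤ x ^ 33 := by
    calc (Q : ℝ) ≤ 10 * (K : ℝ) ^ 32 := hQ
      _ ≤ x * x ^ 32 := by gcongr
      _ = x ^ 33 := by ring
  have hxpow : ∀ n : ℕ, x ^ n = exp (n * K) := fun n => by rw [hx, ← Real.exp_nat_mul]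
  have b1 : R ^ 2 * ((K : ℝ) ^ 32) ^ (-(1 / 16) : ℝ) ≤ 1 := by
    have : ((K : ℝ) ^ 32) ^ (-(1 / 16) : ℝ) = ((K : ℝ) ^ 2)⁻¹ := by
      rw [← Real.rpow_natCast, ← Real.rpow_mul hK0.le, ← Real.rpow_natCast, ← Real.rpow_neg hK0.le]
      norm_num
    rw [this, ← div_eq_mul_inv]
    exact (div_le_one (by positivity)).2 hR2
  have b2 : R ^ 2 * (((K : ℝ) ^ 32) ^ 2 * T ^ (-(1 / 40) : ℝ)) ≤ 1 := by
    rw [Real.rpow_neg hT.le, ← mul_assoc, ← div_eq_mul_inv]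
    refine (div_le_one (by positivity)).2 ?_
    rw [Real.rpow_def_of_pos hT]
    calc R ^ 2 * ((K : ℝ) ^ 32) ^ 2 ≤ x ^ 2 * (x ^ 32) ^ 2 := by gcongr; exact hRK.trans hKxle
      _ = x ^ 66 := by ring
      _ = exp (66 * K) := by rw [hxpow]; norm_num
      _ ≤ _ := Real.exp_le_exp.2 (by nlinarith)
  have b3 : R ^ 2 * (exp R * (((Q : ℝ) ^ 3) ^ K * (((K + 1) * Q) ^ (2 ^ K) / √T))) ≤ 1 := by
    have e : R ^ 2 * (exp R * (((Q : ℝ) ^ 3) ^ K * (((K + 1) * Q) ^ (2 ^ K) / √T))) =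
        R ^ 2 * exp R * ((Q : ℝ) ^ 3) ^ K * ((K + 1) * Q) ^ (2 ^ K) / √T := by ring
    rw [e]
    refine (div_le_one (by positivity)).2 ?_
    have hsq : √T = exp (log T / 2) := by rw [Real.exp_half, Real.exp_log hT]
    have hRx : exp R ≤ x := Real.exp_le_exp.2 hRK
    rw [hsq]
    calc R ^ 2 * exp R * ((Q : ℝ) ^ 3) ^ K * ((K + 1) * Q) ^ (2 ^ K) ≤
        x ^ 2 * x * ((x ^ 33) ^ 3) ^ K * (x * x ^ 33) ^ (2 ^ K) := by
          gcongr
          exact hRK.trans hKxle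
      _ = x ^ (3 + 99 * K + 34 * 2 ^ K) := by
        rw [← pow_mul, ← pow_mul, ← pow_succ, ← pow_succ', ← pow_mul, ← pow_add, ← pow_add]
        congr 1
        ring
      _ = exp ((3 + 99 * K + 34 * 2 ^ K) * K) := by rw [hxpow]; push_cast; rfl
      _ ≤ _ := Real.exp_le_exp.2 (by
        have : (3 + 99 * (K : ℝ) + 34 * 2 ^ K) * K ≤ (136 * 2 ^ K) * K := by
          gcongr
          linarith
        nlinarith)
  have b4 : R ^ 2 * ((R / s) ^ K * exp z) ≤ 2 := by
    have hs0 : 0 < s := by linarith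
    have e1 : R / s = 1 / 8 := by rw [hRs]; field_simp
    have h8 : exp 2 ≤ 8 := by
      have h2 : exp 2 = exp 1 ^ 2 := by rw [← Real.exp_nat_mul]; norm_num
      have h3 := Real.exp_one_lt_d9
      rw [h2]
      nlinarith [Real.exp_pos 1]
    have h9 : (1 / 8 : ℝ) ^ K ≤ exp (-(2 * K)) := by
      have : exp (-(2 * K)) = exp (-2) ^ K := by
        rw [← Real.exp_nat_mul]; congr 1; ring
      rw [this, Real.exp_neg, ← one_div]
      gcongr
    have h10 := Real.pow_div_factorial_le_exp (K : ℝ) hK0.le 2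
    rw [e1]
    calc R ^ 2 * ((1 / 8 : ℝ) ^ K * exp z) ≤
        (2 * exp K) * (exp (-(2 * K)) * exp K) := by
          gcongr
          norm_num [Nat.factorial] at h10
          linarith
      _ = 2 := by
        rw [← Real.exp_add, mul_assoc, ← Real.exp_add]
        ring_nf
        simp
  linarith

lemma exists_abs_probT_sub_le_of_even : ∃ C : ℝ, 0 < C ∧ ∃ K₀ : ℝ, ∀ {Ω : Type*}
    [MeasurableSpace Ω] {P : Measure Ω} [IsProbabilityMeasure P] {X : ℕ → Ω → ℝ},
    UniformPhases P X → ∀ (T : ℝ) (K : ℕ), 36 ≤ T → K₀ ≤ K → 3 ≤ K → Even K →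
    3000 * ((K : ℝ) * 2 ^ K) ≤ log T → ∀ u,
    |probT T F (Set.Iic u) - P.real {ω | FX X ω ≤ u}| ≤
      C * (log K ^ (9 / 4 : ℝ) / (K : ℝ) ^ (3 / 4 : ℝ)) := by
  obtain ⟨C, hC, C', hC', hmain⟩ := exists_abs_probT_sub_le
  set κ := (1 + C') ^ (-(3 / 4) : ℝ) with hκ
  have hκ0 : 0 < κ := by positivity
  have hκ1 : κ ≤ 1 := Real.rpow_le_one_of_one_le_of_nonpos (by linarith) (by norm_num)
  have hκ43 : κ ^ (4 / 3 : ℝ) = (1 + C')⁻¹ := by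
    rw [hκ, ← Real.rpow_mul (by positivity), ← Real.rpow_neg_one]; norm_num
  have hlit := (isLittleO_log_rpow_rpow_atTop (9 / 4) (show (0 : ℝ) < 3 / 4 by norm_num)).bound
    (show 0 < κ / 8 by positivity)
  obtain ⟨K₀, hK₀⟩ := eventually_atTop.1 hlit
  refine ⟨C * (6 * (8 / κ)), by positivity, K₀, ?_⟩
  intro Ω _ P _ X h T K hT hKK hK3 hKe hKT u
  have hK3' : (3 : ℝ) ≤ K := by exact_mod_cast hK3
  have hK0 : (0 : ℝ) < K := by linarith
  set l := log K with hl
  have hl1 : 1 ≤ l := by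
    rw [hl, Real.le_log_iff_exp_le hK0]
    linarith [Real.exp_one_lt_d9]
  have hl0 : 0 < l := by linarith
  set s := κ * ((K : ℝ) ^ (3 / 4 : ℝ) / l ^ (9 / 4 : ℝ)) with hs
  have hs8 : 8 ≤ s := by
    have h1 := hK₀ K hKK
    rw [Real.norm_of_nonneg (by positivity), Real.norm_of_nonneg (by positivity), ← hl] at h1
    rw [hs, mul_div_assoc', le_div_iff₀ (by positivity)]
    linarith
  have hs0 : 0 < s := by linarith
  have hsK : s ≤ K := by
    have h1 : (K : ℝ) ^ (3 / 4 : ℝ) ≤ K := by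
      calc (K : ℝ) ^ (3 / 4 : ℝ) ≤ (K : ℝ) ^ (1 : ℝ) :=
            Real.rpow_le_rpow_of_exponent_le (by linarith) (by norm_num)
        _ = K := Real.rpow_one _
    have h2 : (K : ℝ) ^ (3 / 4 : ℝ) / l ^ (9 / 4 : ℝ) ≤ (K : ℝ) ^ (3 / 4 : ℝ) :=
      div_le_self (by positivity) (Real.one_le_rpow hl1 (by norm_num))
    calc s ≤ 1 * K := mul_le_mul hκ1 (h2.trans h1) (by positivity) (by norm_num)
      _ = K := one_mul _
  have hz : C' * (s ^ (4 / 3 : ℝ) * log s ^ (3 : ℝ)) ≤ K := by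
    have e1 : s ^ (4 / 3 : ℝ) = (1 + C')⁻¹ * (K / l ^ (3 : ℝ)) := by
      rw [hs, Real.mul_rpow hκ0.le (by positivity), hκ43, Real.div_rpow (by positivity) (by positivity),
        ← Real.rpow_mul hK0.le, ← Real.rpow_mul hl0.le]
      norm_num
    have h1 : log s ^ (3 : ℝ) ≤ l ^ (3 : ℝ) :=
      Real.rpow_le_rpow (Real.log_nonneg (by linarith)) (Real.log_le_log hs0 hsK) (by norm_num)
    calc _ ≤ C' * ((1 + C')⁻¹ * (K / l ^ (3 : ℝ)) * l ^ (3 : ℝ)) := by rw [e1]; gcongr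
      _ = C' * (1 + C')⁻¹ * K := by field_simp
      _ ≤ 1 * K := by
        gcongr
        rw [← div_eq_mul_inv, div_le_one (by positivity)]; linarith
      _ = K := one_mul _
  set N : ℝ := (K : ℝ) ^ 32 with hN
  have hN1 : 1 ≤ N := one_le_pow₀ (by linarith)
  set Q := ⌈9 * N⌉₊ with hQ
  have hQ1 : 9 * N ≤ Q := Nat.le_ceil _
  have hQ2 : (Q : ℝ) ≤ 10 * N := by
    have := (Nat.ceil_lt_add_one (show 0 ≤ 9 * N by positivity)).le
    linarith
  have hR1 : 1 ≤ s / 8 := by linarith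
  refine (hmain h T N (s / 8) s Q K hT hN1 hQ1 hQ2 hKe (by omega) (by linarith) hR1 u).trans ?_
  have herr := sq_mul_error_le hK3 (by linarith) hKT hQ2 hR1 rfl hsK hz
  set R := s / 8 with hR
  rw [← hN] at herr
  have hR0 : 0 < R := by linarith
  set W := N ^ (-(1 / 16) : ℝ) + N ^ 2 * T ^ (-(1 / 40) : ℝ) +
    exp R * (((Q : ℝ) ^ 3) ^ K * (((K + 1) * Q) ^ (2 ^ K) / √T)) +
    (R / s) ^ K * exp (C' * (s ^ (4 / 3 : ℝ) * log s ^ (3 : ℝ)))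
  have h1 : R * W ≤ 5 * (1 / R) := by
    rw [mul_one_div, le_div_iff₀ hR0]
    calc R * W * R = R ^ 2 * W := by ring
      _ ≤ 5 := herr
  have h2 : 1 / R = 8 / κ * (l ^ (9 / 4 : ℝ) / (K : ℝ) ^ (3 / 4 : ℝ)) := by
    rw [hR, hs]; field_simp
  calc C * (1 / R + R * W) ≤ C * (6 * (1 / R)) := by gcongr; linarith
    _ = _ := by rw [h2]; ring

lemma exists_discrepancy_le : ∃ C : ℝ, 0 < C ∧ ∃ T₀ : ℝ, ∀ {Ω : Type*} [MeasurableSpace Ω]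
    {P : Measure Ω} [IsProbabilityMeasure P] {X : ℕ → Ω → ℝ}, UniformPhases P X → ∀ T, T₀ ≤ T →
    discrepancy P X T ≤ C * (log (log (log T)) ^ (9 / 4 : ℝ) /
      log (log T) ^ (3 / 4 : ℝ)) := by
  obtain ⟨C, hC, K₀, hmain⟩ := exists_abs_probT_sub_le_of_even
  set L₀ := max 24 (8 * K₀) with hL₀
  refine ⟨C * 8, by positivity, exp (exp L₀), ?_⟩
  intro Ω _ P _ X h T hT
  have hT0 : 0 < T := (Real.exp_pos _).trans_le hT
  have hlogT : exp L₀ ≤ log T := (Real.le_log_iff_exp_le hT0).2 hT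
  have hlogT0 : 0 < log T := (Real.exp_pos _).trans_le hlogT
  set L := log (log T) with hL
  have hLL : L₀ ≤ L := (Real.le_log_iff_exp_le hlogT0).2 hlogT
  have hL24 : 24 ≤ L := (le_max_left _ _).trans hLL
  have hLK : 8 * K₀ ≤ L := (le_max_right _ _).trans hLL
  have heL : exp L = log T := Real.exp_log hlogT0
  set n := ⌊L / 8⌋₊ with hn
  have hn1 : (n : ℝ) ≤ L / 8 := Nat.floor_le (by linarith)
  have hn2 : L / 8 < n + 1 := Nat.lt_floor_add_one _
  have hK1 : ((2 * n : ℕ) : ℝ) ≤ L / 4 := by push_cast; linarith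
  have hK2 : L / 8 ≤ ((2 * n : ℕ) : ℝ) := by push_cast; linarith
  have hK3 : 3 ≤ 2 * n := by
    have : (3 : ℝ) ≤ ((2 * n : ℕ) : ℝ) := by linarith
    exact_mod_cast this
  set K := 2 * n with hK
  have hK0 : (0 : ℝ) < K := by linarith
  have hKT : 3000 * ((K : ℝ) * 2 ^ K) ≤ log T := by
    have h1 : (K : ℝ) ≤ exp K := by linarith [Real.add_one_le_exp (K : ℝ)]
    have h2 : (2 : ℝ) ^ K ≤ exp K := by
      rw [← mul_one (K : ℝ), Real.exp_nat_mul]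
      gcongr
      linarith [Real.exp_one_gt_d9]
    have h3 : exp K * exp K ≤ exp (L / 2) := by
      rw [← Real.exp_add]
      exact Real.exp_le_exp.2 (by linarith)
    have h4 : (3000 : ℝ) ≤ exp (L / 2) := by
      have a1 : exp 10 ≤ exp (L / 2) := Real.exp_le_exp.2 (by linarith)
      have a2 : exp 10 = exp 1 ^ 10 := by rw [← Real.exp_nat_mul]; norm_num
      have a3 : (2.7 : ℝ) ^ 10 ≤ exp 1 ^ 10 := by
        gcongr
        linarith [Real.exp_one_gt_d9]
      norm_num at a3
      linarith
    calc 3000 * ((K : ℝ) * 2 ^ K) ≤ exp (L / 2) * (exp K * exp K) := by gcongr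
      _ ≤ exp (L / 2) * exp (L / 2) := by gcongr
      _ = log T := by rw [← Real.exp_add, ← heL]; congr 1; ring
  have hT36 : 36 ≤ T := by
    have h1 : log T + 1 ≤ T := by
      have := Real.add_one_le_exp (log T)
      rwa [Real.exp_log hT0] at this
    have h2 := Real.add_one_le_exp L
    have h3 : (9 : ℝ) ≤ K * 2 ^ K := by
      have a1 : (3 : ℝ) ≤ K := by exact_mod_cast hK3
      have a2 : (8 : ℝ) ≤ 2 ^ K := by
        calc (8 : ℝ) = 2 ^ 3 := by norm_num
          _ ≤ 2 ^ K := pow_le_pow_right₀ (by norm_num) hK3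
      nlinarith
    linarith
  have hbound := hmain h T K hT36 (by linarith) hK3 ⟨n, by omega⟩ hKT
  refine (ciSup_le hbound).trans ?_
  rw [mul_assoc]
  refine mul_le_mul_of_nonneg_left ?_ hC.le
  have h1 : log K ≤ log L := Real.log_le_log hK0 (by linarith)
  have h2 : L ^ (3 / 4 : ℝ) / 8 ≤ (K : ℝ) ^ (3 / 4 : ℝ) := by
    calc L ^ (3 / 4 : ℝ) / 8 ≤ L ^ (3 / 4 : ℝ) / 8 ^ (3 / 4 : ℝ) := by
          gcongr
          calc (8 : ℝ) ^ (3 / 4 : ℝ) ≤ 8 ^ (1 : ℝ) :=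
                Real.rpow_le_rpow_of_exponent_le (by norm_num) (by norm_num)
            _ = 8 := Real.rpow_one _
      _ = (L / 8) ^ (3 / 4 : ℝ) := (Real.div_rpow (by linarith) (by norm_num) _).symm
      _ ≤ _ := Real.rpow_le_rpow (by linarith) hK2 (by norm_num)
  have hK1' : (1 : ℝ) ≤ K := by
    have : (3 : ℝ) ≤ K := by exact_mod_cast hK3
    linarith
  have h3 : 0 ≤ log K := Real.log_nonneg hK1'
  have hL0 : 0 < L := by linarith
  calc log K ^ (9 / 4 : ℝ) / (K : ℝ) ^ (3 / 4 : ℝ) ≤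
      log L ^ (9 / 4 : ℝ) / (L ^ (3 / 4 : ℝ) / 8) := by
        have h4 : 0 ≤ log L := h3.trans h1
        gcongr
    _ = _ := by field_simp

end DivisorDiscrepancy

end

theorem theorem1 :
    ∃ C : ℝ, 0 < C ∧ ∃ T₀ : ℝ,
      ∀ (Ω : Type*) [MeasurableSpace Ω] (P : Measure Ω) [IsProbabilityMeasure P]
        (X : ℕ → Ω → ℝ),
        (∀ n : ℕ, Squarefree n → Measurable (X n)) →
        (∀ n : ℕ, Squarefree n → pdf.IsUniform (X n) (Set.Icc 0 1) P volume) →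
        iIndepFun (fun n : {n : ℕ // Squarefree n} => X n) P →
        (∀ᵐ ω ∂P, DivisorDiscrepancy.SeriesConverges (fun n => X n ω)) ∧
        ∀ T : ℝ, T₀ ≤ T →
          DivisorDiscrepancy.discrepancy P X T ≤
            C * (Real.log (Real.log (Real.log T)) ^ (9 / 4 : ℝ) /
              Real.log (Real.log T) ^ (3 / 4 : ℝ)) := by
  obtain ⟨C, hC, T₀, h⟩ := DivisorDiscrepancy.exists_discrepancy_le
  refine ⟨C, hC, T₀, fun Ω _ P _ X h1 h2 h3 => ?_⟩
  have hX : DivisorDiscrepancy.UniformPhases P X := ⟨h1, h2, h3⟩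
  exact ⟨hX.ae_seriesConverges, h hX⟩
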